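/- All functions are real-valued and $C^\infty$ unless said otherwise; subscripts denote partial derivatives. **Definition (integrability).** Let $\Omega\subset\mathbb R^2$ be open and $\varphi,\psi,\eta$ functions of $(u,w)\in\Omega$ with $\eta\neq0$. An $N$-phase solution of $$u_t=\varphi u_x+\psi u_y+\eta w_y,\qquad w_x=u_y \tag{1}$$ is a solution $u=U(R^1,\dots,R^N)$, $w=W(R^1,\dots,R^N)$, whose phases $R^i(x,y,t)$ satisfy $R^i_y=\mu^i(R)R^i_x$, $R^i_t=\lambda^i(R)R^i_x$, where $\partial_j\mu^i(\lambda^j-\lambda^i)=\partial_j\lambda^i(\mu^j-\mu^i)$ for $i\ne j$ and the coefficient of every $R^i_x$ vanishes identically in $R$ when the ansatz is substituted into (1). System (1) is *integrable by hydrodynamic reductions* if for every $N$ it has $N$-phase solutions parametrised by $2N$ arbitrary functions of one variable: for every $(u_0,w_0)\in\Omega$ and all real-analytic germs $m_1,\dots,m_N$, $r_1,\dots,r_N$ at $0$ with $m_i(0)$ pairwise distinct and $r_i(0)=0$ there is, locally near $0$, an $N$-phase solution with $U(0)=u_0$, $W(0)=w_0$, $U=u_0+R^i$ and $\mu^i=m_i(R^i)$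 on the $i$-th coordinate axis (the first equality normalises the phases), and $R^i(x,0,0)=r_i(x)$. **(A)** Let $\Omega$ be open and $\eta\ne0$ on $\Omega$. Then (1) is integrable by hydrodynamic reductions if and only if on $\Omega$ $$\varphi_{uu}=-\tfrac{\varphi_w^2+\psi_u\varphi_w-2\psi_w\varphi_u}{\eta},\quad \varphi_{uw}=\tfrac{\eta_w\varphi_u}{\eta},\quad \varphi_{ww}=\tfrac{\eta_w\varphi_w}{\eta},$$ $$\psi_{uu}=\tfrac{-\varphi_w\psi_w+\psi_u\psi_w-2\varphi_w\eta_u+2\eta_w\varphi_u}{\eta},\quad \psi_{uw}=\tfrac{\eta_w\psi_u}{\eta},\quad \psi_{ww}=\tfrac{\eta_w\psi_w}{\eta},$$ $$\eta_{uu}=-\tfrac{\eta_w(\varphi_w-\psi_u)}{\eta},\quad \eta_{uw}=\tfrac{\eta_w\eta_u}{\eta},\quad \eta_{ww}=\tfrac{\eta_w^2}{\eta}. \tag{2}$$ **(B)** Let in addition $\Omega$ be convex. Then (2) holds on $\Omega$ if and only if a transformation $$\tilde x=p(x-sy)+k_1t,\ \ \tilde y=qy+k_2t,\ \ \tilde t=rt,\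 \ \tilde u=au+b,\ \ \tilde w=\tfrac{ap}{q}(w+su)+c\qquad(p,q,r,a\ne0),$$ that is $\tilde\varphi=\frac{p(\varphi-s\psi+s^2\eta)-k_1}{r}$, $\tilde\psi=\frac{q(\psi-2s\eta)-k_2}{r}$, $\tilde\eta=\frac{q^2}{pr}\eta$, brings the coefficients to one of the following forms on the image of $\Omega$ (Greek letters other than $\varphi,\psi,\eta$ are constants): 1. $\eta=1$, and either $\psi=\gamma u$, $\varphi=\beta w-\frac12\beta(\beta+\gamma)u^2+\delta u$; or $\psi=\alpha w+\gamma e^{\alpha u}$, $\varphi=\delta e^{2\alpha u}$ with $\alpha\ne0$. 2. $\eta=u>0$, and either $\psi=\alpha w+\gamma u^{\alpha+1}$, $\varphi=\delta u^{2\alpha+1}$ with $\alpha\notin\{0,-1,-\frac12\}$; or $\psi=-2\beta u\ln u-\beta u$, $\varphi=\beta w+\beta^2u\ln^2u+\delta u$; or $\psi=-w+\gamma\ln u$, $\varphi=\delta/u$; or $\psi=-\frac12w+\gamma\sqrt u$, $\varphi=\delta\ln u$. 3. $\eta=e^wh(u)$, $\psi=e^wf(u)$, $\varphi=e^wg(u)$,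 where $$h''=f'-g,\qquad g''h=2fg'-gf'-g^2,\qquad f''h=2hg'-2gh'+ff'-fg. \tag{3}$$ Moreover, on an open set $I\subset\mathbb R$, writing $f=h'+p$, system (3) is equivalent to $g=p'$, $hp'''=2h'p''-p'h''+2pp''-2p'^2$, $hh'''=h'h''-2h'p'+hp''+ph''$. Let $I$ be an open interval and $h\ne0$ on $I$. * For $p=h'$, i.e. $f=2h'$, $g=h''$, system (3) is equivalent to $h''''h+3(h'')^2-4h'h'''=0$, and this holds if and only if $h$ is a sigma-function: $(\ln|h|)''=-\wp$ on $I$ where, for some real $c$ and $u_0$, $\wp(u)=\wp(u-u_0;g_2=0,g_3=c)$ is a translated Weierstrass function (for $c=0$: $\wp=(u-u_0)^{-2}$ or the limiting case $\wp=0$). * For $p=ch$, $c$ a constant, i.e. $f=h'+ch$, $g=ch'$, system (3) is equivalent to $h'''h-h''h'=2c(h''h-h'^2)$, and this holds if and only if for some constants $\alpha,\beta,\gamma$ one has $h=\alpha e^{(c+\gamma)u}+\beta e^{(c-\gamma)u}$, or $h=(\alpha+\beta u)e^{cu}$, or $h=e^{cu}(\alpha\cos\gamma u+\beta\sin\gamma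 u)$. **(C)** Let $\Omega\subset\mathbb R^3$ be open and convex, let $\varphi,\psi,\eta,\tau$ be functions of $(u,v,w)\in\Omega$ with $\eta\ne0$, $\tau\ne0$, and write the system $u_t=\varphi u_x+\psi u_y+\eta w_y+\tau v_x$, $w_x=u_y$, $v_y=u_x$ as $A\mathbf u_t+B\mathbf u_x+C\mathbf u_y=0$, $\mathbf u=(u,v,w)^t$, with $$A=\begin{pmatrix}-1&0&0\\0&0&0\\0&0&0\end{pmatrix},\quad B=\begin{pmatrix}\varphi&\tau&0\\0&0&1\\-1&0&0\end{pmatrix},\quad C=\begin{pmatrix}\psi&0&\eta\\-1&0&0\\0&1&0\end{pmatrix}.$$ For a $(1,1)$-tensor $V=[v^i_j]$ put $N^i_{jk}=v^p_j\partial_pv^i_k-v^p_k\partial_pv^i_j-v^i_p(\partial_jv^p_k-\partial_kv^p_j)$; its Haantjes tensor is $H^i_{jk}=N^i_{pr}v^p_jv^r_k-N^p_{jr}v^i_pv^r_k-N^p_{rk}v^i_pv^r_j+N^p_{jk}v^i_rv^r_p$. The following are equivalent: (i) the Haantjes tensor of $(\alpha A+\beta B+\gamma C)^{-1}(\tilde\alpha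 A+\tilde\beta B+\tilde\gamma C)$ vanishes for all constants, wherever the inverse exists in $\Omega$; (ii) the same for the family $(\alpha A+B)^{-1}(\tilde\alpha A+C)$; (iii) $\tau_u=\varphi_v$, $\eta_u=\psi_w$, $\tau_v=\frac\tau\eta\psi_u$, $\eta_v=0$, $\tau_w=0$, $\eta_w=\frac\eta\tau\varphi_u$, $\psi_v=\varphi_w=0$, $\tau\psi_w=\eta\varphi_v$; (iv) up to a transformation $\tilde x=px+k_1t$, $\tilde y=qy+k_2t$, $\tilde t=rt$, $\tilde u=au+b$, $\tilde v=\frac{aq}{p}v+c$, $\tilde w=\frac{ap}{q}w+d$ $(p,q,r,a\ne0)$, possibly after interchanging $x\leftrightarrow y$, $v\leftrightarrow w$, the system is one of 1. $u_t=\nu(uv)_x+\mu(uw)_y$, or the linear system $u_t=\nu v_x+\mu w_y$; 2. $u_t=\nu(uv+\alpha u^3/6)_x+\mu(e^{\alpha w}u)_y$ or $u_t=\nu(v+\alpha u^2/2)_x+\mu(e^{\alpha w})_y$, with $\alpha\ne0$; 3. $u_t=\nu(e^{\beta v}k(u))_x+\mu(e^{\alpha w}k(u))_y$ with $\alpha,\beta\ne0$,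 $k''=\alpha\beta k$, where $\mu,\nu,\alpha,\beta$ are constants. -/

import Mathlib

open scoped ContDiff Topology

noncomputable section

namespace DispersionlessLimits

/-- Partial derivative in the `i`-th coordinate. -/
def pd {n : ℕ} (i : Fin n) (F : (Fin n → ℝ) → ℝ) : (Fin n → ℝ) → ℝ :=
  fun x => fderiv ℝ F x (Pi.single i 1)

/-! ### Non-symmetric systems `u_t = φ u_x + ψ u_y + η w_y`, `w_x = u_y`

The coefficients are functions of `z = ![u, w]`; coordinate `0` is `u`, coordinate `1` is `w`. -/

/-- The second order system for `φ, ψ, η` on the set `Ω` of the `(u, w)`-plane. -/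
def NonsymInt (Ω : Set (Fin 2 → ℝ)) (φ ψ η : (Fin 2 → ℝ) → ℝ) : Prop :=
  ∀ z ∈ Ω,
    pd 0 (pd 0 φ) z = -((pd 1 φ z) ^ 2 + pd 0 ψ z * pd 1 φ z - 2 * pd 1 ψ z * pd 0 φ z) / η z ∧
    pd 1 (pd 0 φ) z = pd 1 η z * pd 0 φ z / η z ∧
    pd 1 (pd 1 φ) z = pd 1 η z * pd 1 φ z / η z ∧
    pd 0 (pd 0 ψ) z = (-(pd 1 φ z * pd 1 ψ z) + pd 0 ψ z * pd 1 ψ z - 2 * pd 1 φ z * pd 0 η z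
      + 2 * pd 1 η z * pd 0 φ z) / η z ∧
    pd 1 (pd 0 ψ) z = pd 1 η z * pd 0 ψ z / η z ∧
    pd 1 (pd 1 ψ) z = pd 1 η z * pd 1 ψ z / η z ∧
    pd 0 (pd 0 η) z = -(pd 1 η z * (pd 1 φ z - pd 0 ψ z)) / η z ∧
    pd 1 (pd 0 η) z = pd 1 η z * pd 0 η z / η z ∧
    pd 1 (pd 1 η) z = (pd 1 η z) ^ 2 / η z

/-- An `N`-component hydrodynamic reduction of the non-symmetric system, on a set `V` of values of
the phases `R = (R¹, …, Rᴺ)`: fields `u = U(R)`, `w = W(R)` and characteristic speeds `μⁱ(R)`,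
`λⁱ(R)` (here `lam i`) such that the flows `Rⁱ_y = μⁱ Rⁱ_x`, `Rⁱ_t = λⁱ Rⁱ_x` are consistent, and
such that substituting `u = U(R)`, `w = W(R)` into the system makes the coefficient of each `Rⁱ_x`
vanish identically. -/
structure IsReduction {N : ℕ} (Ω : Set (Fin 2 → ℝ)) (φ ψ η : (Fin 2 → ℝ) → ℝ)
    (V : Set (Fin N → ℝ)) (U W : (Fin N → ℝ) → ℝ) (μ lam : Fin N → (Fin N → ℝ) → ℝ) : Prop where
  smooth_U : ContDiffOn ℝ ∞ U V
  smooth_W : ContDiffOn ℝ ∞ W V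
  smooth_μ : ∀ i, ContDiffOn ℝ ∞ (μ i) V
  smooth_lam : ∀ i, ContDiffOn ℝ ∞ (lam i) V
  mem : ∀ R ∈ V, ![U R, W R] ∈ Ω
  consistent : ∀ R ∈ V, ∀ i j, i ≠ j →
    pd j (μ i) R * (lam j R - lam i R) = pd j (lam i) R * (μ j R - μ i R)
  first_eq : ∀ R ∈ V, ∀ i,
    lam i R * pd i U R = φ ![U R, W R] * pd i U R + ψ ![U R, W R] * (μ i R * pd i U R)
      + η ![U R, W R] * (μ i R * pd i W R)
  second_eq : ∀ R ∈ V, ∀ i, pd i W R = μ i R * pd i U R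

/-- The phases `R(x, y, t)` (coordinates `0, 1, 2` are `x, y, t`) solve `Rⁱ_y = μⁱ Rⁱ_x`,
`Rⁱ_t = λⁱ Rⁱ_x` on `O`, and the fields `u = U(R(x, y, t))`, `w = W(R(x, y, t))` solve
`u_t = φ u_x + ψ u_y + η w_y`, `w_x = u_y` there. -/
structure IsPhaseSolution {N : ℕ} (φ ψ η : (Fin 2 → ℝ) → ℝ)
    (V : Set (Fin N → ℝ)) (U W : (Fin N → ℝ) → ℝ) (μ lam : Fin N → (Fin N → ℝ) → ℝ)
    (O : Set (Fin 3 → ℝ)) (R : (Fin 3 → ℝ) → (Fin N → ℝ)) : Prop where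
  smooth : ContDiffOn ℝ ∞ R O
  mem : ∀ q ∈ O, R q ∈ V
  y_flow : ∀ q ∈ O, ∀ i, pd 1 (fun q => R q i) q = μ i (R q) * pd 0 (fun q => R q i) q
  t_flow : ∀ q ∈ O, ∀ i, pd 2 (fun q => R q i) q = lam i (R q) * pd 0 (fun q => R q i) q
  first_eq : ∀ q ∈ O,
    pd 2 (fun q => U (R q)) q
      = φ ![U (R q), W (R q)] * pd 0 (fun q => U (R q)) q
        + ψ ![U (R q), W (R q)] * pd 1 (fun q => U (R q)) q
        + η ![U (R q), W (R q)] * pd 1 (fun q => W (R q)) q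
  second_eq : ∀ q ∈ O, pd 0 (fun q => W (R q)) q = pd 1 (fun q => U (R q)) q

/-- Integrability by hydrodynamic reductions: for every number of phases `N`, the system has
`N`-phase solutions parametrised by `2N` arbitrary functions of one variable.

The freedom `Rⁱ ↦ Fⁱ(Rⁱ)` in the choice of the phases is removed by requiring `u = u₀ + Rⁱ` along
the `i`-th coordinate axis. The arbitrary functions are then the restrictions `m i` of the
characteristic speeds `μⁱ` to the coordinate axes (pairwise distinct at the base point) and the
initial profiles `r i = Rⁱ(·, 0, 0)`. Everything is local, near an arbitrary point `(u₀, w₀)`. -/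
def HydrodynamicallyIntegrable (Ω : Set (Fin 2 → ℝ)) (φ ψ η : (Fin 2 → ℝ) → ℝ) : Prop :=
  ∀ (N : ℕ) (u₀ w₀ : ℝ), ![u₀, w₀] ∈ Ω →
  ∀ m r : Fin N → ℝ → ℝ,
    (∀ i, AnalyticAt ℝ (m i) 0) → (∀ i, AnalyticAt ℝ (r i) 0) →
    Function.Injective (fun i => m i 0) → (∀ i, r i 0 = 0) →
  ∃ (V : Set (Fin N → ℝ)) (U W : (Fin N → ℝ) → ℝ) (μ lam : Fin N → (Fin N → ℝ) → ℝ),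
    IsOpen V ∧ 0 ∈ V ∧ IsReduction Ω φ ψ η V U W μ lam ∧
    U 0 = u₀ ∧ W 0 = w₀ ∧
    (∀ i, ∀ᶠ s in 𝓝 (0 : ℝ), U (Pi.single i s) = u₀ + s ∧ μ i (Pi.single i s) = m i s) ∧
    ∃ (O : Set (Fin 3 → ℝ)) (R : (Fin 3 → ℝ) → (Fin N → ℝ)),
      IsOpen O ∧ 0 ∈ O ∧ IsPhaseSolution φ ψ η V U W μ lam O R ∧
      ∀ i, ∀ᶠ x in 𝓝 (0 : ℝ), R ![x, 0, 0] i = r i x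

/-- The changes of variables preserving the form of the non-symmetric system: translations,
rescalings, Galilean transformations and `x ↦ x - s y`. In full,
`x' = p (x - s y) + k₁ t`, `y' = q y + k₂ t`, `t' = r t`,
`u' = a u + b`, `w' = a (p / q) (w + s u) + c`. -/
structure NonsymTransformation where
  (p q r a s b c k₁ k₂ : ℝ)
  p_ne : p ≠ 0
  q_ne : q ≠ 0
  r_ne : r ≠ 0
  a_ne : a ≠ 0

/-- The action on `(u, w)`. -/
def NonsymTransformation.map (T : NonsymTransformation) (z : Fin 2 → ℝ) : Fin 2 → ℝ :=
  ![T.a * z 0 + T.b, T.a * (T.p / T.q) * (z 1 + T.s * z 0) + T.c]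

/-- `T` carries the system with coefficients `φ, ψ, η` on `Ω` to the system with coefficients
`φ', ψ', η'` on the image of `Ω`. -/
def NonsymTransformation.Carries (T : NonsymTransformation) (Ω : Set (Fin 2 → ℝ))
    (φ ψ η φ' ψ' η' : (Fin 2 → ℝ) → ℝ) : Prop :=
  ∀ z ∈ Ω,
    φ' (T.map z) = (T.p * (φ z - T.s * ψ z + T.s ^ 2 * η z) - T.k₁) / T.r ∧
    ψ' (T.map z) = (T.q * (ψ z - 2 * T.s * η z) - T.k₂) / T.r ∧
    η' (T.map z) = T.q ^ 2 / (T.p * T.r) * η z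

/-- The system of ordinary differential equations for `f, g, h` in the case
`φ = e^w g(u)`, `ψ = e^w f(u)`, `η = e^w h(u)`. -/
def ExpSystem (I : Set ℝ) (f g h : ℝ → ℝ) : Prop :=
  ∀ u ∈ I,
    iteratedDeriv 2 h u = deriv f u - g u ∧
    iteratedDeriv 2 g u * h u = 2 * f u * deriv g u - g u * deriv f u - (g u) ^ 2 ∧
    iteratedDeriv 2 f u * h u
      = 2 * h u * deriv g u - 2 * g u * deriv h u + f u * deriv f u - f u * g u

/-- The coefficients are `φ, ψ, η` on `Ω`, as functions of `u` and `w`. -/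
def HasCoeffs (Ω : Set (Fin 2 → ℝ)) (φ ψ η : (Fin 2 → ℝ) → ℝ) (φ₀ ψ₀ η₀ : ℝ → ℝ → ℝ) : Prop :=
  ∀ z ∈ Ω, φ z = φ₀ (z 0) (z 1) ∧ ψ z = ψ₀ (z 0) (z 1) ∧ η z = η₀ (z 0) (z 1)

/-- `η = 1`, polynomial solutions. -/
def PolynomialFamily (Ω : Set (Fin 2 → ℝ)) (φ ψ η : (Fin 2 → ℝ) → ℝ) : Prop :=
  ∃ β γ δ : ℝ, HasCoeffs Ω φ ψ η
    (fun u w => β * w - 1 / 2 * β * (β + γ) * u ^ 2 + δ * u) (fun u _ => γ * u) (fun _ _ => 1)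

/-- `η = 1`, exponential solutions. -/
def ExponentialFamily (Ω : Set (Fin 2 → ℝ)) (φ ψ η : (Fin 2 → ℝ) → ℝ) : Prop :=
  ∃ α γ δ : ℝ, α ≠ 0 ∧ HasCoeffs Ω φ ψ η
    (fun u _ => δ * Real.exp (2 * α * u)) (fun u w => α * w + γ * Real.exp (α * u)) (fun _ _ => 1)

/-- `η = u`, power-like solutions. -/
def PowerFamily (Ω : Set (Fin 2 → ℝ)) (φ ψ η : (Fin 2 → ℝ) → ℝ) : Prop :=
  (∀ z ∈ Ω, 0 < z 0) ∧
  ∃ α γ δ : ℝ, α ≠ 0 ∧ α ≠ -1 ∧ α ≠ -1 / 2 ∧ HasCoeffs Ω φ ψ η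
    (fun u _ => δ * u ^ (2 * α + 1)) (fun u w => α * w + γ * u ^ (α + 1)) (fun u _ => u)

/-- `η = u`, logarithmic solutions, `α = 0`. -/
def LogFamily₁ (Ω : Set (Fin 2 → ℝ)) (φ ψ η : (Fin 2 → ℝ) → ℝ) : Prop :=
  (∀ z ∈ Ω, 0 < z 0) ∧
  ∃ β δ : ℝ, HasCoeffs Ω φ ψ η
    (fun u w => β * w + β ^ 2 * u * Real.log u ^ 2 + δ * u)
    (fun u _ => -2 * β * u * Real.log u - β * u) (fun u _ => u)

/-- `η = u`, logarithmic solutions, `α = -1`. -/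
def LogFamily₂ (Ω : Set (Fin 2 → ℝ)) (φ ψ η : (Fin 2 → ℝ) → ℝ) : Prop :=
  (∀ z ∈ Ω, 0 < z 0) ∧
  ∃ γ δ : ℝ, HasCoeffs Ω φ ψ η
    (fun u _ => δ / u) (fun u w => -w + γ * Real.log u) (fun u _ => u)

/-- `η = u`, logarithmic solutions, `α = -1/2`. -/
def LogFamily₃ (Ω : Set (Fin 2 → ℝ)) (φ ψ η : (Fin 2 → ℝ) → ℝ) : Prop :=
  (∀ z ∈ Ω, 0 < z 0) ∧
  ∃ γ δ : ℝ, HasCoeffs Ω φ ψ η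
    (fun u _ => δ * Real.log u) (fun u w => -(1 / 2) * w + γ * Real.sqrt u) (fun u _ => u)

/-- `η = e^w h(u)`. -/
def ExpFamily (Ω : Set (Fin 2 → ℝ)) (φ ψ η : (Fin 2 → ℝ) → ℝ) : Prop :=
  ∃ f g h : ℝ → ℝ,
    ContDiffOn ℝ ∞ f ((fun z => z 0) '' Ω) ∧ ContDiffOn ℝ ∞ g ((fun z => z 0) '' Ω) ∧
    ContDiffOn ℝ ∞ h ((fun z => z 0) '' Ω) ∧
    ExpSystem ((fun z => z 0) '' Ω) f g h ∧
    HasCoeffs Ω φ ψ η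
      (fun u w => Real.exp w * g u) (fun u w => Real.exp w * f u) (fun u w => Real.exp w * h u)

/-- The list of normal forms of non-symmetric systems. -/
def NonsymNormalForm (Ω : Set (Fin 2 → ℝ)) (φ ψ η : (Fin 2 → ℝ) → ℝ) : Prop :=
  PolynomialFamily Ω φ ψ η ∨ ExponentialFamily Ω φ ψ η ∨ PowerFamily Ω φ ψ η ∨
  LogFamily₁ Ω φ ψ η ∨ LogFamily₂ Ω φ ψ η ∨ LogFamily₃ Ω φ ψ η ∨ ExpFamily Ω φ ψ η

/-- On `I`, the real function `P` is a translate of the Weierstrass function `℘(u; g₂, g₃)` with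
`g₂ = 0`, `g₃ = c`. For `c = 0` this function degenerates to `1 / u²` (or, when the pole is sent to
infinity, to `0`). -/
def IsWeierstrassP (I : Set ℝ) (c : ℝ) (P : ℝ → ℝ) : Prop :=
  (c ≠ 0 ∧ ∃ (L : PeriodPair) (u₀ : ℝ), L.g₂ = 0 ∧ L.g₃ = (c : ℂ) ∧
    ∀ u ∈ I, ((u - u₀ : ℝ) : ℂ) ∉ L.lattice ∧ (P u : ℂ) = L.weierstrassP ((u - u₀ : ℝ) : ℂ)) ∨
  (c = 0 ∧ ((∃ u₀ : ℝ, ∀ u ∈ I, u ≠ u₀ ∧ P u = 1 / (u - u₀) ^ 2) ∨ ∀ u ∈ I, P u = 0))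

/-- On `I`, the function `σ` is a Weierstrass sigma-function with `g₂ = 0`, in the sense that
`(ln |σ|)'' = -℘` (this fixes `σ` up to a factor `e^{k u + l}` and a sign). -/
def IsSigmaFunction (I : Set ℝ) (σ : ℝ → ℝ) : Prop :=
  ∃ (c : ℝ) (P : ℝ → ℝ), IsWeierstrassP I c P ∧
    ∀ u ∈ I, iteratedDeriv 2 (fun s => Real.log |σ s|) u = -P u

/-! ### Symmetric systems `u_t = φ u_x + ψ u_y + η w_y + τ v_x`, `w_x = u_y`, `v_y = u_x`

The coefficients are functions of `z = ![u, v, w]`; coordinates `0, 1, 2` are `u, v, w`. -/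

/-- Nijenhuis tensor `N^i_{jk}` of a `(1,1)`-tensor `V = [v^i_j]`, where `v^i_j = V z i j`. -/
def nijenhuis {m : ℕ} (V : (Fin m → ℝ) → Matrix (Fin m) (Fin m) ℝ) (z : Fin m → ℝ)
    (i j k : Fin m) : ℝ :=
  ∑ p, (V z p j * pd p (fun y => V y i k) z - V z p k * pd p (fun y => V y i j) z
    - V z i p * (pd j (fun y => V y p k) z - pd k (fun y => V y p j) z))

/-- Haantjes tensor `H^i_{jk}`. -/
def haantjes {m : ℕ} (V : (Fin m → ℝ) → Matrix (Fin m) (Fin m) ℝ) (z : Fin m → ℝ)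
    (i j k : Fin m) : ℝ :=
  ∑ p, ∑ r, (nijenhuis V z i p r * V z p j * V z r k - nijenhuis V z p j r * V z i p * V z r k
    - nijenhuis V z p r k * V z i p * V z r j + nijenhuis V z p j k * V z i r * V z r p)

/-- The matrices of the system, written as `A 𝐮_t + B 𝐮_x + C 𝐮_y = 0` with `𝐮 = (u, v, w)`. -/
def symA : Matrix (Fin 3) (Fin 3) ℝ := !![-1, 0, 0; 0, 0, 0; 0, 0, 0]

def symB (φ τ : (Fin 3 → ℝ) → ℝ) (z : Fin 3 → ℝ) : Matrix (Fin 3) (Fin 3) ℝ :=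
  !![φ z, τ z, 0; 0, 0, 1; -1, 0, 0]

def symC (ψ η : (Fin 3 → ℝ) → ℝ) (z : Fin 3 → ℝ) : Matrix (Fin 3) (Fin 3) ℝ :=
  !![ψ z, 0, η z; -1, 0, 0; 0, 1, 0]

/-- The Haantjes tensor of `(αA + βB + γC)⁻¹ (α'A + β'B + γ'C)` vanishes, for all constants and at
all points where the inverse exists. -/
def HaantjesVanishes (Ω : Set (Fin 3 → ℝ)) (φ ψ η τ : (Fin 3 → ℝ) → ℝ) : Prop :=
  ∀ α β γ α' β' γ' : ℝ, ∀ z ∈ Ω, (α • symA + β • symB φ τ z + γ • symC ψ η z).det ≠ 0 →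
    ∀ i j k, haantjes (fun y => (α • symA + β • symB φ τ y + γ • symC ψ η y)⁻¹
      * (α' • symA + β' • symB φ τ y + γ' • symC ψ η y)) z i j k = 0

/-- The same for the two-parameter family `(αA + B)⁻¹ (α'A + C)` only
(here `det (αA + B) = -τ`). -/
def HaantjesVanishes₂ (Ω : Set (Fin 3 → ℝ)) (φ ψ η τ : (Fin 3 → ℝ) → ℝ) : Prop :=
  ∀ α α' : ℝ, ∀ z ∈ Ω, ∀ i j k,
    haantjes (fun y => (α • symA + symB φ τ y)⁻¹ * (α' • symA + symC ψ η y)) z i j k = 0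

/-- The first order system for `φ, ψ, η, τ`. -/
def SymInt (Ω : Set (Fin 3 → ℝ)) (φ ψ η τ : (Fin 3 → ℝ) → ℝ) : Prop :=
  ∀ z ∈ Ω,
    pd 0 τ z = pd 1 φ z ∧ pd 0 η z = pd 2 ψ z ∧
    pd 1 τ z = τ z / η z * pd 0 ψ z ∧ pd 1 η z = 0 ∧
    pd 2 τ z = 0 ∧ pd 2 η z = η z / τ z * pd 0 φ z ∧
    pd 1 ψ z = 0 ∧ pd 2 φ z = 0 ∧ τ z * pd 2 ψ z = η z * pd 1 φ z

/-- Translations, rescalings and Galilean transformations, in full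
`x' = p x + k₁ t`, `y' = q y + k₂ t`, `t' = r t`,
`u' = a u + b`, `v' = a (q / p) v + c`, `w' = a (p / q) w + d`. -/
structure SymTransformation where
  (p q r a b c d k₁ k₂ : ℝ)
  p_ne : p ≠ 0
  q_ne : q ≠ 0
  r_ne : r ≠ 0
  a_ne : a ≠ 0

/-- The action on `(u, v, w)`. -/
def SymTransformation.map (T : SymTransformation) (z : Fin 3 → ℝ) : Fin 3 → ℝ :=
  ![T.a * z 0 + T.b, T.a * (T.q / T.p) * z 1 + T.c, T.a * (T.p / T.q) * z 2 + T.d]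

/-- `T` carries the system with coefficients `φ, ψ, η, τ` on `Ω` to the system with coefficients
`φ', ψ', η', τ'` on the image of `Ω`. -/
def SymTransformation.Carries (T : SymTransformation) (Ω : Set (Fin 3 → ℝ))
    (φ ψ η τ φ' ψ' η' τ' : (Fin 3 → ℝ) → ℝ) : Prop :=
  ∀ z ∈ Ω,
    φ' (T.map z) = (T.p * φ z - T.k₁) / T.r ∧
    ψ' (T.map z) = (T.q * ψ z - T.k₂) / T.r ∧
    η' (T.map z) = T.q ^ 2 / (T.p * T.r) * η z ∧
    τ' (T.map z) = T.p ^ 2 / (T.q * T.r) * τ z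

/-- The interchange `v ↔ w`, which comes from `x ↔ y` and exchanges `φ ↔ ψ`, `η ↔ τ`. -/
def swapVW (z : Fin 3 → ℝ) : Fin 3 → ℝ := ![z 0, z 2, z 1]

/-- On `Ω` the system is the equation `u_t = (G(u, v))_x + (F(u, w))_y` (with `w_x = u_y`,
`v_y = u_x`), that is `φ = G_u`, `τ = G_v`, `ψ = F_u`, `η = F_w`. -/
def IsConservationLaw (Ω : Set (Fin 3 → ℝ)) (φ ψ η τ : (Fin 3 → ℝ) → ℝ)
    (G F : ℝ → ℝ → ℝ) : Prop :=
  ∀ z ∈ Ω,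
    φ z = deriv (fun u => G u (z 1)) (z 0) ∧ τ z = deriv (fun v => G (z 0) v) (z 1) ∧
    ψ z = deriv (fun u => F u (z 2)) (z 0) ∧ η z = deriv (fun w => F (z 0) w) (z 2)

/-- The list of normal forms of symmetric systems:
`u_t = ν (uv)_x + μ (uw)_y`;
`u_t = ν v_x + μ w_y`;
`u_t = ν (uv + α u³/6)_x + μ (e^{αw} u)_y`;
`u_t = ν (v + α u²/2)_x + μ (e^{αw})_y`;
`u_t = ν (e^{βv} k(u))_x + μ (e^{αw} k(u))_y` with `k'' = αβ k`. -/
def SymNormalForm (Ω : Set (Fin 3 → ℝ)) (φ ψ η τ : (Fin 3 → ℝ) → ℝ) : Prop :=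
  (∃ ν μ : ℝ, IsConservationLaw Ω φ ψ η τ (fun u v => ν * (u * v)) (fun u w => μ * (u * w))) ∨
  (∃ ν μ : ℝ, IsConservationLaw Ω φ ψ η τ (fun _ v => ν * v) (fun _ w => μ * w)) ∨
  (∃ ν μ α : ℝ, α ≠ 0 ∧ IsConservationLaw Ω φ ψ η τ
    (fun u v => ν * (u * v + α * u ^ 3 / 6)) (fun u w => μ * (Real.exp (α * w) * u))) ∨
  (∃ ν μ α : ℝ, α ≠ 0 ∧ IsConservationLaw Ω φ ψ η τ
    (fun u v => ν * (v + α * u ^ 2 / 2)) (fun _ w => μ * Real.exp (α * w))) ∨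
  (∃ ν μ α β : ℝ, α ≠ 0 ∧ β ≠ 0 ∧ ∃ k : ℝ → ℝ, ContDiff ℝ ∞ k ∧
    (∀ u, iteratedDeriv 2 k u = α * β * k u) ∧ IsConservationLaw Ω φ ψ η τ
      (fun u v => ν * (Real.exp (β * v) * k u)) (fun u w => μ * (Real.exp (α * w) * k u)))

/-- The system can be brought to normal form by translations, rescalings and Galilean
transformations, possibly after the interchange of `x, v` with `y, w`. -/
def SymReducible (Ω : Set (Fin 3 → ℝ)) (φ ψ η τ : (Fin 3 → ℝ) → ℝ) : Prop :=
  ∃ (T : SymTransformation) (φ' ψ' η' τ' : (Fin 3 → ℝ) → ℝ),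
    (T.Carries Ω φ ψ η τ φ' ψ' η' τ' ∧ SymNormalForm (T.map '' Ω) φ' ψ' η' τ') ∨
    (T.Carries (swapVW '' Ω) (ψ ∘ swapVW) (φ ∘ swapVW) (τ ∘ swapVW) (η ∘ swapVW) φ' ψ' η' τ' ∧
      SymNormalForm (T.map '' (swapVW '' Ω)) φ' ψ' η' τ')

end DispersionlessLimits

end

open DispersionlessLimits

/-! (A) Wherever `∂ᵢu ≠ 0`, a reduction satisfies the dispersion relation `λⁱ = φ + ψ μⁱ + η (μⁱ)²`.
Inserted into the consistency condition, together with `∂ᵢw = μⁱ ∂ᵢu` and the symmetry of the mixed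
derivatives of `w`, it yields the Gibbons-Tsarev system: `∂ⱼμⁱ = gtA(μⁱ, μʲ) ∂ⱼu` and `∂ⱼ∂ᵢu =
gtB(μⁱ, μʲ) ∂ᵢu ∂ⱼu`, with coefficients rational in the speeds. Necessity: with three phases the
speeds at a point are three arbitrary distinct numbers, so the equality of `∂ₖ∂ⱼμⁱ` and `∂ⱼ∂ₖμⁱ`
holds for all of them. It is affine in the nine second derivatives of the coefficients, and finitely
many values of the speeds determine these (`JetInt.of_gtA_compat`). Sufficiency: under (2) the
Gibbons-Tsarev system is compatible (`JetInt.gtA_compat`, `JetInt.gtB_compat`), and it is a Darboux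
system: each unknown has prescribed derivatives in some directions and prescribed values along the
others. The coefficients are only smooth, so power series are not available.
`exists_darboux_solution` integrates along straight paths, solves the resulting Volterra equation
with the inverse function theorem in a Banach space (`exists_volterra_solution`), and shows that
compatibility forces the remaining residuals to vanish. The phases themselves come from Tsarev's
generalized hodograph method (`exists_hodograph_solution`), which needs two more applications of
this kind of argument: a Darboux system for a third commuting flow, and the implicit function
theorem.

(B) The last two equations of (2) say that `η_w / η` is a constant `κ`. If `κ ≠ 0`, all coefficients
are `e^{κw}` times functions of `u`, up to additive constants in `φ` and `ψ`, and (2) becomes (3).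
If `κ = 0`, then `η` is affine in `u`, `φ` and `ψ` are linear in `w`, and (2) becomes linear
ordinary differential equations; a shear decouples them and elementary integration gives the lists
(`exists_normalForm_of_const`, `exists_normalForm_of_affine`). For sigma-functions, `P = -(ln
|h|)''` turns the fourth order equation into `P'' = 6P²`. Its real solutions are identified by
matching a point value and slope with those of `℘` for a suitable hexagonal lattice and invoking
uniqueness across the poles (`exists_isWeierstrassP`).

(C) The two-parameter family already yields the first order system (iii), by varying the two
constants at a fixed point. Conversely, (iii) says that the differentials of all four coefficients
are governed by three numbers `A, B, C` at each point (`SymDifferential`), and then the Haantjes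
tensor vanishes: up to a multiple of the identity the matrix is a rank one term plus a constant one,
and Cayley-Hamilton reduces the claim to identities between two-forms
(`haantjesAt_eq_zero_of_two_forms`). Integrating (iii), `A` and `C` are constants and `B` is the
logarithmic derivative of a function `k(u)` with `k'' = A C k`, which leads to the normal forms
(`SymInt.exists_eq_exp_mul`). -/

namespace DispersionlessLimits
-- Superposition operators on spaces of continuous functions
/-- The bilinear map induced by a bilinear map on spaces of continuous functions. -/
noncomputable def bilinField (K : Type) {L E F : Type} [TopologicalSpace K] [CompactSpace K]
    [NormedAddCommGroup L] [NormedSpace ℝ L]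
    [NormedAddCommGroup E] [NormedSpace ℝ E] [NormedAddCommGroup F] [NormedSpace ℝ F]
    (B : L →L[ℝ] E →L[ℝ] F) : C(K, L) →L[ℝ] C(K, E) →L[ℝ] C(K, F) :=
  LinearMap.mkContinuous₂
    (LinearMap.mk₂ ℝ
      (fun (A : C(K, L)) (h : C(K, E)) => (⟨fun x => B (A x) (h x), by fun_prop⟩ : C(K, F)))
      (fun _ _ _ => by ext; simp) (fun _ _ _ => by ext; simp)
      (fun _ _ _ => by ext; simp) (fun _ _ _ => by ext; simp)) ‖B‖
    (fun A h => by
      rw [ContinuousMap.norm_le _ (by positivity)]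
      intro x
      simp only [LinearMap.mk₂_apply, ContinuousMap.coe_mk]
      refine (B.le_opNorm₂ _ _).trans ?_
      gcongr
      · exact A.norm_coe_le_norm x
      · exact h.norm_coe_le_norm x)

@[simp] lemma bilinField_apply {K L E F : Type} [TopologicalSpace K] [CompactSpace K]
    [NormedAddCommGroup L] [NormedSpace ℝ L]
    [NormedAddCommGroup E] [NormedSpace ℝ E] [NormedAddCommGroup F] [NormedSpace ℝ F]
    (B : L →L[ℝ] E →L[ℝ] F) (A : C(K, L)) (h : C(K, E)) (x : K) :
    bilinField K B A h x = B (A x) (h x) := rfl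

/-- The derivative at `g` sends `h` to `x ↦ B (f' (g x)) (h x)`. Continuity of `g ↦ f' ∘ g` in the
sup norm makes `B ∘ f'` vary by at most `c` on every segment from `g x` to `g x + h x`, so the mean
value inequality bounds the remainder uniformly in `x`. -/
lemma contDiff_succ_comp_continuousMap {K E F L : Type} [TopologicalSpace K] [CompactSpace K]
    [NormedAddCommGroup E] [NormedSpace ℝ E] [NormedAddCommGroup F] [NormedSpace ℝ F]
    [NormedAddCommGroup L] [NormedSpace ℝ L] (B : L →L[ℝ] E →L[ℝ] F) (n : ℕ)
    (f : C(E, F)) (f' : C(E, L)) (hf : ∀ x, HasFDerivAt f (B (f' x)) x)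
    (h1 : ContDiff ℝ n (fun g : C(K, E) => f'.comp g)) :
    ContDiff ℝ (n + 1 : ℕ) (fun g : C(K, E) => f.comp g) := by
  have hc : Continuous (fun g : C(K, E) => (bilinField K B (f'.comp g))) :=
    (bilinField K B).continuous.comp h1.continuous
  have hc' : Continuous (fun g : C(K, E) => f'.comp g) := h1.continuous
  have : ((n + 1 : ℕ) : ℕ∞ω) = (n : ℕ∞ω) + 1 := by push_cast; rfl
  rw [this, contDiff_succ_iff_hasFDerivAt]
  refine ⟨fun g => bilinField K B (f'.comp g),
    ContDiff.comp (g := fun A => bilinField K B A) (bilinField K B).contDiff h1, fun g => ?_⟩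
  rw [hasFDerivAt_iff_isLittleO_nhds_zero, Asymptotics.isLittleO_iff]
  intro c hc0
  obtain ⟨δ, hδ, hδ'⟩ := Metric.continuousAt_iff (f := fun g : C(K, E) => f'.comp g).1
    (hc'.continuousAt (x := g)) (c / (‖B‖ + 1)) (by positivity)
  filter_upwards [Metric.ball_mem_nhds (0 : C(K, E)) hδ] with h hh
  rw [mem_ball_zero_iff] at hh
  rw [ContinuousMap.norm_le _ (by positivity)]
  intro x
  have key : ∀ y ∈ segment ℝ (g x) (g x + h x), ‖B (f' y) - B (f' (g x))‖ ≤ c := by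
    intro y hy
    rw [segment_eq_image'] at hy
    obtain ⟨t, ht, rfl⟩ := hy
    have h2 : dist (g + t • h) g < δ := by
      rw [dist_eq_norm, add_sub_cancel_left, norm_smul, Real.norm_of_nonneg ht.1]
      exact (mul_le_of_le_one_left (norm_nonneg _) ht.2).trans_lt hh
    have h3 := (ContinuousMap.dist_apply_le_dist x).trans (hδ' h2).le
    rw [dist_eq_norm] at h3
    have h4 : ‖f' (g x + t • (g x + h x - g x)) - f' (g x)‖ ≤ c / (‖B‖ + 1) := by simpa using h3
    rw [← map_sub]
    refine (B.le_opNorm _).trans ((mul_le_mul_of_nonneg_left h4 (norm_nonneg _)).trans ?_)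
    rw [mul_div_assoc', div_le_iff₀ (by positivity)]
    nlinarith [norm_nonneg B]
  have h4 := (convex_segment (g x) (g x + h x)).norm_image_sub_le_of_norm_hasFDerivWithin_le'
    (f := f) (f' := fun y => B (f' y)) (φ := B (f' (g x)))
    (fun y _ => (hf y).hasFDerivWithinAt) key
    (left_mem_segment ℝ _ _) (right_mem_segment ℝ _ _)
  simp only [add_sub_cancel_left] at h4
  have h5 : ‖h x‖ ≤ ‖h‖ := h.norm_coe_le_norm x
  calc _ = ‖f (g x + h x) - f (g x) - B (f' (g x)) (h x)‖ := by simp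
    _ ≤ c * ‖h x‖ := h4
    _ ≤ c * ‖h‖ := by gcongr

/-- The target `F` is quantified inside the induction, because the derivative of `f` takes its
values in `E →L[ℝ] F`. -/
lemma contDiff_nat_comp_continuousMap {K E : Type} [TopologicalSpace K] [CompactSpace K]
    [NormedAddCommGroup E] [NormedSpace ℝ E] (n : ℕ) :
    ∀ {F : Type} [NormedAddCommGroup F] [NormedSpace ℝ F] (f : C(E, F)), ContDiff ℝ ∞ f →
      ContDiff ℝ n (fun g : C(K, E) => f.comp g) := by
  induction n with
  | zero =>
    intro F _ _ f hf
    exact contDiff_zero.2 (ContinuousMap.continuous_postcomp f)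
  | succ n ih =>
    intro F _ _ f hf
    have hf' : ContDiff ℝ ∞ (fderiv ℝ f) := hf.fderiv_right (by simp)
    exact contDiff_succ_comp_continuousMap (L := E →L[ℝ] F) (.id ℝ _) n f
      ⟨fderiv ℝ f, hf'.continuous⟩ (fun x => ((hf.differentiable (by simp)) x).hasFDerivAt)
      (ih _ hf')

/-- Smoothness of superposition operators on spaces of continuous functions. -/
lemma contDiff_comp_continuousMap {K E F : Type} [TopologicalSpace K] [CompactSpace K]
    [NormedAddCommGroup E] [NormedSpace ℝ E] [NormedAddCommGroup F] [NormedSpace ℝ F]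
    (f : C(E, F)) (hf : ContDiff ℝ ∞ f) : ContDiff ℝ ∞ (fun g : C(K, E) => f.comp g) :=
  contDiff_infty.2 fun n => contDiff_nat_comp_continuousMap n f hf

/-! ### Averages along paths of linear contractions -/

/-- The average of `f ∘ p t` over `t ∈ [0, 1]`. -/
noncomputable def pathAverage {K : Type} [TopologicalSpace K] [CompactSpace K] (F : Type)
    [NormedAddCommGroup F] [NormedSpace ℝ F] (p : C(ℝ × K, K)) : C(K, F) →L[ℝ] C(K, F) :=
  LinearMap.mkContinuous
    { toFun := fun f => ⟨fun x => ∫ t in (0 : ℝ)..1, f (p (t, x)),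
        intervalIntegral.continuous_parametric_intervalIntegral_of_continuous' (by fun_prop) _ _⟩
      map_add' := fun f g => by
        ext x
        exact intervalIntegral.integral_add
          (Continuous.intervalIntegrable (by fun_prop) _ _)
          (Continuous.intervalIntegrable (by fun_prop) _ _)
      map_smul' := fun c f => by
        ext x
        exact intervalIntegral.integral_smul _ _ } 1
    (fun f => by
      rw [ContinuousMap.norm_le _ (by positivity)]
      intro x
      have := intervalIntegral.norm_integral_le_of_norm_le_const (a := (0 : ℝ)) (b := 1)
        (f := fun t => f (p (t, x))) (C := ‖f‖) (fun t _ => f.norm_coe_le_norm _)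
      simpa using this)

@[simp] lemma pathAverage_apply {K F : Type} [TopologicalSpace K] [CompactSpace K]
    [NormedAddCommGroup F] [NormedSpace ℝ F] (p : C(ℝ × K, K)) (f : C(K, F)) (x : K) :
    pathAverage F p f x = ∫ t in (0 : ℝ)..1, f (p (t, x)) := rfl

/-- Pairing of continuous functions, as a continuous linear map. -/
noncomputable def pairField (K S Y : Type) [TopologicalSpace K] [CompactSpace K]
    [NormedAddCommGroup S] [NormedSpace ℝ S] [NormedAddCommGroup Y] [NormedSpace ℝ Y] :
    C(K, S) × C(K, Y) →L[ℝ] C(K, S × Y) :=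
  LinearMap.mkContinuous
    { toFun := fun f => f.1.prodMk f.2
      map_add' := fun f g => by ext <;> rfl
      map_smul' := fun c f => by ext <;> rfl } 1
    (fun f => by
      rw [ContinuousMap.norm_le _ (by positivity), one_mul]
      intro x
      exact max_le_max (f.1.norm_coe_le_norm x) (f.2.norm_coe_le_norm x))

@[simp] lemma pairField_apply {K S Y : Type} [TopologicalSpace K] [CompactSpace K]
    [NormedAddCommGroup S] [NormedSpace ℝ S] [NormedAddCommGroup Y] [NormedSpace ℝ Y]
    (f : C(K, S) × C(K, Y)) (x : K) : pairField K S Y f x = (f.1 x, f.2 x) := rfl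

/-- The linear contractions of a normed space. -/
abbrev Contractions (S : Type) [NormedAddCommGroup S] [NormedSpace ℝ S] : Type :=
  Metric.closedBall (0 : S →L[ℝ] S) 1

section Contractions

variable {S : Type} [NormedAddCommGroup S] [NormedSpace ℝ S]

instance [FiniteDimensional ℝ S] : CompactSpace (Contractions S) :=
  have : ProperSpace (S →L[ℝ] S) := FiniteDimensional.proper ℝ _
  isCompact_iff_compactSpace.1 (isCompact_closedBall _ _)

lemma Contractions.norm_le (M : Contractions S) : ‖M.1‖ ≤ 1 := mem_closedBall_zero_iff.1 M.2

lemma Contractions.norm_apply_le (M : Contractions S) (s : S) : ‖M.1 s‖ ≤ ‖s‖ := by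
  simpa using M.1.le_of_opNorm_le M.norm_le s

/-- Composition of contractions. -/
def Contractions.comp (A B : Contractions S) : Contractions S :=
  ⟨A.1.comp B.1, mem_closedBall_zero_iff.2 <|
    (A.1.opNorm_comp_le B.1).trans (mul_le_one₀ A.norm_le (norm_nonneg _) B.norm_le)⟩

/-- The identity contraction. -/
def Contractions.one : Contractions S :=
  ⟨.id ℝ S, mem_closedBall_zero_iff.2 ContinuousLinearMap.norm_id_le⟩

lemma Contractions.continuous_comp_left (B : Contractions S) :
    Continuous (fun A : Contractions S => A.comp B) :=
  Continuous.subtype_mk (by fun_prop) _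

/-- The path of contractions `t ↦ p t`, acting on contractions by composition. -/
def Contractions.path (p : ℝ → Contractions S) (hp : Continuous p) :
    C(ℝ × Contractions S, Contractions S) :=
  ⟨fun x => (p x.1).comp x.2, Continuous.subtype_mk
    ((continuous_subtype_val.comp (hp.comp continuous_fst)).clm_comp
      (continuous_subtype_val.comp continuous_snd)) _⟩

/-- Evaluation of contractions at a vector. -/
noncomputable def Contractions.eval [FiniteDimensional ℝ S] : S →L[ℝ] C(Contractions S, S) :=
  LinearMap.mkContinuous
    { toFun := fun s => ⟨fun M => M.1 s, by fun_prop⟩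
      map_add' := fun f g => by ext; simp
      map_smul' := fun c f => by ext; simp } 1
    (fun s => by
      rw [ContinuousMap.norm_le _ (by positivity), one_mul]
      exact fun M => M.norm_apply_le s)

@[simp] lemma Contractions.eval_apply [FiniteDimensional ℝ S] (s : S) (M : Contractions S) :
    Contractions.eval s M = M.1 s := rfl

end Contractions

/-! ### Smooth solutions of a Volterra type equation -/

section FixedPoint

variable {S Y L ι : Type} [NormedAddCommGroup S] [NormedSpace ℝ S] [FiniteDimensional ℝ S]
  [NormedAddCommGroup Y] [NormedSpace ℝ Y] [NormedAddCommGroup L] [NormedSpace ℝ L]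
  [Fintype ι]

/-- The right hand side of the integral equation, lifted to functions of a contraction. -/
noncomputable def volterraLift (B : ι → L →L[ℝ] S →L[ℝ] Y)
    (p : ι → C(ℝ × Contractions S, Contractions S)) (D : C(S, Y)) (G : C(S × Y, L))
    (z : S × C(Contractions S, Y)) : C(Contractions S, Y) :=
  D.comp (Contractions.eval z.1) + ∑ a, bilinField _ (B a)
    (pathAverage L (p a) (G.comp (pairField _ _ _ (Contractions.eval z.1, z.2))))
    (Contractions.eval z.1)

lemma contDiff_volterraLift (B : ι → L →L[ℝ] S →L[ℝ] Y)
    (p : ι → C(ℝ × Contractions S, Contractions S)) (D : C(S, Y)) (G : C(S × Y, L))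
    (hD : ContDiff ℝ ∞ D) (hG : ContDiff ℝ ∞ G) : ContDiff ℝ ∞ (volterraLift B p D G) := by
  unfold volterraLift
  have h1 : ContDiff ℝ ∞ (fun z : S × C(Contractions S, Y) =>
      (Contractions.eval z.1 : C(Contractions S, S))) :=
    ContDiff.comp (g := fun s : S => (Contractions.eval s : C(Contractions S, S)))
      (ContinuousLinearMap.contDiff (𝕜 := ℝ) (E := S) (F := C(Contractions S, S)) Contractions.eval)
      contDiff_fst
  refine ((contDiff_comp_continuousMap D hD).comp h1).add (ContDiff.sum fun a _ => ?_)
  have h2 : ContDiff ℝ ∞ (fun z : S × C(Contractions S, Y) =>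
      pairField (Contractions S) S Y (Contractions.eval z.1, z.2)) :=
    (pairField (Contractions S) S Y).contDiff.comp (h1.prodMk contDiff_snd)
  have h3 := (pathAverage L (p a)).contDiff.comp ((contDiff_comp_continuousMap G hG).comp h2)
  exact ((bilinField _ (B a)).contDiff.comp h3).clm_apply h1

lemma volterraLift_apply (B : ι → L →L[ℝ] S →L[ℝ] Y)
    (p : ι → C(ℝ × Contractions S, Contractions S)) (D : C(S, Y)) (G : C(S × Y, L))
    (s : S) (X : C(Contractions S, Y)) (M : Contractions S) :
    volterraLift B p D G (s, X) M = D (M.1 s) + ∑ a, B a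
      (∫ t in (0 : ℝ)..1, G ((p a (t, M)).1 s, X (p a (t, M)))) (M.1 s) := by
  simp [volterraLift, ContinuousMap.sum_apply]

/-- A Volterra type integral equation along paths of linear contractions has a smooth solution
near the origin. -/
theorem exists_volterra_solution [CompleteSpace Y]
    (B : ι → L →L[ℝ] S →L[ℝ] Y) (p : ι → ℝ → Contractions S) (hp : ∀ a, Continuous (p a))
    (D : S → Y) (G : S × Y → L) (hD : ContDiff ℝ ∞ D) (hG : ContDiff ℝ ∞ G) :
    ∃ δ > 0, ∃ X : S → Y, ContDiffOn ℝ ∞ X (Metric.ball 0 δ) ∧ ∀ s ∈ Metric.ball (0 : S) δ,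
      X s = D s + ∑ a, B a (∫ t in (0 : ℝ)..1, G ((p a t).1 s, X ((p a t).1 s))) s := by
  -- For fixed `s` the unknown becomes the function `M ↦ X (M s)` on the compact space of
  -- contractions. This function space is the same for all `s`, and the equation reads `X = Φ (s,
  -- X)` with `Φ` smooth on a Banach space, so that smoothness in `s` follows from the inverse
  -- function theorem.
  set Z := C(Contractions S, Y)
  let P : ι → C(ℝ × Contractions S, Contractions S) := fun a => Contractions.path (p a) (hp a)
  let Φ : S × Z → Z := volterraLift B P ⟨D, hD.continuous⟩ ⟨G, hG.continuous⟩
  have hΦ : ContDiff ℝ ∞ Φ := contDiff_volterraLift B P _ _ hD hG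
  have hΦa : ∀ s X M, Φ (s, X) M = D (M.1 s) + ∑ a, B a
      (∫ t in (0 : ℝ)..1, G ((P a (t, M)).1 s, X (P a (t, M)))) (M.1 s) := fun s X M =>
    volterraLift_apply B P _ _ s X M
  let X₀ : Z := ContinuousMap.const _ (D 0)
  have hΦ0 : ∀ X, Φ (0, X) = X₀ := by
    intro X; ext M; rw [hΦa]; simp [X₀]
  let Ψ : S × Z → S × Z := fun z => (z.1, z.2 - Φ z)
  have hΨ : ContDiff ℝ ∞ Ψ := contDiff_fst.prodMk (contDiff_snd.sub hΦ)
  let z₀ : S × Z := (0, X₀)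
  let ℓ : S →L[ℝ] Z := (fderiv ℝ Φ z₀).comp (.inl ℝ S Z)
  -- At `s = 0` every contraction gives the same point, so `Φ (0, ·)` is constant and the derivative
  -- of `Φ` at `z₀` sees only the variable `s`.
  have hℓ : ∀ v : S × Z, fderiv ℝ Φ z₀ v = ℓ v.1 := by
    intro v
    have h1 : v = (v.1, 0) + (0, v.2) := by simp
    have h2 : fderiv ℝ Φ z₀ (0, v.2) = 0 := by
      have h3 : HasFDerivAt Φ (fderiv ℝ Φ z₀) z₀ := (hΦ.differentiable (by simp) z₀).hasFDerivAt
      have h4 : HasFDerivAt (fun X : Z => ((0 : S), X)) (ContinuousLinearMap.inr ℝ S Z) X₀ :=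
        (ContinuousLinearMap.inr ℝ S Z).hasFDerivAt
      have h5 := h3.comp X₀ h4
      have h6 : HasFDerivAt (Φ ∘ fun X : Z => ((0 : S), X)) (0 : Z →L[ℝ] Z) X₀ := by
        have : (Φ ∘ fun X : Z => ((0 : S), X)) = fun _ => X₀ := funext fun X => hΦ0 X
        rw [this]; exact hasFDerivAt_const _ _
      have := congrArg (fun T : Z →L[ℝ] Z => T v.2) (h5.unique h6)
      simpa using this
    conv_lhs => rw [h1]
    rw [map_add, h2, add_zero]; rfl
  -- The derivative of `Ψ` at `z₀` is the identity minus a strictly triangular map; its inverse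
  -- changes the sign of `ℓ`.
  let e : (S × Z) ≃L[ℝ] (S × Z) := ContinuousLinearEquiv.equivOfInverse
    ((ContinuousLinearMap.fst ℝ S Z).prod
      (.snd ℝ S Z - ℓ.comp (.fst ℝ S Z)))
    ((ContinuousLinearMap.fst ℝ S Z).prod
      (.snd ℝ S Z + ℓ.comp (.fst ℝ S Z)))
    (fun v => by ext1 <;> simp) (fun v => by ext1 <;> simp)
  have hΨ' : HasFDerivAt Ψ (e : (S × Z) →L[ℝ] (S × Z)) z₀ := by
    have h3 : HasFDerivAt Φ (fderiv ℝ Φ z₀) z₀ := (hΦ.differentiable (by simp) z₀).hasFDerivAt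
    have h4 : HasFDerivAt Ψ ((ContinuousLinearMap.fst ℝ S Z).prod
      (.snd ℝ S Z - fderiv ℝ Φ z₀)) z₀ := hasFDerivAt_fst.prodMk (hasFDerivAt_snd.sub h3)
    convert! h4 using 1
    refine ContinuousLinearMap.ext fun v => ?_
    simp [e, hℓ]
  let O := hΨ.contDiffAt.toOpenPartialHomeomorph Ψ hΨ' (by simp)
  have hO : ∀ z, O z = Ψ z := fun z => rfl
  have hz₀ : z₀ ∈ O.source := hΨ.contDiffAt.mem_toOpenPartialHomeomorph_source hΨ' (by simp)
  have hΨz : Ψ z₀ = 0 := by simp [Ψ, z₀, hΦ0]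
  have h0 : (0 : S × Z) ∈ O.target := by
    rw [← hΨz]; exact O.map_source hz₀
  have hsym0 : O.symm 0 = z₀ := by rw [← hΨz]; exact O.left_inv hz₀
  have hcs : ContinuousAt O.symm 0 := O.continuousAt_symm h0
  -- a good neighbourhood
  obtain ⟨ρ, hρ, hρs⟩ := Metric.mem_nhds_iff.1 (O.open_source.mem_nhds hz₀)
  -- The derivative of `Ψ` has to be invertible near `z₀` as well, since the local inverse must be
  -- smooth at every point of a ball.
  have hinv : ∀ᶠ z in 𝓝 z₀, ∃ e' : (S × Z) ≃L[ℝ] (S × Z), (e' : (S × Z) →L[ℝ] (S × Z)) = fderiv ℝ Ψ z := by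
    have hc : ContinuousAt (fderiv ℝ Ψ) z₀ := (hΨ.continuous_fderiv (by simp)).continuousAt
    have := hc.eventually (p := fun A => ∃ e' : (S × Z) ≃L[ℝ] (S × Z), (e' : (S × Z) →L[ℝ] (S × Z)) = A)
    refine this ?_
    rw [hΨ'.fderiv]
    exact e.nhds
  have hev : ∀ᶠ s in 𝓝 (0 : S), (s, (0 : Z)) ∈ O.target ∧
      O.symm (s, 0) ∈ Metric.ball z₀ ρ ∧
      ∃ e' : (S × Z) ≃L[ℝ] (S × Z), (e' : (S × Z) →L[ℝ] (S × Z)) = fderiv ℝ Ψ (O.symm (s, 0)) := by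
    have hc : ContinuousAt (fun s : S => (s, (0 : Z))) 0 := by fun_prop
    have h1 : ∀ᶠ z in 𝓝 (0 : S × Z), z ∈ O.target ∧ O.symm z ∈ Metric.ball z₀ ρ ∧
        ∃ e' : (S × Z) ≃L[ℝ] (S × Z), (e' : (S × Z) →L[ℝ] (S × Z)) = fderiv ℝ Ψ (O.symm z) := by
      rw [ContinuousAt, hsym0] at hcs
      exact Filter.Eventually.and (O.open_target.mem_nhds h0)
        ((hcs.eventually (Metric.ball_mem_nhds z₀ hρ)).and (hcs.eventually hinv))
    exact hc.eventually h1
  obtain ⟨δ, hδ, hδ'⟩ := Metric.eventually_nhds_iff_ball.1 hev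
  let Xs : S → Z := fun s => (O.symm (s, 0)).2
  have hXs : ∀ s ∈ Metric.ball (0 : S) δ, O.symm (s, 0) = (s, Xs s) ∧ Xs s = Φ (s, Xs s) := by
    intro s hs
    have h1 : Ψ (O.symm (s, 0)) = (s, 0) := O.right_inv (hδ' s hs).1
    have h2 := congrArg Prod.fst h1
    have h3 := congrArg Prod.snd h1
    have h4 : O.symm (s, 0) = (s, Xs s) := Prod.ext h2 rfl
    refine ⟨h4, ?_⟩
    rw [h4] at h3
    exact sub_eq_zero.1 h3
  -- The solution for `s`, precomposed with `M`, solves the equation for `M s`. By injectivity of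
  -- `Ψ` on the chart it is the solution for `M s`, so the family comes from the single function `s
  -- ↦ Xs s .one`.
  have huniq : ∀ s ∈ Metric.ball (0 : S) δ, ∀ M : Contractions S, Xs s M = Xs (M.1 s) .one := by
    intro s hs M
    have hMs : M.1 s ∈ Metric.ball (0 : S) δ := by
      rw [mem_ball_zero_iff] at hs ⊢
      exact (M.norm_apply_le s).trans_lt hs
    let g : Z := (Xs s).comp ⟨fun A => A.comp M, M.continuous_comp_left⟩
    have hg : g = Φ (M.1 s, g) := by
      ext A
      rw [hΦa]
      change Xs s (A.comp M) = _
      conv_lhs => rw [(hXs s hs).2]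
      rw [hΦa]
      rfl
    have hb := (hδ' s hs).2.1
    rw [(hXs s hs).1, mem_ball_iff_norm, Prod.norm_def, max_lt_iff] at hb
    -- Neither coordinate moves away from `z₀`: `M` is a contraction, and precomposition does not
    -- increase the sup distance to the constant `X₀`.
    have hgs : (M.1 s, g) ∈ O.source := by
      apply hρs
      rw [mem_ball_iff_norm, Prod.norm_def, max_lt_iff]
      refine ⟨?_, ?_⟩
      · simp only [z₀, Prod.fst_sub, sub_zero] at hb ⊢
        exact (M.norm_apply_le s).trans_lt hb.1
      · refine lt_of_le_of_lt ?_ hb.2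
        rw [ContinuousMap.norm_le _ (by positivity)]
        intro A
        exact (Xs s - X₀).norm_coe_le_norm (A.comp M)
    have h5 : O (M.1 s, g) = (M.1 s, 0) := by
      rw [hO]; simp only [Ψ]; rw [← hg]; simp
    have h6 : O.symm (M.1 s, 0) = (M.1 s, g) := by rw [← h5]; exact O.left_inv hgs
    have h7 : Xs (M.1 s) = g := by simp only [Xs, h6]
    rw [h7]
    rfl
  refine ⟨δ, hδ, fun s => Xs s .one, ?_, ?_⟩
  · intro s hs
    obtain ⟨ht, -, e', he'⟩ := hδ' s hs
    have h1 : ContDiffAt ℝ ∞ O.symm (s, 0) :=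
      O.contDiffAt_symm ht (f₀' := e')
        (by rw [he']; exact (hΨ.differentiable (by simp) _).hasFDerivAt) hΨ.contDiffAt
    have h2 : ContDiffAt ℝ ∞ Xs s :=
      contDiff_snd.contDiffAt.comp s (h1.comp s (contDiff_prodMk_left (0 : Z)).contDiffAt)
    let ev : Z →L[ℝ] Y := ContinuousMap.evalCLM ℝ (Contractions.one (S := S))
    exact (ev.contDiff.contDiffAt.comp s h2).contDiffWithinAt
  · intro s hs
    have h1 := congrArg (fun f : Z => f .one) (hXs s hs).2
    refine h1.trans ?_
    rw [hΦa]
    have h2 : (Contractions.one : Contractions S).1 s = s := rfl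
    rw [h2]
    congr 1
    refine Finset.sum_congr rfl fun a _ => ?_
    have h3 : ∀ t, P a (t, Contractions.one) = p a t := fun t => by
      apply Subtype.ext; ext; rfl
    congr 2
    refine intervalIntegral.integral_congr fun t _ => ?_
    rw [h3, huniq s hs (p a t)]

end FixedPoint

/-- Multiplication by a bump function. It supplies the globally smooth data that
`exists_volterra_solution` asks for. -/
lemma exists_contDiff_eventuallyEq {E F : Type} [NormedAddCommGroup E] [NormedSpace ℝ E]
    [FiniteDimensional ℝ E] [NormedAddCommGroup F] [NormedSpace ℝ F] {f : E → F} {U : Set E}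
    {x : E} (hU : U ∈ 𝓝 x) (hf : ContDiffOn ℝ ∞ f U) :
    ∃ g : E → F, ContDiff ℝ ∞ g ∧ g =ᶠ[𝓝 x] f := by
  obtain ⟨r, hr, hrU⟩ := Metric.mem_nhds_iff.1 hU
  let b : ContDiffBump x := ⟨r / 4, r / 2, by positivity, by linarith⟩
  refine ⟨fun y => b y • f y, contDiff_iff_contDiffAt.2 fun y => ?_, ?_⟩
  · by_cases hy : y ∈ Metric.ball x r
    · exact b.contDiff.contDiffAt.smul
        (hf.contDiffAt (Filter.mem_of_superset (Metric.isOpen_ball.mem_nhds hy) hrU))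
    · have h1 : (fun y => b y • f y) =ᶠ[𝓝 y] fun _ => 0 := by
        have h2 : y ∉ tsupport b := by
          rw [b.tsupport_eq]
          exact fun h => hy (Metric.closedBall_subset_ball (by change r / 2 < r; linarith) h)
        filter_upwards [notMem_tsupport_iff_eventuallyEq.1 h2] with z hz
        simp [hz]
      exact contDiffAt_const.congr_of_eventuallyEq h1
  · filter_upwards [b.eventuallyEq_one] with y hy
    simp [hy]

/-! ### Darboux systems as integral equations along straight paths -/

section Darboux

variable {N : ℕ} {ι : Type} [Fintype ι]

/-- The straight path of contractions from a projection to the identity. -/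
noncomputable def clampPath (Pr : (Fin N → ℝ) →L[ℝ] (Fin N → ℝ)) (h : ‖Pr‖ ≤ 1) (t : ℝ) :
    Contractions (Fin N → ℝ) :=
  -- The parameter is clamped to `[0, 1]` so that the path is defined for all real `t`; each value
  -- is a convex combination of `Pr` and the identity, hence a contraction.
  ⟨Pr + (Set.projIcc (0 : ℝ) 1 zero_le_one t : ℝ) • (.id ℝ _ - Pr), by
    set c := Set.projIcc (0 : ℝ) 1 zero_le_one t
    have h1 : Pr + (c : ℝ) • (.id ℝ _ - Pr) = (1 - (c : ℝ)) • Pr + (c : ℝ) • .id ℝ _ := by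
      module
    rw [mem_closedBall_zero_iff, h1]
    have hc := c.2
    refine (norm_add_le _ _).trans ?_
    rw [norm_smul, norm_smul, Real.norm_of_nonneg (sub_nonneg.2 hc.2), Real.norm_of_nonneg hc.1]
    have h2 : ‖ContinuousLinearMap.id ℝ (Fin N → ℝ)‖ ≤ 1 := ContinuousLinearMap.norm_id_le
    nlinarith [hc.1, hc.2, mul_le_mul_of_nonneg_left h (sub_nonneg.2 hc.2),
      mul_le_mul_of_nonneg_left h2 hc.1]⟩

lemma continuous_clampPath (Pr : (Fin N → ℝ) →L[ℝ] (Fin N → ℝ)) (h : ‖Pr‖ ≤ 1) :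
    Continuous (clampPath Pr h) :=
  Continuous.subtype_mk (by
    have : Continuous fun t => ((Set.projIcc (0 : ℝ) 1 zero_le_one t : Set.Icc (0:ℝ) 1) : ℝ) :=
      continuous_subtype_val.comp continuous_projIcc
    fun_prop) _

lemma clampPath_apply (Pr : (Fin N → ℝ) →L[ℝ] (Fin N → ℝ)) (h : ‖Pr‖ ≤ 1) {t : ℝ}
    (ht : t ∈ Set.Icc (0 : ℝ) 1) (s : Fin N → ℝ) :
    (clampPath Pr h t).1 s = Pr s + t • (s - Pr s) := by
  simp [clampPath, Set.projIcc_of_mem zero_le_one ht]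

lemma norm_straightPath_le (Pr : (Fin N → ℝ) →L[ℝ] (Fin N → ℝ)) (h : ‖Pr‖ ≤ 1) {t : ℝ}
    (ht : t ∈ Set.Icc (0 : ℝ) 1) (s : Fin N → ℝ) : ‖Pr s + t • (s - Pr s)‖ ≤ ‖s‖ := by
  rw [← clampPath_apply Pr h ht]; exact (clampPath Pr h t).norm_apply_le s

/-- The solution obtained from globally extended data takes the value `(0, D 0)` at the origin, so
by continuity it meets only the region where the data were not changed. No compatibility is needed
here: each unknown is only prescribed along one family of paths. -/
lemma exists_darboux_integral_solution (J : ι → Finset (Fin N))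
    (Pr : ι → (Fin N → ℝ) →L[ℝ] (Fin N → ℝ)) (hPr : ∀ a, ‖Pr a‖ ≤ 1)
    (D : ι → (Fin N → ℝ) → ℝ) (F : ι → Fin N → (Fin N → ℝ) × (ι → ℝ) → ℝ)
    {U : Set (Fin N → ℝ)} (hU : U ∈ 𝓝 0) (hD : ∀ a, ContDiffOn ℝ ∞ (D a) U)
    {W : Set ((Fin N → ℝ) × (ι → ℝ))} (hW : W ∈ 𝓝 (0, fun a => D a 0))
    (hF : ∀ a j, ContDiffOn ℝ ∞ (F a j) W) :
    ∃ δ > 0, ∃ X : (Fin N → ℝ) → ι → ℝ, ContDiffOn ℝ ∞ X (Metric.ball 0 δ) ∧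
      (∀ s ∈ Metric.ball 0 δ, (s, X s) ∈ W) ∧
      ∀ s ∈ Metric.ball 0 δ, ∀ a, X s a = D a (Pr a s) + ∫ t in (0 : ℝ)..1, ∑ j ∈ J a,
        F a j (Pr a s + t • (s - Pr a s), X (Pr a s + t • (s - Pr a s))) * (s - Pr a s) j := by
  classical
  obtain ⟨D', hD', hDD⟩ := exists_contDiff_eventuallyEq hU (contDiffOn_pi.2 hD)
  obtain ⟨F', hF', hFF⟩ := exists_contDiff_eventuallyEq (F := ι → Fin N → ℝ)
    (f := fun z a j => F a j z) hW (contDiffOn_pi.2 fun a => contDiffOn_pi.2 (hF a))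
  let D'' : (Fin N → ℝ) → ι → ℝ := fun s a => D' (Pr a s) a
  have hD'' : ContDiff ℝ ∞ D'' := contDiff_pi.2 fun a =>
    (contDiff_pi.1 hD' a).comp (Pr a).contDiff
  -- `B a M s` places the number `∑ M a j (s - Pr a s)ⱼ` in slot `a`. The path velocity `s - Pr a s`
  -- does not depend on `t` and is taken out of the integral.
  let B : ι → (ι → Fin N → ℝ) →L[ℝ] (Fin N → ℝ) →L[ℝ] (ι → ℝ) := fun a =>
    ∑ j ∈ J a, ((ContinuousLinearMap.proj (R := ℝ) (φ := fun _ : Fin N => ℝ) j).comp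
      (ContinuousLinearMap.proj (R := ℝ) (φ := fun _ : ι => Fin N → ℝ) a)).smulRight
      (((ContinuousLinearMap.proj (R := ℝ) (φ := fun _ : Fin N => ℝ) j).comp
        (.id ℝ _ - Pr a)).smulRight (Pi.single a (1 : ℝ) : ι → ℝ))
  have hB : ∀ a M s, B a M s = Pi.single a (∑ j ∈ J a, M a j * (s - Pr a s) j) := by
    intro a M s
    ext b
    by_cases hb : b = a
    · subst hb; simp [B, Finset.sum_apply]
    · simp [B, Finset.sum_apply, hb]
  obtain ⟨δ, hδ, X, hX, hXe⟩ := exists_volterra_solution B (fun a => clampPath (Pr a) (hPr a))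
    (fun a => continuous_clampPath _ _) D'' F' hD'' hF'
  have hX0 : X 0 = fun a => D a 0 := by
    rw [hXe 0 (Metric.mem_ball_self hδ)]
    simp [D'', hDD.self_of_nhds]
  have hXc : ContinuousAt X 0 := hX.continuousOn.continuousAt (Metric.ball_mem_nhds _ hδ)
  have hpair : Filter.Tendsto (fun s => (s, X s)) (𝓝 0) (𝓝 (0, fun a => D a 0)) := by
    rw [← hX0]; exact continuousAt_id.prodMk hXc
  have hev : ∀ᶠ s in 𝓝 (0 : Fin N → ℝ), s ∈ Metric.ball (0 : Fin N → ℝ) δ ∧ D' s = (fun a => D a s) ∧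
      (s, X s) ∈ W ∧ F' (s, X s) = fun a j => F a j (s, X s) :=
    Filter.Eventually.and (Metric.ball_mem_nhds (0 : Fin N → ℝ) hδ)
      (hDD.and ((hpair.eventually hW).and (hpair.eventually hFF)))
  obtain ⟨ε, hε, hε'⟩ := Metric.eventually_nhds_iff_ball.1 hev
  refine ⟨ε, hε, X, hX.mono fun s hs => (hε' s hs).1, fun s hs => (hε' s hs).2.2.1,
    fun s hs a => ?_⟩
  have hmem : ∀ a, ∀ t ∈ Set.Icc (0 : ℝ) 1, Pr a s + t • (s - Pr a s) ∈ Metric.ball 0 ε := by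
    intro a t ht
    rw [mem_ball_zero_iff] at hs ⊢
    exact (norm_straightPath_le _ (hPr a) ht s).trans_lt hs
  have hcont : ∀ a, ContinuousOn (fun t => F' ((clampPath (Pr a) (hPr a) t).1 s,
      X ((clampPath (Pr a) (hPr a) t).1 s))) (Set.Icc 0 1) := by
    intro a
    have h1 : Continuous fun t => (clampPath (Pr a) (hPr a) t).1 s :=
      (continuous_subtype_val.comp (continuous_clampPath _ _)).clm_apply continuous_const
    refine hF'.continuous.comp_continuousOn (h1.continuousOn.prodMk
      (hX.continuousOn.comp h1.continuousOn fun t ht => ?_))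
    rw [clampPath_apply _ _ ht]
    exact (hε' _ (hmem a t ht)).1
  rw [hXe s (hε' s hs).1]
  simp only [Pi.add_apply, Finset.sum_apply, hB]
  congr 1
  · have := congrFun (hε' (Pr a s) (by simpa using hmem a 0 (by simp))).2.1 a
    simpa [D''] using this
  · rw [Finset.sum_eq_single a (fun b _ hb => by simp [Ne.symm hb]) (by simp), Pi.single_eq_same]
    have hint : IntervalIntegrable (fun t => F' ((clampPath (Pr a) (hPr a) t).1 s,
      X ((clampPath (Pr a) (hPr a) t).1 s))) MeasureTheory.volume 0 1 :=
      ContinuousOn.intervalIntegrable (by rw [Set.uIcc_of_le zero_le_one]; exact hcont a)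
    let Λ : (ι → Fin N → ℝ) →L[ℝ] ℝ := ∑ j ∈ J a, ((s - Pr a s) j) •
      ((ContinuousLinearMap.proj (R := ℝ) (φ := fun _ : Fin N => ℝ) j).comp
      (ContinuousLinearMap.proj (R := ℝ) (φ := fun _ : ι => Fin N → ℝ) a))
    have hΛ : ∀ M, Λ M = ∑ j ∈ J a, M a j * (s - Pr a s) j := by
      intro M; simp [Λ, mul_comm]
    rw [← hΛ, ← Λ.intervalIntegral_comp_comm hint]
    refine intervalIntegral.integral_congr fun t ht => ?_
    rw [Set.uIcc_of_le zero_le_one] at ht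
    simp only [hΛ, clampPath_apply _ _ ht, (hε' _ (hmem a t ht)).2.2.2]

end Darboux

/-! ### Partial derivatives of smooth functions -/

lemma contDiffOn_pd {n : ℕ} {f : (Fin n → ℝ) → ℝ} {U : Set (Fin n → ℝ)} (hU : IsOpen U)
    (hf : ContDiffOn ℝ ∞ f U) (i : Fin n) : ContDiffOn ℝ ∞ (pd i f) U :=
  (hf.fderiv_of_isOpen hU (by simp)).clm_apply contDiffOn_const

lemma pd_comm {n : ℕ} {f : (Fin n → ℝ) → ℝ} {U : Set (Fin n → ℝ)} (hU : IsOpen U)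
    (hf : ContDiffOn ℝ ∞ f U) (i j : Fin n) {x : Fin n → ℝ} (hx : x ∈ U) :
    pd i (pd j f) x = pd j (pd i f) x := by
  have h := hf.contDiffAt (hU.mem_nhds hx)
  have hs := h.isSymmSndFDerivAt (by
    rw [minSmoothness_of_isRCLikeNormedField]; exact WithTop.coe_le_coe.2 (le_top : (2 : ℕ∞) ≤ ⊤))
  have hd : DifferentiableAt ℝ (fderiv ℝ f) x :=
    (h.fderiv_right (m := ∞) (by simp)).differentiableAt (by simp)
  have key : ∀ i j : Fin n, pd i (pd j f) x
      = fderiv ℝ (fderiv ℝ f) x (Pi.single i 1) (Pi.single j 1) := by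
    intro i j
    have : pd j f = fun y => fderiv ℝ f y (Pi.single j 1) := rfl
    rw [pd, this, fderiv_clm_apply hd (by fun_prop)]
    simp
  rw [key, key, hs]

lemma hasFDerivAt_eq_sum_pd {n : ℕ} {f : (Fin n → ℝ) → ℝ} {x v : Fin n → ℝ} :
    fderiv ℝ f x v = ∑ i, v i * pd i f x := by
  conv_lhs => rw [← Finset.univ_sum_single v]
  rw [map_sum]
  refine Finset.sum_congr rfl fun i _ => ?_
  have : (Pi.single i (v i) : Fin n → ℝ) = v i • Pi.single i 1 := by
    rw [← Pi.single_smul]; simp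
  rw [this, map_smul]; rfl

/-! ### Compatible Darboux systems -/

section Darboux

variable {N : ℕ} {ι : Type} [Fintype ι]

/-- Local solvability of compatible Darboux systems: each unknown `X a` has prescribed derivatives
in the directions `j ∈ J a`, and prescribed values on the range of the projection `Pr a` along
these directions. -/
theorem exists_darboux_solution (J : ι → Finset (Fin N))
    (Pr : ι → (Fin N → ℝ) →L[ℝ] (Fin N → ℝ)) (hPr : ∀ a, ‖Pr a‖ ≤ 1)
    (hPrJ : ∀ a, ∀ j ∈ J a, Pr a (Pi.single j 1) = 0)
    (hPrC : ∀ a s, ∀ j ∉ J a, Pr a s j = s j)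
    (D : ι → (Fin N → ℝ) → ℝ) (F : ι → Fin N → (Fin N → ℝ) × (ι → ℝ) → ℝ)
    {U : Set (Fin N → ℝ)} (hU : U ∈ 𝓝 0) (hD : ∀ a, ContDiffOn ℝ ∞ (D a) U)
    {W : Set ((Fin N → ℝ) × (ι → ℝ))} (hWo : IsOpen W) (hW : (0, fun a => D a 0) ∈ W)
    (hF : ∀ a j, ContDiffOn ℝ ∞ (F a j) W)
    (hcompat : ∀ z ∈ W, ∀ a, ∀ j ∈ J a, ∀ k ∈ J a, j ≠ k → ∀ η ζ : ι → ℝ,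
      (∀ b, k ∈ J b → η b = F b k z) → (∀ b, j ∈ J b → ζ b = F b j z) →
      fderiv ℝ (F a j) z (Pi.single k 1, η) = fderiv ℝ (F a k) z (Pi.single j 1, ζ)) :
    ∃ δ > 0, ∃ X : (Fin N → ℝ) → ι → ℝ, ContDiffOn ℝ ∞ X (Metric.ball 0 δ) ∧
      (∀ s ∈ Metric.ball 0 δ, (s, X s) ∈ W) ∧
      (∀ s ∈ Metric.ball 0 δ, ∀ a, X (Pr a s) a = D a (Pr a s)) ∧
      ∀ s ∈ Metric.ball 0 δ, ∀ a, ∀ j ∈ J a, pd j (fun s => X s a) s = F a j (s, X s) := by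
  classical
  obtain ⟨δ, hδ, X, hX, hXW, hXe⟩ := exists_darboux_integral_solution J Pr hPr D F hU hD
    (hWo.mem_nhds hW) hF
  have hPr2 : ∀ a s, s - Pr a s = ∑ j ∈ J a, (s - Pr a s) j • Pi.single j (1 : ℝ) := by
    intro a s
    ext i
    by_cases hi : i ∈ J a
    · simp [Finset.sum_apply, Pi.single_apply, hi]
    · simp [Finset.sum_apply, Pi.single_apply, hi, hPrC a s i hi]
  have hPrPr : ∀ a s, Pr a (s - Pr a s) = 0 := by
    intro a s
    rw [hPr2, map_sum]
    exact Finset.sum_eq_zero fun j hj => by rw [map_smul, hPrJ a j hj, smul_zero]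
  have hPrPr' : ∀ a s, Pr a (Pr a s) = Pr a s := by
    intro a s
    have := hPrPr a s
    rw [map_sub, sub_eq_zero] at this
    exact this.symm
  have hball : ∀ {ε : ℝ} {s}, s ∈ Metric.ball (0 : Fin N → ℝ) ε → ∀ a, ∀ t ∈ Set.Icc (0 : ℝ) 1,
      Pr a s + t • (s - Pr a s) ∈ Metric.ball (0 : Fin N → ℝ) ε := by
    intro ε s hs a t ht
    rw [mem_ball_zero_iff] at hs ⊢
    exact (norm_straightPath_le _ (hPr a) ht s).trans_lt hs
  have hpath1 : ∀ a s, ∀ t : ℝ, Pr a (Pr a s + t • (s - Pr a s)) = Pr a s := by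
    intro a s t
    rw [map_add, map_smul, hPrPr, hPrPr', smul_zero, add_zero]
  have hpath2 : ∀ a s, ∀ t : ℝ, (Pr a s + t • (s - Pr a s)) - Pr a (Pr a s + t • (s - Pr a s))
      = t • (s - Pr a s) := by
    intro a s t
    rw [hpath1]; abel
  have hXa : ∀ a, ContDiffOn ℝ ∞ (fun s => X s a) (Metric.ball 0 δ) := fun a =>
    contDiffOn_pi.1 hX a
  have hpairX : ContDiffOn ℝ ∞ (fun s => (s, X s)) (Metric.ball 0 δ) := contDiffOn_id.prodMk hX
  have hFX : ∀ a j, ContDiffOn ℝ ∞ (fun s => F a j (s, X s)) (Metric.ball 0 δ) := fun a j =>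
    (hF a j).comp hpairX hXW
  -- The integral equation controls only the derivative along the path, so the residuals `E` have to
  -- be shown to vanish. Their radial component is zero, and by compatibility their curl is bounded
  -- by their size; on a small ball this forces their maximum to be at most half of itself.
  let E : ι → Fin N → (Fin N → ℝ) → ℝ := fun a j s =>
    if j ∈ J a then pd j (fun s => X s a) s - F a j (s, X s) else 0
  have hEJ : ∀ a, ∀ j ∈ J a, E a j = fun s => pd j (fun s => X s a) s - F a j (s, X s) :=
    fun a j hj => by ext s; simp [E, hj]
  have hE : ∀ a j, ContDiffOn ℝ ∞ (E a j) (Metric.ball 0 δ) := by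
    intro a j
    by_cases hj : j ∈ J a
    · rw [hEJ a j hj]
      exact (contDiffOn_pd Metric.isOpen_ball (hXa a) j).sub (hFX a j)
    · have : E a j = fun _ => 0 := by ext s; simp [E, hj]
      rw [this]; exact contDiffOn_const
  -- the radial equation
  have step1 : ∀ a, ∀ s ∈ Metric.ball (0 : Fin N → ℝ) δ,
      ∑ j ∈ J a, (s - Pr a s) j * E a j s = 0 := by
    intro a s hs
    let q : ℝ → Fin N → ℝ := fun t => Pr a s + t • (s - Pr a s)
    have hq1 : q 1 = s := by simp [q]
    let f : ℝ → ℝ := fun t => ∑ j ∈ J a, F a j (q t, X (q t)) * (s - Pr a s) j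
    have hqc : Continuous q := by fun_prop
    have hfc : ContinuousOn f (q ⁻¹' Metric.ball 0 δ) := by
      refine continuousOn_finsetSum _ fun j _ => ContinuousOn.mul ?_ continuousOn_const
      exact (hFX a j).continuousOn.comp hqc.continuousOn fun t ht => ht
    have hopen : IsOpen (q ⁻¹' Metric.ball 0 δ) := Metric.isOpen_ball.preimage hqc
    have h1mem : (1 : ℝ) ∈ q ⁻¹' Metric.ball 0 δ := by
      change q 1 ∈ Metric.ball 0 δ; rwa [hq1]
    have hd1 : HasDerivAt (fun σ => D a (Pr a s) + ∫ t in (0 : ℝ)..σ, f t) (f 1) 1 := by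
      refine HasDerivAt.const_add _ (intervalIntegral.integral_hasDerivAt_right ?_ ?_ ?_)
      · refine ContinuousOn.intervalIntegrable (hfc.mono ?_)
        rw [Set.uIcc_of_le zero_le_one]
        exact fun t ht => hball hs a t ht
      · exact hfc.stronglyMeasurableAtFilter hopen _ h1mem
      · exact hfc.continuousAt (hopen.mem_nhds h1mem)
    have hd2 : HasDerivAt (fun σ => X (q σ) a) (f 1) 1 := by
      refine hd1.congr_of_eventuallyEq ?_
      filter_upwards [hopen.mem_nhds h1mem] with σ hσ
      rw [hXe (q σ) hσ a]
      simp only [q, hpath1]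
      congr 1
      have h3 := intervalIntegral.smul_integral_comp_mul_right (a := (0 : ℝ)) (b := 1) f σ
      rw [zero_mul, one_mul] at h3
      rw [← h3, smul_eq_mul, ← intervalIntegral.integral_const_mul]
      refine intervalIntegral.integral_congr fun t _ => ?_
      simp only [f, Finset.mul_sum, q, add_sub_cancel_left, smul_smul, Pi.smul_apply, smul_eq_mul]
      refine Finset.sum_congr rfl fun j _ => ?_
      ring
    have hq' : HasDerivAt q (s - Pr a s) 1 := by
      have := ((hasDerivAt_id (1 : ℝ)).smul_const (s - Pr a s)).const_add (Pr a s)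
      rwa [one_smul] at this
    have hd3 : HasDerivAt (fun σ => X (q σ) a) (fderiv ℝ (fun s => X s a) s (s - Pr a s)) 1 := by
      have h4 : HasFDerivAt (fun s => X s a) (fderiv ℝ (fun s => X s a) s) (q 1) := by
        rw [hq1]
        exact (((hXa a).contDiffAt (Metric.isOpen_ball.mem_nhds hs)).differentiableAt
          (by simp)).hasFDerivAt
      exact h4.comp_hasDerivAt 1 hq'
    have h5 := hd3.unique hd2
    simp only [f, hq1] at h5
    rw [hPr2, map_sum] at h5
    rw [← sub_eq_zero, ← Finset.sum_sub_distrib] at h5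
    rw [← h5]
    refine Finset.sum_congr rfl fun j hj => ?_
    have h6 : (∑ j ∈ J a, (s - Pr a s) j • Pi.single j (1 : ℝ)) j = (s - Pr a s) j := by
      rw [← hPr2]
    rw [map_smul, hEJ a j hj, h6]
    simp only [pd, smul_eq_mul]
    ring
  -- its derivative
  have hEd : ∀ a j, ∀ s ∈ Metric.ball (0 : Fin N → ℝ) δ,
      HasFDerivAt (E a j) (fderiv ℝ (E a j) s) s := fun a j s hs =>
    (((hE a j).contDiffAt (Metric.isOpen_ball.mem_nhds hs)).differentiableAt (by simp)).hasFDerivAt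
  have step2 : ∀ a, ∀ j ∈ J a, ∀ s ∈ Metric.ball (0 : Fin N → ℝ) δ,
      E a j s + ∑ k ∈ J a, (s - Pr a s) k * pd j (E a k) s = 0 := by
    intro a j hj s hs
    have h1 : HasFDerivAt (fun s => ∑ k ∈ J a, (s - Pr a s) k * E a k s) (0 : _ →L[ℝ] ℝ) s := by
      refine (hasFDerivAt_const (0 : ℝ) s).congr_of_eventuallyEq ?_
      filter_upwards [Metric.isOpen_ball.mem_nhds hs] with y hy
      exact step1 a y hy
    have hl : ∀ k, HasFDerivAt (fun s => (s - Pr a s) k)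
        ((ContinuousLinearMap.proj (R := ℝ) (φ := fun _ : Fin N => ℝ) k).comp
          (.id ℝ _ - Pr a)) s := fun k =>
      ((ContinuousLinearMap.proj (R := ℝ) (φ := fun _ : Fin N => ℝ) k).comp
          (.id ℝ _ - Pr a)).hasFDerivAt
    have h2 : HasFDerivAt (fun s => ∑ k ∈ J a, (s - Pr a s) k * E a k s) _ s :=
      HasFDerivAt.fun_sum fun k _ => (hl k).mul (hEd a k s hs)
    have h3 := congrArg (fun T : (Fin N → ℝ) →L[ℝ] ℝ => T (Pi.single j 1)) (h2.unique h1)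
    simp [hPrJ a j hj, Finset.sum_add_distrib, Pi.single_apply, hj] at h3
    rw [add_comm] at h3
    exact h3
  -- curl of the residual
  have step3 : ∀ a, ∀ j ∈ J a, ∀ k ∈ J a, ∀ s ∈ Metric.ball (0 : Fin N → ℝ) δ,
      ∀ C M : ℝ, (∀ a j, ‖fderiv ℝ (F a j) (s, X s)‖ ≤ C) → (∀ a j, |E a j s| ≤ M) →
      |pd k (E a j) s - pd j (E a k) s| ≤ 2 * C * M := by
    intro a j hj k hk s hs C M hC hM
    have hM0 : 0 ≤ M := (abs_nonneg _).trans (hM a j)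
    have hC0 : 0 ≤ C := (norm_nonneg _).trans (hC a j)
    by_cases hjk : j = k
    · subst hjk; simp; positivity
    have hXd : HasFDerivAt X (fderiv ℝ X s) s :=
      ((hX.contDiffAt (Metric.isOpen_ball.mem_nhds hs)).differentiableAt (by simp)).hasFDerivAt
    have hFd : ∀ j, HasFDerivAt (F a j) (fderiv ℝ (F a j) (s, X s)) (s, X s) := fun j =>
      (((hF a j).contDiffAt (hWo.mem_nhds (hXW s hs))).differentiableAt (by simp)).hasFDerivAt
    have hXpd : ∀ k b, fderiv ℝ X s (Pi.single k 1) b = pd k (fun s => X s b) s := by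
      intro k b
      exact (congrArg (fun T : (Fin N → ℝ) →L[ℝ] ℝ => T (Pi.single k 1))
        (hasFDerivAt_pi'.1 hXd b).fderiv).symm
    have h1 : ∀ j k, j ∈ J a → pd k (E a j) s = pd k (pd j (fun s => X s a)) s
        - fderiv ℝ (F a j) (s, X s) (Pi.single k 1, fderiv ℝ X s (Pi.single k 1)) := by
      intro j k hj
      rw [hEJ a j hj]
      have h2 : HasFDerivAt (fun s => F a j (s, X s)) _ s :=
        (hFd j).comp s ((hasFDerivAt_id s).prodMk hXd)
      have h3 : HasFDerivAt (pd j (fun s => X s a)) (fderiv ℝ (pd j (fun s => X s a)) s) s :=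
        ((((contDiffOn_pd Metric.isOpen_ball (hXa a) j)).contDiffAt
          (Metric.isOpen_ball.mem_nhds hs)).differentiableAt (by simp)).hasFDerivAt
      have h4 := (h3.sub h2).fderiv
      have h5 := congrArg (fun T : (Fin N → ℝ) →L[ℝ] ℝ => T (Pi.single k 1)) h4
      refine h5.trans ?_
      simp [pd]
    -- The vectors `∂X - E` have the prescribed components wherever there is a prescription, because
    -- `E` is the residual there, and equal `∂X` elsewhere, where `E = 0`. So compatibility holds up
    -- to terms linear in `E`.
    have h2 := hcompat (s, X s) (hXW s hs) a j hj k hk hjk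
      (fun b => fderiv ℝ X s (Pi.single k 1) b - E b k s)
      (fun b => fderiv ℝ X s (Pi.single j 1) b - E b j s)
      (fun b hb => by rw [hEJ b k hb, hXpd]; ring) (fun b hb => by rw [hEJ b j hb, hXpd]; ring)
    have h3 : ∀ j k : Fin N, ((Pi.single k 1, fun b => fderiv ℝ X s (Pi.single k 1) b - E b k s) :
        (Fin N → ℝ) × (ι → ℝ)) = (Pi.single k 1, fderiv ℝ X s (Pi.single k 1))
          - (0, fun b => E b k s) := by
      intro j k; ext <;> simp
    rw [h3 j k, h3 k j, map_sub, map_sub] at h2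
    rw [h1 j k hj, h1 k j hk, pd_comm Metric.isOpen_ball (hXa a) k j hs]
    have h4 : ∀ j k : Fin N, |fderiv ℝ (F a j) (s, X s) (0, fun b => E b k s)| ≤ C * M := by
      intro j k
      rw [← Real.norm_eq_abs]
      refine (ContinuousLinearMap.le_opNorm _ _).trans ?_
      refine mul_le_mul (hC a j) ?_ (norm_nonneg _) hC0
      rw [Prod.norm_def, norm_zero]
      exact max_le hM0 ((pi_norm_le_iff_of_nonneg hM0).2 fun b => hM b k)
    have h5 := h4 j k
    have h6 := h4 k j
    rw [abs_le] at h5 h6 ⊢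
    constructor <;> linarith
  -- a bound for the derivatives
  have hCb : ∃ C : ℝ, 0 ≤ C ∧ ∀ s ∈ Metric.closedBall (0 : Fin N → ℝ) (δ / 2), ∀ a j,
      ‖fderiv ℝ (F a j) (s, X s)‖ ≤ C := by
    have h1 : ∀ a j, ∃ C : ℝ, ∀ s ∈ Metric.closedBall (0 : Fin N → ℝ) (δ / 2),
        ‖fderiv ℝ (F a j) (s, X s)‖ ≤ C := by
      intro a j
      refine (isCompact_closedBall _ _).exists_bound_of_continuousOn
        (f := fun s => fderiv ℝ (F a j) (s, X s)) ?_
      have h2 : Metric.closedBall (0 : Fin N → ℝ) (δ / 2) ⊆ Metric.ball 0 δ :=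
        Metric.closedBall_subset_ball (by linarith)
      exact ((hF a j).continuousOn_fderiv_of_isOpen hWo (by simp)).comp
        (hpairX.continuousOn.mono h2) fun s hs => hXW s (h2 hs)
    choose C hC using h1
    refine ⟨∑ a, ∑ j, |C a j|, by positivity, fun s hs a j => (hC a j s hs).trans ?_⟩
    refine (le_abs_self _).trans ?_
    refine le_trans ?_ (Finset.single_le_sum (f := fun a => ∑ j, |C a j|)
      (fun _ _ => by positivity) (Finset.mem_univ a))
    exact Finset.single_le_sum (f := fun j => |C a j|) (fun _ _ => by positivity)
      (Finset.mem_univ j)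
  obtain ⟨C, hC0, hC⟩ := hCb
  -- radial estimate
  have step4 : ∀ ε : ℝ, ε ≤ δ / 2 → ∀ M : ℝ, 0 ≤ M →
      (∀ s ∈ Metric.closedBall (0 : Fin N → ℝ) ε, ∀ a j, |E a j s| ≤ M) →
      ∀ s ∈ Metric.closedBall (0 : Fin N → ℝ) ε, ∀ a j,
        |E a j s| ≤ N * (2 * ε * (2 * C * M)) := by
    intro ε hε M hM0 hM s hs a j
    have hε0 : 0 ≤ ε := (norm_nonneg s).trans (mem_closedBall_zero_iff.1 hs)
    by_cases hj : j ∈ J a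
    swap
    · simp only [E, hj, if_false, abs_zero]; positivity
    let q : ℝ → Fin N → ℝ := fun t => Pr a s + t • (s - Pr a s)
    have hq1 : q 1 = s := by simp [q]
    have hq : ∀ t ∈ Set.Icc (0 : ℝ) 1, q t ∈ Metric.closedBall (0 : Fin N → ℝ) ε := by
      intro t ht
      rw [mem_closedBall_zero_iff] at hs ⊢
      exact (norm_straightPath_le _ (hPr a) ht s).trans hs
    have hsub : Metric.closedBall (0 : Fin N → ℝ) ε ⊆ Metric.ball 0 δ :=
      Metric.closedBall_subset_ball (by linarith)
    have hq' : ∀ t, HasDerivAt q (s - Pr a s) t := by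
      intro t
      have := ((hasDerivAt_id t).smul_const (s - Pr a s)).const_add (Pr a s)
      rwa [one_smul] at this
    have hlq : ∀ t, q t - Pr a (q t) = t • (s - Pr a s) := fun t => hpath2 a s t
    -- The function `t E(q t)` vanishes at `t = 0` and equals `E s` at `t = 1`. By `step2` its
    -- derivative involves the residual only through its curl.
    have hder : ∀ t ∈ Set.Icc (0 : ℝ) 1, HasDerivAt (fun t => t * E a j (q t))
        (∑ k ∈ J a, (q t - Pr a (q t)) k * (pd k (E a j) (q t) - pd j (E a k) (q t))) t := by
      intro t ht
      have h1 := (hEd a j (q t) (hsub (hq t ht))).comp_hasDerivAt t (hq' t)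
      have h2 := (hasDerivAt_id t).mul h1
      convert! h2 using 1
      have h3 := step2 a j hj (q t) (hsub (hq t ht))
      simp only [mul_sub, Finset.sum_sub_distrib]
      have h4 : t * fderiv ℝ (E a j) (q t) (s - Pr a s)
          = ∑ k ∈ J a, (q t - Pr a (q t)) k * pd k (E a j) (q t) := by
        rw [← smul_eq_mul, ← map_smul, ← hlq, hPr2 a (q t), map_sum, ← hPr2 a (q t)]
        refine Finset.sum_congr rfl fun k _ => ?_
        rw [map_smul]; rfl
      simp only [id, one_mul, Function.comp]
      rw [h4]
      linarith
    have hbd : ∀ t ∈ Set.Ico (0 : ℝ) 1,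
        ‖∑ k ∈ J a, (q t - Pr a (q t)) k * (pd k (E a j) (q t) - pd j (E a k) (q t))‖
          ≤ N * (2 * ε * (2 * C * M)) := by
      intro t ht
      have ht' : t ∈ Set.Icc (0 : ℝ) 1 := ⟨ht.1, ht.2.le⟩
      have hqt := hq t ht'
      refine (norm_sum_le _ _).trans ?_
      have h1 : ∀ k ∈ J a, ‖(q t - Pr a (q t)) k * (pd k (E a j) (q t) - pd j (E a k) (q t))‖
          ≤ 2 * ε * (2 * C * M) := by
        intro k hk
        rw [norm_mul]
        refine mul_le_mul ?_ (step3 a j hj k hk (q t) (hsub hqt) C M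
          (hC (q t) (Metric.closedBall_subset_closedBall hε hqt)) (hM (q t) hqt))
          (norm_nonneg _) (by positivity)
        refine (norm_le_pi_norm _ k).trans ((norm_sub_le _ _).trans ?_)
        have h2 := mem_closedBall_zero_iff.1 hqt
        have h3 := (Pr a).le_of_opNorm_le (hPr a) (q t)
        linarith
      refine (Finset.sum_le_sum h1).trans ?_
      rw [Finset.sum_const, nsmul_eq_mul]
      refine mul_le_mul_of_nonneg_right ?_ (by positivity)
      exact_mod_cast (Finset.card_le_univ (J a)).trans (by simp)
    have h5 := norm_image_sub_le_of_norm_deriv_le_segment_01'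
      (fun t ht => (hder t ht).hasDerivWithinAt) hbd
    simpa [hq1] using h5
  -- conclusion
  let ε : ℝ := min (δ / 2) (1 / (8 * (N + 1) * (C + 1)))
  have hε0 : 0 < ε := by positivity
  have hεδ : ε ≤ δ / 2 := min_le_left _ _
  have hsub : Metric.ball (0 : Fin N → ℝ) ε ⊆ Metric.ball 0 δ :=
    Metric.ball_subset_ball (by linarith)
  have hE0 : ∀ s ∈ Metric.closedBall (0 : Fin N → ℝ) ε, ∀ a j, E a j s = 0 := by
    have hcont : ContinuousOn (fun s => ‖fun (a : ι) (j : Fin N) => E a j s‖)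
        (Metric.closedBall 0 ε) := by
      refine ContinuousOn.norm (continuousOn_pi.2 fun a => continuousOn_pi.2 fun j => ?_)
      exact (hE a j).continuousOn.mono (Metric.closedBall_subset_ball (by linarith))
    obtain ⟨s₀, hs₀, hmax⟩ := (isCompact_closedBall (0 : Fin N → ℝ) ε).exists_isMaxOn
      ⟨0, Metric.mem_closedBall_self hε0.le⟩ hcont
    set M := ‖fun (a : ι) (j : Fin N) => E a j s₀‖
    have hM : ∀ s ∈ Metric.closedBall (0 : Fin N → ℝ) ε, ∀ a j, |E a j s| ≤ M := by
      intro s hs a j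
      exact ((norm_le_pi_norm (fun j => E a j s) j).trans
        (norm_le_pi_norm (fun (a : ι) (j : Fin N) => E a j s) a)).trans (hmax hs)
    have h1 := step4 ε hεδ M (norm_nonneg _) hM s₀ hs₀
    have h2 : M ≤ N * (2 * ε * (2 * C * M)) := by
      have h0 : 0 ≤ N * (2 * ε * (2 * C * M)) := by positivity
      exact (pi_norm_le_iff_of_nonneg h0).2 fun a => (pi_norm_le_iff_of_nonneg h0).2 fun j => h1 a j
    have h3 : ε * (8 * (N + 1) * (C + 1)) ≤ 1 := by
      have : ε ≤ 1 / (8 * (N + 1) * (C + 1)) := min_le_right _ _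
      rwa [le_div_iff₀ (by positivity)] at this
    have hN : (0 : ℝ) ≤ N := Nat.cast_nonneg N
    -- The second bound in the definition of `ε` is made for this; the estimate becomes `M ≤ M / 2`.
    have h4 : N * (2 * ε * (2 * C)) ≤ 1 / 2 := by
      have : (N : ℝ) * C * ε ≤ (N + 1) * (C + 1) * ε := by gcongr <;> linarith
      nlinarith
    have h5 : M ≤ 0 := by
      have hM0 : 0 ≤ M := norm_nonneg _
      nlinarith [mul_le_mul_of_nonneg_right h4 hM0]
    intro s hs a j
    exact abs_eq_zero.1 (le_antisymm ((hM s hs a j).trans h5) (abs_nonneg _))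
  refine ⟨ε, hε0, X, hX.mono hsub, fun s hs => hXW s (hsub hs), fun s hs a => ?_,
    fun s hs a j hj => ?_⟩
  · have h1 := hball hs a 0 (by simp)
    rw [zero_smul, add_zero] at h1
    rw [hXe _ (hsub h1) a, hPrPr']
    simp
  · have := hE0 s (Metric.ball_subset_closedBall hs) a j
    rw [hEJ a j hj] at this
    exact sub_eq_zero.1 this

end Darboux

/-! ### Algebra of the Gibbons-Tsarev system -/

/-- The quadratic polynomial governing the derivative of one characteristic speed in the direction
of another one; `p` lists the first order partial derivatives of the coefficients. -/
def gtQ (p : Fin 6 → ℝ) (x y : ℝ) : ℝ :=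
  p 0 + p 1 * y + x * (p 2 + p 3 * y) + x ^ 2 * (p 4 + p 5 * y)

/-- The derivative of `gtQ` along the phase with characteristic speed `z`; `s` lists the second
order partial derivatives of the coefficients, `x'` and `y'` are the derivatives of `x` and `y`. -/
def gtDQ (p : Fin 6 → ℝ) (s : Fin 9 → ℝ) (x y z x' y' : ℝ) : ℝ :=
  (s 0 + s 1 * z + (s 1 + s 2 * z) * y + p 1 * y')
  + x * (s 3 + s 4 * z + (s 4 + s 5 * z) * y + p 3 * y')
  + x ^ 2 * (s 6 + s 7 * z + (s 7 + s 8 * z) * y + p 5 * y')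
  + x' * (p 2 + p 3 * y + 2 * x * (p 4 + p 5 * y))

/-- Coefficient of the Gibbons-Tsarev equation for a characteristic speed. -/
noncomputable def gtA (h : ℝ) (p : Fin 6 → ℝ) (x y : ℝ) : ℝ := gtQ p x y / (h * (y - x))

/-- Coefficient of the Gibbons-Tsarev equation for the derivative of the field. -/
noncomputable def gtB (h : ℝ) (p : Fin 6 → ℝ) (x y : ℝ) : ℝ :=
  (gtQ p x y + gtQ p y x) / (h * (x - y) ^ 2)

/-- The derivative of `gtA` along the phase with characteristic speed `z`. -/
noncomputable def gtDA (h : ℝ) (p : Fin 6 → ℝ) (s : Fin 9 → ℝ) (x y z : ℝ) : ℝ :=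
  gtDQ p s x y z (gtA h p x z) (gtA h p y z) / (h * (y - x))
    - gtQ p x y * (p 4 + p 5 * z) / (h ^ 2 * (y - x))
    - gtQ p x y * (gtA h p y z - gtA h p x z) / (h * (y - x) ^ 2)

/-- The derivative of `gtB` along the phase with characteristic speed `z`. -/
noncomputable def gtDB (h : ℝ) (p : Fin 6 → ℝ) (s : Fin 9 → ℝ) (x y z : ℝ) : ℝ :=
  (gtDQ p s x y z (gtA h p x z) (gtA h p y z) + gtDQ p s y x z (gtA h p y z) (gtA h p x z))
      / (h * (x - y) ^ 2)
    - (gtQ p x y + gtQ p y x) * (p 4 + p 5 * z) / (h ^ 2 * (x - y) ^ 2)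
    - 2 * (gtQ p x y + gtQ p y x) * (gtA h p x z - gtA h p y z) / (h * (x - y) ^ 3)

/-- The integrability conditions as relations between the first and second derivatives. -/
def JetInt (h : ℝ) (p : Fin 6 → ℝ) (s : Fin 9 → ℝ) : Prop :=
  s 0 = -(p 1 ^ 2 + p 2 * p 1 - 2 * p 3 * p 0) / h ∧
  s 1 = p 5 * p 0 / h ∧ s 2 = p 5 * p 1 / h ∧
  s 3 = (-(p 1 * p 3) + p 2 * p 3 - 2 * p 1 * p 4 + 2 * p 5 * p 0) / h ∧
  s 4 = p 5 * p 2 / h ∧ s 5 = p 5 * p 3 / h ∧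
  s 6 = -(p 5 * (p 1 - p 2)) / h ∧ s 7 = p 5 * p 4 / h ∧ s 8 = p 5 ^ 2 / h

-- With `vⱼ = ∂ⱼu` and speeds `x = μⁱ`, `y = μʲ`, `z = μᵏ`, the two sides are the coefficients of
-- `vⱼ vₖ` in `∂ₖ∂ⱼμⁱ` and `∂ⱼ∂ₖμⁱ`. After insertion of the second derivatives it is an identity of
-- rational functions.
set_option maxRecDepth 100000 in
set_option maxHeartbeats 4000000 in
lemma JetInt.gtA_compat {h : ℝ} {p : Fin 6 → ℝ} {s : Fin 9 → ℝ} (H : JetInt h p s) (hh : h ≠ 0)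
    {x y z : ℝ} (hxy : x ≠ y) (hxz : x ≠ z) (hyz : y ≠ z) :
    gtDA h p s x y z + gtA h p x y * gtB h p y z
      = gtDA h p s x z y + gtA h p x z * gtB h p z y := by
  obtain ⟨e0, e1, e2, e3, e4, e5, e6, e7, e8⟩ := H
  have a1 : y - x ≠ 0 := sub_ne_zero.2 hxy.symm
  have a2 : z - x ≠ 0 := sub_ne_zero.2 hxz.symm
  have a3 : z - y ≠ 0 := sub_ne_zero.2 hyz.symm
  have a4 : y - z ≠ 0 := sub_ne_zero.2 hyz
  simp only [gtDA, gtA, gtB, gtDQ, e0, e1, e2, e3, e4, e5, e6, e7, e8, gtQ]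
  generalize p 0 = p0; generalize p 1 = p1; generalize p 2 = p2
  generalize p 3 = p3; generalize p 4 = p4; generalize p 5 = p5
  field_simp
  ring

-- The same for `∂ₖ∂ⱼvᵢ`: the sides are the coefficients of `vᵢ vⱼ vₖ`.
set_option maxRecDepth 100000 in
set_option maxHeartbeats 4000000 in
lemma JetInt.gtB_compat {h : ℝ} {p : Fin 6 → ℝ} {s : Fin 9 → ℝ} (H : JetInt h p s) (hh : h ≠ 0)
    {x y z : ℝ} (hxy : x ≠ y) (hxz : x ≠ z) (hyz : y ≠ z) :
    gtDB h p s x y z + gtB h p x y * (gtB h p x z + gtB h p y z)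
      = gtDB h p s x z y + gtB h p x z * (gtB h p x y + gtB h p z y) := by
  obtain ⟨e0, e1, e2, e3, e4, e5, e6, e7, e8⟩ := H
  have a1 : x - y ≠ 0 := sub_ne_zero.2 hxy
  have a2 : x - z ≠ 0 := sub_ne_zero.2 hxz
  have a3 : z - y ≠ 0 := sub_ne_zero.2 hyz.symm
  have a4 : y - z ≠ 0 := sub_ne_zero.2 hyz
  have a5 : y - x ≠ 0 := sub_ne_zero.2 hxy.symm
  have a6 : z - x ≠ 0 := sub_ne_zero.2 hxz.symm
  simp only [gtDB, gtA, gtB, gtDQ, e0, e1, e2, e3, e4, e5, e6, e7, e8, gtQ]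
  generalize p 0 = p0; generalize p 1 = p1; generalize p 2 = p2
  generalize p 3 = p3; generalize p 4 = p4; generalize p 5 = p5
  field_simp
  ring

-- The hypothesis is affine in the nine second derivatives `s`. Nine triples of small integers give
-- the relations `r0`, ..., `r8`, each multiplied by a number and `h ^ 2` to clear denominators;
-- they form a linear system with invertible matrix.
set_option maxHeartbeats 1000000 in
lemma JetInt.of_gtA_compat {h : ℝ} {p : Fin 6 → ℝ} {s : Fin 9 → ℝ} (hh : h ≠ 0)
    (H : ∀ x y z : ℝ, x ≠ y → x ≠ z → y ≠ z → gtDA h p s x y z + gtA h p x y * gtB h p y z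
      = gtDA h p s x z y + gtA h p x z * gtB h p z y) : JetInt h p s := by
  have r0 : 2 * p 0 * p 3 - h * s 0 - p 1 * p 2 - p 1 * p 5 - p 1 ^ 2 + h * s 2 = 0 := by
    have H1 := sub_eq_zero.2 (H 0 (-1) 1 (by norm_num) (by norm_num) (by norm_num))
    have H2 := congrArg (fun t : ℝ => 1/2 * h ^ 2 * t) H1
    simp only [mul_zero] at H2
    rw [← H2]
    simp only [gtDA, gtA, gtB, gtDQ, gtQ]
    field_simp
    ring
  have r1 : - 2 * p 0 * p 3 - p 0 * p 5 + h * s 0 - h * s 1 + p 1 * p 2 + p 1 * p 3 + 2 * p 1 *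
      p 4 + p 1 * p 5 + p 1 ^ 2 - p 2 * p 3 + h * s 3 - h * s 4 + p 4 * p 5 + h * s 6 - h * s 7
      = 0 := by
    have H1 := sub_eq_zero.2 (H 1 (-1) 0 (by norm_num) (by norm_num) (by norm_num))
    have H2 := congrArg (fun t : ℝ => 2 * h ^ 2 * t) H1
    simp only [mul_zero] at H2
    rw [← H2]
    simp only [gtDA, gtA, gtB, gtDQ, gtQ]
    field_simp
    ring
  have r2 : - 2 * p 0 * p 3 + p 0 * p 5 + h * s 0 + h * s 1 + p 1 * p 2 - p 1 * p 3 - 2 * p 1 *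
      p 4 + p 1 * p 5 + p 1 ^ 2 + p 2 * p 3 - h * s 3 - h * s 4 - p 4 * p 5 + h * s 6 + h * s 7
      = 0 := by
    have H1 := sub_eq_zero.2 (H (-1) 0 1 (by norm_num) (by norm_num) (by norm_num))
    have H2 := congrArg (fun t : ℝ => 2 * h ^ 2 * t) H1
    simp only [mul_zero] at H2
    rw [← H2]
    simp only [gtDA, gtA, gtB, gtDQ, gtQ]
    field_simp
    ring
  have r3 : - 2 * p 0 * p 3 - 3 * p 0 * p 5 + h * s 0 + 3 * h * s 1 + p 1 * p 2 - 2 * p 1 * p 5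
      + p 1 ^ 2 + 2 * h * s 2 = 0 := by
    have H1 := sub_eq_zero.2 (H 0 1 2 (by norm_num) (by norm_num) (by norm_num))
    have H2 := congrArg (fun t : ℝ => 2 * h ^ 2 * t) H1
    simp only [mul_zero] at H2
    rw [← H2]
    simp only [gtDA, gtA, gtB, gtDQ, gtQ]
    field_simp
    ring
  have r4 : 2 * p 0 * p 3 + p 0 * p 5 - h * s 0 - h * s 1 - p 1 * p 2 - 2 * p 1 * p 5 - p 1 ^ 2
      + 2 * h * s 2 = 0 := by
    have H1 := sub_eq_zero.2 (H 0 (-1) 2 (by norm_num) (by norm_num) (by norm_num))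
    have H2 := congrArg (fun t : ℝ => 2/3 * h ^ 2 * t) H1
    simp only [mul_zero] at H2
    rw [← H2]
    simp only [gtDA, gtA, gtB, gtDQ, gtQ]
    field_simp
    ring
  have r5 : 2 * p 0 * p 3 + 4 * p 0 * p 5 - h * s 0 - 2 * h * s 1 - p 1 * p 2 - p 1 * p 3 - 2 *
      p 1 * p 4 - p 1 * p 5 - p 1 ^ 2 + p 2 * p 3 + 3 * p 2 * p 5 - h * s 3 - 2 * h * s 4 + 2 *
      p 4 * p 5 - h * s 6 - 2 * h * s 7 = 0 := by
    have H1 := sub_eq_zero.2 (H 1 0 2 (by norm_num) (by norm_num) (by norm_num))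
    have H2 := congrArg (fun t : ℝ => 1/2 * h ^ 2 * t) H1
    simp only [mul_zero] at H2
    rw [← H2]
    simp only [gtDA, gtA, gtB, gtDQ, gtQ]
    field_simp
    ring
  have r6 : - 2 * p 0 * p 3 + h * s 0 + 2 * h * s 1 + p 1 * p 2 - p 1 * p 3 - 2 * p 1 * p 4 + p
      1 * p 5 + p 1 ^ 2 + p 2 * p 3 + p 2 * p 5 - h * s 3 - 2 * h * s 4 - 2 * p 4 * p 5 + h * s
      6 + 2 * h * s 7 = 0 := by
    have H1 := sub_eq_zero.2 (H (-1) 0 2 (by norm_num) (by norm_num) (by norm_num))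
    have H2 := congrArg (fun t : ℝ => 3/2 * h ^ 2 * t) H1
    simp only [mul_zero] at H2
    rw [← H2]
    simp only [gtDA, gtA, gtB, gtDQ, gtQ]
    field_simp
    ring
  have r7 : 2 * p 0 * p 3 + 3 * p 0 * p 5 - h * s 0 - h * s 1 - p 1 * p 2 - p 1 * p 3 - 2 * p 1
      * p 4 - 3 * p 1 * p 5 - p 1 ^ 2 + 2 * h * s 2 + p 2 * p 3 + 2 * p 2 * p 5 - h * s 3 - h *
      s 4 - 2 * p 3 * p 5 + 2 * h * s 5 + p 4 * p 5 - h * s 6 - h * s 7 - 2 * p 5 ^ 2 + 2 * h *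
      s 8 = 0 := by
    have H1 := sub_eq_zero.2 (H 1 (-1) 2 (by norm_num) (by norm_num) (by norm_num))
    have H2 := congrArg (fun t : ℝ => 2/3 * h ^ 2 * t) H1
    simp only [mul_zero] at H2
    rw [← H2]
    simp only [gtDA, gtA, gtB, gtDQ, gtQ]
    field_simp
    ring
  have r8 : - 2 * p 0 * p 3 - p 0 * p 5 + h * s 0 + 3 * h * s 1 + p 1 * p 2 - p 1 * p 3 - 2 * p
      1 * p 4 - p 1 * p 5 + p 1 ^ 2 + 2 * h * s 2 + p 2 * p 3 + 2 * p 2 * p 5 - h * s 3 - 3 * h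
      * s 4 + 2 * p 3 * p 5 - 2 * h * s 5 - 3 * p 4 * p 5 + h * s 6 + 3 * h * s 7 - 2 * p 5 ^ 2
      + 2 * h * s 8 = 0 := by
    have H1 := sub_eq_zero.2 (H (-1) 1 2 (by norm_num) (by norm_num) (by norm_num))
    have H2 := congrArg (fun t : ℝ => 6 * h ^ 2 * t) H1
    simp only [mul_zero] at H2
    rw [← H2]
    simp only [gtDA, gtA, gtB, gtDQ, gtQ]
    field_simp
    ring
  -- The coefficients below are the rows of the inverse matrix of that system, for the unknowns `h *
  -- s i`.
  refine ⟨?_, ?_, ?_, ?_, ?_, ?_, ?_, ?_, ?_⟩ <;> rw [eq_div_iff hh]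
  · linear_combination (-4/3) * r0 + (1/6) * r3 + (1/2) * r4
  · linear_combination (2/3) * r0 + (1/6) * r3 + (-1/2) * r4
  · linear_combination (-1/3) * r0 + (1/6) * r3 + (1/2) * r4
  · linear_combination (1/3) * r1 + (-1) * r2 + (-1/6) * r5 + (1/2) * r6
  · linear_combination (-1/6) * r1 + (1/2) * r2 + (-1/6) * r5 + (-1/2) * r6
  · linear_combination (1/12) * r1 + (-1/4) * r2 + (-1/6) * r5 + (1/2) * r6 + (1/4) * r7 + (-1/4) * r8
  · linear_combination (4/3) * r0 + (1/3) * r1 + (1) * r2 + (-1/6) * r3 + (-1/2) * r4 + (-1/6) * r5 + (-1/2) * r6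
  · linear_combination (-2/3) * r0 + (-1/6) * r1 + (-1/2) * r2 + (-1/6) * r3 + (1/2) * r4 + (-1/6) * r5 + (1/2) * r6
  · linear_combination (1/3) * r0 + (1/12) * r1 + (1/4) * r2 + (-1/6) * r3 + (-1/2) * r4 + (-1/6) * r5 + (-1/2) * r6 + (1/4) * r7 + (1/4) * r8

/-! ### Jets of the coefficients and their derivatives along a phase -/

/-- First order derivatives of the coefficients. -/
noncomputable def jet1 (φ ψ η : (Fin 2 → ℝ) → ℝ) (z : Fin 2 → ℝ) : Fin 6 → ℝ :=
  ![pd 0 φ z, pd 1 φ z, pd 0 ψ z, pd 1 ψ z, pd 0 η z, pd 1 η z]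

/-- Second order derivatives of the coefficients. -/
noncomputable def jet2 (φ ψ η : (Fin 2 → ℝ) → ℝ) (z : Fin 2 → ℝ) : Fin 9 → ℝ :=
  ![pd 0 (pd 0 φ) z, pd 1 (pd 0 φ) z, pd 1 (pd 1 φ) z,
    pd 0 (pd 0 ψ) z, pd 1 (pd 0 ψ) z, pd 1 (pd 1 ψ) z,
    pd 0 (pd 0 η) z, pd 1 (pd 0 η) z, pd 1 (pd 1 η) z]

lemma nonsymInt_iff_jetInt {Ω : Set (Fin 2 → ℝ)} {φ ψ η : (Fin 2 → ℝ) → ℝ} :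
    NonsymInt Ω φ ψ η ↔ ∀ z ∈ Ω, JetInt (η z) (jet1 φ ψ η z) (jet2 φ ψ η z) := Iff.rfl

lemma hasDerivAt_line {n : ℕ} {f : (Fin n → ℝ) → ℝ} {x : Fin n → ℝ} (hf : DifferentiableAt ℝ f x)
    (k : Fin n) : HasDerivAt (fun t : ℝ => f (x + t • Pi.single k 1)) (pd k f x) 0 :=
  hf.hasFDerivAt.hasLineDerivAt _

lemma hasDerivAt_comp_curve {Ω : Set (Fin 2 → ℝ)} (hΩ : IsOpen Ω) {g : (Fin 2 → ℝ) → ℝ}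
    (hg : ContDiffOn ℝ ∞ g Ω) {u w : ℝ → ℝ} {u' w' t : ℝ} (hu : HasDerivAt u u' t)
    (hw : HasDerivAt w w' t) (hz : ![u t, w t] ∈ Ω) :
    HasDerivAt (fun t => g ![u t, w t]) (pd 0 g ![u t, w t] * u' + pd 1 g ![u t, w t] * w') t := by
  have h1 : HasDerivAt (fun t => ![u t, w t]) ![u', w'] t := by
    rw [hasDerivAt_pi]
    intro i
    fin_cases i
    · exact hu
    · exact hw
  have h2 := ((hg.contDiffAt (hΩ.mem_nhds hz)).differentiableAt (by simp)).hasFDerivAt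
  have h3 := h2.comp_hasDerivAt t h1
  refine h3.congr_deriv ?_
  rw [hasFDerivAt_eq_sum_pd]
  simp [Fin.sum_univ_two, mul_comm]

section Curve

variable {Ω : Set (Fin 2 → ℝ)} {φ ψ η : (Fin 2 → ℝ) → ℝ} {u w x y : ℝ → ℝ} {v z x' y' : ℝ}

/-- Along the phase with speed `z` the derivatives of `u`, `w` and the speeds are all multiples of
`v = ∂u`. This factor is kept apart, so that `gtDQ`, `gtDA` and `gtDB` involve only the speeds and
the jets. -/
lemma hasDerivAt_gtQ (hΩ : IsOpen Ω) (hφ : ContDiffOn ℝ ∞ φ Ω) (hψ : ContDiffOn ℝ ∞ ψ Ω)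
    (hη : ContDiffOn ℝ ∞ η Ω) (hz : ![u 0, w 0] ∈ Ω) (hu : HasDerivAt u v 0)
    (hw : HasDerivAt w (z * v) 0) (hx : HasDerivAt x (x' * v) 0) (hy : HasDerivAt y (y' * v) 0) :
    HasDerivAt (fun t => gtQ (jet1 φ ψ η ![u t, w t]) (x t) (y t))
      (v * gtDQ (jet1 φ ψ η ![u 0, w 0]) (jet2 φ ψ η ![u 0, w 0]) (x 0) (y 0) z x' y') 0 := by
  have h1 : ∀ {g}, ContDiffOn ℝ ∞ g Ω → ∀ i, HasDerivAt (fun t => pd i g ![u t, w t])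
      (pd 0 (pd i g) ![u 0, w 0] * v + pd 1 (pd i g) ![u 0, w 0] * (z * v)) 0 := fun hg i =>
    hasDerivAt_comp_curve hΩ (contDiffOn_pd hΩ hg i) hu hw hz
  have h2 : ∀ {g}, ContDiffOn ℝ ∞ g Ω → pd 0 (pd 1 g) ![u 0, w 0] = pd 1 (pd 0 g) ![u 0, w 0] :=
    fun hg => pd_comm hΩ hg 0 1 hz
  have h3 := (((h1 hφ 0).add ((h1 hφ 1).mul hy)).add (hx.mul ((h1 hψ 0).add
    ((h1 hψ 1).mul hy)))).add ((hx.pow 2).mul ((h1 hη 0).add ((h1 hη 1).mul hy)))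
  refine (h3.congr_deriv ?_).congr_of_eventuallyEq (Filter.Eventually.of_forall fun t => ?_)
  · simp only [h2 hφ, h2 hψ, h2 hη, gtDQ, jet1, jet2, Matrix.cons_val]
    simp
    ring
  · simp [gtQ, jet1]

lemma hasDerivAt_gtA (hΩ : IsOpen Ω) (hφ : ContDiffOn ℝ ∞ φ Ω) (hψ : ContDiffOn ℝ ∞ ψ Ω)
    (hη : ContDiffOn ℝ ∞ η Ω) (hη0 : ∀ z ∈ Ω, η z ≠ 0) (hz : ![u 0, w 0] ∈ Ω)
    (hu : HasDerivAt u v 0) (hw : HasDerivAt w (z * v) 0)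
    (hx : HasDerivAt x (gtA (η ![u 0, w 0]) (jet1 φ ψ η ![u 0, w 0]) (x 0) z * v) 0)
    (hy : HasDerivAt y (gtA (η ![u 0, w 0]) (jet1 φ ψ η ![u 0, w 0]) (y 0) z * v) 0)
    (hxy : x 0 ≠ y 0) :
    HasDerivAt (fun t => gtA (η ![u t, w t]) (jet1 φ ψ η ![u t, w t]) (x t) (y t))
      (v * gtDA (η ![u 0, w 0]) (jet1 φ ψ η ![u 0, w 0]) (jet2 φ ψ η ![u 0, w 0])
        (x 0) (y 0) z) 0 := by
  have hQ := hasDerivAt_gtQ hΩ hφ hψ hη hz hu hw hx hy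
  have hd := (hasDerivAt_comp_curve hΩ hη hu hw hz).mul (hy.sub hx)
  have h0 := hη0 _ hz
  have h1 : y 0 - x 0 ≠ 0 := sub_ne_zero.2 hxy.symm
  refine (hQ.div hd (mul_ne_zero h0 h1)).congr_deriv ?_
  have e4 : jet1 φ ψ η ![u 0, w 0] 4 = pd 0 η ![u 0, w 0] := rfl
  have e5 : jet1 φ ψ η ![u 0, w 0] 5 = pd 1 η ![u 0, w 0] := rfl
  simp only [gtDA, e4, e5, Pi.mul_apply, Pi.sub_apply]
  field_simp
  ring

lemma hasDerivAt_gtB (hΩ : IsOpen Ω) (hφ : ContDiffOn ℝ ∞ φ Ω) (hψ : ContDiffOn ℝ ∞ ψ Ω)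
    (hη : ContDiffOn ℝ ∞ η Ω) (hη0 : ∀ z ∈ Ω, η z ≠ 0) (hz : ![u 0, w 0] ∈ Ω)
    (hu : HasDerivAt u v 0) (hw : HasDerivAt w (z * v) 0)
    (hx : HasDerivAt x (gtA (η ![u 0, w 0]) (jet1 φ ψ η ![u 0, w 0]) (x 0) z * v) 0)
    (hy : HasDerivAt y (gtA (η ![u 0, w 0]) (jet1 φ ψ η ![u 0, w 0]) (y 0) z * v) 0)
    (hxy : x 0 ≠ y 0) :
    HasDerivAt (fun t => gtB (η ![u t, w t]) (jet1 φ ψ η ![u t, w t]) (x t) (y t))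
      (v * gtDB (η ![u 0, w 0]) (jet1 φ ψ η ![u 0, w 0]) (jet2 φ ψ η ![u 0, w 0])
        (x 0) (y 0) z) 0 := by
  have hQ := hasDerivAt_gtQ hΩ hφ hψ hη hz hu hw hx hy
  have hQ' := hasDerivAt_gtQ hΩ hφ hψ hη hz hu hw hy hx
  have hd := (hasDerivAt_comp_curve hΩ hη hu hw hz).mul ((hx.sub hy).pow 2)
  have h0 := hη0 _ hz
  have h1 : x 0 - y 0 ≠ 0 := sub_ne_zero.2 hxy
  refine ((hQ.add hQ').div hd (mul_ne_zero h0 (pow_ne_zero 2 h1))).congr_deriv ?_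
  have e4 : jet1 φ ψ η ![u 0, w 0] 4 = pd 0 η ![u 0, w 0] := rfl
  have e5 : jet1 φ ψ η ![u 0, w 0] 5 = pd 1 η ![u 0, w 0] := rfl
  simp only [gtDB, e4, e5, Pi.mul_apply, Pi.sub_apply, Pi.add_apply, Pi.pow_apply]
  field_simp
  simp only [Nat.cast_ofNat, Nat.add_one_sub_one, pow_one]
  ring

end Curve

/-! ### Necessity of the integrability conditions -/

section Necessity


variable {N : ℕ} {Ω : Set (Fin 2 → ℝ)} {φ ψ η : (Fin 2 → ℝ) → ℝ} {V : Set (Fin N → ℝ)}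
  {U W : (Fin N → ℝ) → ℝ} {μ lam : Fin N → (Fin N → ℝ) → ℝ}

lemma IsReduction.hasDerivAt_U (h : IsReduction Ω φ ψ η V U W μ lam) (hV : IsOpen V)
    {R : Fin N → ℝ} (hR : R ∈ V) (j : Fin N) :
    HasDerivAt (fun t : ℝ => U (R + t • Pi.single j 1)) (pd j U R) 0 :=
  hasDerivAt_line ((h.smooth_U.contDiffAt (hV.mem_nhds hR)).differentiableAt (by simp)) j

lemma IsReduction.hasDerivAt_W (h : IsReduction Ω φ ψ η V U W μ lam) (hV : IsOpen V)
    {R : Fin N → ℝ} (hR : R ∈ V) (j : Fin N) :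
    HasDerivAt (fun t : ℝ => W (R + t • Pi.single j 1)) (μ j R * pd j U R) 0 := by
  rw [← h.second_eq R hR j]
  exact hasDerivAt_line ((h.smooth_W.contDiffAt (hV.mem_nhds hR)).differentiableAt (by simp)) j

lemma IsReduction.hasDerivAt_mu (h : IsReduction Ω φ ψ η V U W μ lam) (hV : IsOpen V)
    {R : Fin N → ℝ} (hR : R ∈ V) (i j : Fin N) :
    HasDerivAt (fun t : ℝ => μ i (R + t • Pi.single j 1)) (pd j (μ i) R) 0 :=
  hasDerivAt_line (((h.smooth_μ i).contDiffAt (hV.mem_nhds hR)).differentiableAt (by simp)) j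

/-- The dispersion relation. -/
lemma IsReduction.lam_eq (h : IsReduction Ω φ ψ η V U W μ lam) {R : Fin N → ℝ} (hR : R ∈ V)
    {i : Fin N} (hi : pd i U R ≠ 0) :
    lam i R = φ ![U R, W R] + ψ ![U R, W R] * μ i R + η ![U R, W R] * μ i R ^ 2 := by
  have h1 := h.first_eq R hR i
  rw [h.second_eq R hR i] at h1
  have h2 : (lam i R - (φ ![U R, W R] + ψ ![U R, W R] * μ i R + η ![U R, W R] * μ i R ^ 2))
      * pd i U R = 0 := by linear_combination h1
  rcases mul_eq_zero.1 h2 with h3 | h3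
  · exact sub_eq_zero.1 h3
  · exact absurd h3 hi

lemma tendsto_line (R : Fin N → ℝ) (j : Fin N) :
    Filter.Tendsto (fun t : ℝ => R + t • (Pi.single j 1 : Fin N → ℝ)) (𝓝 0) (𝓝 R) := by
  have : Continuous (fun t : ℝ => R + t • (Pi.single j 1 : Fin N → ℝ)) := by fun_prop
  simpa using this.tendsto 0

/-- Differentiating the dispersion relation gives `∂ⱼλⁱ = gtQ(μⁱ, μʲ) ∂ⱼu + (ψ + 2 η μⁱ) ∂ⱼμⁱ`,
while `λʲ - λⁱ = (μʲ - μⁱ)(ψ + η (μⁱ + μʲ))`. In the consistency condition the factor `μʲ - μⁱ`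
cancels and `η (μʲ - μⁱ) ∂ⱼμⁱ = gtQ(μⁱ, μʲ) ∂ⱼu` remains. -/
lemma IsReduction.pd_mu (h : IsReduction Ω φ ψ η V U W μ lam) (hV : IsOpen V) (hΩ : IsOpen Ω)
    (hφ : ContDiffOn ℝ ∞ φ Ω) (hψ : ContDiffOn ℝ ∞ ψ Ω) (hη : ContDiffOn ℝ ∞ η Ω)
    (hη0 : ∀ z ∈ Ω, η z ≠ 0) {R : Fin N → ℝ} (hR : R ∈ V) (hU : ∀ i, pd i U R ≠ 0)
    {i j : Fin N} (hij : i ≠ j) (hμ : μ i R ≠ μ j R) :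
    pd j (μ i) R = gtA (η ![U R, W R]) (jet1 φ ψ η ![U R, W R]) (μ i R) (μ j R) * pd j U R := by
  have hmem := h.mem R hR
  have hu := h.hasDerivAt_U hV hR j
  have hw := h.hasDerivAt_W hV hR j
  have hm := h.hasDerivAt_mu hV hR i j
  have hz : ![U (R + (0 : ℝ) • Pi.single j 1), W (R + (0 : ℝ) • Pi.single j 1)] ∈ Ω := by
    simpa using hmem
  have h1 := ((hasDerivAt_comp_curve hΩ hφ hu hw hz).add
    ((hasDerivAt_comp_curve hΩ hψ hu hw hz).mul hm)).add
    ((hasDerivAt_comp_curve hΩ hη hu hw hz).mul (hm.pow 2))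
  have hUi : ∀ᶠ R' in 𝓝 R, R' ∈ V ∧ pd i U R' ≠ 0 :=
    Filter.Eventually.and (hV.mem_nhds hR) <|
      (((contDiffOn_pd hV h.smooth_U i).continuousOn.continuousAt
        (hV.mem_nhds hR)).eventually_ne (hU i))
  have h2 : HasDerivAt (fun t : ℝ => lam i (R + t • Pi.single j 1)) _ 0 :=
    h1.congr_of_eventuallyEq (by
      filter_upwards [(tendsto_line R j).eventually hUi] with t ht
      exact h.lam_eq ht.1 ht.2)
  have h3 : pd j (lam i) R = _ := (hasDerivAt_line
    (((h.smooth_lam i).contDiffAt (hV.mem_nhds hR)).differentiableAt (by simp)) j).unique h2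
  have h4 := h.consistent R hR i j hij
  rw [h3, h.lam_eq hR (hU i), h.lam_eq hR (hU j)] at h4
  simp only [Pi.pow_apply, zero_smul, add_zero] at h4
  have h0 := hη0 _ hmem
  have hne : μ j R - μ i R ≠ 0 := sub_ne_zero.2 hμ.symm
  have h5 : (pd j (μ i) R * (η ![U R, W R] * (μ j R - μ i R))
      - gtQ (jet1 φ ψ η ![U R, W R]) (μ i R) (μ j R) * pd j U R) * (μ j R - μ i R) = 0 := by
    simp only [gtQ, jet1, Matrix.cons_val]
    simp only [Nat.cast_ofNat, Nat.add_one_sub_one, pow_one] at h4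
    linear_combination h4
  have h6 := (mul_eq_zero.1 h5).resolve_right hne
  rw [gtA, div_mul_eq_mul_div, eq_div_iff (mul_ne_zero h0 hne)]
  linear_combination h6

/-- The mixed derivatives of `W`, computed from `∂ᵢW = μⁱ ∂ᵢU` and from `∂ⱼW = μʲ ∂ⱼU`, agree;
solving for the mixed derivative of `U` requires `μⁱ ≠ μʲ`. -/
lemma IsReduction.pd_pd_U (h : IsReduction Ω φ ψ η V U W μ lam) (hV : IsOpen V) (hΩ : IsOpen Ω)
    (hφ : ContDiffOn ℝ ∞ φ Ω) (hψ : ContDiffOn ℝ ∞ ψ Ω) (hη : ContDiffOn ℝ ∞ η Ω)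
    (hη0 : ∀ z ∈ Ω, η z ≠ 0) {R : Fin N → ℝ} (hR : R ∈ V) (hU : ∀ i, pd i U R ≠ 0)
    {i j : Fin N} (hij : i ≠ j) (hμ : μ i R ≠ μ j R) :
    pd j (pd i U) R = gtB (η ![U R, W R]) (jet1 φ ψ η ![U R, W R]) (μ i R) (μ j R)
      * pd i U R * pd j U R := by
  have hW : ∀ i j, pd j (pd i W) R = pd j (μ i) R * pd i U R + μ i R * pd j (pd i U) R := by
    intro i j
    have h1 := (h.hasDerivAt_mu hV hR i j).mul (hasDerivAt_line
      (((contDiffOn_pd hV h.smooth_U i).contDiffAt (hV.mem_nhds hR)).differentiableAt (by simp)) j)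
    have h2 : HasDerivAt (fun t : ℝ => pd i W (R + t • Pi.single j 1)) _ 0 :=
      h1.congr_of_eventuallyEq (by
        filter_upwards [(tendsto_line R j).eventually (hV.mem_nhds hR)] with t ht
        exact h.second_eq _ ht i)
    have h3 := (hasDerivAt_line (((contDiffOn_pd hV h.smooth_W i).contDiffAt
      (hV.mem_nhds hR)).differentiableAt (by simp)) j).unique h2
    simpa using h3
  have h1 := hW i j
  have h2 := hW j i
  rw [pd_comm hV h.smooth_W j i hR, h2, pd_comm hV h.smooth_U i j hR,
    h.pd_mu hV hΩ hφ hψ hη hη0 hR hU hij hμ, h.pd_mu hV hΩ hφ hψ hη hη0 hR hU hij.symm hμ.symm] at h1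
  have hne : μ i R - μ j R ≠ 0 := sub_ne_zero.2 hμ
  have hne' : μ j R - μ i R ≠ 0 := sub_ne_zero.2 hμ.symm
  have h0 := hη0 _ (h.mem R hR)
  rw [gtB]
  simp only [gtA] at h1
  have h3 : (μ i R - μ j R) * pd j (pd i U) R = (μ i R - μ j R) *
      ((gtQ (jet1 φ ψ η ![U R, W R]) (μ i R) (μ j R) + gtQ (jet1 φ ψ η ![U R, W R]) (μ j R) (μ i R))
      / (η ![U R, W R] * (μ i R - μ j R) ^ 2) * pd i U R * pd j U R) := by
    have h4 : (μ i R - μ j R) * pd j (pd i U) R = gtQ (jet1 φ ψ η ![U R, W R]) (μ j R) (μ i R) /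
        (η ![U R, W R] * (μ i R - μ j R)) * pd i U R * pd j U R -
        gtQ (jet1 φ ψ η ![U R, W R]) (μ i R) (μ j R) /
        (η ![U R, W R] * (μ j R - μ i R)) * pd j U R * pd i U R := by linear_combination -h1
    rw [h4, ← neg_sub (μ i R) (μ j R)]
    field_simp
    ring
  exact mul_left_cancel₀ hne h3

/-- Integrability by hydrodynamic reductions implies the second order conditions. -/
theorem HydrodynamicallyIntegrable.nonsymInt (hΩ : IsOpen Ω)
    (hφ : ContDiffOn ℝ ∞ φ Ω) (hψ : ContDiffOn ℝ ∞ ψ Ω) (hη : ContDiffOn ℝ ∞ η Ω)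
    (hη0 : ∀ z ∈ Ω, η z ≠ 0) (H : HydrodynamicallyIntegrable Ω φ ψ η) : NonsymInt Ω φ ψ η := by
  rw [nonsymInt_iff_jetInt]
  intro z hz
  refine JetInt.of_gtA_compat (hη0 z hz) fun a b c hab hac hbc => ?_
  have hz' : z = ![z 0, z 1] := by ext i; fin_cases i <;> rfl
  have hinj : Function.Injective (fun i : Fin 3 => ![a, b, c] i) := by
    intro i j hij
    fin_cases i <;> fin_cases j <;> first | rfl | (simp at hij; exfalso; tauto)
  -- Three phases with constant speeds on the axes are enough: at the origin the speeds are the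
  -- arbitrary numbers `a, b, c` and every `∂ᵢU` equals `1`. Only the reduction is used, so the
  -- initial profiles may be zero.
  obtain ⟨V, U, W, μ, lam, hV, h0V, h, hU0, hW0, hax, -⟩ := H 3 (z 0) (z 1) (hz' ▸ hz)
    (fun i _ => ![a, b, c] i) (fun _ _ => 0) (fun _ => analyticAt_const) (fun _ => analyticAt_const)
    hinj (fun _ => rfl)
  have hμ0 : ∀ i, μ i 0 = ![a, b, c] i := by
    intro i
    have := (hax i).self_of_nhds.2
    simpa using this
  have hv0 : ∀ i, pd i U 0 = 1 := by
    intro i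
    have h1 := h.hasDerivAt_U hV h0V i
    have h2 : HasDerivAt (fun t : ℝ => U (0 + t • Pi.single i 1)) 1 0 := by
      refine ((hasDerivAt_id (0 : ℝ)).const_add (z 0)).congr_of_eventuallyEq ?_
      filter_upwards [hax i] with t ht
      rw [zero_add, ← Pi.single_smul, smul_eq_mul, mul_one]
      exact ht.1
    exact h1.unique h2
  have hdist : ∀ i j, i ≠ j → μ i 0 ≠ μ j 0 := by
    intro i j hij
    rw [hμ0, hμ0]
    exact fun h => hij (hinj h)
  have hgood : ∀ᶠ R in 𝓝 (0 : Fin 3 → ℝ), R ∈ V ∧ (∀ i, pd i U R ≠ 0) ∧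
      ∀ i j, i ≠ j → μ i R ≠ μ j R := by
    refine Filter.Eventually.and (hV.mem_nhds h0V) (Filter.Eventually.and ?_ ?_)
    · refine Filter.eventually_all.2 fun i => ?_
      exact (((contDiffOn_pd hV h.smooth_U i).continuousOn.continuousAt
        (hV.mem_nhds h0V)).eventually_ne (by rw [hv0]; exact one_ne_zero))
    · refine Filter.eventually_all.2 fun i => Filter.eventually_all.2 fun j =>
        Filter.eventually_imp_distrib_left.2 fun hij => ?_
      have h1 : ContinuousAt (fun R => μ i R - μ j R) 0 :=
        (((h.smooth_μ i).continuousOn.continuousAt (hV.mem_nhds h0V))).sub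
          ((h.smooth_μ j).continuousOn.continuousAt (hV.mem_nhds h0V))
      filter_upwards [h1.eventually_ne (sub_ne_zero.2 (hdist i j hij))] with R hR
      exact sub_ne_zero.1 hR
  have key : ∀ j k : Fin 3, (0 : Fin 3) ≠ j → (0 : Fin 3) ≠ k → j ≠ k →
      pd k (pd j (μ 0)) 0 = gtDA (η z) (jet1 φ ψ η z) (jet2 φ ψ η z) (μ 0 0) (μ j 0) (μ k 0)
        + gtA (η z) (jet1 φ ψ η z) (μ 0 0) (μ j 0) * gtB (η z) (jet1 φ ψ η z) (μ j 0) (μ k 0) := by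
    intro j k h0j h0k hjk
    have hz0 : ![U 0, W 0] = z := by rw [hU0, hW0, ← hz']
    have hg0 := hgood.self_of_nhds
    have hm : ∀ i, i ≠ k → HasDerivAt (fun t : ℝ => μ i (0 + t • Pi.single k 1))
        (gtA (η ![U 0, W 0]) (jet1 φ ψ η ![U 0, W 0]) (μ i 0) (μ k 0) * pd k U 0) 0 := by
      intro i hik
      rw [← h.pd_mu hV hΩ hφ hψ hη hη0 h0V hg0.2.1 hik (hdist i k hik)]
      exact h.hasDerivAt_mu hV h0V i k
    have e0 : (0 : Fin 3 → ℝ) + (0 : ℝ) • Pi.single k 1 = 0 := by simp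
    have h1 := hasDerivAt_gtA (u := fun t : ℝ => U (0 + t • Pi.single k 1))
      (w := fun t : ℝ => W (0 + t • Pi.single k 1))
      (x := fun t : ℝ => μ 0 (0 + t • Pi.single k 1))
      (y := fun t : ℝ => μ j (0 + t • Pi.single k 1)) hΩ hφ hψ hη hη0
      (by rw [e0]; exact h.mem 0 h0V) (h.hasDerivAt_U hV h0V k) (h.hasDerivAt_W hV h0V k)
      (by rw [e0]; exact hm 0 h0k) (by rw [e0]; exact hm j hjk)
      (by rw [e0]; exact hdist 0 j h0j)
    have h2 := h1.mul (hasDerivAt_line (((contDiffOn_pd hV h.smooth_U j).contDiffAt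
      (hV.mem_nhds h0V)).differentiableAt (by simp)) k)
    have h3 : HasDerivAt (fun t : ℝ => pd j (μ 0) (0 + t • Pi.single k 1)) _ 0 :=
      h2.congr_of_eventuallyEq (by
        filter_upwards [(tendsto_line 0 k).eventually hgood] with t ht
        exact h.pd_mu hV hΩ hφ hψ hη hη0 ht.1 ht.2.1 h0j (ht.2.2 0 j h0j))
    have h4 := (hasDerivAt_line (((contDiffOn_pd hV (h.smooth_μ 0) j).contDiffAt
      (hV.mem_nhds h0V)).differentiableAt (by simp)) k).unique h3
    rw [h4, h.pd_pd_U hV hΩ hφ hψ hη hη0 h0V hg0.2.1 hjk (hdist j k hjk)]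
    simp only [e0, hz0, hv0]
    ring
  have h1 := key 1 2 (by decide) (by decide) (by decide)
  have h2 := key 2 1 (by decide) (by decide) (by decide)
  rw [pd_comm hV (h.smooth_μ 0) 2 1 h0V, h2] at h1
  simp only [hμ0] at h1
  exact h1.symm

end Necessity

/-! ### The Gibbons-Tsarev system as a Darboux system -/

/-- Projection onto a coordinate axis. -/
noncomputable def axisProj {N : ℕ} (i : Fin N) : (Fin N → ℝ) →L[ℝ] (Fin N → ℝ) :=
  (ContinuousLinearMap.single ℝ (fun _ : Fin N => ℝ) i).comp
    (ContinuousLinearMap.proj (R := ℝ) (φ := fun _ : Fin N => ℝ) i)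

lemma axisProj_apply {N : ℕ} (i : Fin N) (s : Fin N → ℝ) :
    axisProj i s = Pi.single i (s i) := rfl

lemma norm_axisProj_le {N : ℕ} (i : Fin N) : ‖axisProj (N := N) i‖ ≤ 1 := by
  refine ContinuousLinearMap.opNorm_le_bound _ zero_le_one fun s => ?_
  rw [axisProj_apply, one_mul, Pi.norm_single]
  exact norm_le_pi_norm s i

/-- The unknowns of the Gibbons-Tsarev system: `u`, `w`, the speeds `μⁱ` and the derivatives
`∂ᵢ u`. -/
abbrev GTVar (N : ℕ) : Type := Fin 2 ⊕ (Fin N ⊕ Fin N)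

namespace GTVar

/-- The unknown `u`. -/
abbrev u {N : ℕ} : GTVar N := .inl 0
/-- The unknown `w`. -/
abbrev w {N : ℕ} : GTVar N := .inl 1
/-- The unknown `μⁱ`. -/
abbrev mu {N : ℕ} (i : Fin N) : GTVar N := .inr (.inl i)
/-- The unknown `∂ᵢ u`. -/
abbrev v {N : ℕ} (i : Fin N) : GTVar N := .inr (.inr i)

/-- The directions in which the derivative of an unknown is prescribed. -/
def dirs {N : ℕ} : GTVar N → Finset (Fin N)
  | .inl _ => Finset.univ
  | .inr (.inl i) => Finset.univ.erase i
  | .inr (.inr i) => Finset.univ.erase i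

/-- The projection onto the set where the values of an unknown are prescribed. -/
noncomputable def proj {N : ℕ} : GTVar N → (Fin N → ℝ) →L[ℝ] (Fin N → ℝ)
  | .inl _ => 0
  | .inr (.inl i) => axisProj i
  | .inr (.inr i) => axisProj i

/-- The prescribed values. -/
def data {N : ℕ} (u₀ w₀ : ℝ) (m : Fin N → ℝ → ℝ) : GTVar N → (Fin N → ℝ) → ℝ
  | .inl i => fun _ => ![u₀, w₀] i
  | .inr (.inl i) => fun s => m i (s i)
  | .inr (.inr _) => fun _ => 1

/-- The right hand sides of the Gibbons-Tsarev system. -/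
noncomputable def rhs {N : ℕ} (φ ψ η : (Fin 2 → ℝ) → ℝ) :
    GTVar N → Fin N → (Fin N → ℝ) × (GTVar N → ℝ) → ℝ
  | .inl 0 => fun j z => z.2 (v j)
  | .inl 1 => fun j z => z.2 (mu j) * z.2 (v j)
  | .inr (.inl i) => fun j z => gtA (η ![z.2 u, z.2 w]) (jet1 φ ψ η ![z.2 u, z.2 w])
      (z.2 (mu i)) (z.2 (mu j)) * z.2 (v j)
  | .inr (.inr i) => fun j z => gtB (η ![z.2 u, z.2 w]) (jet1 φ ψ η ![z.2 u, z.2 w])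
      (z.2 (mu i)) (z.2 (mu j)) * z.2 (v i) * z.2 (v j)

/-- The domain of the right hand sides. -/
def dom {N : ℕ} (Ω : Set (Fin 2 → ℝ)) : Set ((Fin N → ℝ) × (GTVar N → ℝ)) :=
  {z | ![z.2 u, z.2 w] ∈ Ω ∧ ∀ i j, i ≠ j → z.2 (mu i) ≠ z.2 (mu j)}

variable {N : ℕ} {Ω : Set (Fin 2 → ℝ)} {φ ψ η : (Fin 2 → ℝ) → ℝ}

lemma contDiff_coord (b : GTVar N) :
    ContDiff ℝ ∞ (fun z : (Fin N → ℝ) × (GTVar N → ℝ) => z.2 b) :=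
  (contDiff_apply ℝ ℝ b).comp contDiff_snd

lemma contDiff_field :
    ContDiff ℝ ∞ (fun z : (Fin N → ℝ) × (GTVar N → ℝ) => ![z.2 u, z.2 w]) := by
  refine contDiff_pi.2 fun i => ?_
  fin_cases i
  · exact contDiff_coord u
  · exact contDiff_coord w

lemma isOpen_dom (hΩ : IsOpen Ω) : IsOpen (dom (N := N) Ω) := by
  refine (hΩ.preimage contDiff_field.continuous).inter ?_
  have : {z : (Fin N → ℝ) × (GTVar N → ℝ) | ∀ i j, i ≠ j → z.2 (mu i) ≠ z.2 (mu j)}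
      = ⋂ i, ⋂ j, {z | i ≠ j → z.2 (mu i) ≠ z.2 (mu j)} := by ext; simp
  change IsOpen {z : (Fin N → ℝ) × (GTVar N → ℝ) | ∀ i j, i ≠ j → z.2 (mu i) ≠ z.2 (mu j)}
  rw [this]
  refine isOpen_iInter_of_finite fun i => isOpen_iInter_of_finite fun j => ?_
  by_cases hij : i = j
  · simp [hij]
  · simp only [hij, ne_eq, not_false_eq_true, forall_const]
    exact isOpen_ne_fun (contDiff_coord _).continuous (contDiff_coord _).continuous

lemma contDiffOn_jet1 (hΩ : IsOpen Ω) (hφ : ContDiffOn ℝ ∞ φ Ω) (hψ : ContDiffOn ℝ ∞ ψ Ω)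
    (hη : ContDiffOn ℝ ∞ η Ω) (k : Fin 6) : ContDiffOn ℝ ∞ (fun z => jet1 φ ψ η z k) Ω := by
  fin_cases k
  · exact contDiffOn_pd hΩ hφ 0
  · exact contDiffOn_pd hΩ hφ 1
  · exact contDiffOn_pd hΩ hψ 0
  · exact contDiffOn_pd hΩ hψ 1
  · exact contDiffOn_pd hΩ hη 0
  · exact contDiffOn_pd hΩ hη 1

lemma contDiffOn_rhs (hΩ : IsOpen Ω) (hφ : ContDiffOn ℝ ∞ φ Ω) (hψ : ContDiffOn ℝ ∞ ψ Ω)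
    (hη : ContDiffOn ℝ ∞ η Ω) (hη0 : ∀ z ∈ Ω, η z ≠ 0) (a : GTVar N) (j : Fin N) :
    ContDiffOn ℝ ∞ (rhs φ ψ η a j) (dom Ω) := by
  have hmaps : Set.MapsTo (fun z : (Fin N → ℝ) × (GTVar N → ℝ) => ![z.2 u, z.2 w]) (dom Ω) Ω :=
    fun z hz => hz.1
  have hc : ∀ b, ContDiffOn ℝ ∞ (fun z : (Fin N → ℝ) × (GTVar N → ℝ) => z.2 b) (dom Ω) :=
    fun b => (contDiff_coord b).contDiffOn
  have hj : ∀ k, ContDiffOn ℝ ∞ (fun z : (Fin N → ℝ) × (GTVar N → ℝ) =>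
      jet1 φ ψ η ![z.2 u, z.2 w] k) (dom Ω) := fun k =>
    (contDiffOn_jet1 hΩ hφ hψ hη k).comp contDiff_field.contDiffOn hmaps
  have hη' : ContDiffOn ℝ ∞ (fun z : (Fin N → ℝ) × (GTVar N → ℝ) => η ![z.2 u, z.2 w]) (dom Ω) :=
    hη.comp contDiff_field.contDiffOn hmaps
  have hQ : ∀ i j, ContDiffOn ℝ ∞ (fun z : (Fin N → ℝ) × (GTVar N → ℝ) =>
      gtQ (jet1 φ ψ η ![z.2 u, z.2 w]) (z.2 (mu i)) (z.2 (mu j))) (dom Ω) := fun i j =>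
    (((hj 0).add ((hj 1).mul (hc _))).add ((hc _).mul ((hj 2).add ((hj 3).mul (hc _))))).add
      (((hc _).pow 2).mul ((hj 4).add ((hj 5).mul (hc _))))
  match a with
  | .inl 0 => exact hc _
  | .inl 1 => exact (hc _).mul (hc _)
  | .inr (.inl i) =>
    -- For `i = j` the denominator is zero, and division by zero makes the right hand side the zero
    -- function. This direction is not prescribed, but smoothness is required of all right hand
    -- sides.
    by_cases hij : i = j
    · subst hij
      have : rhs (N := N) φ ψ η (.inr (.inl i)) i = fun _ => 0 := by
        ext z; simp [rhs, gtA]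
      rw [this]; exact contDiffOn_const
    · refine ((hQ i j).div (hη'.mul ((hc _).sub (hc _))) fun z hz => ?_).mul (hc _)
      exact mul_ne_zero (hη0 _ hz.1) (sub_ne_zero.2 (hz.2 j i (Ne.symm hij)))
  | .inr (.inr i) =>
    by_cases hij : i = j
    · subst hij
      have : rhs (N := N) φ ψ η (.inr (.inr i)) i = fun _ => 0 := by
        ext z; simp [rhs, gtB]
      rw [this]; exact contDiffOn_const
    · refine ((((hQ i j).add (hQ j i)).div (hη'.mul (((hc _).sub (hc _)).pow 2))
        fun z hz => ?_).mul (hc _)).mul (hc _)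
      exact mul_ne_zero (hη0 _ hz.1) (pow_ne_zero 2 (sub_ne_zero.2 (hz.2 i j hij)))

lemma gtB_comm (h : ℝ) (p : Fin 6 → ℝ) (x y : ℝ) : gtB h p x y = gtB h p y x := by
  rw [gtB, gtB, add_comm, ← neg_sub y x, neg_sq]

/-- The compatibility condition of the equations `∂ⱼw = μʲ vⱼ`. -/
lemma gtA_add_mul_gtB {h : ℝ} (hh : h ≠ 0) (p : Fin 6 → ℝ) {x y : ℝ} (hxy : x ≠ y) :
    gtA h p x y + x * gtB h p x y = gtA h p y x + y * gtB h p y x := by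
  have h1 : x - y ≠ 0 := sub_ne_zero.2 hxy
  rw [gtA, gtA, gtB, gtB, ← neg_sub x y]
  field_simp
  ring

/-- The right hand side in direction `j` contains `μʲ` and `vⱼ`, whose derivatives are prescribed in
every direction `k ≠ j`, so the undetermined components of `ξ` and `ζ` never enter. The four kinds
of unknowns are settled by `gtB_comm`, `gtA_add_mul_gtB`, `JetInt.gtA_compat` and
`JetInt.gtB_compat`. -/
lemma rhs_compat (hΩ : IsOpen Ω) (hφ : ContDiffOn ℝ ∞ φ Ω) (hψ : ContDiffOn ℝ ∞ ψ Ω)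
    (hη : ContDiffOn ℝ ∞ η Ω) (hη0 : ∀ z ∈ Ω, η z ≠ 0) (H : NonsymInt Ω φ ψ η) :
    ∀ z ∈ dom (N := N) Ω, ∀ a, ∀ j ∈ dirs a, ∀ k ∈ dirs a, j ≠ k → ∀ ξ ζ : GTVar N → ℝ,
      (∀ b, k ∈ dirs b → ξ b = rhs φ ψ η b k z) → (∀ b, j ∈ dirs b → ζ b = rhs φ ψ η b j z) →
      fderiv ℝ (rhs φ ψ η a j) z (Pi.single k 1, ξ)
        = fderiv ℝ (rhs φ ψ η a k) z (Pi.single j 1, ζ) := by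
  intro z hz
  have hline : ∀ a j (d : (Fin N → ℝ) × (GTVar N → ℝ)) (c : ℝ),
      HasDerivAt (fun t : ℝ => rhs φ ψ η a j (z + t • d)) c 0 →
      fderiv ℝ (rhs φ ψ η a j) z d = c := by
    intro a j d c hc
    have h1 : DifferentiableAt ℝ (rhs φ ψ η a j) z :=
      ((contDiffOn_rhs hΩ hφ hψ hη hη0 a j).contDiffAt
        ((isOpen_dom hΩ).mem_nhds hz)).differentiableAt (by simp)
    exact (h1.hasFDerivAt.hasLineDerivAt d).unique hc
  have hco : ∀ (e : Fin N → ℝ) (ξ : GTVar N → ℝ) (b : GTVar N),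
      HasDerivAt (fun t : ℝ => (z + t • (e, ξ)).2 b) (ξ b) 0 := by
    intro e ξ b
    have := ((hasDerivAt_id (0 : ℝ)).mul_const (ξ b)).const_add (z.2 b)
    rw [one_mul] at this
    exact this
  have hzero : ∀ (d : (Fin N → ℝ) × (GTVar N → ℝ)), z + (0 : ℝ) • d = z := by simp
  set h := η ![z.2 u, z.2 w] with hh
  set p := jet1 φ ψ η ![z.2 u, z.2 w] with hp
  set s := jet2 φ ψ η ![z.2 u, z.2 w] with hs
  have hJ : JetInt h p s := nonsymInt_iff_jetInt.1 H _ hz.1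
  have hh0 : h ≠ 0 := hη0 _ hz.1
  -- the derivative in a direction with prescribed derivatives
  have hd : ∀ a j k, j ∈ dirs a → k ∈ dirs a → j ≠ k → ∀ ξ : GTVar N → ℝ,
      (∀ b, k ∈ dirs b → ξ b = rhs φ ψ η b k z) →
      fderiv ℝ (rhs φ ψ η a j) z (Pi.single k 1, ξ) = (match a with
        | .inl 0 => gtB h p (z.2 (mu j)) (z.2 (mu k)) * z.2 (v j) * z.2 (v k)
        | .inl 1 => (gtA h p (z.2 (mu j)) (z.2 (mu k)) + z.2 (mu j) *
            gtB h p (z.2 (mu j)) (z.2 (mu k))) * z.2 (v j) * z.2 (v k)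
        | .inr (.inl i) => (gtDA h p s (z.2 (mu i)) (z.2 (mu j)) (z.2 (mu k))
            + gtA h p (z.2 (mu i)) (z.2 (mu j)) * gtB h p (z.2 (mu j)) (z.2 (mu k)))
            * z.2 (v j) * z.2 (v k)
        | .inr (.inr i) => (gtDB h p s (z.2 (mu i)) (z.2 (mu j)) (z.2 (mu k))
            + gtB h p (z.2 (mu i)) (z.2 (mu j)) * (gtB h p (z.2 (mu i)) (z.2 (mu k))
              + gtB h p (z.2 (mu j)) (z.2 (mu k)))) * z.2 (v i) * z.2 (v j) * z.2 (v k)) := by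
    intro a j k hj hk hjk ξ hξ
    have hu : HasDerivAt (fun t : ℝ => (z + t • ((Pi.single k 1, ξ) :
        (Fin N → ℝ) × (GTVar N → ℝ))).2 u) (z.2 (v k)) 0 := by
      have := hco (Pi.single k 1) ξ u
      rwa [hξ u (by simp [dirs])] at this
    have hw : HasDerivAt (fun t : ℝ => (z + t • ((Pi.single k 1, ξ) :
        (Fin N → ℝ) × (GTVar N → ℝ))).2 w) (z.2 (mu k) * z.2 (v k)) 0 := by
      have := hco (Pi.single k 1) ξ w
      rwa [hξ w (by simp [dirs])] at this
    have hm : ∀ i, k ≠ i → HasDerivAt (fun t : ℝ => (z + t • ((Pi.single k 1, ξ) :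
        (Fin N → ℝ) × (GTVar N → ℝ))).2 (mu i))
        (gtA h p (z.2 (mu i)) (z.2 (mu k)) * z.2 (v k)) 0 := by
      intro i hi
      have := hco (Pi.single k 1) ξ (mu i)
      rwa [hξ (mu i) (by simp [dirs, hi])] at this
    have hv : ∀ i, k ≠ i → HasDerivAt (fun t : ℝ => (z + t • ((Pi.single k 1, ξ) :
        (Fin N → ℝ) × (GTVar N → ℝ))).2 (v i))
        (gtB h p (z.2 (mu i)) (z.2 (mu k)) * z.2 (v i) * z.2 (v k)) 0 := by
      intro i hi
      have := hco (Pi.single k 1) ξ (v i)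
      rwa [hξ (v i) (by simp [dirs, hi])] at this
    apply hline
    match a, hj, hk with
    | .inl 0, _, _ => exact hv j hjk.symm
    | .inl 1, _, _ =>
      refine ((hm j hjk.symm).mul (hv j hjk.symm)).congr_deriv ?_
      simp only [hzero]
      ring
    | .inr (.inl i), hj, hk =>
      have hji : j ≠ i := by simpa [dirs] using hj
      have hki : k ≠ i := by simpa [dirs] using hk
      have h1 := hasDerivAt_gtA (x := fun t : ℝ => (z + t • ((Pi.single k 1, ξ) :
        (Fin N → ℝ) × (GTVar N → ℝ))).2 (mu i)) (y := fun t : ℝ => (z + t • ((Pi.single k 1, ξ) :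
        (Fin N → ℝ) × (GTVar N → ℝ))).2 (mu j)) hΩ hφ hψ hη hη0 (by rw [hzero]; exact hz.1) hu hw
        (by rw [hzero]; exact hm i hki) (by rw [hzero]; exact hm j hjk.symm)
        (by rw [hzero]; exact hz.2 i j hji.symm)
      refine (h1.mul (hv j hjk.symm)).congr_deriv ?_
      simp only [hzero, ← hh, ← hp, ← hs]
      ring
    | .inr (.inr i), hj, hk =>
      have hji : j ≠ i := by simpa [dirs] using hj
      have hki : k ≠ i := by simpa [dirs] using hk
      have h1 := hasDerivAt_gtB (x := fun t : ℝ => (z + t • ((Pi.single k 1, ξ) :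
        (Fin N → ℝ) × (GTVar N → ℝ))).2 (mu i)) (y := fun t : ℝ => (z + t • ((Pi.single k 1, ξ) :
        (Fin N → ℝ) × (GTVar N → ℝ))).2 (mu j)) hΩ hφ hψ hη hη0 (by rw [hzero]; exact hz.1) hu hw
        (by rw [hzero]; exact hm i hki) (by rw [hzero]; exact hm j hjk.symm)
        (by rw [hzero]; exact hz.2 i j hji.symm)
      refine ((h1.mul (hv i hki)).mul (hv j hjk.symm)).congr_deriv ?_
      simp only [hzero, Pi.mul_apply, ← hh, ← hp, ← hs]
      ring
  intro a j hj k hk hjk ξ ζ hξ hζ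
  rw [hd a j k hj hk hjk ξ hξ, hd a k j hk hj hjk.symm ζ hζ]
  match a, hj, hk with
  | .inl 0, _, _ =>
    simp only
    rw [gtB_comm]; ring
  | .inl 1, _, _ =>
    simp only
    rw [gtA_add_mul_gtB hh0 p (hz.2 j k hjk)]; ring
  | .inr (.inl i), hj, hk =>
    have hji : j ≠ i := by simpa [dirs] using hj
    have hki : k ≠ i := by simpa [dirs] using hk
    simp only
    rw [hJ.gtA_compat hh0 (hz.2 i j hji.symm) (hz.2 i k hki.symm) (hz.2 j k hjk)]; ring
  | .inr (.inr i), hj, hk =>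
    have hji : j ≠ i := by simpa [dirs] using hj
    have hki : k ≠ i := by simpa [dirs] using hk
    simp only
    rw [hJ.gtB_compat hh0 (hz.2 i j hji.symm) (hz.2 i k hki.symm) (hz.2 j k hjk)]; ring

end GTVar

lemma _root_.AnalyticAt.exists_contDiffOn_ball {f : ℝ → ℝ} (hf : AnalyticAt ℝ f 0) :
    ∃ ρ > 0, ContDiffOn ℝ ∞ f (Metric.ball 0 ρ) := by
  obtain ⟨ρ, hρ, h⟩ := Metric.eventually_nhds_iff_ball.1 hf.eventually_analyticAt
  exact ⟨ρ, hρ, fun x hx => (h x hx).contDiffAt.contDiffWithinAt⟩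

lemma exists_contDiffOn_ball_of_analyticAt {N : ℕ} {m : Fin N → ℝ → ℝ}
    (hm : ∀ i, AnalyticAt ℝ (m i) 0) :
    ∃ ρ > 0, ∀ i, ContDiffOn ℝ ∞ (m i) (Metric.ball 0 ρ) := by
  have h : ∀ᶠ x in 𝓝 (0 : ℝ), ∀ i, AnalyticAt ℝ (m i) x :=
    Filter.eventually_all.2 fun i => (hm i).eventually_analyticAt
  obtain ⟨ρ, hρ, h⟩ := Metric.eventually_nhds_iff_ball.1 h
  exact ⟨ρ, hρ, fun i x hx => (h x hx i).contDiffAt.contDiffWithinAt⟩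

/-- Existence of hydrodynamic reductions with prescribed characteristic speeds on the axes. -/
theorem exists_reduction {N : ℕ} {Ω : Set (Fin 2 → ℝ)} {φ ψ η : (Fin 2 → ℝ) → ℝ} (hΩ : IsOpen Ω)
    (hφ : ContDiffOn ℝ ∞ φ Ω) (hψ : ContDiffOn ℝ ∞ ψ Ω) (hη : ContDiffOn ℝ ∞ η Ω)
    (hη0 : ∀ z ∈ Ω, η z ≠ 0) (H : NonsymInt Ω φ ψ η) {u₀ w₀ : ℝ} (h0 : ![u₀, w₀] ∈ Ω)
    {m : Fin N → ℝ → ℝ} {ρ : ℝ} (hρ : 0 < ρ) (hm : ∀ i, ContDiffOn ℝ ∞ (m i) (Metric.ball 0 ρ))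
    (hinj : Function.Injective (fun i => m i 0)) :
    ∃ δ > 0, ∃ (U W : (Fin N → ℝ) → ℝ) (μ lam : Fin N → (Fin N → ℝ) → ℝ),
      IsReduction Ω φ ψ η (Metric.ball 0 δ) U W μ lam ∧ U 0 = u₀ ∧ W 0 = w₀ ∧
      (∀ i, ∀ᶠ s in 𝓝 (0 : ℝ), U (Pi.single i s) = u₀ + s ∧ μ i (Pi.single i s) = m i s) ∧
      (∀ R ∈ Metric.ball (0 : Fin N → ℝ) δ, ∀ i j, i ≠ j → μ i R ≠ μ j R) ∧
      ∀ R i, lam i R = φ ![U R, W R] + ψ ![U R, W R] * μ i R + η ![U R, W R] * μ i R ^ 2 := by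
  -- The values of `u` and `w` are given at the origin, those of `μⁱ` and `vᵢ` on the `i`-th axis.
  -- Taking `vᵢ = 1` there encodes the normalisation of the phases.
  obtain ⟨δ, hδ, X, hX, hXW, hX0, hXe⟩ := exists_darboux_solution (N := N) (ι := GTVar N)
    GTVar.dirs GTVar.proj
    (by
      intro a
      match a with
      | .inl _ => simp [GTVar.proj]
      | .inr (.inl i) => exact norm_axisProj_le i
      | .inr (.inr i) => exact norm_axisProj_le i)
    (by
      intro a j hj
      match a, hj with
      | .inl _, _ => simp [GTVar.proj]
      | .inr (.inl i), hj =>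
        have hji : j ≠ i := by simpa [GTVar.dirs] using hj
        simp [GTVar.proj, axisProj_apply, Ne.symm hji]
      | .inr (.inr i), hj =>
        have hji : j ≠ i := by simpa [GTVar.dirs] using hj
        simp [GTVar.proj, axisProj_apply, Ne.symm hji])
    (by
      intro a s j hj
      match a, hj with
      | .inl _, hj => simp [GTVar.dirs] at hj
      | .inr (.inl i), hj =>
        have hji : j = i := by simpa [GTVar.dirs] using hj
        subst hji; simp [GTVar.proj, axisProj_apply]
      | .inr (.inr i), hj =>
        have hji : j = i := by simpa [GTVar.dirs] using hj
        subst hji; simp [GTVar.proj, axisProj_apply])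
    (GTVar.data u₀ w₀ m) (GTVar.rhs φ ψ η) (Metric.ball_mem_nhds 0 hρ)
    (by
      intro a
      match a with
      | .inl _ => exact contDiffOn_const
      | .inr (.inl i) =>
        refine (hm i).comp (contDiff_apply ℝ ℝ i).contDiffOn fun s hs => ?_
        rw [mem_ball_zero_iff] at hs ⊢
        exact (norm_le_pi_norm s i).trans_lt hs
      | .inr (.inr _) => exact contDiffOn_const)
    (GTVar.isOpen_dom hΩ)
    ⟨h0, fun i j hij h => hij (hinj h)⟩
    (GTVar.contDiffOn_rhs hΩ hφ hψ hη hη0) (GTVar.rhs_compat hΩ hφ hψ hη hη0 H)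
  have hV : IsOpen (Metric.ball (0 : Fin N → ℝ) δ) := Metric.isOpen_ball
  have h0V : (0 : Fin N → ℝ) ∈ Metric.ball (0 : Fin N → ℝ) δ := Metric.mem_ball_self hδ
  have hXs : ∀ b, ContDiffOn ℝ ∞ (fun R => X R b) (Metric.ball 0 δ) := contDiffOn_pi.1 hX
  have hU : ∀ R ∈ Metric.ball (0 : Fin N → ℝ) δ, ∀ j,
      pd j (fun R => X R GTVar.u) R = X R (GTVar.v j) := fun R hR j =>
    hXe R hR GTVar.u j (by simp [GTVar.dirs])
  have hW : ∀ R ∈ Metric.ball (0 : Fin N → ℝ) δ, ∀ j,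
      pd j (fun R => X R GTVar.w) R = X R (GTVar.mu j) * X R (GTVar.v j) := fun R hR j =>
    hXe R hR GTVar.w j (by simp [GTVar.dirs])
  let ζ : (Fin N → ℝ) → Fin 2 → ℝ := fun R => ![X R GTVar.u, X R GTVar.w]
  have hζ : ContDiffOn ℝ ∞ ζ (Metric.ball 0 δ) := by
    refine contDiffOn_pi.2 fun i => ?_
    fin_cases i
    · exact hXs GTVar.u
    · exact hXs GTVar.w
  have hζΩ : Set.MapsTo ζ (Metric.ball 0 δ) Ω := fun R hR => (hXW R hR).1
  have hmem0 : ∀ s ∈ Metric.ball (0 : ℝ) δ, ∀ i, (Pi.single i s : Fin N → ℝ) ∈ Metric.ball 0 δ := by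
    intro s hs i
    rw [mem_ball_zero_iff, Pi.norm_single]
    exact mem_ball_zero_iff.1 hs
  have hμax : ∀ i, ∀ s ∈ Metric.ball (0 : ℝ) δ, X (Pi.single i s) (GTVar.mu i) = m i s := by
    intro i s hs
    have := hX0 (Pi.single i s) (hmem0 s hs i) (GTVar.mu i)
    simpa [GTVar.proj, axisProj_apply, GTVar.data] using this
  have hvax : ∀ i, ∀ s ∈ Metric.ball (0 : ℝ) δ, X (Pi.single i s) (GTVar.v i) = 1 := by
    intro i s hs
    have := hX0 (Pi.single i s) (hmem0 s hs i) (GTVar.v i)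
    simpa [GTVar.proj, axisProj_apply, GTVar.data] using this
  have hU0 : X 0 GTVar.u = u₀ := by
    have := hX0 0 h0V GTVar.u
    simpa [GTVar.proj, GTVar.data] using this
  have hW0 : X 0 GTVar.w = w₀ := by
    have := hX0 0 h0V GTVar.w
    simpa [GTVar.proj, GTVar.data] using this
  refine ⟨δ, hδ, fun R => X R GTVar.u, fun R => X R GTVar.w, fun i R => X R (GTVar.mu i),
    fun i R => φ (ζ R) + ψ (ζ R) * X R (GTVar.mu i) + η (ζ R) * X R (GTVar.mu i) ^ 2,
    ?_, hU0, hW0, ?_, fun R hR => (hXW R hR).2, fun R i => rfl⟩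
  · refine ⟨hXs _, hXs _, fun i => hXs _, fun i => ?_, fun R hR => (hXW R hR).1, ?_, ?_, ?_⟩
    · exact ((hφ.comp hζ hζΩ).add ((hψ.comp hζ hζΩ).mul (hXs _))).add
        ((hη.comp hζ hζΩ).mul ((hXs _).pow 2))
    · intro R hR i j hij
      have hd : ∀ b, HasDerivAt (fun t : ℝ => X (R + t • Pi.single j 1) b)
          (pd j (fun R => X R b) R) 0 := fun b =>
        hasDerivAt_line (((hXs b).contDiffAt (hV.mem_nhds hR)).differentiableAt (by simp)) j
      have hu := hd GTVar.u
      have hw := hd GTVar.w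
      have hm := hd (GTVar.mu i)
      rw [hU R hR] at hu
      rw [hW R hR] at hw
      have hz : ![X (R + (0 : ℝ) • Pi.single j 1) GTVar.u,
          X (R + (0 : ℝ) • Pi.single j 1) GTVar.w] ∈ Ω := by
        simpa using (hXW R hR).1
      have h1 := ((hasDerivAt_comp_curve hΩ hφ hu hw hz).add
        ((hasDerivAt_comp_curve hΩ hψ hu hw hz).mul hm)).add
        ((hasDerivAt_comp_curve hΩ hη hu hw hz).mul (hm.pow 2))
      have hls : ContDiffOn ℝ ∞ (fun R => φ (ζ R) + ψ (ζ R) * X R (GTVar.mu i)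
          + η (ζ R) * X R (GTVar.mu i) ^ 2) (Metric.ball 0 δ) :=
        ((hφ.comp hζ hζΩ).add ((hψ.comp hζ hζΩ).mul (hXs _))).add
        ((hη.comp hζ hζΩ).mul ((hXs _).pow 2))
      have h3 := (hasDerivAt_line ((hls.contDiffAt (hV.mem_nhds hR)).differentiableAt
        (by simp)) j).unique h1
      have hμ := hXe R hR (GTVar.mu i) j (by simp [GTVar.dirs, Ne.symm hij])
      have hne : X R (GTVar.mu j) - X R (GTVar.mu i) ≠ 0 :=
        sub_ne_zero.2 ((hXW R hR).2 j i (Ne.symm hij))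
      have h0' := hη0 _ (hXW R hR).1
      simp only [GTVar.rhs, gtA] at hμ
      rw [div_mul_eq_mul_div, eq_div_iff (mul_ne_zero h0' hne)] at hμ
      rw [h3]
      simp only [Pi.pow_apply, zero_smul, add_zero, Nat.cast_ofNat, Nat.add_one_sub_one, pow_one]
      simp only [gtQ, jet1, Matrix.cons_val] at hμ
      simp only [ζ]
      linear_combination (X R (GTVar.mu j) - X R (GTVar.mu i)) * hμ
    · intro R hR i
      rw [hU R hR, hW R hR]
      simp only [ζ]
      ring
    · intro R hR i
      rw [hU R hR, hW R hR]
  · intro i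
    filter_upwards [Metric.ball_mem_nhds (0 : ℝ) hδ] with s hs
    refine ⟨?_, hμax i s hs⟩
    -- On the `i`-th axis `∂ᵢU = vᵢ = 1`, so `U - t` is constant along it.
    have hder : ∀ t ∈ Metric.ball (0 : ℝ) δ,
        HasDerivAt (fun t : ℝ => X (Pi.single i t) GTVar.u - t) 0 t := by
      intro t ht
      have h1 : HasDerivAt (fun t : ℝ => (Pi.single i t : Fin N → ℝ)) (Pi.single i 1) t :=
        (ContinuousLinearMap.single ℝ (fun _ : Fin N => ℝ) i).hasDerivAt
      have h2 := (((hXs GTVar.u).contDiffAt (hV.mem_nhds (hmem0 t ht i))).differentiableAt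
        (by simp)).hasFDerivAt.comp_hasDerivAt t h1
      have h3 : fderiv ℝ (fun R => X R GTVar.u) (Pi.single i t) (Pi.single i 1) = 1 := by
        have := hU _ (hmem0 t ht i) i
        rw [hvax i t ht] at this
        exact this
      rw [h3] at h2
      have h4 := h2.sub (hasDerivAt_id t)
      rw [sub_self] at h4
      exact h4
    have h5 := (convex_ball (0 : ℝ) δ).norm_image_sub_le_of_norm_hasDerivWithin_le (C := 0)
      (fun t ht => (hder t ht).hasDerivWithinAt) (by simp) (Metric.mem_ball_self hδ) hs
    rw [zero_mul, norm_le_zero_iff] at h5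
    simp only [Pi.single_zero, hU0, sub_zero] at h5
    linarith

/-! ### A smooth implicit function theorem -/

/-- The implicit function theorem, with smoothness on a neighbourhood. -/
lemma exists_contDiffOn_implicit {E F G : Type} [NormedAddCommGroup E] [NormedSpace ℝ E]
    [CompleteSpace E] [NormedAddCommGroup F] [NormedSpace ℝ F] [CompleteSpace F]
    [NormedAddCommGroup G] [NormedSpace ℝ G] [CompleteSpace G] {f : E × F → G} {U : Set (E × F)}
    (hU : IsOpen U) (hf : ContDiffOn ℝ ∞ f U) {x₀ : E} {y₀ : F} (h0 : (x₀, y₀) ∈ U)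
    (hf0 : f (x₀, y₀) = 0) (hinv : (fderiv ℝ f (x₀, y₀) ∘L .inr ℝ E F).IsInvertible) :
    ∃ (O : Set E) (g : E → F), IsOpen O ∧ x₀ ∈ O ∧ g x₀ = y₀ ∧ ContDiffOn ℝ ∞ g O ∧
      (∀ x ∈ O, (x, g x) ∈ U ∧ f (x, g x) = 0) ∧ ∀ᶠ v in 𝓝 (x₀, y₀), f v = 0 → g v.1 = v.2 := by
  have hne : (∞ : ℕ∞ω) ≠ 0 := by simp
  have cdf : ContDiffAt ℝ ∞ f (x₀, y₀) := hf.contDiffAt (hU.mem_nhds h0)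
  set g := cdf.implicitFunction hne hinv
  have hg0 : g x₀ = y₀ := cdf.implicitFunction_apply_self hne hinv
  have hgc : ContinuousAt g x₀ := (cdf.contDiffAt_implicitFunction hne hinv).continuousAt
  have hiff := cdf.eventually_apply_eq_iff_implicitFunction hne hinv
  rw [hf0] at hiff
  have hev := cdf.eventually_apply_implicitFunction hne hinv
  rw [hf0] at hev
  have hpair : Filter.Tendsto (fun x => (x, g x)) (𝓝 x₀) (𝓝 (x₀, y₀)) := by
    have := continuousAt_id.prodMk hgc
    rw [ContinuousAt, hg0] at this
    exact this
  have hopen : ∀ᶠ v in 𝓝 (x₀, y₀), (fderiv ℝ f v ∘L .inr ℝ E F).IsInvertible := by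
    have hc : ContinuousAt (fun v => fderiv ℝ f v ∘L .inr ℝ E F) (x₀, y₀) := by
      have := (hf.continuousOn_fderiv_of_isOpen hU (by simp)).continuousAt (hU.mem_nhds h0)
      exact this.clm_comp continuousAt_const
    obtain ⟨e, he⟩ := hinv
    refine hc.eventually (p := fun A => A.IsInvertible) ?_
    beta_reduce
    rw [← he]
    exact e.nhds
  have hall : ∀ᶠ x in 𝓝 x₀, (x, g x) ∈ U ∧ f (x, g x) = 0 ∧
      (fderiv ℝ f (x, g x) ∘L .inr ℝ E F).IsInvertible ∧
      ∀ᶠ v in 𝓝 (x, g x), f v = 0 ↔ g v.1 = v.2 :=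
    (hpair.eventually (hU.mem_nhds h0)).and (hev.and ((hpair.eventually hopen).and
      (hpair.eventually hiff.eventually_nhds)))
  obtain ⟨O, hOs, hO, hxO⟩ := mem_nhds_iff.1 hall
  refine ⟨O, g, hO, hxO, hg0, fun x hx => ?_, fun x hx => ⟨(hOs hx).1, (hOs hx).2.1⟩,
    hiff.mono fun v hv => hv.1⟩
  obtain ⟨h1, h2, h3, h4⟩ := hOs hx
  have cdf' : ContDiffAt ℝ ∞ f (x, g x) := hf.contDiffAt (hU.mem_nhds h1)
  -- Smoothness of `g` is known at `x₀` only. The implicit function `g'` built at the nearby point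
  -- `x` is smooth there, and by local uniqueness near `(x, g x)` it coincides with `g`.
  set g' := cdf'.implicitFunction hne h3
  have hg' : ContDiffAt ℝ ∞ g' x := cdf'.contDiffAt_implicitFunction hne h3
  have hg'0 : g' x = g x := cdf'.implicitFunction_apply_self hne h3
  refine (hg'.congr_of_eventuallyEq ?_).contDiffWithinAt
  have hpair' : Filter.Tendsto (fun y => (y, g' y)) (𝓝 x) (𝓝 (x, g x)) := by
    have := continuousAt_id.prodMk hg'.continuousAt
    rw [ContinuousAt, hg'0] at this
    exact this
  have hev' := cdf'.eventually_apply_implicitFunction hne h3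
  rw [h2] at hev'
  filter_upwards [hpair'.eventually h4, hev'] with y hy hy'
  exact hy.1 hy'

/-- Projection onto the diagonal, along the directions `j ≠ i`. -/
noncomputable def diagProj {N : ℕ} (i : Fin N) : (Fin N → ℝ) →L[ℝ] (Fin N → ℝ) :=
  ContinuousLinearMap.pi fun _ => ContinuousLinearMap.proj (R := ℝ) (φ := fun _ : Fin N => ℝ) i

lemma diagProj_apply {N : ℕ} (i : Fin N) (s : Fin N → ℝ) : diagProj i s = fun _ => s i := rfl

lemma norm_diagProj_le {N : ℕ} (i : Fin N) : ‖diagProj (N := N) i‖ ≤ 1 := by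
  refine ContinuousLinearMap.opNorm_le_bound _ zero_le_one fun s => ?_
  rw [diagProj_apply, one_mul]
  exact (pi_norm_le_iff_of_nonneg (norm_nonneg s)).2 fun _ => norm_le_pi_norm s i

/-! ### The generalized hodograph method -/

section Hodograph

variable {N : ℕ} {δ : ℝ} {M Λ : Fin N → (Fin N → ℝ) → ℝ} {a : Fin N → Fin N → (Fin N → ℝ) → ℝ}

lemma hasDerivAt_pd_of_linear (hM : ∀ i, ContDiffOn ℝ ∞ (M i) (Metric.ball 0 δ))
    (ha : ∀ i j, ContDiffOn ℝ ∞ (a i j) (Metric.ball 0 δ))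
    (hMa : ∀ s ∈ Metric.ball (0 : Fin N → ℝ) δ, ∀ i j, i ≠ j →
      pd j (M i) s = a i j s * (M j s - M i s))
    {s : Fin N → ℝ} (hs : s ∈ Metric.ball (0 : Fin N → ℝ) δ) {i j k : Fin N} (hij : i ≠ j)
    (hik : i ≠ k) (hjk : j ≠ k) :
    pd k (pd j (M i)) s = pd k (a i j) s * (M j s - M i s)
      + a i j s * (a j k s * (M k s - M j s) - a i k s * (M k s - M i s)) := by
  have hV : IsOpen (Metric.ball (0 : Fin N → ℝ) δ) := Metric.isOpen_ball
  have hl : ∀ {f : (Fin N → ℝ) → ℝ}, ContDiffOn ℝ ∞ f (Metric.ball 0 δ) →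
      HasDerivAt (fun t : ℝ => f (s + t • Pi.single k 1)) (pd k f s) 0 := fun hf =>
    hasDerivAt_line ((hf.contDiffAt (hV.mem_nhds hs)).differentiableAt (by simp)) k
  have h1 := (hl (ha i j)).mul ((hl (hM j)).sub (hl (hM i)))
  have h2 : HasDerivAt (fun t : ℝ => pd j (M i) (s + t • Pi.single k 1)) _ 0 :=
    h1.congr_of_eventuallyEq (by
      filter_upwards [(tendsto_line s k).eventually (hV.mem_nhds hs)] with t ht
      exact hMa _ ht i j hij)
  rw [(hl (contDiffOn_pd hV (hM i) j)).unique h2, hMa s hs j k hjk, hMa s hs i k hik]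
  simp

/-- Two independent commuting flows make the coefficients semi-Hamiltonian. -/
lemma semiHamiltonian (hM : ∀ i, ContDiffOn ℝ ∞ (M i) (Metric.ball 0 δ))
    (hΛ : ∀ i, ContDiffOn ℝ ∞ (Λ i) (Metric.ball 0 δ))
    (ha : ∀ i j, ContDiffOn ℝ ∞ (a i j) (Metric.ball 0 δ))
    (hMa : ∀ s ∈ Metric.ball (0 : Fin N → ℝ) δ, ∀ i j, i ≠ j →
      pd j (M i) s = a i j s * (M j s - M i s))
    (hΛa : ∀ s ∈ Metric.ball (0 : Fin N → ℝ) δ, ∀ i j, i ≠ j →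
      pd j (Λ i) s = a i j s * (Λ j s - Λ i s))
    {s : Fin N → ℝ} (hs : s ∈ Metric.ball (0 : Fin N → ℝ) δ) {i j k : Fin N} (hij : i ≠ j)
    (hik : i ≠ k) (hjk : j ≠ k)
    (hdet : (M j s - M i s) * (Λ k s - Λ i s) - (M k s - M i s) * (Λ j s - Λ i s) ≠ 0) :
    pd k (a i j) s = a i j s * a j k s + a i k s * a k j s - a i k s * a i j s := by
  have hV : IsOpen (Metric.ball (0 : Fin N → ℝ) δ) := Metric.isOpen_ball
  have h1 := pd_comm hV (hM i) k j hs
  rw [hasDerivAt_pd_of_linear hM ha hMa hs hij hik hjk,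
    hasDerivAt_pd_of_linear hM ha hMa hs hik hij hjk.symm] at h1
  have h2 := pd_comm hV (hΛ i) k j hs
  rw [hasDerivAt_pd_of_linear hΛ ha hΛa hs hij hik hjk,
    hasDerivAt_pd_of_linear hΛ ha hΛa hs hik hij hjk.symm] at h2
  -- The equality of mixed derivatives, for `M` and for `Λ`, is a homogeneous linear `2 × 2` system
  -- for the defects of `∂ₖaᵢⱼ` and `∂ⱼaᵢₖ`, with determinant `hdet`.
  refine sub_eq_zero.1 (mul_right_cancel₀ hdet ?_)
  rw [zero_mul]
  linear_combination (Λ k s - Λ i s) * h1 - (M k s - M i s) * h2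

/-- The generalized hodograph method: commuting diagonal systems have solutions with all phases
equal to `x` on the `x`-axis. -/
theorem exists_hodograph_solution (hδ : 0 < δ)
    (hM : ∀ i, ContDiffOn ℝ ∞ (M i) (Metric.ball 0 δ))
    (hΛ : ∀ i, ContDiffOn ℝ ∞ (Λ i) (Metric.ball 0 δ))
    (ha : ∀ i j, ContDiffOn ℝ ∞ (a i j) (Metric.ball 0 δ))
    (hMa : ∀ s ∈ Metric.ball (0 : Fin N → ℝ) δ, ∀ i j, i ≠ j →
      pd j (M i) s = a i j s * (M j s - M i s))
    (hΛa : ∀ s ∈ Metric.ball (0 : Fin N → ℝ) δ, ∀ i j, i ≠ j →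
      pd j (Λ i) s = a i j s * (Λ j s - Λ i s))
    (hdet : ∀ s ∈ Metric.ball (0 : Fin N → ℝ) δ, ∀ i j k, i ≠ j → i ≠ k → j ≠ k →
      (M j s - M i s) * (Λ k s - Λ i s) - (M k s - M i s) * (Λ j s - Λ i s) ≠ 0) :
    ∃ (O : Set (Fin 3 → ℝ)) (g : (Fin 3 → ℝ) → Fin N → ℝ), IsOpen O ∧ 0 ∈ O ∧
      ContDiffOn ℝ ∞ g O ∧ (∀ q ∈ O, g q ∈ Metric.ball (0 : Fin N → ℝ) δ) ∧
      (∀ q ∈ O, ∀ i, pd 1 (fun q => g q i) q = M i (g q) * pd 0 (fun q => g q i) q) ∧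
      (∀ q ∈ O, ∀ i, pd 2 (fun q => g q i) q = Λ i (g q) * pd 0 (fun q => g q i) q) ∧
      ∀ᶠ x in 𝓝 (0 : ℝ), g ![x, 0, 0] = fun _ => x := by
  have hBo : IsOpen (Metric.ball (0 : Fin N → ℝ) δ) := Metric.isOpen_ball
  have hpr1 : ∀ i, ContDiffOn ℝ ∞ (fun z : (Fin N → ℝ) × (Fin N → ℝ) => z.2 i)
      (Metric.ball 0 δ ×ˢ Set.univ) := fun i =>
    ((contDiff_apply ℝ ℝ i).comp contDiff_snd).contDiffOn
  have hF : ∀ i j, ContDiffOn ℝ ∞ (fun z : (Fin N → ℝ) × (Fin N → ℝ) =>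
      a i j z.1 * (z.2 j - z.2 i)) (Metric.ball 0 δ ×ˢ Set.univ) := fun i j =>
    ((ha i j).comp contDiffOn_fst fun z hz => hz.1).mul ((hpr1 j).sub (hpr1 i))
  -- `X` is a third solution of the linear system satisfied by `M` and `Λ`; semi-Hamiltonicity is
  -- exactly its compatibility. Prescribing `Xᵢ = sᵢ` on the diagonal makes `(x, ..., x)` the
  -- solution of the hodograph equations at `y = t = 0`.
  obtain ⟨ε, hε, X, hX, hXW, hX0, hXe⟩ := exists_darboux_solution (N := N) (ι := Fin N)
    (fun i => Finset.univ.erase i) diagProj norm_diagProj_le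
    (by
      intro i j hj
      have hji : j ≠ i := by simpa using hj
      ext; simp [diagProj_apply, Ne.symm hji])
    (by
      intro i s j hj
      have hji : j = i := by simpa using hj
      subst hji; simp [diagProj_apply])
    (fun i s => s i) (fun i j z => a i j z.1 * (z.2 j - z.2 i)) Filter.univ_mem
    (fun i => (contDiff_apply ℝ ℝ i).contDiffOn) (hBo.prod isOpen_univ)
    ⟨Metric.mem_ball_self hδ, Set.mem_univ _⟩ hF
    (by
      intro z hz i j hj k hk hjk ξ ζ hξ hζ
      have hji : j ≠ i := by simpa using hj
      have hki : k ≠ i := by simpa using hk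
      have hd : ∀ j k, j ≠ i → k ≠ i → j ≠ k → ∀ ξ : Fin N → ℝ,
          (∀ b, k ∈ Finset.univ.erase b → ξ b = a b k z.1 * (z.2 k - z.2 b)) →
          fderiv ℝ (fun z : (Fin N → ℝ) × (Fin N → ℝ) => a i j z.1 * (z.2 j - z.2 i)) z
            (Pi.single k 1, ξ) = pd k (a i j) z.1 * (z.2 j - z.2 i)
              + a i j z.1 * (a j k z.1 * (z.2 k - z.2 j) - a i k z.1 * (z.2 k - z.2 i)) := by
        intro j k hji hki hjk ξ hξ
        have h1 : DifferentiableAt ℝ (fun z : (Fin N → ℝ) × (Fin N → ℝ) =>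
            a i j z.1 * (z.2 j - z.2 i)) z :=
          ((hF i j).contDiffAt ((hBo.prod isOpen_univ).mem_nhds hz)).differentiableAt (by simp)
        have hco : ∀ b, HasDerivAt (fun t : ℝ => (z + t • ((Pi.single k 1, ξ) :
            (Fin N → ℝ) × (Fin N → ℝ))).2 b) (ξ b) 0 := by
          intro b
          have := ((hasDerivAt_id (0 : ℝ)).mul_const (ξ b)).const_add (z.2 b)
          rw [one_mul] at this
          exact this
        have h2 : HasDerivAt (fun t : ℝ => a i j (z.1 + t • Pi.single k 1))
            (pd k (a i j) z.1) 0 :=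
          hasDerivAt_line (((ha i j).contDiffAt (hBo.mem_nhds hz.1)).differentiableAt (by simp)) k
        have h3 := h2.mul ((hco j).sub (hco i))
        rw [(h1.hasFDerivAt.hasLineDerivAt (Pi.single k 1, ξ)).unique h3,
          hξ j (by simp [hjk.symm]), hξ i (by simp [hki])]
        simp
      rw [hd j k hji hki hjk ξ hξ, hd k j hki hji hjk.symm ζ hζ,
        semiHamiltonian hM hΛ ha hMa hΛa hz.1 hji.symm hki.symm hjk
          (hdet z.1 hz.1 i j k hji.symm hki.symm hjk),
        semiHamiltonian hM hΛ ha hMa hΛa hz.1 hki.symm hji.symm hjk.symm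
          (hdet z.1 hz.1 i k j hki.symm hji.symm hjk.symm)]
      ring)
  have hXs : ∀ i, ContDiffOn ℝ ∞ (fun s => X s i) (Metric.ball 0 ε) := contDiffOn_pi.1 hX
  have hsub : Metric.ball (0 : Fin N → ℝ) ε ⊆ Metric.ball 0 δ := fun s hs => (hXW s hs).1
  have h0B : (0 : Fin N → ℝ) ∈ Metric.ball (0 : Fin N → ℝ) ε := Metric.mem_ball_self hε
  have hXd : ∀ s ∈ Metric.ball (0 : Fin N → ℝ) ε, ∀ i j, i ≠ j →
      pd j (fun s => X s i) s = a i j s * (X s j - X s i) := fun s hs i j hij =>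
    hXe s hs i j (by simp [hij.symm])
  have hdiag : ∀ x ∈ Metric.ball (0 : ℝ) ε, (fun _ => x : Fin N → ℝ) ∈ Metric.ball 0 ε ∧
      X (fun _ => x) = fun _ => x := by
    intro x hx
    have hm : (fun _ => x : Fin N → ℝ) ∈ Metric.ball (0 : Fin N → ℝ) ε := by
      rw [mem_ball_zero_iff] at hx ⊢
      exact (pi_norm_const_le x).trans_lt hx
    refine ⟨hm, ?_⟩
    ext i
    have := hX0 _ hm i
    simpa [diagProj_apply] using this
  have hX00 : X 0 = 0 := (hdiag 0 (Metric.mem_ball_self hε)).2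
  -- the Jacobian of `X` at the origin
  have hJac : fderiv ℝ X 0 = .id ℝ _ := by
    have hXd0 : HasFDerivAt X (fderiv ℝ X 0) 0 :=
      ((hX.contDiffAt (Metric.isOpen_ball.mem_nhds h0B)).differentiableAt (by simp)).hasFDerivAt
    have hpd : ∀ i j, fderiv ℝ X 0 (Pi.single j 1) i = pd j (fun s => X s i) 0 := fun i j =>
      (congrArg (fun T : (Fin N → ℝ) →L[ℝ] ℝ => T (Pi.single j 1))
        (hasFDerivAt_pi'.1 hXd0 i).fderiv).symm
    -- The off-diagonal entries are `aᵢⱼ (Xⱼ - Xᵢ)` and vanish because `X 0 = 0`. The derivative of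
    -- `X` along the diagonal makes each row sum equal to `1`, which gives the diagonal entries.
    have hoff : ∀ i j, i ≠ j → fderiv ℝ X 0 (Pi.single j 1) i = 0 := by
      intro i j hij
      rw [hpd, hXd 0 h0B i j hij, hX00]; simp
    have hone : ∀ i, fderiv ℝ X 0 (fun _ => 1) i = 1 := by
      intro i
      have h1 : HasDerivAt (fun x : ℝ => (fun _ => x : Fin N → ℝ)) (fun _ => 1) 0 :=
        hasDerivAt_pi.2 fun _ => hasDerivAt_id 0
      have h2 : HasFDerivAt X (fderiv ℝ X 0) ((fun x : ℝ => (fun _ => x : Fin N → ℝ)) 0) := hXd0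
      have h3 := h2.comp_hasDerivAt 0 h1
      have h4 : HasDerivAt (X ∘ fun x : ℝ => (fun _ => x : Fin N → ℝ)) (fun _ => 1) 0 := by
        refine h1.congr_of_eventuallyEq ?_
        filter_upwards [Metric.ball_mem_nhds (0 : ℝ) hε] with x hx
        exact (hdiag x hx).2
      exact congrFun (h3.unique h4) i
    refine ContinuousLinearMap.ext fun v => ?_
    ext i
    have hii : fderiv ℝ X 0 (Pi.single i 1) i = 1 := by
      have h1 := hone i
      have h2 : (fun _ => 1 : Fin N → ℝ) = ∑ j, Pi.single j (1 : ℝ) :=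
        (Finset.univ_sum_single _).symm
      rw [h2, map_sum, Finset.sum_apply,
        Finset.sum_eq_single i (fun j _ hj => hoff i j hj.symm) (by simp)] at h1
      exact h1
    have h3 : v = ∑ j, v j • (Pi.single j (1 : ℝ) : Fin N → ℝ) := by
      ext k; simp [Finset.sum_apply, Pi.single_apply]
    rw [h3, map_sum, Finset.sum_apply, Finset.sum_eq_single i, map_smul, ← h3]
    · simp [hii]
    · intro j _ hj
      rw [map_smul, Pi.smul_apply, hoff i j hj.symm, smul_zero]
    · simp
  -- the hodograph equations
  let f : (Fin 3 → ℝ) × (Fin N → ℝ) → Fin N → ℝ := fun z i =>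
    z.1 0 + M i z.2 * z.1 1 + Λ i z.2 * z.1 2 - X z.2 i
  have hUo : IsOpen ((Set.univ : Set (Fin 3 → ℝ)) ×ˢ Metric.ball (0 : Fin N → ℝ) ε) :=
    isOpen_univ.prod Metric.isOpen_ball
  have hq : ∀ c, ContDiffOn ℝ ∞ (fun z : (Fin 3 → ℝ) × (Fin N → ℝ) => z.1 c)
      (Set.univ ×ˢ Metric.ball 0 ε) := fun c =>
    ((contDiff_apply ℝ ℝ c).comp contDiff_fst).contDiffOn
  have hfi : ∀ i, ContDiffOn ℝ ∞ (fun z => f z i) (Set.univ ×ˢ Metric.ball 0 ε) := fun i =>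
    (((hq 0).add ((((hM i).mono hsub).comp contDiffOn_snd fun z hz => hz.2).mul (hq 1))).add
      ((((hΛ i).mono hsub).comp contDiffOn_snd fun z hz => hz.2).mul (hq 2))).sub
      ((hXs i).comp contDiffOn_snd fun z hz => hz.2)
  have hf : ContDiffOn ℝ ∞ f (Set.univ ×ˢ Metric.ball 0 ε) := contDiffOn_pi.2 hfi
  have h0U : ((0 : Fin 3 → ℝ), (0 : Fin N → ℝ)) ∈
      (Set.univ : Set (Fin 3 → ℝ)) ×ˢ Metric.ball (0 : Fin N → ℝ) ε := ⟨Set.mem_univ _, h0B⟩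
  have hf0 : f (0, 0) = 0 := by ext i; simp [f, hX00]
  have hinv : (fderiv ℝ f (0, 0) ∘L .inr ℝ (Fin 3 → ℝ) (Fin N → ℝ)).IsInvertible := by
    have h1 : HasFDerivAt f (fderiv ℝ f (0, 0)) (0, 0) :=
      ((hf.contDiffAt (hUo.mem_nhds h0U)).differentiableAt (by simp)).hasFDerivAt
    have h2 : HasFDerivAt (fun s : Fin N → ℝ => ((0 : Fin 3 → ℝ), s))
        (ContinuousLinearMap.inr ℝ (Fin 3 → ℝ) (Fin N → ℝ)) 0 :=
      (ContinuousLinearMap.inr ℝ (Fin 3 → ℝ) (Fin N → ℝ)).hasFDerivAt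
    have h3 := HasFDerivAt.comp (0 : Fin N → ℝ) h1 h2
    have h4 : HasFDerivAt (f ∘ fun s : Fin N → ℝ => ((0 : Fin 3 → ℝ), s))
        (-(ContinuousLinearMap.id ℝ (Fin N → ℝ))) 0 := by
      have h5 : HasFDerivAt X (ContinuousLinearMap.id ℝ (Fin N → ℝ)) 0 := by
        rw [← hJac]
        exact ((hX.contDiffAt (Metric.isOpen_ball.mem_nhds h0B)).differentiableAt
          (by simp)).hasFDerivAt
      have h6 : (f ∘ fun s : Fin N → ℝ => ((0 : Fin 3 → ℝ), s)) = fun s => -X s := by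
        ext s i; simp [f]
      rw [h6]; exact h5.neg
    rw [h3.unique h4]
    exact ⟨ContinuousLinearEquiv.neg ℝ, rfl⟩
  obtain ⟨O, g, hO, h0O, hg0, hg, hgU, hguniq⟩ :=
    exists_contDiffOn_implicit hUo hf h0U hf0 hinv
  -- differentiation of the hodograph equations
  have hdiff : ∀ q ∈ O, ∀ i, ∃ K : ℝ, ∀ c, (![1, M i (g q), Λ i (g q)] : Fin 3 → ℝ) c
      + K * pd c (fun q => g q i) q = 0 := by
    intro q hqO i
    have hgb : g q ∈ Metric.ball (0 : Fin N → ℝ) ε := (hgU q hqO).1.2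
    -- `K` is the `i`-th diagonal entry of the Jacobian of the hodograph equations with respect to
    -- the phases.
    refine ⟨pd i (M i) (g q) * q 1 + pd i (Λ i) (g q) * q 2 - pd i (fun s => X s i) (g q),
      fun c => ?_⟩
    have hgd : ∀ j, HasDerivAt (fun t : ℝ => g (q + t • Pi.single c 1) j)
        (pd c (fun q => g q j) q) 0 := fun j =>
      hasDerivAt_line (((contDiffOn_pi.1 hg j).contDiffAt (hO.mem_nhds hqO)).differentiableAt
        (by simp)) c
    have hgd' : HasDerivAt (fun t : ℝ => g (q + t • Pi.single c 1))
        (fun j => pd c (fun q => g q j) q) 0 := hasDerivAt_pi.2 hgd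
    have hcomp : ∀ {h : (Fin N → ℝ) → ℝ}, ContDiffOn ℝ ∞ h (Metric.ball 0 ε) →
        HasDerivAt (fun t : ℝ => h (g (q + t • Pi.single c 1)))
          (∑ j, pd c (fun q => g q j) q * pd j h (g q)) 0 := by
      intro h hh
      have h1 : HasFDerivAt h (fderiv ℝ h (g q)) (g (q + (0 : ℝ) • Pi.single c 1)) := by
        rw [zero_smul, add_zero]
        exact ((hh.contDiffAt (Metric.isOpen_ball.mem_nhds hgb)).differentiableAt
          (by simp)).hasFDerivAt
      have h2 := h1.comp_hasDerivAt (0 : ℝ) hgd'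
      rwa [hasFDerivAt_eq_sum_pd] at h2
    have hqd : ∀ e : Fin 3, HasDerivAt (fun t : ℝ => (q + t • (Pi.single c 1 : Fin 3 → ℝ)) e)
        ((Pi.single c 1 : Fin 3 → ℝ) e) 0 := by
      intro e
      have := ((hasDerivAt_id (0 : ℝ)).mul_const ((Pi.single c 1 : Fin 3 → ℝ) e)).const_add (q e)
      rw [one_mul] at this
      exact this
    have h1 := (((hqd 0).add ((hcomp ((hM i).mono hsub)).mul (hqd 1))).add
      ((hcomp ((hΛ i).mono hsub)).mul (hqd 2))).sub (hcomp (hXs i))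
    have h2 : HasDerivAt (fun t : ℝ => f (q + t • Pi.single c 1, g (q + t • Pi.single c 1)) i)
        0 0 := by
      refine (hasDerivAt_const (0 : ℝ) (0 : ℝ)).congr_of_eventuallyEq ?_
      filter_upwards [(tendsto_line q c).eventually (hO.mem_nhds hqO)] with t ht
      rw [(hgU _ ht).2]; rfl
    have h3 := h1.unique h2
    simp only [zero_smul, add_zero] at h3
    -- The off-diagonal entries vanish on the solution: `M`, `Λ` and `X` share the coefficients
    -- `aᵢⱼ`, so the `j`-derivative of the `i`-th equation is `aᵢⱼ` times the difference of the
    -- `j`-th and the `i`-th equation.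
    have h4 : ∑ j, pd c (fun q => g q j) q * (pd j (M i) (g q) * q 1 + pd j (Λ i) (g q) * q 2
        - pd j (fun s => X s i) (g q)) = (pd i (M i) (g q) * q 1 + pd i (Λ i) (g q) * q 2
        - pd i (fun s => X s i) (g q)) * pd c (fun q => g q i) q := by
      rw [Finset.sum_eq_single i _ (by simp), mul_comm]
      intro j _ hj
      rw [hMa _ (hsub hgb) i j hj.symm, hΛa _ (hsub hgb) i j hj.symm, hXd _ hgb i j hj.symm]
      have h5 := congrFun (hgU q hqO).2 i
      have h6 := congrFun (hgU q hqO).2 j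
      simp only [f, Pi.zero_apply] at h5 h6
      linear_combination (pd c (fun q => g q j) q * a i j (g q)) * (h6 - h5)
    rw [← h4]
    simp only [mul_sub, mul_add, Finset.sum_sub_distrib, Finset.sum_add_distrib]
    have h7 : (![1, M i (g q), Λ i (g q)] : Fin 3 → ℝ) c = (Pi.single c 1 : Fin 3 → ℝ) 0
        + M i (g q) * (Pi.single c 1 : Fin 3 → ℝ) 1 + Λ i (g q) * (Pi.single c 1 : Fin 3 → ℝ) 2 := by
      fin_cases c <;> simp
    rw [h7, ← h3]
    simp only [← mul_assoc, ← Finset.sum_mul]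
    ring
  refine ⟨O, g, hO, h0O, hg, fun q hq => hsub (hgU q hq).1.2, fun q hqO i => ?_,
    fun q hqO i => ?_, ?_⟩
  · obtain ⟨K, hK⟩ := hdiff q hqO i
    have k0 := hK 0
    have k1 := hK 1
    simp only [Matrix.cons_val_zero, Matrix.cons_val_one] at k0 k1
    have hK0 : K ≠ 0 := by rintro rfl; simp at k0
    refine mul_left_cancel₀ hK0 ?_
    linear_combination k1 - M i (g q) * k0
  · obtain ⟨K, hK⟩ := hdiff q hqO i
    have k0 := hK 0
    have k1 := hK 2
    simp only [Matrix.cons_val_zero, Matrix.cons_val] at k0 k1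
    have hK0 : K ≠ 0 := by rintro rfl; simp at k0
    refine mul_left_cancel₀ hK0 ?_
    linear_combination k1 - Λ i (g q) * k0
  · have hc : Filter.Tendsto (fun x : ℝ => ((![x, 0, 0] : Fin 3 → ℝ), (fun _ => x : Fin N → ℝ)))
        (𝓝 0) (𝓝 ((0 : Fin 3 → ℝ), (0 : Fin N → ℝ))) := by
      have h1 : Continuous (fun x : ℝ => ((![x, 0, 0] : Fin 3 → ℝ), (fun _ => x : Fin N → ℝ))) := by
        refine Continuous.prodMk (continuous_pi fun i => ?_) (continuous_pi fun _ => continuous_id)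
        fin_cases i
        · exact continuous_id
        · exact continuous_const
        · exact continuous_const
      have h2 := h1.tendsto 0
      have h3 : (![(0 : ℝ), 0, 0] : Fin 3 → ℝ) = 0 := by ext i; fin_cases i <;> rfl
      simp only [h3] at h2
      exact h2
    filter_upwards [hc.eventually hguniq, Metric.ball_mem_nhds (0 : ℝ) hε] with x hx hxε
    refine hx ?_
    ext i
    simp [f, (hdiag x hxε).2]

end Hodograph

/-! ### Sufficiency of the integrability conditions -/

lemma pd_comp {n N : ℕ} {F : (Fin N → ℝ) → ℝ} {R : (Fin n → ℝ) → Fin N → ℝ} {q : Fin n → ℝ}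
    (hF : DifferentiableAt ℝ F (R q)) (hR : DifferentiableAt ℝ R q) (c : Fin n) :
    pd c (fun q => F (R q)) q = ∑ j, pd c (fun q => R q j) q * pd j F (R q) := by
  have h1 := (hF.hasFDerivAt.comp q hR.hasFDerivAt).fderiv
  have h2 : pd c (fun q => F (R q)) q = fderiv ℝ F (R q) (fderiv ℝ R q (Pi.single c 1)) :=
    congrArg (fun T : (Fin n → ℝ) →L[ℝ] ℝ => T (Pi.single c 1)) h1
  have h3 : ∀ j, fderiv ℝ R q (Pi.single c 1) j = pd c (fun q => R q j) q := fun j =>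
    (congrArg (fun T : (Fin n → ℝ) →L[ℝ] ℝ => T (Pi.single c 1))
      (hasFDerivAt_pi'.1 hR.hasFDerivAt j).fderiv).symm
  rw [h2, hasFDerivAt_eq_sum_pd]
  simp only [h3]

lemma pd_comp_coord {n : ℕ} {f : ℝ → ℝ} {s : Fin n → ℝ} {k : Fin n}
    (hf : DifferentiableAt ℝ f (s k)) (c : Fin n) :
    pd c (fun s => f (s k)) s = (Pi.single c 1 : Fin n → ℝ) k * deriv f (s k) := by
  have h1 : HasFDerivAt (fun s : Fin n → ℝ => s k)
      (ContinuousLinearMap.proj (R := ℝ) (φ := fun _ : Fin n => ℝ) k) s :=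
    (ContinuousLinearMap.proj (R := ℝ) (φ := fun _ : Fin n => ℝ) k).hasFDerivAt
  have h2 := (hf.hasDerivAt.comp_hasFDerivAt s h1).fderiv
  have h3 := congrArg (fun T : (Fin n → ℝ) →L[ℝ] ℝ => T (Pi.single c 1)) h2
  refine h3.trans ?_
  simp [mul_comm]

lemma pd_comp_diagonal {N : ℕ} {F : (Fin N → ℝ) → ℝ} {r : Fin N → ℝ → ℝ} {s : Fin N → ℝ}
    (hF : DifferentiableAt ℝ F (fun k => r k (s k))) (hr : ∀ k, DifferentiableAt ℝ (r k) (s k))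
    (j : Fin N) : pd j (fun s => F (fun k => r k (s k))) s
      = pd j F (fun k => r k (s k)) * deriv (r j) (s j) := by
  have hR : DifferentiableAt ℝ (fun s : Fin N → ℝ => fun k => r k (s k)) s :=
    differentiableAt_pi.2 fun k => (hr k).comp s (differentiableAt_apply k s)
  rw [pd_comp hF hR]
  simp only [fun k => pd_comp_coord (hr k) j]
  rw [Finset.sum_eq_single j]
  · simp [mul_comm]
  · intro k _ hk; simp [hk]
  · simp

/-- The integrability conditions are sufficient. -/
theorem NonsymInt.hydrodynamicallyIntegrable {Ω : Set (Fin 2 → ℝ)} {φ ψ η : (Fin 2 → ℝ) → ℝ}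
    (hΩ : IsOpen Ω) (hφ : ContDiffOn ℝ ∞ φ Ω) (hψ : ContDiffOn ℝ ∞ ψ Ω)
    (hη : ContDiffOn ℝ ∞ η Ω) (hη0 : ∀ z ∈ Ω, η z ≠ 0) (H : NonsymInt Ω φ ψ η) :
    HydrodynamicallyIntegrable Ω φ ψ η := by
  intro N u₀ w₀ h0 m r hm hr hinj hr0
  obtain ⟨ρ, hρ, hm⟩ := exists_contDiffOn_ball_of_analyticAt hm
  obtain ⟨ρ', hρ', hr⟩ := exists_contDiffOn_ball_of_analyticAt hr
  obtain ⟨δ, hδ, U, W, μ, lam, hred, hU0, hW0, hax, hne, hlam⟩ :=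
    exists_reduction hΩ hφ hψ hη hη0 H h0 hρ hm hinj
  have hB : IsOpen (Metric.ball (0 : Fin N → ℝ) δ) := Metric.isOpen_ball
  -- The phases are written as `Rᵏ = rₖ(sᵏ)`, and the hodograph method is applied to the speeds as
  -- functions of `s`, with initial profile `x` for every `sᵏ`. In this way the profiles `rₖ` need
  -- not be invertible.
  let ρf : (Fin N → ℝ) → Fin N → ℝ := fun s k => r k (s k)
  have hcoord : ∀ {ε}, ε ≤ ρ' → ∀ s ∈ Metric.ball (0 : Fin N → ℝ) ε, ∀ k,
      s k ∈ Metric.ball (0 : ℝ) ρ' := by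
    intro ε hε s hs k
    rw [mem_ball_zero_iff] at hs ⊢
    exact ((norm_le_pi_norm s k).trans_lt hs).trans_le hε
  have hρf : ∀ {ε}, ε ≤ ρ' → ContDiffOn ℝ ∞ ρf (Metric.ball 0 ε) := fun hε =>
    contDiffOn_pi.2 fun k => (hr k).comp (contDiff_apply ℝ ℝ k).contDiffOn
      fun s hs => hcoord hε s hs k
  have hρ0 : ρf 0 = 0 := funext hr0
  have hcont : ContinuousAt ρf 0 :=
    ((hρf le_rfl).contDiffAt (Metric.ball_mem_nhds 0 hρ')).continuousAt
  have hnear : ∀ᶠ s in 𝓝 (0 : Fin N → ℝ), ρf s ∈ Metric.ball (0 : Fin N → ℝ) δ := by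
    refine hcont.eventually_mem ?_
    rw [hρ0]; exact Metric.ball_mem_nhds 0 hδ
  obtain ⟨ε₁, hε₁, hε₁m⟩ := Metric.eventually_nhds_iff_ball.1 hnear
  obtain ⟨ε, hε, hεm, hερ⟩ : ∃ ε > 0, ε ≤ ε₁ ∧ ε ≤ ρ' :=
    ⟨min ε₁ ρ', lt_min hε₁ hρ', min_le_left _ _, min_le_right _ _⟩
  have hmaps : Set.MapsTo ρf (Metric.ball 0 ε) (Metric.ball 0 δ) := fun s hs =>
    hε₁m s (Metric.ball_subset_ball hεm hs)
  have hBε : IsOpen (Metric.ball (0 : Fin N → ℝ) ε) := Metric.isOpen_ball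
  have hcomp : ∀ {F : (Fin N → ℝ) → ℝ}, ContDiffOn ℝ ∞ F (Metric.ball 0 δ) →
      ContDiffOn ℝ ∞ (fun s => F (ρf s)) (Metric.ball 0 ε) := fun hF => hF.comp (hρf hερ) hmaps
  have hpd : ∀ {F : (Fin N → ℝ) → ℝ}, ContDiffOn ℝ ∞ F (Metric.ball 0 δ) →
      ∀ s ∈ Metric.ball (0 : Fin N → ℝ) ε, ∀ j,
      pd j (fun s => F (ρf s)) s = pd j F (ρf s) * deriv (r j) (s j) := fun hF s hs j =>
    pd_comp_diagonal ((hF.contDiffAt (hB.mem_nhds (hmaps hs))).differentiableAt (by simp))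
      (fun k => (((hr k).contDiffAt (Metric.isOpen_ball.mem_nhds
        (hcoord hερ s hs k))).differentiableAt (by simp))) j
  let a : Fin N → Fin N → (Fin N → ℝ) → ℝ := fun i j s =>
    pd j (fun s => μ i (ρf s)) s / (μ j (ρf s) - μ i (ρf s))
  have ha : ∀ i j, ContDiffOn ℝ ∞ (a i j) (Metric.ball 0 ε) := by
    intro i j
    rcases eq_or_ne i j with rfl | hij
    · refine (contDiffOn_const (c := (0 : ℝ))).congr fun s _ => ?_
      simp [a]
    · exact (contDiffOn_pd hBε (hcomp (hred.smooth_μ i)) j).div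
        ((hcomp (hred.smooth_μ j)).sub (hcomp (hred.smooth_μ i)))
        fun s hs => sub_ne_zero.2 (hne _ (hmaps hs) j i hij.symm)
  obtain ⟨O, g, hO, h0O, hg, hgB, hgy, hgt, hgx⟩ := exists_hodograph_solution
    (M := fun i s => μ i (ρf s)) (Λ := fun i s => lam i (ρf s)) (a := a) hε
    (fun i => hcomp (hred.smooth_μ i)) (fun i => hcomp (hred.smooth_lam i)) ha
    (fun s hs i j hij => (div_mul_cancel₀ _
      (sub_ne_zero.2 (hne _ (hmaps hs) j i hij.symm))).symm)
    (by
      intro s hs i j hij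
      have h1 := hred.consistent _ (hmaps hs) i j hij
      have h2 := sub_ne_zero.2 (hne _ (hmaps hs) j i hij.symm)
      simp only [a]
      rw [hpd (hred.smooth_μ i) s hs, hpd (hred.smooth_lam i) s hs, div_mul_eq_mul_div,
        eq_div_iff h2]
      linear_combination -(deriv (r j) (s j)) * h1)
    (by
      intro s hs i j k hij hik hjk
      have h1 := sub_ne_zero.2 (hne _ (hmaps hs) j i hij.symm)
      have h2 := sub_ne_zero.2 (hne _ (hmaps hs) k i hik.symm)
      have h3 := sub_ne_zero.2 (hne _ (hmaps hs) k j hjk.symm)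
      have h4 := hη0 _ (hred.mem _ (hmaps hs))
      simp only [hlam]
      -- Since `λ` is quadratic in `μ` with leading coefficient `η`, the determinant is `η` times
      -- the Vandermonde determinant of the three speeds.
      have h5 := mul_ne_zero (mul_ne_zero (mul_ne_zero h4 h1) h2) h3
      intro h
      apply h5
      linear_combination h)
  have hgd : ∀ q ∈ O, DifferentiableAt ℝ g q := fun q hq =>
    (hg.contDiffAt (hO.mem_nhds hq)).differentiableAt (by simp)
  have hRs : ContDiffOn ℝ ∞ (fun q => ρf (g q)) O := (hρf hερ).comp hg hgB
  have hRd : ∀ q ∈ O, DifferentiableAt ℝ (fun q => ρf (g q)) q := fun q hq =>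
    (hRs.contDiffAt (hO.mem_nhds hq)).differentiableAt (by simp)
  have hRB : ∀ q ∈ O, ρf (g q) ∈ Metric.ball (0 : Fin N → ℝ) δ := fun q hq => hmaps (hgB q hq)
  have hRpd : ∀ q ∈ O, ∀ i c, pd c (fun q => ρf (g q) i) q
      = pd c (fun q => g q i) q * deriv (r i) (g q i) := by
    intro q hq i c
    have hrd : DifferentiableAt ℝ (r i) (g q i) := ((hr i).contDiffAt (Metric.isOpen_ball.mem_nhds
        (hcoord hερ _ (hgB q hq) i))).differentiableAt (by simp)
    have h2 := pd_comp (F := fun s : Fin N → ℝ => r i (s i)) (R := g) (q := q)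
      (hrd.comp (g q) (differentiableAt_apply i (g q))) (hgd q hq) c
    refine h2.trans ?_
    simp only [pd_comp_coord hrd]
    rw [Finset.sum_eq_single i]
    · simp
    · intro k _ hk; simp [hk.symm]
    · simp
  have hy : ∀ q ∈ O, ∀ i, pd 1 (fun q => ρf (g q) i) q
      = μ i (ρf (g q)) * pd 0 (fun q => ρf (g q) i) q := by
    intro q hq i
    rw [hRpd q hq, hRpd q hq, hgy q hq]; ring
  have ht : ∀ q ∈ O, ∀ i, pd 2 (fun q => ρf (g q) i) q
      = lam i (ρf (g q)) * pd 0 (fun q => ρf (g q) i) q := by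
    intro q hq i
    rw [hRpd q hq, hRpd q hq, hgt q hq]; ring
  have hUd : ∀ q ∈ O, DifferentiableAt ℝ U (ρf (g q)) := fun q hq =>
    (hred.smooth_U.contDiffAt (hB.mem_nhds (hRB q hq))).differentiableAt (by simp)
  have hWd : ∀ q ∈ O, DifferentiableAt ℝ W (ρf (g q)) := fun q hq =>
    (hred.smooth_W.contDiffAt (hB.mem_nhds (hRB q hq))).differentiableAt (by simp)
  refine ⟨Metric.ball 0 δ, U, W, μ, lam, hB, Metric.mem_ball_self hδ, hred, hU0, hW0, hax, O,
    fun q => ρf (g q), hO, h0O, ⟨hRs, hRB, hy, ht, fun q hq => ?_, fun q hq => ?_⟩, fun i => ?_⟩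
  · rw [pd_comp (R := fun q => ρf (g q)) (hUd q hq) (hRd q hq), pd_comp (R := fun q => ρf (g q)) (hUd q hq) (hRd q hq), pd_comp (R := fun q => ρf (g q)) (hUd q hq) (hRd q hq),
      pd_comp (R := fun q => ρf (g q)) (hWd q hq) (hRd q hq), Finset.mul_sum, Finset.mul_sum, Finset.mul_sum,
      ← Finset.sum_add_distrib, ← Finset.sum_add_distrib]
    refine Finset.sum_congr rfl fun j _ => ?_
    rw [ht q hq, hy q hq]
    linear_combination pd 0 (fun q => ρf (g q) j) q * hred.first_eq _ (hRB q hq) j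
  · rw [pd_comp (R := fun q => ρf (g q)) (hUd q hq) (hRd q hq), pd_comp (R := fun q => ρf (g q)) (hWd q hq) (hRd q hq)]
    refine Finset.sum_congr rfl fun j _ => ?_
    rw [hy q hq, hred.second_eq _ (hRB q hq)]; ring
  · filter_upwards [hgx] with x hx
    simp only [ρf, hx]

/-! ### Ordinary differential equations of the exponential case -/

section OneVariable

variable {I : Set ℝ} {f g h p : ℝ → ℝ} {u c : ℝ}

lemma contDiffOn_iteratedDeriv (hI : IsOpen I) (hh : ContDiffOn ℝ ∞ h I) (n : ℕ) :
    ContDiffOn ℝ ∞ (iteratedDeriv n h) I := by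
  induction n with
  | zero => simpa using hh
  | succ n ih => rw [iteratedDeriv_succ]; exact ih.deriv_of_isOpen hI (by simp)

lemma hasDerivAt_iteratedDeriv (hI : IsOpen I) (hh : ContDiffOn ℝ ∞ h I) (n : ℕ) (hu : u ∈ I) :
    HasDerivAt (iteratedDeriv n h) (iteratedDeriv (n + 1) h u) u := by
  rw [iteratedDeriv_succ]
  exact (((contDiffOn_iteratedDeriv hI hh n).contDiffAt (hI.mem_nhds hu)).differentiableAt
    (by simp)).hasDerivAt

lemma hasDerivAt_of_contDiffOn (hI : IsOpen I) (hh : ContDiffOn ℝ ∞ h I) (hu : u ∈ I) :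
    HasDerivAt h (deriv h u) u :=
  ((hh.contDiffAt (hI.mem_nhds hu)).differentiableAt (by simp)).hasDerivAt

lemma hasDerivAt_deriv_of_contDiffOn (hI : IsOpen I) (hh : ContDiffOn ℝ ∞ h I) (hu : u ∈ I) :
    HasDerivAt (deriv h) (iteratedDeriv 2 h u) u := by
  have := hasDerivAt_iteratedDeriv hI hh 1 hu
  rwa [iteratedDeriv_one] at this

lemma hasDerivAt_congr_of_eqOn (hI : IsOpen I) (hfg : ∀ u ∈ I, f u = g u) (hu : u ∈ I) {d : ℝ}
    (hg : HasDerivAt g d u) : HasDerivAt f d u :=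
  hg.congr_of_eventuallyEq (Filter.eventuallyEq_of_mem (hI.mem_nhds hu) hfg)

lemma deriv_eq_of_eqOn (hI : IsOpen I) (hfg : ∀ u ∈ I, f u = g u) (hu : u ∈ I) {g₁ : ℝ → ℝ}
    (hg : ∀ u ∈ I, HasDerivAt g (g₁ u) u) : deriv f u = g₁ u :=
  (hasDerivAt_congr_of_eqOn hI hfg hu (hg u hu)).deriv

lemma iteratedDeriv_two_eq_of_eqOn (hI : IsOpen I) (hfg : ∀ u ∈ I, f u = g u) (hu : u ∈ I)
    {g₁ g₂ : ℝ → ℝ} (hg : ∀ u ∈ I, HasDerivAt g (g₁ u) u)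
    (hg₁ : ∀ u ∈ I, HasDerivAt g₁ (g₂ u) u) : iteratedDeriv 2 f u = g₂ u := by
  rw [iteratedDeriv_succ, iteratedDeriv_one]
  exact deriv_eq_of_eqOn hI (fun v hv => deriv_eq_of_eqOn hI hfg hv hg) hu hg₁

lemma exists_eq_const_of_hasDerivAt_zero (hI : IsOpen I) (hc : Convex ℝ I)
    (hf : ∀ u ∈ I, HasDerivAt f 0 u) : ∃ c, ∀ u ∈ I, f u = c := by
  rcases I.eq_empty_or_nonempty with rfl | ⟨x, hx⟩
  · exact ⟨0, by simp⟩
  · exact ⟨f x, fun u hu => hI.is_const_of_deriv_eq_zero hc.isPreconnected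
      (fun v hv => (hf v hv).differentiableAt.differentiableWithinAt)
      (fun v hv => (hf v hv).deriv) hu hx⟩

/-- The exponential system in terms of `h` and `p = f - h'`. -/
theorem expSystem_iff_of_eq_add (hI : IsOpen I)
    (hh : ContDiffOn ℝ ∞ h I) (hp : ContDiffOn ℝ ∞ p I) (hf : ∀ u ∈ I, f u = deriv h u + p u) :
    ExpSystem I f g h ↔ ∀ u ∈ I, g u = deriv p u ∧
      h u * iteratedDeriv 3 p u = 2 * deriv h u * iteratedDeriv 2 p u
        - deriv p u * iteratedDeriv 2 h u + 2 * p u * iteratedDeriv 2 p u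
        - 2 * (deriv p u) ^ 2 ∧
      h u * iteratedDeriv 3 h u = deriv h u * iteratedDeriv 2 h u
        - 2 * deriv h u * deriv p u + h u * iteratedDeriv 2 p u
        + p u * iteratedDeriv 2 h u := by
  have hf1 : ∀ u ∈ I, HasDerivAt (fun u => deriv h u + p u) (iteratedDeriv 2 h u + deriv p u) u :=
    fun u hu => (hasDerivAt_deriv_of_contDiffOn hI hh hu).add (hasDerivAt_of_contDiffOn hI hp hu)
  have hf2 : ∀ u ∈ I, HasDerivAt (fun u => iteratedDeriv 2 h u + deriv p u)
      (iteratedDeriv 3 h u + iteratedDeriv 2 p u) u := fun u hu =>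
    (hasDerivAt_iteratedDeriv hI hh 2 hu).add (hasDerivAt_deriv_of_contDiffOn hI hp hu)
  have e1 : ∀ u ∈ I, deriv f u = iteratedDeriv 2 h u + deriv p u := fun u hu =>
    deriv_eq_of_eqOn hI hf hu hf1
  have e2 : ∀ u ∈ I, iteratedDeriv 2 f u = iteratedDeriv 3 h u + iteratedDeriv 2 p u :=
    fun u hu => iteratedDeriv_two_eq_of_eqOn hI hf hu hf1 hf2
  have hg' : ∀ hgp : ∀ u ∈ I, g u = deriv p u, ∀ u ∈ I,
      deriv g u = iteratedDeriv 2 p u ∧ iteratedDeriv 2 g u = iteratedDeriv 3 p u :=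
    fun hgp u hu => ⟨deriv_eq_of_eqOn hI hgp hu fun v hv => hasDerivAt_deriv_of_contDiffOn hI hp hv,
      iteratedDeriv_two_eq_of_eqOn hI hgp hu (fun v hv => hasDerivAt_deriv_of_contDiffOn hI hp hv)
        fun v hv => hasDerivAt_iteratedDeriv hI hp 2 hv⟩
  constructor
  · intro H
    have hgp : ∀ u ∈ I, g u = deriv p u := fun u hu => by
      have := (H u hu).1
      rw [e1 u hu] at this; linarith
    intro u hu
    obtain ⟨-, h2, h3⟩ := H u hu
    rw [hf u hu, e1 u hu, (hg' hgp u hu).1, hgp u hu] at h2 h3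
    rw [(hg' hgp u hu).2] at h2
    rw [e2 u hu] at h3
    exact ⟨hgp u hu, by linear_combination h2, by linear_combination h3⟩
  · intro H
    have hgp : ∀ u ∈ I, g u = deriv p u := fun u hu => (H u hu).1
    intro u hu
    obtain ⟨-, h2, h3⟩ := H u hu
    rw [hf u hu, e1 u hu, e2 u hu, (hg' hgp u hu).1, (hg' hgp u hu).2, hgp u hu]
    exact ⟨by ring, by linear_combination h2, by linear_combination h3⟩

/-- The exponential system for `f = 2 h'`, `g = h''`. -/
theorem expSystem_two_mul_deriv_iff (hI : IsOpen I) (hh : ContDiffOn ℝ ∞ h I) :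
    ExpSystem I (fun u => 2 * deriv h u) (iteratedDeriv 2 h) h ↔
      ∀ u ∈ I, iteratedDeriv 4 h u * h u + 3 * (iteratedDeriv 2 h u) ^ 2
        - 4 * deriv h u * iteratedDeriv 3 h u = 0 := by
  have hf1 : ∀ u ∈ I, HasDerivAt (fun u => 2 * deriv h u) (2 * iteratedDeriv 2 h u) u :=
    fun u hu => (hasDerivAt_deriv_of_contDiffOn hI hh hu).const_mul 2
  have hf2 : ∀ u ∈ I, HasDerivAt (fun u => 2 * iteratedDeriv 2 h u) (2 * iteratedDeriv 3 h u) u :=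
    fun u hu => (hasDerivAt_iteratedDeriv hI hh 2 hu).const_mul 2
  have e : ∀ u ∈ I, deriv (iteratedDeriv 2 h) u = iteratedDeriv 3 h u ∧
      iteratedDeriv 2 (iteratedDeriv 2 h) u = iteratedDeriv 4 h u := fun u hu =>
    ⟨(hasDerivAt_iteratedDeriv hI hh 2 hu).deriv, iteratedDeriv_two_eq_of_eqOn hI
      (fun _ _ => rfl) hu (fun v hv => hasDerivAt_iteratedDeriv hI hh 2 hv)
      fun v hv => hasDerivAt_iteratedDeriv hI hh 3 hv⟩
  refine forall₂_congr fun u hu => ?_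
  rw [(hf1 u hu).deriv, iteratedDeriv_two_eq_of_eqOn hI (fun _ _ => rfl) hu hf1 hf2, (e u hu).1,
    (e u hu).2]
  exact ⟨fun H => by linear_combination H.2.1,
    fun H => ⟨by ring, by linear_combination H, by ring⟩⟩

/-- The exponential system for `f = h' + c h`, `g = c h'`. -/
theorem expSystem_deriv_add_mul_iff (hI : IsOpen I) (hh : ContDiffOn ℝ ∞ h I) :
    ExpSystem I (fun u => deriv h u + c * h u) (fun u => c * deriv h u) h ↔
      ∀ u ∈ I, iteratedDeriv 3 h u * h u - iteratedDeriv 2 h u * deriv h u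
        = 2 * c * (iteratedDeriv 2 h u * h u - (deriv h u) ^ 2) := by
  have hf1 : ∀ u ∈ I, HasDerivAt (fun u => deriv h u + c * h u)
      (iteratedDeriv 2 h u + c * deriv h u) u := fun u hu =>
    (hasDerivAt_deriv_of_contDiffOn hI hh hu).add ((hasDerivAt_of_contDiffOn hI hh hu).const_mul c)
  have hf2 : ∀ u ∈ I, HasDerivAt (fun u => iteratedDeriv 2 h u + c * deriv h u)
      (iteratedDeriv 3 h u + c * iteratedDeriv 2 h u) u := fun u hu =>
    (hasDerivAt_iteratedDeriv hI hh 2 hu).add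
      ((hasDerivAt_deriv_of_contDiffOn hI hh hu).const_mul c)
  have hg1 : ∀ u ∈ I, HasDerivAt (fun u => c * deriv h u) (c * iteratedDeriv 2 h u) u :=
    fun u hu => (hasDerivAt_deriv_of_contDiffOn hI hh hu).const_mul c
  have hg2 : ∀ u ∈ I, HasDerivAt (fun u => c * iteratedDeriv 2 h u) (c * iteratedDeriv 3 h u) u :=
    fun u hu => (hasDerivAt_iteratedDeriv hI hh 2 hu).const_mul c
  refine forall₂_congr fun u hu => ?_
  rw [(hf1 u hu).deriv, iteratedDeriv_two_eq_of_eqOn hI (fun _ _ => rfl) hu hf1 hf2,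
    (hg1 u hu).deriv, iteratedDeriv_two_eq_of_eqOn hI (fun _ _ => rfl) hu hg1 hg2]
  exact ⟨fun H => by linear_combination H.2.2,
    fun H => ⟨by ring, by linear_combination c * H, by linear_combination H⟩⟩

/-- Solutions of `k'' = κ k`. -/
lemma exists_of_hasDerivAt_mul {k k₁ : ℝ → ℝ} {κ : ℝ} (hI : IsOpen I) (hc : Convex ℝ I)
    (hk : ∀ u ∈ I, HasDerivAt k (k₁ u) u) (hk₁ : ∀ u ∈ I, HasDerivAt k₁ (κ * k u) u) :
    ∃ α β γ : ℝ,
      (κ = γ ^ 2 ∧ ∀ u ∈ I, k u = α * Real.exp (γ * u) + β * Real.exp (-γ * u)) ∨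
      (κ = 0 ∧ ∀ u ∈ I, k u = α + β * u) ∨
      (κ = -γ ^ 2 ∧ ∀ u ∈ I, k u = α * Real.cos (γ * u) + β * Real.sin (γ * u)) := by
  have hlin : ∀ c u : ℝ, HasDerivAt (fun u => c * u) c u := fun c u => by
    simpa using (hasDerivAt_id u).const_mul c
  -- In each case two first integrals of the pair `(k, k₁)` determine `k`: rotated coordinates for
  -- `κ < 0`, the eigenvectors of the first order system for `κ > 0`.
  rcases lt_trichotomy κ 0 with hκ | rfl | hκ
  · obtain ⟨γ, hγ, rfl⟩ : ∃ γ : ℝ, γ ≠ 0 ∧ κ = -γ ^ 2 :=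
      ⟨Real.sqrt (-κ), (Real.sqrt_pos.2 (neg_pos.2 hκ)).ne', by
        rw [Real.sq_sqrt (neg_pos.2 hκ).le]; ring⟩
    obtain ⟨a, ha⟩ := exists_eq_const_of_hasDerivAt_zero hI hc
      (f := fun u => k u * Real.cos (γ * u) - k₁ u / γ * Real.sin (γ * u)) fun u hu =>
        ((((hk u hu).mul (hlin γ u).cos)).sub (((hk₁ u hu).div_const γ).mul
          (hlin γ u).sin)).congr_deriv (by field_simp; ring)
    obtain ⟨b, hb⟩ := exists_eq_const_of_hasDerivAt_zero hI hc
      (f := fun u => k u * Real.sin (γ * u) + k₁ u / γ * Real.cos (γ * u)) fun u hu =>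
        ((((hk u hu).mul (hlin γ u).sin)).add (((hk₁ u hu).div_const γ).mul
          (hlin γ u).cos)).congr_deriv (by field_simp; ring)
    refine ⟨a, b, γ, .inr (.inr ⟨rfl, fun u hu => ?_⟩)⟩
    linear_combination Real.cos (γ * u) * ha u hu + Real.sin (γ * u) * hb u hu
      - k u * Real.sin_sq_add_cos_sq (γ * u)
  · obtain ⟨b, hb⟩ := exists_eq_const_of_hasDerivAt_zero hI hc (f := k₁) fun u hu => by
      simpa using hk₁ u hu
    obtain ⟨a, ha⟩ := exists_eq_const_of_hasDerivAt_zero hI hc (f := fun u => k u - b * u)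
      fun u hu => ((hk u hu).sub (hlin b u)).congr_deriv (by rw [hb u hu, sub_self])
    exact ⟨a, b, 0, .inr (.inl ⟨rfl, fun u hu => by linear_combination ha u hu⟩)⟩
  · obtain ⟨γ, hγ, rfl⟩ : ∃ γ : ℝ, γ ≠ 0 ∧ κ = γ ^ 2 :=
      ⟨Real.sqrt κ, (Real.sqrt_pos.2 hκ).ne', (Real.sq_sqrt hκ.le).symm⟩
    obtain ⟨a, ha⟩ := exists_eq_const_of_hasDerivAt_zero hI hc
      (f := fun u => (k₁ u + γ * k u) * Real.exp (-γ * u)) fun u hu =>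
        (((hk₁ u hu).add ((hk u hu).const_mul γ)).mul (hlin (-γ) u).exp).congr_deriv
          (by simp only [Pi.add_apply]; ring)
    obtain ⟨b, hb⟩ := exists_eq_const_of_hasDerivAt_zero hI hc
      (f := fun u => (k₁ u - γ * k u) * Real.exp (γ * u)) fun u hu =>
        (((hk₁ u hu).sub ((hk u hu).const_mul γ)).mul (hlin γ u).exp).congr_deriv
          (by simp only [Pi.sub_apply]; ring)
    refine ⟨a / (2 * γ), -b / (2 * γ), γ, .inl ⟨rfl, fun u hu => ?_⟩⟩
    have he : Real.exp (-(γ * u)) * Real.exp (γ * u) = 1 := by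
      rw [← Real.exp_add]; simp
    rw [← ha u hu, ← hb u hu]
    field_simp
    linear_combination (-2 * γ * k u) * he

/-- Exponential solutions of the exponential system. -/
theorem third_order_iff_exponential (hI : IsOpen I) (hcv : Convex ℝ I) (hh : ContDiffOn ℝ ∞ h I)
    (h0 : ∀ u ∈ I, h u ≠ 0) :
    (∀ u ∈ I, iteratedDeriv 3 h u * h u - iteratedDeriv 2 h u * deriv h u
        = 2 * c * (iteratedDeriv 2 h u * h u - (deriv h u) ^ 2)) ↔
      ∃ α β γ : ℝ,
        (∀ u ∈ I, h u = α * Real.exp ((c + γ) * u) + β * Real.exp ((c - γ) * u)) ∨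
        (∀ u ∈ I, h u = (α + β * u) * Real.exp (c * u)) ∨
        (∀ u ∈ I, h u = Real.exp (c * u) * (α * Real.cos (γ * u) + β * Real.sin (γ * u))) := by
  have hlin : ∀ c u : ℝ, HasDerivAt (fun u => c * u) c u := fun c u => by
    simpa using (hasDerivAt_id u).const_mul c
  have d0 := fun u hu => hasDerivAt_of_contDiffOn (u := u) hI hh hu
  have d1 := fun u hu => hasDerivAt_deriv_of_contDiffOn (u := u) hI hh hu
  have d2 := fun u hu => hasDerivAt_iteratedDeriv (u := u) hI hh 2 hu
  constructor
  · intro H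
    -- The third order equation says that `(h'' - 2ch') / h` is constant. The function `h e^{-cu}`
    -- then satisfies an equation without first order term.
    obtain ⟨κ, hκ⟩ := exists_eq_const_of_hasDerivAt_zero hI hcv
      (f := fun u => (iteratedDeriv 2 h u - 2 * c * deriv h u) / h u) fun u hu =>
        (((d2 u hu).sub ((d1 u hu).const_mul (2 * c))).div (d0 u hu) (h0 u hu)).congr_deriv (by
          rw [div_eq_zero_iff]
          simp only [Pi.sub_apply]
          left; linear_combination H u hu)
    have hκ' : ∀ u ∈ I, iteratedDeriv 2 h u = 2 * c * deriv h u + κ * h u := fun u hu => by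
      have := (div_eq_iff (h0 u hu)).1 (hκ u hu)
      linear_combination this
    have hex : ∀ u : ℝ, Real.exp (-c * u) * Real.exp (c * u) = 1 := fun u => by
      rw [← Real.exp_add]; simp
    obtain ⟨α, β, γ, hk⟩ := exists_of_hasDerivAt_mul hI hcv
      (k := fun u => h u * Real.exp (-c * u))
      (k₁ := fun u => (deriv h u - c * h u) * Real.exp (-c * u)) (κ := κ + c ^ 2)
      (fun u hu => ((d0 u hu).mul (hlin (-c) u).exp).congr_deriv (by ring))
      (fun u hu => (((d1 u hu).sub ((d0 u hu).const_mul c)).mul (hlin (-c) u).exp).congr_deriv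
        (by simp only [Pi.sub_apply]; rw [hκ' u hu]; ring))
    refine ⟨α, β, γ, hk.imp (fun H u hu => ?_) (Or.imp (fun H u hu => ?_) fun H u hu => ?_)⟩
    · have h1 : Real.exp ((c + γ) * u) = Real.exp (c * u) * Real.exp (γ * u) := by
        rw [← Real.exp_add]; ring_nf
      have h2 : Real.exp ((c - γ) * u) = Real.exp (c * u) * Real.exp (-γ * u) := by
        rw [← Real.exp_add]; ring_nf
      rw [h1, h2]
      linear_combination Real.exp (c * u) * H.2 u hu - h u * hex u
    · linear_combination Real.exp (c * u) * H.2 u hu - h u * hex u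
    · linear_combination Real.exp (c * u) * H.2 u hu - h u * hex u
  · rintro ⟨α, β, γ, H⟩
    -- Conversely, each of the three forms solves `h'' = 2ch' + κh` for some `κ`, and eliminating
    -- `κ` by differentiation recovers the third order equation.
    have key : ∀ κ : ℝ, (∀ u ∈ I, iteratedDeriv 2 h u = 2 * c * deriv h u + κ * h u) →
        ∀ u ∈ I, iteratedDeriv 3 h u * h u - iteratedDeriv 2 h u * deriv h u
          = 2 * c * (iteratedDeriv 2 h u * h u - (deriv h u) ^ 2) := by
      intro κ hκ u hu
      have h1 := (d2 u hu).unique (hasDerivAt_congr_of_eqOn hI hκ hu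
        (((d1 u hu).const_mul (2 * c)).add ((d0 u hu).const_mul κ)))
      rw [h1]
      linear_combination -(deriv h u) * hκ u hu
    rcases H with H | H | H
    · have e1 : ∀ u ∈ I, HasDerivAt (fun u => α * Real.exp ((c + γ) * u)
          + β * Real.exp ((c - γ) * u)) (α * (c + γ) * Real.exp ((c + γ) * u)
          + β * (c - γ) * Real.exp ((c - γ) * u)) u := fun u _ =>
        (((hlin (c + γ) u).exp.const_mul α).add ((hlin (c - γ) u).exp.const_mul β)).congr_deriv
          (by ring)
      have e2 : ∀ u ∈ I, HasDerivAt (fun u => α * (c + γ) * Real.exp ((c + γ) * u)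
          + β * (c - γ) * Real.exp ((c - γ) * u)) (α * (c + γ) ^ 2 * Real.exp ((c + γ) * u)
          + β * (c - γ) ^ 2 * Real.exp ((c - γ) * u)) u := fun u _ =>
        (((hlin (c + γ) u).exp.const_mul (α * (c + γ))).add
          ((hlin (c - γ) u).exp.const_mul (β * (c - γ)))).congr_deriv (by ring)
      refine key (γ ^ 2 - c ^ 2) fun u hu => ?_
      rw [iteratedDeriv_two_eq_of_eqOn hI H hu e1 e2, deriv_eq_of_eqOn hI H hu e1, H u hu]
      ring
    · have e1 : ∀ u ∈ I, HasDerivAt (fun u => (α + β * u) * Real.exp (c * u))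
          ((β + c * (α + β * u)) * Real.exp (c * u)) u := fun u _ =>
        (((hlin β u).const_add α).mul (hlin c u).exp).congr_deriv (by ring)
      have e2 : ∀ u ∈ I, HasDerivAt (fun u => (β + c * (α + β * u)) * Real.exp (c * u))
          ((2 * c * β + c ^ 2 * (α + β * u)) * Real.exp (c * u)) u := fun u _ =>
        (((((hlin β u).const_add α).const_mul c).const_add β).mul (hlin c u).exp).congr_deriv
          (by ring)
      refine key (-c ^ 2) fun u hu => ?_
      rw [iteratedDeriv_two_eq_of_eqOn hI H hu e1 e2, deriv_eq_of_eqOn hI H hu e1, H u hu]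
      ring
    · have e1 : ∀ α β : ℝ, ∀ u ∈ I, HasDerivAt
          (fun u => Real.exp (c * u) * (α * Real.cos (γ * u) + β * Real.sin (γ * u)))
          (Real.exp (c * u) * ((c * α + γ * β) * Real.cos (γ * u)
            + (c * β - γ * α) * Real.sin (γ * u))) u := fun α β u _ =>
        ((hlin c u).exp.mul (((hlin γ u).cos.const_mul α).add
          ((hlin γ u).sin.const_mul β))).congr_deriv (by simp only [Pi.add_apply]; ring)
      refine key (-c ^ 2 - γ ^ 2) fun u hu => ?_
      rw [iteratedDeriv_two_eq_of_eqOn hI H hu (e1 α β) (e1 _ _), deriv_eq_of_eqOn hI H hu (e1 α β),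
        H u hu]
      ring

end OneVariable

/-! ### The differential equation of `℘` for `g₂ = 0` -/

section Weierstrass

variable (L : PeriodPair)

lemma countable_lattice : (L.lattice : Set ℂ).Countable := by
  have : Countable L.lattice := L.latticeEquivProd.injective.countable
  exact Set.countable_coe_iff.1 this

lemma tendsto_weierstrassP {l : ℂ} (hl : l ∈ L.lattice) :
    Filter.Tendsto L.weierstrassP (𝓝[≠] l) (Bornology.cobounded ℂ) :=
  tendsto_cobounded_of_meromorphicOrderAt_neg (by
    rw [L.order_weierstrassP l hl]; exact WithTop.coe_lt_coe.2 (by norm_num : (-2 : ℤ) < 0))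

lemma eventually_notMem_lattice (z : ℂ) : ∀ᶠ w in 𝓝[≠] z, w ∉ L.lattice := by
  filter_upwards [nhdsWithin_le_nhds (L.compl_lattice_sdiff_singleton_mem_nhds z),
    self_mem_nhdsWithin] with w hw hwz hwL
  exact hw ⟨hwL, hwz⟩

lemma hasDerivAt_weierstrassP {z : ℂ} (hz : z ∉ L.lattice) :
    HasDerivAt L.weierstrassP (L.derivWeierstrassP z) z := by
  rw [← L.deriv_weierstrassP]
  exact (L.analyticOnNhd_weierstrassP z hz).differentiableAt.hasDerivAt

/-- Otherwise `℘'` vanishes identically on the complement of the lattice, which is connected because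
the lattice is countable. Then `4℘³ = g₃` is constant, which contradicts the pole at `0`. -/
lemma eventually_derivWeierstrassP_ne_zero (h2 : L.g₂ = 0) {z : ℂ} (hz : z ∉ L.lattice) :
    ∀ᶠ w in 𝓝[≠] z, L.derivWeierstrassP w ≠ 0 := by
  by_contra H
  have hpre : IsPreconnected ((L.lattice : Set ℂ)ᶜ) :=
    ((countable_lattice L).isPathConnected_compl_of_one_lt_rank (by simp)).isConnected.isPreconnected
  have h0 := L.analyticOnNhd_derivWeierstrassP.eqOn_zero_of_preconnected_of_frequently_eq_zero hpre
    hz (fun h => H (h.mono fun _ => id))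
  have h1 := (tendsto_norm_cobounded_atTop.comp
    (tendsto_weierstrassP L L.lattice.zero_mem)).eventually_gt_atTop (‖L.g₃‖ + 1)
  obtain ⟨w, hw, hwL⟩ := (h1.and (eventually_notMem_lattice L 0)).exists
  have h3 := L.derivWeierstrassP_sq w hwL
  rw [h0 hwL, h2] at h3
  have h4 : 4 * L.weierstrassP w ^ 3 = L.g₃ := by
    simp only [Pi.zero_apply] at h3
    linear_combination -h3
  have h5 := congrArg norm h4
  rw [norm_mul, norm_pow] at h5
  simp only [Function.comp_apply] at hw
  have h6 : ‖(4 : ℂ)‖ = 4 := by norm_num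
  rw [h6] at h5
  nlinarith [norm_nonneg L.g₃, sq_nonneg (‖L.weierstrassP w‖ - 1),
    mul_nonneg (norm_nonneg L.g₃) (norm_nonneg L.g₃), pow_le_pow_left₀ zero_le_one
      (by linarith [norm_nonneg L.g₃] : 1 ≤ ‖L.weierstrassP w‖) 2]

/-- Differentiate `℘'² = 4℘³ - g₃` and cancel `2℘'` where it is nonzero; the zeros of `℘'` are
isolated and are reached by continuity. -/
lemma deriv_derivWeierstrassP (h2 : L.g₂ = 0) {z : ℂ} (hz : z ∉ L.lattice) :
    HasDerivAt L.derivWeierstrassP (6 * L.weierstrassP z ^ 2) z := by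
  have hopen : IsOpen ((L.lattice : Set ℂ)ᶜ) := L.isClosed_lattice.isOpen_compl
  have han := L.analyticOnNhd_derivWeierstrassP
  have key : ∀ w ∉ L.lattice, L.derivWeierstrassP w ≠ 0 →
      deriv L.derivWeierstrassP w = 6 * L.weierstrassP w ^ 2 := by
    intro w hw hw0
    have d1 := ((han w hw).differentiableAt.hasDerivAt).pow 2
    have d2 : HasDerivAt (L.derivWeierstrassP ^ 2)
        (4 * (3 * L.weierstrassP w ^ 2 * L.derivWeierstrassP w)) w := by
      have d3 := ((((hasDerivAt_weierstrassP L hw).pow 3).const_mul 4).sub_const L.g₃)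
      refine (d3.congr_of_eventuallyEq ?_).congr_deriv (by simp)
      filter_upwards [hopen.mem_nhds hw] with y hy
      have := L.derivWeierstrassP_sq y hy
      rw [h2] at this
      simp only [Pi.pow_apply]
      linear_combination this
    have h3 := d1.unique d2
    refine mul_left_cancel₀ hw0 ?_
    simp only [Nat.cast_ofNat, Nat.add_one_sub_one, pow_one] at h3
    linear_combination h3 / 2
  have hev : ∀ᶠ w in 𝓝[≠] z, deriv L.derivWeierstrassP w = 6 * L.weierstrassP w ^ 2 := by
    filter_upwards [eventually_derivWeierstrassP_ne_zero L h2 hz,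
      nhdsWithin_le_nhds (hopen.mem_nhds hz)] with w hw hwL
    exact key w hwL hw
  have hc1 : ContinuousAt (deriv L.derivWeierstrassP) z := (han z hz).deriv.continuousAt
  have hc2 : ContinuousAt (fun w => 6 * L.weierstrassP w ^ 2) z :=
    ((L.analyticOnNhd_weierstrassP z hz).continuousAt.pow 2).const_mul 6
  have := tendsto_nhds_unique ((hc1.tendsto.mono_left nhdsWithin_le_nhds).congr' hev)
    (hc2.tendsto.mono_left nhdsWithin_le_nhds)
  rw [← this]
  exact (han z hz).differentiableAt.hasDerivAt

end Weierstrass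

/-! ### Lattices stable under conjugation and real values of `℘` -/

section RealLattice

open ComplexConjugate

variable {L : PeriodPair}

/-- Complex conjugation on a lattice that is stable under it. -/
noncomputable def latticeConj (hL : ∀ l ∈ L.lattice, conj l ∈ L.lattice) :
    L.lattice ≃ L.lattice :=
  Function.Involutive.toPerm (fun l => ⟨conj l.1, hL l.1 l.2⟩) fun l => by simp

lemma coe_latticeConj (hL : ∀ l ∈ L.lattice, conj l ∈ L.lattice) (l : L.lattice) :
    (latticeConj hL l : ℂ) = conj l.1 := rfl

lemma conj_weierstrassP (hL : ∀ l ∈ L.lattice, conj l ∈ L.lattice) (z : ℂ) :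
    conj (L.weierstrassP z) = L.weierstrassP (conj z) := by
  rw [PeriodPair.weierstrassP, PeriodPair.weierstrassP, Complex.conj_tsum,
    ← (latticeConj hL).tsum_eq]
  refine tsum_congr fun l => ?_
  simp [coe_latticeConj]

lemma conj_derivWeierstrassP (hL : ∀ l ∈ L.lattice, conj l ∈ L.lattice) (z : ℂ) :
    conj (L.derivWeierstrassP z) = L.derivWeierstrassP (conj z) := by
  rw [PeriodPair.derivWeierstrassP, PeriodPair.derivWeierstrassP, map_neg, Complex.conj_tsum,
    ← (latticeConj hL).tsum_eq]
  congr 1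
  refine tsum_congr fun l => ?_
  simp [coe_latticeConj, map_ofNat]

lemma conj_G (hL : ∀ l ∈ L.lattice, conj l ∈ L.lattice) (n : ℕ) : conj (L.G n) = L.G n := by
  rw [PeriodPair.G, Complex.conj_tsum, ← (latticeConj hL).tsum_eq]
  refine tsum_congr fun l => ?_
  simp [coe_latticeConj]

/-- The restriction of `℘` to the real line. -/
noncomputable def realP (L : PeriodPair) (x : ℝ) : ℝ := (L.weierstrassP x).re

/-- The restriction of `℘'` to the real line. -/
noncomputable def realDP (L : PeriodPair) (x : ℝ) : ℝ := (L.derivWeierstrassP x).re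

lemma coe_realP (hL : ∀ l ∈ L.lattice, conj l ∈ L.lattice) (x : ℝ) :
    (realP L x : ℂ) = L.weierstrassP x := by
  refine Complex.conj_eq_iff_re.1 ?_
  rw [conj_weierstrassP hL, Complex.conj_ofReal]

lemma coe_realDP (hL : ∀ l ∈ L.lattice, conj l ∈ L.lattice) (x : ℝ) :
    (realDP L x : ℂ) = L.derivWeierstrassP x := by
  refine Complex.conj_eq_iff_re.1 ?_
  rw [conj_derivWeierstrassP hL, Complex.conj_ofReal]

lemma hasDerivAt_realP {x : ℝ} (hx : (x : ℂ) ∉ L.lattice) :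
    HasDerivAt (realP L) (realDP L x) x :=
  (hasDerivAt_weierstrassP L hx).real_of_complex

lemma hasDerivAt_realDP (hL : ∀ l ∈ L.lattice, conj l ∈ L.lattice) (h2 : L.g₂ = 0) {x : ℝ}
    (hx : (x : ℂ) ∉ L.lattice) : HasDerivAt (realDP L) (6 * realP L x ^ 2) x :=
  (deriv_derivWeierstrassP L h2 hx).real_of_complex.congr_deriv (by
    rw [← coe_realP hL]; norm_cast)

lemma realDP_sq (hL : ∀ l ∈ L.lattice, conj l ∈ L.lattice) (h2 : L.g₂ = 0) {c : ℝ}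
    (h3 : L.g₃ = c) {x : ℝ} (hx : (x : ℂ) ∉ L.lattice) :
    realDP L x ^ 2 = 4 * realP L x ^ 3 - c := by
  have := L.derivWeierstrassP_sq x hx
  rw [h2, h3, ← coe_realP hL, ← coe_realDP hL] at this
  have h : ((realDP L x ^ 2 : ℝ) : ℂ) = ((4 * realP L x ^ 3 - c : ℝ) : ℂ) := by
    push_cast; linear_combination this
  exact_mod_cast h

lemma tendsto_coe_nhdsNE (x : ℝ) :
    Filter.Tendsto (fun x : ℝ => (x : ℂ)) (𝓝[≠] x) (𝓝[≠] (x : ℂ)) :=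
  Complex.continuous_ofReal.continuousAt.continuousWithinAt.tendsto_nhdsWithin
    fun y hy => by simpa using hy

lemma tendsto_abs_realP (hL : ∀ l ∈ L.lattice, conj l ∈ L.lattice) {x : ℝ}
    (hx : (x : ℂ) ∈ L.lattice) : Filter.Tendsto (fun y => |realP L y|) (𝓝[≠] x) Filter.atTop := by
  refine ((tendsto_norm_cobounded_atTop.comp (tendsto_weierstrassP L hx)).comp
    (tendsto_coe_nhdsNE x)).congr fun y => ?_
  simp only [Function.comp_apply]
  rw [← coe_realP hL, Complex.norm_real, Real.norm_eq_abs]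

end RealLattice

/-! ### Uniqueness for `P'' = 6 P²` across poles -/

/-- Local uniqueness for `P'' = 6 P²`. -/
lemma eventuallyEq_of_deriv_eq_six_mul_sq {P P₁ Q Q₁ : ℝ → ℝ} {u : ℝ}
    (hP : ∀ᶠ v in 𝓝 u, HasDerivAt P (P₁ v) v ∧ HasDerivAt P₁ (6 * P v ^ 2) v)
    (hQ : ∀ᶠ v in 𝓝 u, HasDerivAt Q (Q₁ v) v ∧ HasDerivAt Q₁ (6 * Q v ^ 2) v)
    (h0 : P u = Q u) (h1 : P₁ u = Q₁ u) : ∀ᶠ v in 𝓝 u, P v = Q v ∧ P₁ v = Q₁ v := by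
  let F : ℝ × ℝ → ℝ × ℝ := fun x => (x.2, 6 * x.1 ^ 2)
  have hF : ContDiffAt ℝ 1 F (P u, P₁ u) :=
    contDiffAt_snd.prodMk (contDiffAt_const.mul (contDiffAt_fst.pow 2))
  obtain ⟨K, t, ht, hK⟩ := hF.exists_lipschitzOnWith
  have hcP : ContinuousAt (fun v => (P v, P₁ v)) u :=
    hP.self_of_nhds.1.continuousAt.prodMk hP.self_of_nhds.2.continuousAt
  have hcQ : ContinuousAt (fun v => (Q v, Q₁ v)) u :=
    hQ.self_of_nhds.1.continuousAt.prodMk hQ.self_of_nhds.2.continuousAt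
  have heq : (P u, P₁ u) = (Q u, Q₁ u) := by rw [h0, h1]
  have hmP := hcP.eventually_mem ht
  have hmQ := hcQ.eventually_mem (heq ▸ ht)
  have := ODE_solution_unique_of_eventually (v := fun _ => F) (s := fun _ => t) (K := K)
    (f := fun v => (P v, P₁ v)) (g := fun v => (Q v, Q₁ v)) (t₀ := u)
    (Filter.Eventually.of_forall fun _ => hK)
    (by filter_upwards [hP, hmP] with v hv hm using ⟨hv.1.prodMk hv.2, hm⟩)
    (by filter_upwards [hQ, hmQ] with v hv hm using ⟨hv.1.prodMk hv.2, hm⟩) heq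
  filter_upwards [this] with v hv
  exact ⟨congrArg Prod.fst hv, congrArg Prod.snd hv⟩

/-- A smooth solution of `P'' = 6 P²` agrees with a solution `Q` with poles `S` if it does so at
one point. -/
lemma eqOn_of_deriv_eq_six_mul_sq {I S : Set ℝ} (hI : IsOpen I) (hpre : IsPreconnected I)
    (hS : IsClosed S) {P P₁ Q Q₁ : ℝ → ℝ}
    (hP : ∀ v ∈ I, HasDerivAt P (P₁ v) v ∧ HasDerivAt P₁ (6 * P v ^ 2) v)
    (hQ : ∀ v ∉ S, HasDerivAt Q (Q₁ v) v ∧ HasDerivAt Q₁ (6 * Q v ^ 2) v)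
    (hblow : ∀ v ∈ S, Filter.Tendsto (fun y => |Q y|) (𝓝[≠] v) Filter.atTop)
    {u : ℝ} (hu : u ∈ I) (huS : u ∉ S) (h0 : P u = Q u) (h1 : P₁ u = Q₁ u) :
    ∀ v ∈ I, v ∉ S ∧ P v = Q v ∧ P₁ v = Q₁ v := by
  -- `A` is open, and it contains every point of its closure that lies in `I`, so connectedness
  -- gives `I ⊆ A`.
  let A : Set ℝ := {v | ∀ᶠ w in 𝓝 v, w ∈ I ∧ w ∉ S ∧ P w = Q w ∧ P₁ w = Q₁ w}
  have hA : ∀ v ∈ I, v ∉ S → P v = Q v → P₁ v = Q₁ v → v ∈ A := by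
    intro v hv hvS e0 e1
    have hIv := hI.mem_nhds hv
    have hSv := hS.isOpen_compl.mem_nhds hvS
    filter_upwards [hIv, hSv, eventuallyEq_of_deriv_eq_six_mul_sq (Filter.mem_of_superset hIv hP)
      (Filter.mem_of_superset hSv hQ) e0 e1] with w a b c using ⟨a, b, c⟩
  have hAo : IsOpen A := isOpen_iff_mem_nhds.2 fun v hv => (eventually_eventually_nhds.2 hv)
  have hsub : I ⊆ A := by
    refine hpre.subset_of_closure_inter_subset hAo ⟨u, hu, hA u hu huS h0 h1⟩ ?_
    rintro v ⟨hvA, hv⟩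
    have hfr : ∃ᶠ w in 𝓝 v, w ∉ S ∧ P w = Q w ∧ P₁ w = Q₁ w :=
      (mem_closure_iff_frequently.1 hvA).mono fun w hw => hw.self_of_nhds.2
    -- A limit point of agreement is not a pole: `P` stays bounded near it, while `|Q|` tends to
    -- infinity at poles.
    have hvS : v ∉ S := by
      intro hvS
      have hb := (hP v hv).1.continuousAt.abs.eventually_lt continuousAt_const (lt_add_one |P v|)
      have hc : ∀ᶠ w in 𝓝 v, w ∈ Sᶜ → |P v| + 1 < |Q w| := by
        have := (hblow v hvS).eventually_gt_atTop (|P v| + 1)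
        rw [eventually_nhdsWithin_iff] at this
        filter_upwards [this] with w hw hwS
        refine hw fun h => hwS ?_
        rw [Set.mem_singleton_iff.1 h]; exact hvS
      obtain ⟨w, ⟨hwS, hwe, -⟩, hb, hc⟩ := (hfr.and_eventually (hb.and hc)).exists
      have := hc hwS
      rw [← hwe] at this
      exact lt_asymm this hb
    refine hA v hv hvS ?_ ?_
    · by_contra hne
      have := ((hP v hv).1.continuousAt.ne_iff_eventually_ne (hQ v hvS).1.continuousAt).1 hne
      obtain ⟨w, hw, hw'⟩ := (hfr.and_eventually this).exists
      exact hw' hw.2.1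
    · by_contra hne
      have := ((hP v hv).2.continuousAt.ne_iff_eventually_ne (hQ v hvS).2.continuousAt).1 hne
      obtain ⟨w, hw, hw'⟩ := (hfr.and_eventually this).exists
      exact hw' hw.2.2
  exact fun v hv => (hsub hv).self_of_nhds.2

open ComplexConjugate

/-! ### Hexagonal lattices -/

section Hexagonal

/-- The sixth root of unity `exp(πi/3)`. -/
noncomputable def zeta6 : ℂ := ⟨1 / 2, Real.sqrt 3 / 2⟩

lemma zeta6_sq : zeta6 ^ 2 = zeta6 - 1 := by
  have h : Real.sqrt 3 * Real.sqrt 3 = 3 := Real.mul_self_sqrt (by norm_num)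
  apply Complex.ext
  · simp only [zeta6, pow_two, Complex.mul_re, Complex.sub_re, Complex.one_re]
    linear_combination (-1 / 4) * h
  · simp only [zeta6, pow_two, Complex.mul_im, Complex.sub_im, Complex.one_im]
    ring

lemma conj_zeta6 : conj zeta6 = 1 - zeta6 := by
  apply Complex.ext
  · simp [zeta6]; norm_num
  · simp [zeta6]

lemma normSq_add_mul_zeta6 (m n : ℝ) : Complex.normSq (m + n * zeta6) = m ^ 2 + m * n + n ^ 2 := by
  have h : Real.sqrt 3 * Real.sqrt 3 = 3 := Real.mul_self_sqrt (by norm_num)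
  rw [Complex.normSq_apply]
  simp only [zeta6, Complex.add_re, Complex.ofReal_re, Complex.mul_re, Complex.ofReal_im,
    Complex.add_im, Complex.mul_im]
  linear_combination (n ^ 2 / 4) * h

/-- The hexagonal lattice generated by `μ` and `exp(πi/3) μ`. -/
noncomputable def hexPair (μ : ℂ) (hμ : μ ≠ 0) : PeriodPair where
  ω₁ := μ
  ω₂ := μ * zeta6
  indep := by
    rw [LinearIndependent.pair_iff]
    intro s t h
    have h1 : (s : ℂ) + t * zeta6 = 0 := by
      refine mul_left_cancel₀ hμ ?_
      simp only [Complex.real_smul] at h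
      linear_combination h
    have h2 := congrArg Complex.im h1
    have h3 := congrArg Complex.re h1
    have h4 : Real.sqrt 3 ≠ 0 := by positivity
    simp [zeta6] at h2 h3
    have ht : t = 0 := h2
    rw [ht] at h3
    exact ⟨by simpa using h3, ht⟩

variable {μ : ℂ} (hμ : μ ≠ 0)

lemma G_hexPair (n : ℕ) :
    (hexPair μ hμ).G n = ∑' x : ℤ × ℤ, ((x.1 * μ + x.2 * (μ * zeta6)) ^ n)⁻¹ := by
  rw [PeriodPair.G, ← (hexPair μ hμ).latticeEquivProd.symm.toEquiv.tsum_eq]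
  refine tsum_congr fun x => ?_
  have := (hexPair μ hμ).latticeEquiv_symm_apply x
  simp only [LinearEquiv.coe_toEquiv, this]
  rfl

lemma G_hexPair_eq_mul (n : ℕ) :
    (hexPair μ hμ).G n = (μ ^ n)⁻¹ * (hexPair 1 one_ne_zero).G n := by
  rw [G_hexPair, G_hexPair, ← tsum_mul_left]
  refine tsum_congr fun x => ?_
  rw [← mul_inv, ← mul_pow]
  congr 2; ring

/-- Multiplication by `ζ = zeta6` permutes the lattice generated by `1` and `ζ`, so `G₄ = ζ⁻⁴ G₄`;
and `ζ⁴ = -ζ` is not `1`. -/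
lemma g₂_hexPair : (hexPair μ hμ).g₂ = 0 := by
  have h1 : (hexPair 1 one_ne_zero).G 4 = (zeta6 ^ 4)⁻¹ * (hexPair 1 one_ne_zero).G 4 := by
    -- The coordinates of `ζ (m + n ζ) = -n + (m + n) ζ`.
    let e : ℤ × ℤ ≃ ℤ × ℤ :=
      ⟨fun x => (-x.2, x.1 + x.2), fun y => (y.2 + y.1, -y.1), fun x => by ext <;> simp,
        fun y => by ext <;> simp⟩
    conv_lhs => rw [G_hexPair, ← e.tsum_eq]
    rw [G_hexPair, ← tsum_mul_left]
    refine tsum_congr fun x => ?_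
    rw [← mul_inv, ← mul_pow]
    congr 2
    simp only [e, Equiv.coe_fn_mk]
    push_cast
    linear_combination -(x.2 : ℂ) * zeta6_sq
  have h4 : zeta6 ^ 4 = -zeta6 := by linear_combination (zeta6 ^ 2 + zeta6) * zeta6_sq
  have hz : zeta6 ≠ 0 := by
    intro h; have := congrArg Complex.re h; simp [zeta6] at this
  have h5 : (hexPair 1 one_ne_zero).G 4 = 0 := by
    rw [h4] at h1
    field_simp at h1
    have h6 : (zeta6 + 1) * (hexPair 1 one_ne_zero).G 4 = 0 := by linear_combination h1
    refine (mul_eq_zero.1 h6).resolve_left fun h => ?_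
    have := congrArg Complex.re h; simp [zeta6] at this; norm_num at this
  rw [PeriodPair.g₂, G_hexPair_eq_mul, h5]; simp

lemma g₃_hexPair : (hexPair μ hμ).g₃ = (μ ^ 6)⁻¹ * (hexPair 1 one_ne_zero).g₃ := by
  rw [PeriodPair.g₃, PeriodPair.g₃, G_hexPair_eq_mul]; ring

lemma conj_mem_hexPair (hμc : conj μ = μ ∨ conj μ = -μ) :
    ∀ l ∈ (hexPair μ hμ).lattice, conj l ∈ (hexPair μ hμ).lattice := by
  intro l hl
  rw [PeriodPair.mem_lattice] at hl ⊢
  obtain ⟨m, n, rfl⟩ := hl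
  simp only [hexPair, map_add, map_mul, conj_zeta6, map_intCast]
  rcases hμc with h | h
  · exact ⟨m + n, -n, by rw [h]; push_cast; ring⟩
  · exact ⟨-(m + n), n, by rw [h]; push_cast; ring⟩

/-- The squared norm of `m + n ζ` is `m² + mn + n²`, a positive integer unless `m + n ζ = 0`. -/
lemma norm_le_of_mem_hexPair {l : ℂ} (hl : l ∈ (hexPair μ hμ).lattice) (h0 : l ≠ 0) :
    ‖μ‖ ≤ ‖l‖ := by
  rw [PeriodPair.mem_lattice] at hl
  obtain ⟨m, n, rfl⟩ := hl
  have h1 : (m * (hexPair μ hμ).ω₁ + n * (hexPair μ hμ).ω₂ : ℂ)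
      = μ * (((m : ℝ) : ℂ) + ((n : ℝ) : ℂ) * zeta6) := by
    simp only [hexPair, Complex.ofReal_intCast]; ring
  rw [h1] at h0 ⊢
  rw [norm_mul]
  refine le_mul_of_one_le_right (norm_nonneg _) ?_
  have h2 := (mul_ne_zero_iff.1 h0).2
  have h3 : 0 < Complex.normSq (((m : ℝ) : ℂ) + ((n : ℝ) : ℂ) * zeta6) := Complex.normSq_pos.2 h2
  rw [← one_le_sq_iff₀ (norm_nonneg _), ← Complex.normSq_eq_norm_sq]
  rw [normSq_add_mul_zeta6] at h3 ⊢
  have h4 : (0 : ℤ) < m ^ 2 + m * n + n ^ 2 := by exact_mod_cast h3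
  have h5 : (1 : ℤ) ≤ m ^ 2 + m * n + n ^ 2 := h4
  exact_mod_cast h5

end Hexagonal

/-- `℘'` is odd and has period `T`, so its values at `T / 2` and `-T / 2` are both equal and
opposite. -/
lemma realDP_half_period {L : PeriodPair} {T : ℝ} (hT : (T : ℂ) ∈ L.lattice) :
    realDP L (T / 2) = 0 := by
  have h1 := L.derivWeierstrassP_add_coe (-((T / 2 : ℝ) : ℂ)) ⟨T, hT⟩
  rw [L.derivWeierstrassP_neg] at h1
  have h2 : (-((T / 2 : ℝ) : ℂ) + T) = ((T / 2 : ℝ) : ℂ) := by push_cast; ring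
  simp only [h2] at h1
  have h3 : L.derivWeierstrassP ((T / 2 : ℝ) : ℂ) = 0 := by linear_combination h1 / 2
  rw [realDP, h3]; rfl

/-- If `g₃ = 0`, then at the half period `1/2` both `℘'` and, by `℘'² = 4℘³`, also `℘` vanish.
Uniqueness for `P'' = 6P²` makes `℘'` zero on a real neighbourhood, although its zeros are isolated.
-/
lemma g₃_hexPair_ne_zero : (hexPair 1 one_ne_zero).g₃ ≠ 0 := by
  intro h3
  set L := hexPair 1 one_ne_zero with hLdef
  have hL := conj_mem_hexPair (μ := 1) one_ne_zero (.inl (by simp))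
  have h2 : L.g₂ = 0 := g₂_hexPair one_ne_zero
  have h1 : ((1 : ℝ) : ℂ) ∈ L.lattice := by simpa [hLdef, hexPair] using L.ω₁_mem_lattice
  have hhalf : (((1 : ℝ) / 2 : ℝ) : ℂ) ∉ L.lattice := by
    simpa [hLdef, hexPair] using L.ω₁_div_two_notMem_lattice
  have hD : realDP L (1 / 2) = 0 := realDP_half_period h1
  have hsq := realDP_sq hL h2 (c := 0) (by simpa using h3) hhalf
  rw [hD] at hsq
  have hP : realP L (1 / 2) = 0 := by
    have h : realP L (1 / 2) ^ 3 = 0 := by linear_combination -hsq / 4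
    exact pow_eq_zero_iff (by norm_num) |>.1 h
  have hopen : ∀ᶠ v : ℝ in 𝓝 (1 / 2), (v : ℂ) ∉ L.lattice :=
    Complex.continuous_ofReal.continuousAt.eventually
      (L.isClosed_lattice.isOpen_compl.mem_nhds hhalf)
  have hz := eventuallyEq_of_deriv_eq_six_mul_sq (P := realP L) (P₁ := realDP L) (Q := fun _ => 0)
    (Q₁ := fun _ => 0) (u := 1 / 2)
    (hopen.mono fun v hv => ⟨hasDerivAt_realP hv, hasDerivAt_realDP hL h2 hv⟩)
    (Filter.Eventually.of_forall fun v => ⟨hasDerivAt_const _ _, by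
      simpa using hasDerivAt_const v (0 : ℝ)⟩) hP hD
  have hne := (tendsto_coe_nhdsNE (1 / 2)).eventually
    (eventually_derivWeierstrassP_ne_zero L h2 hhalf)
  obtain ⟨v, hv, hv'⟩ := (hne.and (nhdsWithin_le_nhds hz)).exists
  refine hv ?_
  rw [← coe_realDP hL, hv'.2]; simp

/-- For every real `c ≠ 0` there is a lattice with `g₂ = 0`, `g₃ = c`, stable under conjugation. -/
theorem exists_periodPair {c : ℝ} (hc : c ≠ 0) : ∃ L : PeriodPair, L.g₂ = 0 ∧ L.g₃ = c ∧
    (∀ l ∈ L.lattice, conj l ∈ L.lattice) ∧ ∃ T : ℝ, 0 < T ∧ (T : ℂ) ∈ L.lattice ∧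
      ∀ x : ℝ, 0 < x → x ≤ T / 2 → (x : ℂ) ∉ L.lattice := by
  have hL1 := conj_mem_hexPair (μ := 1) one_ne_zero (.inl (by simp))
  obtain ⟨g, hg⟩ : ∃ g : ℝ, (hexPair 1 one_ne_zero).g₃ = g := by
    refine ⟨_, (Complex.conj_eq_iff_re.1 ?_).symm⟩
    rw [PeriodPair.g₃, map_mul, conj_G hL1, map_ofNat]
  have hg0 : g ≠ 0 := by
    rintro rfl; exact g₃_hexPair_ne_zero (by simpa using hg)
  have hroot : ∀ x : ℝ, 0 < x → ∃ r : ℝ, 0 < r ∧ r ^ 6 = x := fun x hx =>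
    ⟨x ^ (1 / 6 : ℝ), Real.rpow_pos_of_pos hx _, by
      rw [← Real.rpow_natCast, ← Real.rpow_mul hx.le]; norm_num⟩
  have hfree : ∀ (μ : ℂ) (hμ : μ ≠ 0) (T : ℝ), T / 2 < ‖μ‖ → ∀ x : ℝ, 0 < x → x ≤ T / 2 →
      (x : ℂ) ∉ (hexPair μ hμ).lattice := by
    intro μ hμ T hT x hx hxT hmem
    have := norm_le_of_mem_hexPair hμ hmem (by exact_mod_cast hx.ne')
    rw [Complex.norm_real, Real.norm_of_nonneg hx.le] at this
    linarith
  -- Since `g₃` scales with `μ⁻⁶`, one needs `μ⁶ = g / c`. Depending on the sign, `μ = i r` or `μ =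
  -- r` works; both keep the lattice stable under conjugation.
  rcases lt_or_gt_of_ne (div_ne_zero hg0 hc) with hs | hs
  · obtain ⟨r, hr, hr6⟩ := hroot (-(g / c)) (neg_pos.2 hs)
    have hμ : (r : ℂ) * Complex.I ≠ 0 := mul_ne_zero (by exact_mod_cast hr.ne') Complex.I_ne_zero
    have hn : ‖(r : ℂ) * Complex.I‖ = r := by simp [abs_of_pos hr]
    refine ⟨hexPair _ hμ, g₂_hexPair hμ, ?_, conj_mem_hexPair hμ (.inr (by simp)),
      r * Real.sqrt 3, by positivity, ?_, hfree _ hμ _ ?_⟩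
    · have h1 : ((r : ℂ) * Complex.I) ^ 6 = ((g / c : ℝ) : ℂ) := by
        have h2 : Complex.I ^ 6 = -1 := by
          rw [show (6 : ℕ) = 2 * 3 by norm_num, pow_mul, Complex.I_sq]; norm_num
        have h3 : g / c = -r ^ 6 := by linear_combination hr6
        rw [mul_pow, h2, h3]; push_cast; ring
      rw [g₃_hexPair, hg, h1]
      have : (g / c)⁻¹ * g = c := by field_simp
      exact_mod_cast this
    · rw [PeriodPair.mem_lattice]
      -- For imaginary `μ` the real period is `i r (1 - 2ζ) = r √3`. Half of it is less than `r`,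
      -- the smallest norm of a nonzero lattice point.
      refine ⟨1, -2, ?_⟩
      apply Complex.ext
      · simp [hexPair, zeta6]; ring
      · simp [hexPair, zeta6]; ring
    · rw [hn]
      have : Real.sqrt 3 < 2 := by
        rw [Real.sqrt_lt' (by norm_num)]; norm_num
      nlinarith
  · obtain ⟨r, hr, hr6⟩ := hroot (g / c) hs
    have hμ : (r : ℂ) ≠ 0 := by exact_mod_cast hr.ne'
    refine ⟨hexPair _ hμ, g₂_hexPair hμ, ?_, conj_mem_hexPair hμ (.inl (by simp)),
      r, hr, (hexPair _ hμ).ω₁_mem_lattice, hfree _ hμ _ ?_⟩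
    · have h1 : (r : ℂ) ^ 6 = ((g / c : ℝ) : ℂ) := by exact_mod_cast hr6
      rw [g₃_hexPair, hg, h1]
      have : (g / c)⁻¹ * g = c := by field_simp
      exact_mod_cast this
    · rw [Complex.norm_real, Real.norm_of_nonneg hr.le]; linarith

open ComplexConjugate

/-! ### Real solutions of `P'' = 6 P²` and sigma-functions -/

/-- A smooth solution of `P'' = 6 P²` on an interval is a Weierstrass function with `g₂ = 0`. -/
lemma exists_isWeierstrassP {I : Set ℝ} (hI : IsOpen I) (hc : Convex ℝ I) {P P₁ : ℝ → ℝ}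
    (hP : ∀ v ∈ I, HasDerivAt P (P₁ v) v ∧ HasDerivAt P₁ (6 * P v ^ 2) v) :
    ∃ c : ℝ, IsWeierstrassP I c P := by
  rcases I.eq_empty_or_nonempty with rfl | ⟨x, hx⟩
  · exact ⟨0, .inr ⟨rfl, .inr (by simp)⟩⟩
  -- The first integral `4P³ - P'²` plays the part of `g₃`.
  obtain ⟨c, hcI⟩ := exists_eq_const_of_hasDerivAt_zero hI hc
    (f := fun v => 4 * P v ^ 3 - P₁ v ^ 2) fun v hv =>
      ((((hP v hv).1.pow 3).const_mul 4).sub ((hP v hv).2.pow 2)).congr_deriv (by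
        simp only [Nat.cast_ofNat, Nat.add_one_sub_one, pow_one]; ring)
  refine ⟨c, ?_⟩
  rcases eq_or_ne c 0 with rfl | hc0
  · refine .inr ⟨rfl, ?_⟩
    by_cases hz : ∃ v ∈ I, P v = 0
    · right
      obtain ⟨v, hv, hv0⟩ := hz
      have h1 : P₁ v = 0 := by
        have := hcI v hv
        rw [hv0] at this
        exact pow_eq_zero_iff (n := 2) (by norm_num) |>.1 (by linear_combination -this)
      intro w hw
      exact (eqOn_of_deriv_eq_six_mul_sq hI hc.isPreconnected isClosed_empty hP
        (Q := fun _ => 0) (Q₁ := fun _ => 0) (fun v _ => ⟨hasDerivAt_const _ _, by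
          simpa using hasDerivAt_const v (0 : ℝ)⟩) (by simp) hv (by simp) hv0 h1 w hw).2.1
    · left
      push Not at hz
      have h1 : ∀ v ∈ I, P₁ v ≠ 0 := by
        intro v hv h
        have := hcI v hv
        rw [h] at this
        exact hz v hv (pow_eq_zero_iff (n := 3) (by norm_num) |>.1 (by linear_combination this / 4))
      -- For `P = (v - u₀)⁻²` one has `2P / P' = -(v - u₀)`, so this expression recovers the pole.
      obtain ⟨u₀, hu₀⟩ := exists_eq_const_of_hasDerivAt_zero hI hc
        (f := fun v => 2 * P v / P₁ v + v) fun v hv =>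
          ((((hP v hv).1.const_mul 2).div (hP v hv).2 (h1 v hv)).add (hasDerivAt_id v)).congr_deriv
            (by
              have := h1 v hv
              field_simp
              linear_combination -3 * hcI v hv)
      refine ⟨u₀, fun v hv => ?_⟩
      have h2 : v - u₀ = -(2 * P v / P₁ v) := by rw [← hu₀ v hv]; ring
      have h3 := h1 v hv
      have h4 := hz v hv
      refine ⟨fun h => ?_, ?_⟩
      · have h5 : 2 * P v / P₁ v ≠ 0 := div_ne_zero (mul_ne_zero two_ne_zero h4) h3
        rw [sub_eq_zero.2 h, eq_comm, neg_eq_zero] at h2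
        exact h5 h2
      · rw [h2]
        field_simp
        linear_combination P v ^ 0 * hcI v hv
  · refine .inl ⟨hc0, ?_⟩
    obtain ⟨L, h2, h3, hL, T, hT, hTL, hfree⟩ := exists_periodPair hc0
    have hsq : ∀ y : ℝ, (y : ℂ) ∉ L.lattice → realDP L y ^ 2 = 4 * realP L y ^ 3 - c := fun y hy =>
      realDP_sq hL h2 h3 hy
    -- a real point where `℘` takes the value `P x`
    obtain ⟨y, hyL, hy⟩ : ∃ y : ℝ, (y : ℂ) ∉ L.lattice ∧ realP L y = P x := by
      have hev := (tendsto_abs_realP hL (x := 0) (by simp)).eventually_gt_atTop (|P x| + |c| + 1)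
      have hlt : ∀ᶠ y : ℝ in 𝓝[>] 0, y < T / 2 :=
        nhdsWithin_le_nhds (eventually_lt_nhds (half_pos hT))
      obtain ⟨y₁, ⟨hy₁, hy₁T⟩, hy₁0⟩ := (((hev.filter_mono
        (nhdsWithin_mono (s := Set.Ioi 0) 0 fun y hy => ne_of_gt hy)).and hlt).and self_mem_nhdsWithin).exists
      have hy₁0 : 0 < y₁ := hy₁0
      have hs := hsq y₁ (hfree y₁ hy₁0 hy₁T.le)
      -- Near the pole `|℘|` is large, and `4℘³ = c + ℘'² ≥ c` excludes large negative values.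
      have hge : P x ≤ realP L y₁ := by
        rcases le_or_gt 0 (realP L y₁) with h | h
        · rw [abs_of_nonneg h] at hy₁
          linarith [le_abs_self (P x), abs_nonneg c]
        · exfalso
          rw [abs_of_neg h] at hy₁
          have h5 : 1 ≤ -realP L y₁ := by linarith [abs_nonneg (P x), abs_nonneg c]
          have h6 : |c| < -realP L y₁ := by linarith [abs_nonneg (P x)]
          have h7 : -realP L y₁ ≤ (-realP L y₁) ^ 3 := by nlinarith [sq_nonneg (realP L y₁)]
          nlinarith [neg_abs_le c, sq_nonneg (realDP L y₁)]
      -- At the half period `℘' = 0`, so `4℘³ = c ≤ c + P₁(x)² = 4P(x)³` there. The intermediate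
      -- value theorem on an interval free of poles then yields the point.
      have hle : realP L (T / 2) ≤ P x := by
        have h5 := hsq (T / 2) (hfree _ (half_pos hT) le_rfl)
        rw [realDP_half_period hTL] at h5
        have h6 : realP L (T / 2) ^ 3 ≤ P x ^ 3 := by
          nlinarith [hcI x hx, sq_nonneg (P₁ x)]
        exact (Odd.pow_le_pow (by decide)).1 h6
      have hcont : ContinuousOn (realP L) (Set.Icc y₁ (T / 2)) := fun y hy =>
        (hasDerivAt_realP (hfree y (hy₁0.trans_le hy.1) hy.2)).continuousAt.continuousWithinAt
      obtain ⟨y, hy, hyP⟩ := intermediate_value_Icc' hy₁T.le hcont ⟨hle, hge⟩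
      exact ⟨y, hfree y (hy₁0.trans_le hy.1) hy.2, hyP⟩
    obtain ⟨y, hyL, hy, hy'⟩ : ∃ y : ℝ, (y : ℂ) ∉ L.lattice ∧ realP L y = P x ∧
        realDP L y = P₁ x := by
      have h5 : realDP L y ^ 2 = P₁ x ^ 2 := by
        rw [hsq y hyL, hy, ← hcI x hx]; ring
      -- Equal values of `℘` leave the sign of `℘'` open; replacing `y` by `-y` corrects it, `℘`
      -- being even and `℘'` odd.
      rcases sq_eq_sq_iff_eq_or_eq_neg.1 h5 with h | h
      · exact ⟨y, hyL, hy, h⟩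
      · refine ⟨-y, ?_, ?_, ?_⟩
        · rw [Complex.ofReal_neg, neg_mem_iff]; exact hyL
        · rw [realP, Complex.ofReal_neg, L.weierstrassP_neg]; exact hy
        · rw [realDP, Complex.ofReal_neg, L.derivWeierstrassP_neg, Complex.neg_re]
          rw [realDP] at h
          rw [h, neg_neg]
    have hshift : ∀ v : ℝ, HasDerivAt (fun v => v - (x - y)) 1 v := fun v =>
      (hasDerivAt_id v).sub_const _
    have hxy : x - (x - y) = y := by ring
    have key := eqOn_of_deriv_eq_six_mul_sq (S := {v : ℝ | ((v - (x - y) : ℝ) : ℂ) ∈ L.lattice})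
      hI hc.isPreconnected
      (L.isClosed_lattice.preimage (Complex.continuous_ofReal.comp (continuous_sub_right _))) hP
      (Q := fun v => realP L (v - (x - y))) (Q₁ := fun v => realDP L (v - (x - y)))
      (fun v hv => ⟨(hasDerivAt_realP hv).comp_sub_const v (x - y),
        (hasDerivAt_realDP hL h2 hv).comp_sub_const v (x - y)⟩)
      (fun v hv => (tendsto_abs_realP hL hv).comp
        ((hshift v).continuousAt.continuousWithinAt.tendsto_nhdsWithin fun w hw => by
          simpa using hw)) hx
      (by simpa only [Set.mem_ofPred_eq, hxy] using hyL) (by simp only [hxy]; exact hy.symm)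
      (by simp only [hxy]; exact hy'.symm)
    refine ⟨L, x - y, h2, h3, fun v hv => ⟨(key v hv).1, ?_⟩⟩
    rw [(key v hv).2.1, coe_realP hL]

/-- Weierstrass functions with `g₂ = 0` solve `P'' = 6 P²`. -/
lemma IsWeierstrassP.deriv_eq {I : Set ℝ} (hI : IsOpen I) {P P₁ P₂ : ℝ → ℝ}
    (hP : ∀ v ∈ I, HasDerivAt P (P₁ v) v) (hP₁ : ∀ v ∈ I, HasDerivAt P₁ (P₂ v) v) {c : ℝ}
    (h : IsWeierstrassP I c P) : ∀ v ∈ I, P₂ v = 6 * P v ^ 2 := by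
  rcases h with ⟨-, L, u₀, h2, -, h⟩ | ⟨-, ⟨u₀, h⟩ | h⟩
  · have e0 : ∀ v ∈ I, P v = realP L (v - u₀) := fun v hv => by
      rw [realP, ← (h v hv).2, Complex.ofReal_re]
    have e1 : ∀ v ∈ I, P₁ v = realDP L (v - u₀) := fun v hv =>
      (hP v hv).unique (hasDerivAt_congr_of_eqOn hI e0 hv
        ((hasDerivAt_realP (h v hv).1).comp_sub_const v u₀))
    intro v hv
    refine (hP₁ v hv).unique (hasDerivAt_congr_of_eqOn hI e1 hv
      (((deriv_derivWeierstrassP L h2 (h v hv).1).real_of_complex.comp_sub_const v u₀).congr_deriv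
        ?_))
    rw [← (h v hv).2]; norm_cast
  · have e1 : ∀ v ∈ I, P₁ v = -2 / (v - u₀) ^ 3 := fun v hv => by
      have h0 : v - u₀ ≠ 0 := sub_ne_zero.2 (h v hv).1
      refine (hP v hv).unique (hasDerivAt_congr_of_eqOn hI (fun v hv => (h v hv).2) hv
        (((hasDerivAt_const v (1 : ℝ)).div (((hasDerivAt_id v).sub_const u₀).pow 2)
          (pow_ne_zero 2 h0)).congr_deriv ?_))
      simp only [id, Nat.cast_ofNat, Nat.add_one_sub_one, pow_one, Pi.pow_apply]
      field_simp
      ring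
    intro v hv
    have h0 : v - u₀ ≠ 0 := sub_ne_zero.2 (h v hv).1
    refine (hP₁ v hv).unique (hasDerivAt_congr_of_eqOn hI e1 hv
        (((hasDerivAt_const v (-2 : ℝ)).div (((hasDerivAt_id v).sub_const u₀).pow 3)
          (pow_ne_zero 3 h0)).congr_deriv ?_))
    rw [(h v hv).2]
    simp only [id, Nat.cast_ofNat, Nat.add_one_sub_one, Pi.pow_apply]
    field_simp
    ring
  · have e1 : ∀ v ∈ I, P₁ v = 0 := fun v hv =>
      (hP v hv).unique (hasDerivAt_congr_of_eqOn hI h hv (hasDerivAt_const v 0))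
    intro v hv
    rw [h v hv, (hP₁ v hv).unique (hasDerivAt_congr_of_eqOn hI e1 hv (hasDerivAt_const v 0))]
    simp

/-- The fourth order equation characterizes sigma-functions with `g₂ = 0`. -/
theorem fourth_order_iff_isSigmaFunction {I : Set ℝ} {h : ℝ → ℝ} (hI : IsOpen I)
    (hc : Convex ℝ I) (hh : ContDiffOn ℝ ∞ h I) (h0 : ∀ u ∈ I, h u ≠ 0) :
    (∀ u ∈ I, iteratedDeriv 4 h u * h u + 3 * (iteratedDeriv 2 h u) ^ 2
      - 4 * deriv h u * iteratedDeriv 3 h u = 0) ↔ IsSigmaFunction I h := by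
  have d0 := fun u hu => hasDerivAt_of_contDiffOn (u := u) hI hh hu
  have d1 := fun u hu => hasDerivAt_deriv_of_contDiffOn (u := u) hI hh hu
  have d2 := fun u hu => hasDerivAt_iteratedDeriv (u := u) hI hh 2 hu
  have d3 := fun u hu => hasDerivAt_iteratedDeriv (u := u) hI hh 3 hu
  -- `P = -(ln |h|)''` and `P₁` is its derivative. The computation of `P₁'` below shows that the
  -- fourth order expression, divided by `h²`, equals `6P² - P''`.
  let P : ℝ → ℝ := fun u => (deriv h u ^ 2 - iteratedDeriv 2 h u * h u) / h u ^ 2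
  let P₁ : ℝ → ℝ := fun u => -(iteratedDeriv 3 h u * h u ^ 2 - 3 * iteratedDeriv 2 h u * deriv h u
    * h u + 2 * deriv h u ^ 3) / h u ^ 3
  have hlog : ∀ u ∈ I, iteratedDeriv 2 (fun s => Real.log |h s|) u = -P u := by
    intro u hu
    refine iteratedDeriv_two_eq_of_eqOn hI (fun v _ => Real.log_abs (h v)) hu
      (g₁ := fun u => deriv h u / h u) (g₂ := fun u => -P u) (fun v hv => (d0 v hv).log (h0 v hv))
      (fun v hv => ((d1 v hv).div (d0 v hv) (h0 v hv)).congr_deriv ?_)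
    have := h0 v hv
    simp only [P]
    field_simp
    ring
  have hP : ∀ u ∈ I, HasDerivAt P (P₁ u) u := by
    intro u hu
    have := h0 u hu
    refine ((((d1 u hu).pow 2).sub ((d2 u hu).mul (d0 u hu))).div ((d0 u hu).pow 2)
      (pow_ne_zero 2 this)).congr_deriv ?_
    simp only [Nat.cast_ofNat, Nat.add_one_sub_one, pow_one, Pi.pow_apply, Pi.mul_apply,
      Pi.sub_apply, P₁]
    field_simp
    ring
  have hP₁ : ∀ u ∈ I, HasDerivAt P₁ (6 * P u ^ 2 - (iteratedDeriv 4 h u * h u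
      + 3 * (iteratedDeriv 2 h u) ^ 2 - 4 * deriv h u * iteratedDeriv 3 h u) / h u ^ 2) u := by
    intro u hu
    have := h0 u hu
    refine ((((((d3 u hu).mul ((d0 u hu).pow 2)).sub ((((d2 u hu).const_mul 3).mul (d1 u hu)).mul
      (d0 u hu))).add (((d1 u hu).pow 3).const_mul 2)).neg).div ((d0 u hu).pow 3)
      (pow_ne_zero 3 this)).congr_deriv ?_
    simp only [Nat.cast_ofNat, Nat.add_one_sub_one, pow_one, Pi.pow_apply, Pi.mul_apply,
      Pi.sub_apply, Pi.add_apply, Pi.neg_apply, P]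
    field_simp
    ring
  constructor
  · intro H
    obtain ⟨c, hW⟩ := exists_isWeierstrassP hI hc (P := P) (P₁ := P₁) fun v hv =>
      ⟨hP v hv, (hP₁ v hv).congr_deriv (by rw [H v hv]; simp)⟩
    exact ⟨c, P, hW, hlog⟩
  · rintro ⟨c, Q, hW, hQ⟩ u hu
    have hPQ : ∀ v ∈ I, Q v = P v := fun v hv => by
      have := hQ v hv
      rw [hlog v hv] at this
      exact (neg_injective this).symm
    have := hW.deriv_eq hI (fun v hv => hasDerivAt_congr_of_eqOn hI hPQ hv (hP v hv)) hP₁ u hu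
    rw [hPQ u hu, sub_eq_self, div_eq_zero_iff] at this
    exact this.resolve_right (pow_ne_zero 2 (h0 u hu))

/-! ### Gradients and functions on convex sets -/

section Gradient

variable {n : ℕ}

/-- `F` is differentiable at `z` with partial derivatives `d`. -/
def HasGrad (F : (Fin n → ℝ) → ℝ) (d : Fin n → ℝ) (z : Fin n → ℝ) : Prop :=
  HasFDerivAt F (∑ i, d i • ContinuousLinearMap.proj (R := ℝ) (φ := fun _ : Fin n => ℝ) i) z

variable {F G : (Fin n → ℝ) → ℝ} {d e : Fin n → ℝ} {z : Fin n → ℝ} {Ω : Set (Fin n → ℝ)}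

lemma HasGrad.pd_eq (h : HasGrad F d z) (i : Fin n) : pd i F z = d i := by
  rw [pd, h.fderiv]
  simp [Pi.single_apply]

lemma hasGrad_of_differentiableAt (h : DifferentiableAt ℝ F z) :
    HasGrad F (fun i => pd i F z) z := by
  refine h.hasFDerivAt.congr_fderiv ?_
  ext v
  rw [hasFDerivAt_eq_sum_pd]
  simp [mul_comm]

lemma hasGrad_of_contDiffOn (hΩ : IsOpen Ω) (hF : ContDiffOn ℝ ∞ F Ω) (hz : z ∈ Ω) :
    HasGrad F (fun i => pd i F z) z :=
  hasGrad_of_differentiableAt ((hF.contDiffAt (hΩ.mem_nhds hz)).differentiableAt (by simp))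

lemma HasGrad.congr_grad (h : HasGrad F d z) (he : ∀ i, d i = e i) : HasGrad F e z := by
  rwa [← funext he]

lemma HasGrad.congr_of_eqOn (hΩ : IsOpen Ω) (hFG : ∀ z ∈ Ω, F z = G z) (hz : z ∈ Ω)
    (h : HasGrad G d z) : HasGrad F d z :=
  HasFDerivAt.congr_of_eventuallyEq h (Filter.eventuallyEq_of_mem (hΩ.mem_nhds hz) hFG)

lemma hasGrad_coord (i : Fin n) (z : Fin n → ℝ) :
    HasGrad (fun z => z i) (fun j => if j = i then 1 else 0) z := by
  refine ((ContinuousLinearMap.proj (R := ℝ) (φ := fun _ : Fin n => ℝ) i).hasFDerivAt).congr_fderiv ?_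
  ext v; simp

lemma hasGrad_const (c : ℝ) (z : Fin n → ℝ) : HasGrad (fun _ => c) (fun _ => 0) z := by
  refine (hasFDerivAt_const c z).congr_fderiv ?_
  ext v; simp

lemma HasGrad.add (hF : HasGrad F d z) (hG : HasGrad G e z) :
    HasGrad (fun z => F z + G z) (fun i => d i + e i) z := by
  refine (HasFDerivAt.add hF hG).congr_fderiv ?_
  simp only [add_smul, Finset.sum_add_distrib]

lemma HasGrad.sub (hF : HasGrad F d z) (hG : HasGrad G e z) :
    HasGrad (fun z => F z - G z) (fun i => d i - e i) z := by
  refine (HasFDerivAt.sub hF hG).congr_fderiv ?_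
  rw [← Finset.sum_sub_distrib]
  exact Finset.sum_congr rfl fun i _ => (sub_smul _ _ _).symm

lemma HasGrad.mul (hF : HasGrad F d z) (hG : HasGrad G e z) :
    HasGrad (fun z => F z * G z) (fun i => d i * G z + F z * e i) z := by
  refine (HasFDerivAt.mul hF hG).congr_fderiv ?_
  simp only [Finset.smul_sum, add_smul, Finset.sum_add_distrib, smul_smul, mul_comm]
  rw [add_comm]

lemma HasGrad.const_mul (c : ℝ) (hF : HasGrad F d z) :
    HasGrad (fun z => c * F z) (fun i => c * d i) z :=
  ((hasGrad_const c z).mul hF).congr_grad fun i => by ring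

lemma HasGrad.comp {f : ℝ → ℝ} {f' : ℝ} (hf : HasDerivAt f f' (F z)) (hF : HasGrad F d z) :
    HasGrad (fun z => f (F z)) (fun i => f' * d i) z := by
  refine (HasDerivAt.comp_hasFDerivAt z hf hF).congr_fderiv ?_
  simp only [Finset.smul_sum, smul_smul]

lemma HasGrad.div (hF : HasGrad F d z) (hG : HasGrad G e z) (h0 : G z ≠ 0) :
    HasGrad (fun z => F z / G z) (fun i => (d i * G z - F z * e i) / G z ^ 2) z := by
  have h1 := hF.mul (HasGrad.comp (hasDerivAt_inv h0) hG)
  refine (h1.congr_grad fun i => ?_)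
  field_simp
  ring

lemma HasGrad.hasDerivAt_line (hF : HasGrad F d z) (v : Fin n → ℝ) :
    HasDerivAt (fun t : ℝ => F (z + t • v)) (∑ i, d i * v i) 0 := by
  have := HasFDerivAt.hasLineDerivAt hF v
  simpa [HasLineDerivAt] using this

/-- The derivative along the segment from `x` to `y` vanishes. Partial derivatives matter only in
the coordinates where the two points differ, which covers both constancy and dependence on a single
coordinate. -/
lemma eq_of_pd_mul_eq_zero (hΩ : IsOpen Ω) (hc : Convex ℝ Ω) (hF : ContDiffOn ℝ ∞ F Ω)
    {x y : Fin n → ℝ} (hx : x ∈ Ω) (hy : y ∈ Ω)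
    (h : ∀ z ∈ Ω, ∀ i, pd i F z * (y i - x i) = 0) : F x = F y := by
  have hmem : ∀ t ∈ Set.Icc (0 : ℝ) 1, x + t • (y - x) ∈ Ω := fun t ht =>
    hc.add_smul_sub_mem hx hy ht
  have hd : ∀ t ∈ Set.Icc (0 : ℝ) 1, HasDerivAt (fun t : ℝ => F (x + t • (y - x))) 0 t := by
    intro t ht
    have h1 : HasDerivAt (fun s : ℝ => F (x + t • (y - x) + s • (y - x))) 0 0 := by
      refine ((hasGrad_of_contDiffOn hΩ hF (hmem t ht)).hasDerivAt_line (y - x)).congr_deriv ?_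
      exact Finset.sum_eq_zero fun i _ => h _ (hmem t ht) i
    have h2 := HasDerivAt.comp_sub_const (x := t) (a := t)
      (f := fun s : ℝ => F (x + t • (y - x) + s • (y - x))) (f' := 0) (by rwa [sub_self])
    refine h2.congr_of_eventuallyEq (Filter.Eventually.of_forall fun s => ?_)
    simp only
    congr 1
    ext i
    simp only [Pi.add_apply, Pi.smul_apply, Pi.sub_apply, smul_eq_mul]
    ring
  have := constant_of_has_deriv_right_zero (f := fun t : ℝ => F (x + t • (y - x))) (a := 0) (b := 1)
    (fun t ht => (hd t ht).continuousAt.continuousWithinAt)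
    (fun t ht => (hd t (Set.Ico_subset_Icc_self ht)).hasDerivWithinAt) 1 (by simp)
  simpa using this.symm

lemma exists_eq_const_of_pd_zero (hΩ : IsOpen Ω) (hc : Convex ℝ Ω) (hF : ContDiffOn ℝ ∞ F Ω)
    (h : ∀ z ∈ Ω, ∀ i, pd i F z = 0) : ∃ c, ∀ z ∈ Ω, F z = c := by
  rcases Ω.eq_empty_or_nonempty with rfl | ⟨x, hx⟩
  · exact ⟨0, by simp⟩
  · exact ⟨F x, fun z hz => eq_of_pd_mul_eq_zero hΩ hc hF hz hx fun y hy i => by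
      rw [h y hy i, zero_mul]⟩

/-- The projection to a coordinate axis. -/
lemma isOpen_image_coord (hΩ : IsOpen Ω) (i : Fin n) : IsOpen ((fun z : Fin n → ℝ => z i) '' Ω) :=
  isOpenMap_eval i _ hΩ

lemma convex_image_coord (hc : Convex ℝ Ω) (i : Fin n) :
    Convex ℝ ((fun z : Fin n → ℝ => z i) '' Ω) :=
  hc.linear_image (LinearMap.proj (R := ℝ) (φ := fun _ : Fin n => ℝ) i)

/-- A function on a convex set whose partial derivatives in all other directions vanish is a
function of one coordinate. -/
lemma exists_eq_comp_coord (hΩ : IsOpen Ω) (hc : Convex ℝ Ω) (hF : ContDiffOn ℝ ∞ F Ω) (i : Fin n)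
    (h : ∀ z ∈ Ω, ∀ j, j ≠ i → pd j F z = 0) :
    ∃ f : ℝ → ℝ, ContDiffOn ℝ ∞ f ((fun z : Fin n → ℝ => z i) '' Ω) ∧
      ∀ z ∈ Ω, F z = f (z i) := by
  classical
  have hwd : ∀ x ∈ Ω, ∀ y ∈ Ω, x i = y i → F x = F y := by
    intro x hx y hy hxy
    refine eq_of_pd_mul_eq_zero hΩ hc hF hx hy fun z hz j => ?_
    rcases eq_or_ne j i with rfl | hj
    · rw [hxy, sub_self, mul_zero]
    · rw [h z hz j hj, zero_mul]
  let f : ℝ → ℝ := fun t => if ht : ∃ z ∈ Ω, z i = t then F ht.choose else 0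
  have hf : ∀ z ∈ Ω, F z = f (z i) := by
    intro z hz
    have ht : ∃ y ∈ Ω, y i = z i := ⟨z, hz, rfl⟩
    simp only [f, dif_pos ht]
    exact hwd z hz _ ht.choose_spec.1 ht.choose_spec.2.symm
  refine ⟨f, ?_, hf⟩
  rintro _ ⟨z, hz, rfl⟩
  -- Near `z i` the function `f` is the restriction of `F` to the line through `z` in direction `i`,
  -- hence smooth.
  have hl : ContDiff ℝ ∞ (fun t : ℝ => z + (t - z i) • (Pi.single i 1 : Fin n → ℝ)) := by fun_prop
  have hz0 : z + (z i - z i) • (Pi.single i 1 : Fin n → ℝ) = z := by simp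
  have h1 : ContDiffAt ℝ ∞ (fun t : ℝ => F (z + (t - z i) • (Pi.single i 1 : Fin n → ℝ))) (z i) :=
    ContDiffAt.comp (z i) (by rw [hz0]; exact hF.contDiffAt (hΩ.mem_nhds hz)) hl.contDiffAt
  refine (h1.congr_of_eventuallyEq ?_).contDiffWithinAt
  have hnear : ∀ᶠ t in 𝓝 (z i), z + (t - z i) • (Pi.single i 1 : Fin n → ℝ) ∈ Ω :=
    hl.continuous.continuousAt.eventually_mem (by rw [hz0]; exact hΩ.mem_nhds hz)
  filter_upwards [hnear] with t ht
  rw [hf _ ht]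
  simp

end Gradient

/-! ### Reduction of (2) to ordinary differential equations -/

section TwoVariables

variable {Ω : Set (Fin 2 → ℝ)} {F : (Fin 2 → ℝ) → ℝ} {g : ℝ → ℝ} {β κ k : ℝ}

/-- Partial derivatives of functions of the form `β w + e^{κ w} g(u) + k`. -/
lemma pd_of_eq_exp (hΩ : IsOpen Ω) (hg : ContDiffOn ℝ ∞ g ((fun z => z 0) '' Ω))
    (hF : ∀ z ∈ Ω, F z = β * z 1 + Real.exp (κ * z 1) * g (z 0) + k) {z : Fin 2 → ℝ} (hz : z ∈ Ω) :
    pd 0 F z = Real.exp (κ * z 1) * deriv g (z 0) ∧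
    pd 1 F z = β + κ * (Real.exp (κ * z 1) * g (z 0)) ∧
    pd 0 (pd 0 F) z = Real.exp (κ * z 1) * iteratedDeriv 2 g (z 0) ∧
    pd 1 (pd 0 F) z = κ * (Real.exp (κ * z 1) * deriv g (z 0)) ∧
    pd 1 (pd 1 F) z = κ * (κ * (Real.exp (κ * z 1) * g (z 0))) := by
  have hJ := isOpen_image_coord hΩ 0
  have key : ∀ {f : ℝ → ℝ} {f' : ℝ} {z : Fin 2 → ℝ}, HasDerivAt f f' (z 0) →
      HasGrad (fun z => Real.exp (κ * z 1) * f (z 0))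
        ![Real.exp (κ * z 1) * f', κ * (Real.exp (κ * z 1) * f (z 0))] z := by
    intro f f' z hf
    have h1 : HasGrad (fun z : Fin 2 → ℝ => Real.exp (κ * z 1)) _ z :=
      HasGrad.comp (Real.hasDerivAt_exp _) ((hasGrad_coord 1 z).const_mul κ)
    refine (h1.mul (HasGrad.comp hf (hasGrad_coord 0 z))).congr_grad fun i => ?_
    fin_cases i
    · simp
    · simp; ring
  have hg1 := fun (z : Fin 2 → ℝ) (hz : z ∈ Ω) =>
    hasDerivAt_of_contDiffOn hJ hg (Set.mem_image_of_mem _ hz)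
  have hg2 := fun (z : Fin 2 → ℝ) (hz : z ∈ Ω) =>
    hasDerivAt_deriv_of_contDiffOn hJ hg (Set.mem_image_of_mem _ hz)
  have e : ∀ z ∈ Ω, HasGrad F ![Real.exp (κ * z 1) * deriv g (z 0),
      β + κ * (Real.exp (κ * z 1) * g (z 0))] z := fun z hz =>
    ((((hasGrad_coord 1 z).const_mul β).add (key (hg1 z hz))).add
      (hasGrad_const k z)).congr_of_eqOn hΩ hF hz |>.congr_grad fun i => by
        fin_cases i <;> simp
  have e0 : ∀ z ∈ Ω, pd 0 F z = Real.exp (κ * z 1) * deriv g (z 0) := fun z hz => (e z hz).pd_eq 0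
  have e1 : ∀ z ∈ Ω, pd 1 F z = β + κ * (Real.exp (κ * z 1) * g (z 0)) := fun z hz =>
    (e z hz).pd_eq 1
  have e00 := (key (hg2 z hz)).congr_of_eqOn hΩ e0 hz
  have e11 := ((hasGrad_const β z).add ((key (hg1 z hz)).const_mul κ)).congr_of_eqOn hΩ e1 hz
  exact ⟨e0 z hz, e1 z hz, e00.pd_eq 0, e00.pd_eq 1, by rw [e11.pd_eq 1]; simp⟩

variable {φ ψ η : (Fin 2 → ℝ) → ℝ} {f h : ℝ → ℝ} {α l : ℝ}

/-- The conditions contain `φ` and `ψ` only through derivatives, so the additive constants drop out.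
The factors `κ` and `κ²` are those by which `f` and `g` change when `w` is rescaled to `κw`. -/
lemma nonsymInt_exp_iff (hΩ : IsOpen Ω) (hκ : κ ≠ 0)
    (hg : ContDiffOn ℝ ∞ g ((fun z => z 0) '' Ω)) (hf : ContDiffOn ℝ ∞ f ((fun z => z 0) '' Ω))
    (hh : ContDiffOn ℝ ∞ h ((fun z => z 0) '' Ω)) (hh0 : ∀ z ∈ Ω, h (z 0) ≠ 0)
    (hφ : ∀ z ∈ Ω, φ z = Real.exp (κ * z 1) * g (z 0) + k)
    (hψ : ∀ z ∈ Ω, ψ z = Real.exp (κ * z 1) * f (z 0) + l)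
    (hη : ∀ z ∈ Ω, η z = Real.exp (κ * z 1) * h (z 0)) :
    NonsymInt Ω φ ψ η ↔
      ExpSystem ((fun z => z 0) '' Ω) (fun u => κ * f u) (fun u => κ ^ 2 * g u) h := by
  have hJ := isOpen_image_coord hΩ 0
  rw [ExpSystem, Set.forall_mem_image]
  refine forall₂_congr fun z hz => ?_
  obtain ⟨a1, a2, a3, a4, a5⟩ := pd_of_eq_exp (F := φ) (β := 0) (k := k) (κ := κ) hΩ hg
    (fun z hz => by rw [hφ z hz]; ring) hz
  obtain ⟨b1, b2, b3, b4, b5⟩ := pd_of_eq_exp (F := ψ) (β := 0) (k := l) (κ := κ) hΩ hf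
    (fun z hz => by rw [hψ z hz]; ring) hz
  obtain ⟨c1, c2, c3, c4, c5⟩ := pd_of_eq_exp (F := η) (β := 0) (k := 0) (κ := κ) hΩ hh
    (fun z hz => by rw [hη z hz]; ring) hz
  have hJz := Set.mem_image_of_mem (fun z : Fin 2 → ℝ => z 0) hz
  rw [a1, a2, a3, a4, a5, b1, b2, b3, b4, b5, c1, c2, c3, c4, c5, hη z hz,
    ((hasDerivAt_of_contDiffOn hJ hf hJz).const_mul κ).deriv,
    ((hasDerivAt_of_contDiffOn hJ hg hJz).const_mul (κ ^ 2)).deriv,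
    iteratedDeriv_two_eq_of_eqOn hJ (fun _ _ => rfl) hJz
      (fun v hv => (hasDerivAt_of_contDiffOn hJ hf hv).const_mul κ)
      (fun v hv => (hasDerivAt_deriv_of_contDiffOn hJ hf hv).const_mul κ),
    iteratedDeriv_two_eq_of_eqOn hJ (fun _ _ => rfl) hJz
      (fun v hv => (hasDerivAt_of_contDiffOn hJ hg hv).const_mul (κ ^ 2))
      (fun v hv => (hasDerivAt_deriv_of_contDiffOn hJ hg hv).const_mul (κ ^ 2))]
  have hE : Real.exp (κ * z 1) ≠ 0 := (Real.exp_pos _).ne'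
  have hH := hh0 z hz
  generalize Real.exp (κ * z 1) = E at *
  generalize h (z 0) = H at *
  simp only [zero_add]
  field_simp
  constructor
  · rintro ⟨h1, -, -, h2, -, -, h3, -, -⟩
    exact ⟨by linear_combination h3, by linear_combination h1, by linear_combination h2⟩
  · rintro ⟨h3, h1, h2⟩
    exact ⟨by linear_combination h1, trivial, trivial, by linear_combination h2, trivial, trivial,
      by linear_combination h3, trivial, trivial⟩

/-- The case `κ = 0` of `pd_of_eq_exp`: since `η_w = 0`, all conditions on derivatives with respect
to `w` hold trivially. -/
lemma nonsymInt_linear_iff (hΩ : IsOpen Ω)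
    (hg : ContDiffOn ℝ ∞ g ((fun z => z 0) '' Ω)) (hf : ContDiffOn ℝ ∞ f ((fun z => z 0) '' Ω))
    (hh : ContDiffOn ℝ ∞ h ((fun z => z 0) '' Ω)) (hh0 : ∀ z ∈ Ω, h (z 0) ≠ 0)
    (hφ : ∀ z ∈ Ω, φ z = β * z 1 + g (z 0)) (hψ : ∀ z ∈ Ω, ψ z = α * z 1 + f (z 0))
    (hη : ∀ z ∈ Ω, η z = h (z 0)) :
    NonsymInt Ω φ ψ η ↔ ∀ u ∈ (fun z : Fin 2 → ℝ => z 0) '' Ω,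
      iteratedDeriv 2 g u * h u = -(β ^ 2 + β * deriv f u - 2 * α * deriv g u) ∧
      iteratedDeriv 2 f u * h u = -(α * β) + α * deriv f u - 2 * β * deriv h u ∧
      iteratedDeriv 2 h u = 0 := by
  rw [Set.forall_mem_image]
  refine forall₂_congr fun z hz => ?_
  obtain ⟨a1, a2, a3, a4, a5⟩ := pd_of_eq_exp (F := φ) (β := β) (k := 0) (κ := 0) hΩ hg
    (fun z hz => by rw [hφ z hz]; simp) hz
  obtain ⟨b1, b2, b3, b4, b5⟩ := pd_of_eq_exp (F := ψ) (β := α) (k := 0) (κ := 0) hΩ hf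
    (fun z hz => by rw [hψ z hz]; simp) hz
  obtain ⟨c1, c2, c3, c4, c5⟩ := pd_of_eq_exp (F := η) (β := 0) (k := 0) (κ := 0) hΩ hh
    (fun z hz => by rw [hη z hz]; simp) hz
  rw [a1, a2, a3, a4, a5, b1, b2, b3, b4, b5, c1, c2, c3, c4, c5, hη z hz]
  have hH := hh0 z hz
  generalize h (z 0) = H at *
  simp only [zero_mul, Real.exp_zero, one_mul, add_zero, mul_zero, neg_zero, zero_div]
  field_simp
  constructor
  · rintro ⟨h1, -, -, h2, -, -, h3, -, -⟩
    exact ⟨by linear_combination h1, by linear_combination h2, by linear_combination h3⟩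
  · rintro ⟨h1, h2, h3⟩
    exact ⟨by linear_combination h1, trivial, trivial, by linear_combination h2, trivial, trivial,
      by linear_combination h3, trivial, by simp⟩

end TwoVariables

/-! ### Invariance of the integrability conditions -/

section Transformations

variable {Ω : Set (Fin 2 → ℝ)} {φ ψ η φ' ψ' η' : (Fin 2 → ℝ) → ℝ}

lemma pd_linear_combination {n : ℕ} {Ω : Set (Fin n → ℝ)} (hΩ : IsOpen Ω)
    {F F₁ F₂ F₃ : (Fin n → ℝ) → ℝ} {c₁ c₂ c₃ k : ℝ} (h₁ : ContDiffOn ℝ ∞ F₁ Ω)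
    (h₂ : ContDiffOn ℝ ∞ F₂ Ω) (h₃ : ContDiffOn ℝ ∞ F₃ Ω)
    (hF : ∀ z ∈ Ω, F z = c₁ * F₁ z + c₂ * F₂ z + c₃ * F₃ z + k) (i : Fin n) :
    ∀ z ∈ Ω, pd i F z = c₁ * pd i F₁ z + c₂ * pd i F₂ z + c₃ * pd i F₃ z + 0 := fun z hz =>
  (HasGrad.congr_of_eqOn hΩ hF hz ((((hasGrad_of_contDiffOn hΩ h₁ hz).const_mul c₁).add
    ((hasGrad_of_contDiffOn hΩ h₂ hz).const_mul c₂)).add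
    ((hasGrad_of_contDiffOn hΩ h₃ hz).const_mul c₃) |>.add (hasGrad_const k z))).pd_eq i

namespace NonsymTransformation

variable (T : NonsymTransformation)

/-- The inverse of the action on `(u, w)`. -/
noncomputable def invMap (z : Fin 2 → ℝ) : Fin 2 → ℝ :=
  ![(z 0 - T.b) / T.a, (z 1 - T.c) * T.q / (T.a * T.p) - T.s * ((z 0 - T.b) / T.a)]

lemma invMap_map (z : Fin 2 → ℝ) : T.invMap (T.map z) = z := by
  have h1 := T.a_ne
  have h2 := T.p_ne
  have h3 := T.q_ne
  ext i
  fin_cases i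
  · simp [invMap, map, h1]
  · simp only [invMap, map, Fin.mk_one, Matrix.cons_val_one, Matrix.cons_val_zero]
    field_simp
    ring

lemma map_invMap (z : Fin 2 → ℝ) : T.map (T.invMap z) = z := by
  have h1 := T.a_ne
  have h2 := T.p_ne
  have h3 := T.q_ne
  ext i
  fin_cases i
  · simp only [invMap, map, Fin.zero_eta, Matrix.cons_val_zero]
    field_simp
    ring
  · simp only [invMap, map, Fin.mk_one, Matrix.cons_val_one, Matrix.cons_val_zero]
    field_simp
    ring

lemma contDiff_map : ContDiff ℝ ∞ T.map := by
  refine contDiff_pi.2 fun i => ?_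
  fin_cases i
  · simp only [map, Fin.zero_eta, Matrix.cons_val_zero]; fun_prop
  · simp only [map, Fin.mk_one, Matrix.cons_val_one, Matrix.cons_val_zero]; fun_prop

lemma contDiff_invMap : ContDiff ℝ ∞ T.invMap := by
  refine contDiff_pi.2 fun i => ?_
  fin_cases i
  · simp only [invMap, Fin.zero_eta, Matrix.cons_val_zero]; fun_prop
  · simp only [invMap, Fin.mk_one, Matrix.cons_val_one, Matrix.cons_val_zero]; fun_prop

lemma image_map (Ω : Set (Fin 2 → ℝ)) : T.map '' Ω = T.invMap ⁻¹' Ω :=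
  congrFun (Set.image_eq_preimage_of_inverse T.invMap_map T.map_invMap) Ω

lemma isOpen_image_map (hΩ : IsOpen Ω) : IsOpen (T.map '' Ω) := by
  rw [image_map]; exact hΩ.preimage T.contDiff_invMap.continuous

lemma invMap_mem {z : Fin 2 → ℝ} (hz : z ∈ T.map '' Ω) : T.invMap z ∈ Ω := by
  rwa [image_map] at hz

lemma contDiffOn_comp_invMap (hφ : ContDiffOn ℝ ∞ φ Ω) :
    ContDiffOn ℝ ∞ (fun z => φ (T.invMap z)) (T.map '' Ω) :=
  hφ.comp T.contDiff_invMap.contDiffOn fun _ hz => T.invMap_mem hz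

lemma contDiffOn_comp_map (hφ : ContDiffOn ℝ ∞ φ (T.map '' Ω)) :
    ContDiffOn ℝ ∞ (fun z => φ (T.map z)) Ω :=
  hφ.comp T.contDiff_map.contDiffOn fun _ hz => Set.mem_image_of_mem _ hz

lemma Carries.contDiffOn {T : NonsymTransformation} (h : T.Carries Ω φ ψ η φ' ψ' η')
    (hφ : ContDiffOn ℝ ∞ φ Ω) (hψ : ContDiffOn ℝ ∞ ψ Ω) (hη : ContDiffOn ℝ ∞ η Ω) :
    ContDiffOn ℝ ∞ φ' (T.map '' Ω) ∧ ContDiffOn ℝ ∞ ψ' (T.map '' Ω) ∧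
      ContDiffOn ℝ ∞ η' (T.map '' Ω) := by
  have hφ := T.contDiffOn_comp_invMap hφ
  have hψ := T.contDiffOn_comp_invMap hψ
  have hη := T.contDiffOn_comp_invMap hη
  have hc := fun z hz => h (T.invMap z) (T.invMap_mem (z := z) hz)
  simp only [map_invMap] at hc
  refine ⟨ContDiffOn.congr ?_ fun z hz => (hc z hz).1,
    ContDiffOn.congr ?_ fun z hz => (hc z hz).2.1, ContDiffOn.congr ?_ fun z hz => (hc z hz).2.2⟩
  · exact ((contDiffOn_const.mul ((hφ.sub (contDiffOn_const.mul hψ)).add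
      (contDiffOn_const.mul hη))).sub contDiffOn_const).div_const _
  · exact ((contDiffOn_const.mul (hψ.sub (contDiffOn_const.mul hη))).sub contDiffOn_const).div_const _
  · exact contDiffOn_const.mul hη

lemma pd_comp_map (hΩ : IsOpen Ω) (hF : ContDiffOn ℝ ∞ φ (T.map '' Ω)) :
    (∀ z ∈ Ω, pd 0 (fun z => φ (T.map z)) z = T.a * pd 0 φ (T.map z)
      + T.a * (T.p / T.q) * T.s * pd 1 φ (T.map z) + 0 * φ (T.map z) + 0) ∧
    ∀ z ∈ Ω, pd 1 (fun z => φ (T.map z)) z = 0 * pd 0 φ (T.map z)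
      + T.a * (T.p / T.q) * pd 1 φ (T.map z) + 0 * φ (T.map z) + 0 := by
  have key : ∀ z ∈ Ω, ∀ c, pd c (fun z => φ (T.map z)) z
      = ∑ j, pd c (fun z => T.map z j) z * pd j φ (T.map z) := fun z hz c =>
    pd_comp ((hF.contDiffAt ((T.isOpen_image_map hΩ).mem_nhds
      (Set.mem_image_of_mem _ hz))).differentiableAt (by simp))
      (T.contDiff_map.differentiable (by simp) z) c
  have e0 : ∀ z c, pd c (fun z => T.map z 0) z = if c = 0 then T.a else 0 := fun z c => by
    have h1 := ((hasGrad_coord 0 z).const_mul T.a).add (hasGrad_const T.b z)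
    exact (h1.pd_eq c).trans (by simp)
  have e1 : ∀ z c, pd c (fun z => T.map z 1) z
      = T.a * (T.p / T.q) * ((if c = 1 then 1 else 0) + T.s * if c = 0 then 1 else 0) := fun z c => by
    have h1 := (((hasGrad_coord 1 z).add ((hasGrad_coord 0 z).const_mul T.s)).const_mul
      (T.a * (T.p / T.q))).add (hasGrad_const T.c z)
    exact (h1.pd_eq c).trans (by simp)
  constructor
  · intro z hz
    rw [key z hz, Fin.sum_univ_two, e0, e1]; simp
  · intro z hz
    rw [key z hz, Fin.sum_univ_two, e0, e1]; simp

lemma pd_pd_comp_map (hΩ : IsOpen Ω) (hF : ContDiffOn ℝ ∞ φ (T.map '' Ω)) {z : Fin 2 → ℝ}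
    (hz : z ∈ Ω) :
    pd 0 (pd 0 (fun z => φ (T.map z))) z = T.a ^ 2 * (pd 0 (pd 0 φ) (T.map z)
      + 2 * (T.p / T.q) * T.s * pd 1 (pd 0 φ) (T.map z)
      + (T.p / T.q) ^ 2 * T.s ^ 2 * pd 1 (pd 1 φ) (T.map z)) ∧
    pd 1 (pd 0 (fun z => φ (T.map z))) z = T.a ^ 2 * (T.p / T.q) * (pd 1 (pd 0 φ) (T.map z)
      + (T.p / T.q) * T.s * pd 1 (pd 1 φ) (T.map z)) ∧
    pd 1 (pd 1 (fun z => φ (T.map z))) z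
      = T.a ^ 2 * (T.p / T.q) ^ 2 * pd 1 (pd 1 φ) (T.map z) := by
  obtain ⟨h0, h1⟩ := T.pd_comp_map hΩ hF
  have hTΩ := T.isOpen_image_map hΩ
  have hp0 := contDiffOn_pd hTΩ hF 0
  have hp1 := contDiffOn_pd hTΩ hF 1
  have e00 := pd_linear_combination hΩ (T.contDiffOn_comp_map hp0) (T.contDiffOn_comp_map hp1)
    (T.contDiffOn_comp_map hF) h0
  have e11 := pd_linear_combination hΩ (T.contDiffOn_comp_map hp0) (T.contDiffOn_comp_map hp1)
    (T.contDiffOn_comp_map hF) h1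
  obtain ⟨h00, h01⟩ := T.pd_comp_map hΩ hp0
  obtain ⟨h10, h11⟩ := T.pd_comp_map hΩ hp1
  have hcm := pd_comm hTΩ hF 0 1 (Set.mem_image_of_mem T.map hz)
  refine ⟨?_, ?_, ?_⟩
  · rw [e00 0 z hz, h00 z hz, h10 z hz, hcm]; ring
  · rw [e00 1 z hz, h01 z hz, h11 z hz]; ring
  · rw [e11 1 z hz, h01 z hz, h11 z hz]; ring

end NonsymTransformation

/-- The old coefficients are constant linear combinations of the new ones composed with an affine
map, plus constants; the chain rule reduces the claim to rational identities. It transports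
integrability from the normal forms back to the given system. -/
lemma nonsymInt_of_carries {T : NonsymTransformation} (hΩ : IsOpen Ω) (hφ : ContDiffOn ℝ ∞ φ Ω)
    (hψ : ContDiffOn ℝ ∞ ψ Ω) (hη : ContDiffOn ℝ ∞ η Ω) (hη0 : ∀ z ∈ Ω, η z ≠ 0)
    (h : T.Carries Ω φ ψ η φ' ψ' η') (H : NonsymInt (T.map '' Ω) φ' ψ' η') :
    NonsymInt Ω φ ψ η := by
  obtain ⟨hφ', hψ', hη'⟩ := h.contDiffOn hφ hψ hη
  have h1 := T.a_ne
  have h2 := T.p_ne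
  have h3 := T.q_ne
  have h4 := T.r_ne
  have cη : ∀ z ∈ Ω, η z = 0 * φ' (T.map z) + 0 * ψ' (T.map z)
      + T.p * T.r / T.q ^ 2 * η' (T.map z) + 0 := fun z hz => by
    rw [(h z hz).2.2]; field_simp; ring
  have cψ : ∀ z ∈ Ω, ψ z = 0 * φ' (T.map z) + T.r / T.q * ψ' (T.map z)
      + 2 * T.s * (T.p * T.r / T.q ^ 2) * η' (T.map z) + T.k₂ / T.q := fun z hz => by
    rw [(h z hz).2.2, (h z hz).2.1]; field_simp; ring
  have cφ : ∀ z ∈ Ω, φ z = T.r / T.p * φ' (T.map z) + T.s * (T.r / T.q) * ψ' (T.map z)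
      + T.s ^ 2 * (T.p * T.r / T.q ^ 2) * η' (T.map z) + (T.k₁ / T.p + T.s * (T.k₂ / T.q)) :=
    fun z hz => by
    rw [(h z hz).2.2, (h z hz).2.1, (h z hz).1]; field_simp; ring
  have sφ := T.contDiffOn_comp_map hφ'
  have sψ := T.contDiffOn_comp_map hψ'
  have sη := T.contDiffOn_comp_map hη'
  intro z hz
  have hTz := Set.mem_image_of_mem T.map hz
  have hη0' : η' (T.map z) ≠ 0 := by
    rw [(h z hz).2.2]
    exact mul_ne_zero (div_ne_zero (pow_ne_zero 2 h3) (mul_ne_zero h2 h4)) (hη0 z hz)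
  have key : ∀ {F : (Fin 2 → ℝ) → ℝ} {c₁ c₂ c₃ k : ℝ}, (∀ z ∈ Ω, F z = c₁ * φ' (T.map z)
      + c₂ * ψ' (T.map z) + c₃ * η' (T.map z) + k) → ∀ i j,
      pd i F z = c₁ * pd i (fun z => φ' (T.map z)) z + c₂ * pd i (fun z => ψ' (T.map z)) z
        + c₃ * pd i (fun z => η' (T.map z)) z + 0 ∧
      pd j (pd i F) z = c₁ * pd j (pd i (fun z => φ' (T.map z))) z
        + c₂ * pd j (pd i (fun z => ψ' (T.map z))) z
        + c₃ * pd j (pd i (fun z => η' (T.map z))) z + 0 := fun hF i j =>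
    have e := pd_linear_combination hΩ sφ sψ sη hF i
    ⟨e z hz, pd_linear_combination hΩ (contDiffOn_pd hΩ sφ i) (contDiffOn_pd hΩ sψ i)
      (contDiffOn_pd hΩ sη i) e j z hz⟩
  obtain ⟨e1, e2, e3, e4, e5, e6, e7, e8, e9⟩ := H _ hTz
  rw [(key cφ 0 0).1, (key cφ 1 0).1, (key cψ 0 0).1, (key cψ 1 0).1, (key cη 0 0).1,
    (key cη 1 0).1, (key cφ 0 0).2, (key cφ 0 1).2, (key cφ 1 1).2, (key cψ 0 0).2, (key cψ 0 1).2,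
    (key cψ 1 1).2, (key cη 0 0).2, (key cη 0 1).2, (key cη 1 1).2, cη z hz,
    (T.pd_comp_map hΩ hφ').1 z hz, (T.pd_comp_map hΩ hφ').2 z hz,
    (T.pd_comp_map hΩ hψ').1 z hz, (T.pd_comp_map hΩ hψ').2 z hz,
    (T.pd_comp_map hΩ hη').1 z hz, (T.pd_comp_map hΩ hη').2 z hz,
    (T.pd_pd_comp_map hΩ hφ' hz).1, (T.pd_pd_comp_map hΩ hφ' hz).2.1,
    (T.pd_pd_comp_map hΩ hφ' hz).2.2,
    (T.pd_pd_comp_map hΩ hψ' hz).1, (T.pd_pd_comp_map hΩ hψ' hz).2.1,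
    (T.pd_pd_comp_map hΩ hψ' hz).2.2,
    (T.pd_pd_comp_map hΩ hη' hz).1, (T.pd_pd_comp_map hΩ hη' hz).2.1,
    (T.pd_pd_comp_map hΩ hη' hz).2.2, e1, e2, e3, e4, e5, e6, e7, e8, e9]
  generalize pd 0 φ' (T.map z) = φ0
  generalize pd 1 φ' (T.map z) = φ1
  generalize pd 0 ψ' (T.map z) = ψ0
  generalize pd 1 ψ' (T.map z) = ψ1
  generalize pd 0 η' (T.map z) = η0
  generalize pd 1 η' (T.map z) = η1
  generalize η' (T.map z) = e at hη0' ⊢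
  clear * - h1 h2 h3 h4 hη0'
  generalize T.a = a at *
  generalize T.p = p at *
  generalize T.q = q at *
  generalize T.r = r at *
  generalize T.s = s
  refine ⟨?_, ?_, ?_, ?_, ?_, ?_, ?_, ?_, ?_⟩ <;>
  · simp only [zero_mul, zero_add, add_zero]
    field_simp <;> ring

end Transformations

/-! ### The normal forms solve the integrability conditions -/

section Families

variable {Ω : Set (Fin 2 → ℝ)} {φ ψ η : (Fin 2 → ℝ) → ℝ}

lemma hasDerivAt_mul_left (c u : ℝ) : HasDerivAt (fun u => c * u) c u := by
  simpa using (hasDerivAt_id u).const_mul c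

/-- The common form of all families in which `η` is affine in `u`; two linear equations for `f` and
`g` remain to be checked. -/
lemma nonsymInt_of_hasDerivAt {α β c₀ c₁ : ℝ} {f f₁ f₂ g g₁ g₂ : ℝ → ℝ} (hΩ : IsOpen Ω)
    (hη0 : ∀ z ∈ Ω, η z ≠ 0)
    (hg : ContDiffOn ℝ ∞ g ((fun z => z 0) '' Ω)) (hf : ContDiffOn ℝ ∞ f ((fun z => z 0) '' Ω))
    (hc : HasCoeffs Ω φ ψ η (fun u w => β * w + g u) (fun u w => α * w + f u)
      (fun u _ => c₀ + c₁ * u))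
    (hd : ∀ u ∈ (fun z : Fin 2 → ℝ => z 0) '' Ω, HasDerivAt f (f₁ u) u ∧ HasDerivAt f₁ (f₂ u) u ∧
      HasDerivAt g (g₁ u) u ∧ HasDerivAt g₁ (g₂ u) u ∧
      g₂ u * (c₀ + c₁ * u) = -(β ^ 2 + β * f₁ u - 2 * α * g₁ u) ∧
      f₂ u * (c₀ + c₁ * u) = -(α * β) + α * f₁ u - 2 * β * c₁) : NonsymInt Ω φ ψ η := by
  have hJ := isOpen_image_coord hΩ 0
  have hh : ∀ u ∈ (fun z : Fin 2 → ℝ => z 0) '' Ω, HasDerivAt (fun u => c₀ + c₁ * u) c₁ u :=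
    fun u _ => (hasDerivAt_mul_left c₁ u).const_add c₀
  rw [nonsymInt_linear_iff (h := fun u => c₀ + c₁ * u) hΩ hg hf (by fun_prop)
    (fun z hz h0 => hη0 z hz ((hc z hz).2.2.trans h0)) (fun z hz => (hc z hz).1)
    (fun z hz => (hc z hz).2.1) (fun z hz => (hc z hz).2.2)]
  intro u hu
  obtain ⟨h1, h2, h3, h4, h5, h6⟩ := hd u hu
  rw [iteratedDeriv_two_eq_of_eqOn hJ (fun _ _ => rfl) hu (fun v hv => (hd v hv).1)
      (fun v hv => (hd v hv).2.1), h1.deriv,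
    iteratedDeriv_two_eq_of_eqOn hJ (fun _ _ => rfl) hu (fun v hv => (hd v hv).2.2.1)
      (fun v hv => (hd v hv).2.2.2.1), h3.deriv, (hh u hu).deriv,
    iteratedDeriv_two_eq_of_eqOn hJ (fun _ _ => rfl) hu hh fun v _ => hasDerivAt_const v c₁]
  exact ⟨h5, h6, rfl⟩

lemma PolynomialFamily.nonsymInt (hΩ : IsOpen Ω) (hη0 : ∀ z ∈ Ω, η z ≠ 0)
    (h : PolynomialFamily Ω φ ψ η) : NonsymInt Ω φ ψ η := by
  obtain ⟨β, γ, δ, h⟩ := h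
  refine nonsymInt_of_hasDerivAt (α := 0) (β := β) (c₀ := 1) (c₁ := 0) (f := fun u => γ * u)
    (f₁ := fun _ => γ) (f₂ := fun _ => 0)
    (g := fun u => -(1 / 2 * β * (β + γ) * u ^ 2) + δ * u)
    (g₁ := fun u => -(β * (β + γ)) * u + δ) (g₂ := fun _ => -(β * (β + γ)))
    hΩ hη0 (by fun_prop) (by fun_prop)
    (fun z hz => ⟨by rw [(h z hz).1]; ring, by rw [(h z hz).2.1]; ring,
      by rw [(h z hz).2.2]; ring⟩) fun u _ => ⟨hasDerivAt_mul_left γ u, hasDerivAt_const u γ,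
      ((((hasDerivAt_pow 2 u).const_mul _).neg).add (hasDerivAt_mul_left δ u)).congr_deriv
        (by simp; ring), (hasDerivAt_mul_left _ u).add_const δ, by ring, by ring⟩

lemma ExponentialFamily.nonsymInt (hΩ : IsOpen Ω) (hη0 : ∀ z ∈ Ω, η z ≠ 0)
    (h : ExponentialFamily Ω φ ψ η) : NonsymInt Ω φ ψ η := by
  obtain ⟨α, γ, δ, -, h⟩ := h
  have hd : ∀ γ α u : ℝ, HasDerivAt (fun u => γ * Real.exp (α * u)) (γ * α * Real.exp (α * u)) u :=
    fun γ α u => ((hasDerivAt_mul_left α u).exp.const_mul γ).congr_deriv (by ring)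
  exact nonsymInt_of_hasDerivAt (α := α) (β := 0) (c₀ := 1) (c₁ := 0)
    (f := fun u => γ * Real.exp (α * u)) (g := fun u => δ * Real.exp (2 * α * u))
    hΩ hη0 (by fun_prop) (by fun_prop)
    (fun z hz => ⟨by rw [(h z hz).1]; ring, by rw [(h z hz).2.1],
      by rw [(h z hz).2.2]; ring⟩) fun u _ => ⟨hd _ _ u, hd _ _ u, hd _ _ u, hd _ _ u,
        by ring, by ring⟩

lemma hasDerivAt_mul_rpow (c a : ℝ) {u : ℝ} (hu : 0 < u) :
    HasDerivAt (fun u => c * u ^ a) (c * a * u ^ (a - 1)) u :=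
  ((Real.hasDerivAt_rpow_const (.inl hu.ne')).const_mul c).congr_deriv (by ring)

lemma contDiffOn_mul_rpow {J : Set ℝ} (hJ : ∀ u ∈ J, 0 < u) (c a : ℝ) :
    ContDiffOn ℝ ∞ (fun u => c * u ^ a) J :=
  contDiffOn_const.mul (contDiffOn_id.rpow_const_of_ne fun u hu => (hJ u hu).ne')

lemma contDiffOn_mul_log {J : Set ℝ} (hJ : ∀ u ∈ J, 0 < u) (c : ℝ) :
    ContDiffOn ℝ ∞ (fun u => c * Real.log u) J :=
  contDiffOn_const.mul (contDiffOn_id.log fun u hu => (hJ u hu).ne')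

lemma hasDerivAt_mul_log (c : ℝ) {u : ℝ} (hu : 0 < u) :
    HasDerivAt (fun u => c * Real.log u) (c * u ^ (-1 : ℝ)) u :=
  ((Real.hasDerivAt_log hu.ne').const_mul c).congr_deriv (by rw [Real.rpow_neg_one])

lemma PowerFamily.nonsymInt (hΩ : IsOpen Ω) (hη0 : ∀ z ∈ Ω, η z ≠ 0)
    (h : PowerFamily Ω φ ψ η) : NonsymInt Ω φ ψ η := by
  obtain ⟨h0, α, γ, δ, -, -, -, h⟩ := h
  have hJ : ∀ u ∈ (fun z : Fin 2 → ℝ => z 0) '' Ω, 0 < u := Set.forall_mem_image.2 h0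
  refine nonsymInt_of_hasDerivAt (α := α) (β := 0) (c₀ := 0) (c₁ := 1) hΩ hη0
    (contDiffOn_mul_rpow hJ δ (2 * α + 1)) (contDiffOn_mul_rpow hJ γ (α + 1))
    (fun z hz => ⟨by rw [(h z hz).1]; ring, by rw [(h z hz).2.1],
      by rw [(h z hz).2.2]; ring⟩) fun u hu => ⟨hasDerivAt_mul_rpow _ _ (hJ u hu),
        hasDerivAt_mul_rpow _ _ (hJ u hu), hasDerivAt_mul_rpow _ _ (hJ u hu),
        hasDerivAt_mul_rpow _ _ (hJ u hu), ?_, ?_⟩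
  · rw [Real.rpow_sub_one (hJ u hu).ne']; field_simp [(hJ u hu).ne']; ring
  · rw [Real.rpow_sub_one (hJ u hu).ne']; field_simp [(hJ u hu).ne']; ring

lemma LogFamily₁.nonsymInt (hΩ : IsOpen Ω) (hη0 : ∀ z ∈ Ω, η z ≠ 0)
    (h : LogFamily₁ Ω φ ψ η) : NonsymInt Ω φ ψ η := by
  obtain ⟨h0, β, δ, h⟩ := h
  have hJ : ∀ u ∈ (fun z : Fin 2 → ℝ => z 0) '' Ω, 0 < u := Set.forall_mem_image.2 h0
  have hlog : ContDiffOn ℝ ∞ Real.log ((fun z : Fin 2 → ℝ => z 0) '' Ω) :=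
    contDiffOn_id.log fun u hu => (hJ u hu).ne'
  refine nonsymInt_of_hasDerivAt (α := 0) (β := β) (c₀ := 0) (c₁ := 1)
    (f := fun u => -2 * β * u * Real.log u - β * u)
    (f₁ := fun u => -2 * β * Real.log u - 3 * β) (f₂ := fun u => -2 * β / u)
    (g := fun u => β ^ 2 * u * Real.log u ^ 2 + δ * u)
    (g₁ := fun u => β ^ 2 * (Real.log u ^ 2 + 2 * Real.log u) + δ)
    (g₂ := fun u => β ^ 2 * (2 * Real.log u / u + 2 / u)) hΩ hη0
    (((contDiffOn_const.mul contDiffOn_id).mul (hlog.pow 2)).add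
      (contDiffOn_const.mul contDiffOn_id))
    (((contDiffOn_const.mul contDiffOn_id).mul hlog).sub (contDiffOn_const.mul contDiffOn_id))
    (fun z hz => ⟨by rw [(h z hz).1]; ring, by rw [(h z hz).2.1]; ring,
      by rw [(h z hz).2.2]; ring⟩) fun u hu => ?_
  have hu0 := (hJ u hu).ne'
  have hl := Real.hasDerivAt_log hu0
  refine ⟨(((hasDerivAt_mul_left (-2 * β) u).mul hl).sub (hasDerivAt_mul_left β u)).congr_deriv ?_,
    ((hl.const_mul (-2 * β)).sub_const (3 * β)).congr_deriv ?_,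
    (((hasDerivAt_mul_left (β ^ 2) u).mul (hl.pow 2)).add
      (hasDerivAt_mul_left δ u)).congr_deriv ?_,
    ((((hl.pow 2).add (hl.const_mul 2)).const_mul (β ^ 2)).add_const δ).congr_deriv ?_, ?_, ?_⟩
  · field_simp; ring
  · field_simp
  · simp only [Pi.pow_apply, Nat.cast_ofNat, Nat.add_one_sub_one, pow_one]; field_simp
  · simp only [Nat.cast_ofNat, Nat.add_one_sub_one, pow_one]; field_simp
  · field_simp; ring
  · field_simp; ring

lemma LogFamily₂.nonsymInt (hΩ : IsOpen Ω) (hη0 : ∀ z ∈ Ω, η z ≠ 0)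
    (h : LogFamily₂ Ω φ ψ η) : NonsymInt Ω φ ψ η := by
  obtain ⟨h0, γ, δ, h⟩ := h
  have hJ : ∀ u ∈ (fun z : Fin 2 → ℝ => z 0) '' Ω, 0 < u := Set.forall_mem_image.2 h0
  refine nonsymInt_of_hasDerivAt (α := -1) (β := 0) (c₀ := 0) (c₁ := 1) hΩ hη0
    (contDiffOn_mul_rpow hJ δ (-1)) (contDiffOn_mul_log hJ γ)
    (fun z hz => ⟨by rw [(h z hz).1]; beta_reduce; rw [Real.rpow_neg_one]; ring, by rw [(h z hz).2.1]; ring,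
      by rw [(h z hz).2.2]; ring⟩) fun u hu => ⟨hasDerivAt_mul_log _ (hJ u hu),
        hasDerivAt_mul_rpow _ _ (hJ u hu), hasDerivAt_mul_rpow _ _ (hJ u hu),
        hasDerivAt_mul_rpow _ _ (hJ u hu), ?_, ?_⟩
  · rw [Real.rpow_sub_one (hJ u hu).ne']; field_simp [(hJ u hu).ne']; ring
  · rw [Real.rpow_sub_one (hJ u hu).ne']; field_simp [(hJ u hu).ne']; ring

lemma LogFamily₃.nonsymInt (hΩ : IsOpen Ω) (hη0 : ∀ z ∈ Ω, η z ≠ 0)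
    (h : LogFamily₃ Ω φ ψ η) : NonsymInt Ω φ ψ η := by
  obtain ⟨h0, γ, δ, h⟩ := h
  have hJ : ∀ u ∈ (fun z : Fin 2 → ℝ => z 0) '' Ω, 0 < u := Set.forall_mem_image.2 h0
  refine nonsymInt_of_hasDerivAt (α := -(1 / 2)) (β := 0) (c₀ := 0) (c₁ := 1) hΩ hη0
    (contDiffOn_mul_log hJ δ) (contDiffOn_mul_rpow hJ γ (1 / 2))
    (fun z hz => ⟨by rw [(h z hz).1]; ring, by rw [(h z hz).2.1]; beta_reduce; rw [Real.sqrt_eq_rpow],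
      by rw [(h z hz).2.2]; ring⟩) fun u hu => ⟨hasDerivAt_mul_rpow _ _ (hJ u hu),
        hasDerivAt_mul_rpow _ _ (hJ u hu), hasDerivAt_mul_log _ (hJ u hu),
        hasDerivAt_mul_rpow _ _ (hJ u hu), ?_, ?_⟩
  · rw [Real.rpow_sub_one (hJ u hu).ne']; field_simp [(hJ u hu).ne']; ring
  · rw [Real.rpow_sub_one (hJ u hu).ne']; field_simp [(hJ u hu).ne']; ring

lemma ExpFamily.nonsymInt (hΩ : IsOpen Ω) (hη0 : ∀ z ∈ Ω, η z ≠ 0)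
    (h : ExpFamily Ω φ ψ η) : NonsymInt Ω φ ψ η := by
  obtain ⟨f, g, h, hf, hg, hh, hE, hc⟩ := h
  rw [nonsymInt_exp_iff (κ := 1) (k := 0) (l := 0) hΩ one_ne_zero hg hf hh
    (fun z hz h0 => hη0 z hz (by rw [(hc z hz).2.2]; beta_reduce; rw [h0, mul_zero]))
    (fun z hz => by rw [(hc z hz).1]; simp) (fun z hz => by rw [(hc z hz).2.1]; simp)
    (fun z hz => by rw [(hc z hz).2.2]; simp)]
  simpa using hE

/-- All normal forms are integrable. -/
theorem NonsymNormalForm.nonsymInt (hΩ : IsOpen Ω) (hη0 : ∀ z ∈ Ω, η z ≠ 0)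
    (h : NonsymNormalForm Ω φ ψ η) : NonsymInt Ω φ ψ η := by
  rcases h with h | h | h | h | h | h | h
  exacts [h.nonsymInt hΩ hη0, h.nonsymInt hΩ hη0, h.nonsymInt hΩ hη0, h.nonsymInt hΩ hη0,
    h.nonsymInt hΩ hη0, h.nonsymInt hΩ hη0, h.nonsymInt hΩ hη0]

end Families

/-! ### Elementary integrations in one variable -/

section OneVariable

variable {J : Set ℝ} {y y₁ : ℝ → ℝ} {lam : ℝ}

lemma exists_eq_add_const (hJ : IsOpen J) (hc : Convex ℝ J) {F : ℝ → ℝ}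
    (hy : ∀ u ∈ J, HasDerivAt y (y₁ u) u) (hF : ∀ u ∈ J, HasDerivAt F (y₁ u) u) :
    ∃ K, ∀ u ∈ J, y u = F u + K := by
  obtain ⟨K, hK⟩ := exists_eq_const_of_hasDerivAt_zero hJ hc (f := fun u => y u - F u)
    fun u hu => ((hy u hu).sub (hF u hu)).congr_deriv (sub_self _)
  exact ⟨K, fun u hu => by rw [← hK u hu]; ring⟩

/-- Solutions of `y'' = λ y'`. -/
lemma exists_exp_of_deriv_eq (hJ : IsOpen J) (hc : Convex ℝ J) (hlam : lam ≠ 0)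
    (hy : ∀ u ∈ J, HasDerivAt y (y₁ u) u) (hy₁ : ∀ u ∈ J, HasDerivAt y₁ (lam * y₁ u) u) :
    ∃ C K, ∀ u ∈ J, y u = C * Real.exp (lam * u) + K := by
  obtain ⟨C, hC⟩ := exists_eq_const_of_hasDerivAt_zero hJ hc
    (f := fun u => y₁ u * Real.exp (-lam * u)) fun u hu =>
      ((hy₁ u hu).mul (hasDerivAt_mul_left (-lam) u).exp).congr_deriv (by ring)
  have hC' : ∀ u ∈ J, y₁ u = C * Real.exp (lam * u) := fun u hu => by
    rw [← hC u hu, mul_assoc, ← Real.exp_add]; simp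
  obtain ⟨K, hK⟩ := exists_eq_add_const hJ hc (F := fun u => C / lam * Real.exp (lam * u)) hy
    fun u hu => ((hasDerivAt_mul_left lam u).exp.const_mul (C / lam)).congr_deriv (by
      rw [hC' u hu]; field_simp)
  exact ⟨C / lam, K, hK⟩

/-- Solutions of `(a₀ u + b₀) y'' = λ y'`; here `H = |a₀ u + b₀|`. -/
lemma exists_rpow_of_deriv_eq (hJ : IsOpen J) (hc : Convex ℝ J) {y₂ H : ℝ → ℝ} {a : ℝ} (ha : a ≠ 0)
    (hH : ∀ u, HasDerivAt H a u) (hH0 : ∀ u ∈ J, 0 < H u)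
    (hy : ∀ u ∈ J, HasDerivAt y (y₁ u) u) (hy₁ : ∀ u ∈ J, HasDerivAt y₁ (y₂ u) u)
    (hy₂ : ∀ u ∈ J, y₂ u * H u = lam * a * y₁ u) :
    (lam ≠ -1 → ∃ C K, ∀ u ∈ J, y u = C * H u ^ (lam + 1) + K) ∧
    (lam = -1 → ∃ C K, ∀ u ∈ J, y u = C * Real.log (H u) + K) := by
  have hr : ∀ p, ∀ u ∈ J, HasDerivAt (fun u => H u ^ p) (a * p * H u ^ (p - 1)) u := fun p u hu =>
    (hH u).rpow_const (.inl (hH0 u hu).ne')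
  -- `y' H^{-λ}` is constant, so `y'` is a multiple of `H^λ`; its primitive is a power unless `λ =
  -- -1`.
  obtain ⟨C, hC⟩ := exists_eq_const_of_hasDerivAt_zero hJ hc
    (f := fun u => y₁ u * H u ^ (-lam)) fun u hu =>
      ((hy₁ u hu).mul (hr (-lam) u hu)).congr_deriv (by
        have h0 := (hH0 u hu).ne'
        rw [Real.rpow_sub_one h0]
        field_simp
        linear_combination H u ^ (-lam) * hy₂ u hu)
  have hC' : ∀ u ∈ J, y₁ u = C * H u ^ lam := fun u hu => by
    rw [← hC u hu, mul_assoc, ← Real.rpow_add (hH0 u hu)]; simp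
  constructor
  · intro hne
    have hne' : lam + 1 ≠ 0 := fun h => hne (by linarith)
    obtain ⟨K, hK⟩ := exists_eq_add_const hJ hc
      (F := fun u => C / (a * (lam + 1)) * H u ^ (lam + 1)) hy
      fun u hu => ((hr (lam + 1) u hu).const_mul (C / (a * (lam + 1)))).congr_deriv (by
        rw [hC' u hu, add_sub_cancel_right]; field_simp)
    exact ⟨_, K, hK⟩
  · rintro rfl
    obtain ⟨K, hK⟩ := exists_eq_add_const hJ hc (F := fun u => C / a * Real.log (H u)) hy
      fun u hu => (((hH u).log (hH0 u hu).ne').const_mul (C / a)).congr_deriv (by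
        rw [hC' u hu, Real.rpow_neg_one]; field_simp)
    exact ⟨_, K, hK⟩

end OneVariable

/-! ### Dependence of the coefficients on `w` -/

section Shape

variable {Ω : Set (Fin 2 → ℝ)} {F : (Fin 2 → ℝ) → ℝ} {κ k : ℝ}

lemma exists_exp_form_of_pd (hΩ : IsOpen Ω) (hc : Convex ℝ Ω) (hF : ContDiffOn ℝ ∞ F Ω)
    (h : ∀ z ∈ Ω, pd 1 F z = κ * (F z - k)) :
    ∃ g : ℝ → ℝ, ContDiffOn ℝ ∞ g ((fun z => z 0) '' Ω) ∧
      ∀ z ∈ Ω, F z = Real.exp (κ * z 1) * g (z 0) + k := by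
  have hexp : ContDiff ℝ ∞ (fun z : Fin 2 → ℝ => Real.exp (-κ * z 1)) := by fun_prop
  obtain ⟨g, hg, hFg⟩ := exists_eq_comp_coord hΩ hc (hexp.contDiffOn.mul (hF.sub contDiffOn_const))
    0 (F := fun z => Real.exp (-κ * z 1) * (F z - k)) (by
      intro z hz j hj
      obtain rfl : j = 1 := by fin_cases j <;> simp_all
      have h1 : HasGrad (fun z : Fin 2 → ℝ => Real.exp (-κ * z 1)) _ z :=
        HasGrad.comp (Real.hasDerivAt_exp _) ((hasGrad_coord 1 z).const_mul (-κ))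
      have h2 := h1.mul ((hasGrad_of_contDiffOn hΩ hF hz).sub (hasGrad_const k z))
      rw [h2.pd_eq 1, h z hz]
      simp
      ring)
  refine ⟨g, hg, fun z hz => ?_⟩
  have h1 : Real.exp (κ * z 1) * Real.exp (-κ * z 1) = 1 := by rw [← Real.exp_add]; simp
  rw [← hFg z hz]
  linear_combination -(F z - k) * h1

/-- The gradient of `F - κ⁻¹ F_w` vanishes. With `k` its constant value, `F_w = κ (F - k)`. -/
lemma exists_exp_form (hΩ : IsOpen Ω) (hc : Convex ℝ Ω) (hF : ContDiffOn ℝ ∞ F Ω) (hκ : κ ≠ 0)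
    (h0 : ∀ z ∈ Ω, pd 1 (pd 0 F) z = κ * pd 0 F z) (h1 : ∀ z ∈ Ω, pd 1 (pd 1 F) z = κ * pd 1 F z) :
    ∃ (g : ℝ → ℝ) (k : ℝ), ContDiffOn ℝ ∞ g ((fun z => z 0) '' Ω) ∧
      ∀ z ∈ Ω, F z = Real.exp (κ * z 1) * g (z 0) + k := by
  have hF1 := contDiffOn_pd hΩ hF 1
  obtain ⟨k, hk⟩ := exists_eq_const_of_pd_zero hΩ hc (hF.sub (contDiffOn_const.mul hF1))
    (F := fun z => F z - κ⁻¹ * pd 1 F z) (by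
      intro z hz i
      have h2 := (hasGrad_of_contDiffOn hΩ hF hz).sub
        ((hasGrad_of_contDiffOn hΩ hF1 hz).const_mul κ⁻¹)
      rw [h2.pd_eq i]
      fin_cases i
      · simp only [Fin.zero_eta]
        rw [pd_comm hΩ hF 0 1 hz, h0 z hz]; field_simp; ring
      · simp only [Fin.mk_one]
        rw [h1 z hz]; field_simp; ring)
  obtain ⟨g, hg, hFg⟩ := exists_exp_form_of_pd hΩ hc hF (κ := κ) (k := k) fun z hz => by
    rw [← hk z hz]; field_simp; ring
  exact ⟨g, k, hg, hFg⟩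

lemma exists_linear_form (hΩ : IsOpen Ω) (hc : Convex ℝ Ω) (hF : ContDiffOn ℝ ∞ F Ω)
    (h0 : ∀ z ∈ Ω, pd 1 (pd 0 F) z = 0) (h1 : ∀ z ∈ Ω, pd 1 (pd 1 F) z = 0) :
    ∃ (β : ℝ) (g : ℝ → ℝ), ContDiffOn ℝ ∞ g ((fun z => z 0) '' Ω) ∧
      ∀ z ∈ Ω, F z = β * z 1 + g (z 0) := by
  obtain ⟨β, hβ⟩ := exists_eq_const_of_pd_zero hΩ hc (contDiffOn_pd hΩ hF 1) (by
      intro z hz i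
      fin_cases i
      · exact (pd_comm hΩ hF 0 1 hz).trans (h0 z hz)
      · exact h1 z hz)
  have hl : ContDiff ℝ ∞ (fun z : Fin 2 → ℝ => β * z 1) := by fun_prop
  obtain ⟨g, hg, hFg⟩ := exists_eq_comp_coord hΩ hc (hF.sub hl.contDiffOn) 0 (by
      intro z hz j hj
      obtain rfl : j = 1 := by fin_cases j <;> simp_all
      have h2 := (hasGrad_of_contDiffOn hΩ hF hz).sub ((hasGrad_coord 1 z).const_mul β)
      exact (h2.pd_eq 1).trans (by rw [hβ z hz]; simp))
  exact ⟨β, g, hg, fun z hz => by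
    have : F z - β * z 1 = g (z 0) := hFg z hz
    linear_combination this⟩

end Shape

/-! ### Classification of non-symmetric systems -/

section Classification

variable {Ω : Set (Fin 2 → ℝ)} {φ ψ η : (Fin 2 → ℝ) → ℝ}

/-- The conditions on `η_{uw}` and `η_{ww}` say that the gradient of `η_w / η` is zero. -/
lemma NonsymInt.exists_pd_eta (hΩ : IsOpen Ω) (hc : Convex ℝ Ω) (hη : ContDiffOn ℝ ∞ η Ω)
    (hη0 : ∀ z ∈ Ω, η z ≠ 0) (H : NonsymInt Ω φ ψ η) : ∃ κ, ∀ z ∈ Ω, pd 1 η z = κ * η z := by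
  obtain ⟨κ, hκ⟩ := exists_eq_const_of_pd_zero hΩ hc ((contDiffOn_pd hΩ hη 1).div hη hη0) (by
    intro z hz i
    have h1 := (hasGrad_of_contDiffOn hΩ (contDiffOn_pd hΩ hη 1) hz).div
      (hasGrad_of_contDiffOn hΩ hη hz) (hη0 z hz)
    obtain ⟨-, -, -, -, -, -, -, h2, h3⟩ := H z hz
    refine (h1.pd_eq i).trans ?_
    have := hη0 z hz
    fin_cases i
    · simp only [Fin.zero_eta]
      rw [pd_comm hΩ hη 0 1 hz, h2]; field_simp; ring
    · simp only [Fin.mk_one]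
      rw [h3]; field_simp; ring)
  exact ⟨κ, fun z hz => by rw [← hκ z hz, Pi.div_apply, div_mul_cancel₀ _ (hη0 z hz)]⟩

/-- Reduction to normal form when `η` depends on `w`. -/
lemma NonsymInt.exists_expFamily (hΩ : IsOpen Ω) (hc : Convex ℝ Ω) (hφ : ContDiffOn ℝ ∞ φ Ω)
    (hψ : ContDiffOn ℝ ∞ ψ Ω) (hη : ContDiffOn ℝ ∞ η Ω) (hη0 : ∀ z ∈ Ω, η z ≠ 0)
    (H : NonsymInt Ω φ ψ η) {κ : ℝ} (hκ0 : κ ≠ 0) (hκ : ∀ z ∈ Ω, pd 1 η z = κ * η z) :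
    ∃ (T : NonsymTransformation) (φ' ψ' η' : (Fin 2 → ℝ) → ℝ),
      T.Carries Ω φ ψ η φ' ψ' η' ∧ ExpFamily (T.map '' Ω) φ' ψ' η' := by
  have hdiv : ∀ z ∈ Ω, ∀ x, pd 1 η z * x / η z = κ * x := fun z hz x => by
    have := hη0 z hz
    rw [hκ z hz]; field_simp
  obtain ⟨g, k, hg, hφg⟩ := exists_exp_form hΩ hc hφ hκ0
    (fun z hz => (H z hz).2.1.trans (hdiv z hz _)) (fun z hz => (H z hz).2.2.1.trans (hdiv z hz _))
  obtain ⟨f, l, hf, hψf⟩ := exists_exp_form hΩ hc hψ hκ0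
    (fun z hz => (H z hz).2.2.2.2.1.trans (hdiv z hz _))
    (fun z hz => (H z hz).2.2.2.2.2.1.trans (hdiv z hz _))
  obtain ⟨h, hh, hηh⟩ := exists_exp_form_of_pd hΩ hc hη (κ := κ) (k := 0) fun z hz => by
    rw [hκ z hz, sub_zero]
  simp only [add_zero] at hηh
  have hE := (nonsymInt_exp_iff hΩ hκ0 hg hf hh (fun z hz h0 => hη0 z hz (by
    rw [hηh z hz, h0, mul_zero])) hφg hψf hηh).1 H
  -- Here `w' = κw`, the product `p r = 1` leaves `η` unchanged, and the Galilean constants remove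
  -- `k` and `l`.
  let T : NonsymTransformation := ⟨κ, 1, 1 / κ, 1, 0, 0, 0, κ * k, l, hκ0, one_ne_zero,
    one_div_ne_zero hκ0, one_ne_zero⟩
  have hT0 : ∀ z, T.map z 0 = z 0 := fun z => by simp [T, NonsymTransformation.map]
  have hT1 : ∀ z, T.map z 1 = κ * z 1 := fun z => by simp [T, NonsymTransformation.map]
  have him : (fun z : Fin 2 → ℝ => z 0) '' (T.map '' Ω) = (fun z => z 0) '' Ω := by
    rw [Set.image_image]; simp only [hT0]
  refine ⟨T, fun z => Real.exp (z 1) * (κ ^ 2 * g (z 0)), fun z => Real.exp (z 1) * (κ * f (z 0)),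
    fun z => Real.exp (z 1) * h (z 0), fun z hz => ?_, fun u => κ * f u, fun u => κ ^ 2 * g u, h,
    ?_⟩
  · beta_reduce
    rw [hT0, hT1, hφg z hz, hψf z hz, hηh z hz]
    simp only [T]
    refine ⟨?_, ?_, ?_⟩ <;> field_simp <;> ring
  · rw [him]
    exact ⟨contDiffOn_const.mul hf, contDiffOn_const.mul hg, hh, hE,
      fun z _ => ⟨rfl, rfl, rfl⟩⟩

end Classification

section Classification

variable {Ω : Set (Fin 2 → ℝ)} {φ ψ η : (Fin 2 → ℝ) → ℝ} {α β a₀ b₀ : ℝ} {f f₁ f₂ g g₁ g₂ : ℝ → ℝ}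

/-- Reduction to normal form when `η` is constant. -/
lemma exists_normalForm_of_const (hΩ : IsOpen Ω) (hc : Convex ℝ Ω) (hb₀ : b₀ ≠ 0)
    (hφ : ∀ z ∈ Ω, φ z = β * z 1 + g (z 0)) (hψ : ∀ z ∈ Ω, ψ z = α * z 1 + f (z 0))
    (hη : ∀ z ∈ Ω, η z = b₀)
    (hf : ∀ u ∈ (fun z : Fin 2 → ℝ => z 0) '' Ω, HasDerivAt f (f₁ u) u ∧ HasDerivAt f₁ (f₂ u) u)
    (hg : ∀ u ∈ (fun z : Fin 2 → ℝ => z 0) '' Ω, HasDerivAt g (g₁ u) u ∧ HasDerivAt g₁ (g₂ u) u)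
    (eg : ∀ u ∈ (fun z : Fin 2 → ℝ => z 0) '' Ω, g₂ u * b₀ = -(β ^ 2 + β * f₁ u - 2 * α * g₁ u))
    (ef : ∀ u ∈ (fun z : Fin 2 → ℝ => z 0) '' Ω, f₂ u * b₀ = -(α * β) + α * f₁ u) :
    ∃ (T : NonsymTransformation) (φ' ψ' η' : (Fin 2 → ℝ) → ℝ),
      T.Carries Ω φ ψ η φ' ψ' η' ∧ NonsymNormalForm (T.map '' Ω) φ' ψ' η' := by
  have hJ := isOpen_image_coord hΩ 0
  have hJc := convex_image_coord hc 0
  have hmem := fun (z : Fin 2 → ℝ) (hz : z ∈ Ω) => Set.mem_image_of_mem (fun z => z 0) hz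
  -- The choice `p = b₀` makes `η` equal to `1`; the shear `s` and the Galilean constants `k, l`
  -- stay free.
  have hT : ∀ s k l, ∃ T : NonsymTransformation, (∀ z, T.map z 0 = z 0) ∧
      (∀ z, T.map z 1 = b₀ * (z 1 + s * z 0)) ∧ ∀ φ' ψ' : ℝ → ℝ → ℝ,
      (∀ z ∈ Ω, φ' (z 0) (b₀ * (z 1 + s * z 0)) = b₀ * (φ z - s * ψ z + s ^ 2 * b₀) - k ∧
        ψ' (z 0) (b₀ * (z 1 + s * z 0)) = ψ z - 2 * s * b₀ - l) →
      T.Carries Ω φ ψ η (fun z => φ' (z 0) (z 1)) (fun z => ψ' (z 0) (z 1)) (fun _ => 1) := by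
    intro s k l
    refine ⟨⟨b₀, 1, 1, 1, s, 0, 0, k, l, hb₀, one_ne_zero, one_ne_zero, one_ne_zero⟩,
      fun z => by simp [NonsymTransformation.map], fun z => by simp [NonsymTransformation.map],
      fun φ' ψ' h z hz => ?_⟩
    simp only [NonsymTransformation.map, Matrix.cons_val_zero, Matrix.cons_val_one, hη z hz,
      one_mul, add_zero, div_one, mul_one]
    exact ⟨(h z hz).1, (h z hz).2, by field_simp⟩
  rcases eq_or_ne α 0 with rfl | hα
  · obtain ⟨γ, hγ⟩ := exists_eq_add_const hJ hJc (y := f₁) (F := fun _ => 0) (fun u hu => (hf u hu).2)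
      fun u hu => (hasDerivAt_const u 0).congr_deriv (by
        have := ef u hu
        simp only [zero_mul, neg_zero, add_zero, mul_eq_zero] at this
        exact (this.resolve_right hb₀).symm)
    obtain ⟨K, hK⟩ := exists_eq_add_const hJ hJc (F := fun u => γ * u) (fun u hu => (hf u hu).1)
      fun u hu => (hasDerivAt_mul_left γ u).congr_deriv (by rw [hγ u hu, zero_add])
    obtain ⟨δ, hδ⟩ := exists_eq_add_const hJ hJc (F := fun u => -(β ^ 2 + β * γ) / b₀ * u)
      (fun u hu => (hg u hu).2) fun u hu => (hasDerivAt_mul_left _ u).congr_deriv (by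
        have := eg u hu
        rw [hγ u hu] at this
        rw [div_eq_iff hb₀, this]; ring)
    obtain ⟨K', hK'⟩ := exists_eq_add_const hJ hJc
      (F := fun u => -(β ^ 2 + β * γ) / b₀ * (u ^ 2 / 2) + δ * u) (fun u hu => (hg u hu).1)
      fun u hu => ((((hasDerivAt_pow 2 u).div_const 2).const_mul _).add
        (hasDerivAt_mul_left δ u)).congr_deriv (by rw [hδ u hu]; simp)
    obtain ⟨T, hT0, hT1, hT⟩ := hT 0 (b₀ * K') K
    refine ⟨T, _, _, _, hT (fun u w => β * w - 1 / 2 * β * (β + γ) * u ^ 2 + b₀ * δ * u)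
      (fun u _ => γ * u) fun z hz => ?_,
      .inl ⟨β, γ, b₀ * δ, fun z _ => ⟨rfl, rfl, rfl⟩⟩⟩
    rw [hφ z hz, hψ z hz, hK _ (hmem z hz), hK' _ (hmem z hz)]
    refine ⟨?_, by ring⟩
    field_simp
    ring
  -- The shear `s = β / α` removes `w` from `φ - sψ` and absorbs `βu` in `α (w + su)`. What is left
  -- of `ψ` and `φ` satisfies `y'' = λy'` with `λ = α / b₀` and `λ = 2α / b₀`.
  · obtain ⟨C, K, hCK⟩ := exists_exp_of_deriv_eq hJ hJc (y := fun u => f u - β * u)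
      (y₁ := fun u => f₁ u - β) (lam := α / b₀) (div_ne_zero hα hb₀)
      (fun u hu => (hf u hu).1.sub (hasDerivAt_mul_left β u))
      fun u hu => ((hf u hu).2.sub_const β).congr_deriv (by
        field_simp
        linear_combination ef u hu)
    obtain ⟨C', K', hCK'⟩ := exists_exp_of_deriv_eq hJ hJc (y := fun u => g u - β / α * f u)
      (y₁ := fun u => g₁ u - β / α * f₁ u) (lam := 2 * (α / b₀))
      (mul_ne_zero two_ne_zero (div_ne_zero hα hb₀))
      (fun u hu => (hg u hu).1.sub ((hf u hu).1.const_mul _))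
      fun u hu => ((hg u hu).2.sub ((hf u hu).2.const_mul _)).congr_deriv (by
        field_simp
        linear_combination α * eg u hu - β * ef u hu)
    obtain ⟨T, hT0, hT1, hT⟩ := hT (β / α) (b₀ * (K' + (β / α) ^ 2 * b₀)) (K - 2 * (β / α) * b₀)
    refine ⟨T, _, _, _, hT (fun u _ => b₀ * C' * Real.exp (2 * (α / b₀) * u))
      (fun u w => α / b₀ * w + C * Real.exp (α / b₀ * u)) fun z hz => ?_,
      .inr (.inl ⟨α / b₀, C, b₀ * C', div_ne_zero hα hb₀, fun z _ => ⟨rfl, rfl, rfl⟩⟩)⟩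
    have h1 := hCK _ (hmem z hz)
    have h2 := hCK' _ (hmem z hz)
    rw [hφ z hz, hψ z hz]
    constructor
    · have h3 : β / α * α = β := div_mul_cancel₀ β hα
      linear_combination (-b₀) * h2 + (b₀ * z 1) * h3
    · have h3 : β / α * α = β := div_mul_cancel₀ β hα
      have h4 : α / b₀ * b₀ = α := div_mul_cancel₀ α hb₀
      linear_combination -h1 + (z 1 + β / α * z 0) * h4 + z 0 * h3

/-- Reduction to normal form when `η` is a nonconstant function of `u`; here `H = ε η`, `ε = ±1`. -/
lemma exists_normalForm_of_affine (hΩ : IsOpen Ω) (hc : Convex ℝ Ω) (ha₀ : a₀ ≠ 0) {ε : ℝ}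
    (hε : ε ^ 2 = 1) (hpos : ∀ u ∈ (fun z : Fin 2 → ℝ => z 0) '' Ω, 0 < ε * (a₀ * u + b₀))
    (hφ : ∀ z ∈ Ω, φ z = β * z 1 + g (z 0)) (hψ : ∀ z ∈ Ω, ψ z = α * z 1 + f (z 0))
    (hη : ∀ z ∈ Ω, η z = a₀ * z 0 + b₀)
    (hf : ∀ u ∈ (fun z : Fin 2 → ℝ => z 0) '' Ω, HasDerivAt f (f₁ u) u ∧ HasDerivAt f₁ (f₂ u) u)
    (hg : ∀ u ∈ (fun z : Fin 2 → ℝ => z 0) '' Ω, HasDerivAt g (g₁ u) u ∧ HasDerivAt g₁ (g₂ u) u)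
    (eg : ∀ u ∈ (fun z : Fin 2 → ℝ => z 0) '' Ω,
      g₂ u * (a₀ * u + b₀) = -(β ^ 2 + β * f₁ u - 2 * α * g₁ u))
    (ef : ∀ u ∈ (fun z : Fin 2 → ℝ => z 0) '' Ω,
      f₂ u * (a₀ * u + b₀) = -(α * β) + α * f₁ u - 2 * β * a₀) :
    ∃ (T : NonsymTransformation) (φ' ψ' η' : (Fin 2 → ℝ) → ℝ),
      T.Carries Ω φ ψ η φ' ψ' η' ∧ NonsymNormalForm (T.map '' Ω) φ' ψ' η' := by
  have hJ := isOpen_image_coord hΩ 0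
  have hJc := convex_image_coord hc 0
  have hmem := fun (z : Fin 2 → ℝ) (hz : z ∈ Ω) => Set.mem_image_of_mem (fun z => z 0) hz
  have hε0 : ε ≠ 0 := by rintro rfl; norm_num at hε
  obtain ⟨H, hH⟩ : ∃ H : ℝ → ℝ, ∀ u, H u = ε * (a₀ * u + b₀) := ⟨_, fun _ => rfl⟩
  have hHd : ∀ u, HasDerivAt H (ε * a₀) u := fun u => by
    rw [funext hH]
    exact ((hasDerivAt_mul_left a₀ u).add_const b₀).const_mul ε
  have hη' : ∀ u, a₀ * u + b₀ = ε * H u := fun u => by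
    rw [hH]; linear_combination -(a₀ * u + b₀) * hε
  have hH0 : ∀ u ∈ (fun z : Fin 2 → ℝ => z 0) '' Ω, 0 < H u := fun u hu => by
    rw [hH]; exact hpos u hu
  have ha : ε * a₀ ≠ 0 := mul_ne_zero hε0 ha₀
  have hhd : ∀ u, HasDerivAt (fun u => a₀ * u + b₀) a₀ u := fun u =>
    (hasDerivAt_mul_left a₀ u).add_const b₀
  have hT : ∀ s k l, ∃ T : NonsymTransformation, (∀ z, T.map z 0 = H (z 0)) ∧
      (∀ z, T.map z 1 = a₀ * (z 1 + s * z 0)) ∧ ∀ φ' ψ' : ℝ → ℝ → ℝ,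
      (∀ z ∈ Ω, φ' (H (z 0)) (a₀ * (z 1 + s * z 0))
          = ε * (φ z - s * ψ z + s ^ 2 * (a₀ * z 0 + b₀)) - k ∧
        ψ' (H (z 0)) (a₀ * (z 1 + s * z 0)) = ψ z - 2 * s * (a₀ * z 0 + b₀) - l) →
      T.Carries Ω φ ψ η (fun z => φ' (z 0) (z 1)) (fun z => ψ' (z 0) (z 1)) (fun z => z 0) := by
    intro s k l
    -- The new `u` is `H = εη`, and `p = ε` turns `η` into `εη`, that is into the new `u`.
    refine ⟨⟨ε, 1, 1, ε * a₀, s, ε * b₀, 0, k, l, hε0, one_ne_zero, one_ne_zero, ha⟩, ?_⟩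
    have hT0 : ∀ z : Fin 2 → ℝ, ε * a₀ * z 0 + ε * b₀ = H (z 0) := fun z => by rw [hH]; ring
    have hT1 : ∀ z : Fin 2 → ℝ, ε * a₀ * (ε / 1) * (z 1 + s * z 0) + 0 = a₀ * (z 1 + s * z 0) :=
      fun z => by linear_combination a₀ * (z 1 + s * z 0) * hε
    refine ⟨fun z => hT0 z, fun z => hT1 z, fun φ' ψ' h z hz => ?_⟩
    simp only [NonsymTransformation.map, Matrix.cons_val_zero, Matrix.cons_val_one, hη z hz, hT0,
      hT1]
    refine ⟨by rw [(h z hz).1]; ring, by rw [(h z hz).2]; ring, ?_⟩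
    rw [hH]
    field_simp
    linear_combination (a₀ * z 0 + b₀) * hε
  have hpos' : ∀ (T : NonsymTransformation), (∀ z, T.map z 0 = H (z 0)) →
      ∀ z ∈ T.map '' Ω, 0 < z 0 := by
    rintro T hT0 _ ⟨z, hz, rfl⟩
    rw [hT0]; exact hH0 _ (hmem z hz)
  rcases eq_or_ne α 0 with rfl | hα
  · obtain ⟨K, hK⟩ := exists_eq_add_const hJ hJc (y := f₁) (F := fun u => -2 * β * Real.log (H u))
      (fun u hu => (hf u hu).2) fun u hu =>
        (((hHd u).log (hH0 u hu).ne').const_mul (-2 * β)).congr_deriv (by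
          have h1 := ef u hu
          have h2 := (hH0 u hu).ne'
          rw [hη'] at h1
          field_simp
          refine mul_left_cancel₀ hε0 ?_
          linear_combination -h1 - (2 * β * a₀) * hε)
    -- The shear changes `ψ` by a multiple of `η`, so the linear term of `ψ` can be adjusted. In the
    -- normal form `ψ' = -2β ln u - 3β`, whence `3β`.
    obtain ⟨s, hs⟩ : ∃ s, 2 * s * a₀ = 3 * β + K := ⟨(3 * β + K) / (2 * a₀), by field_simp⟩
    obtain ⟨K₂, hK₂⟩ := exists_eq_add_const hJ hJc (y := fun u => f u - 2 * s * (a₀ * u + b₀))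
      (F := fun u => -2 * (ε * β / a₀) * H u * Real.log (H u) - ε * β / a₀ * H u)
      (fun u hu => (hf u hu).1.sub ((hhd u).const_mul (2 * s))) fun u hu =>
        ((((hHd u).const_mul (-2 * (ε * β / a₀))).mul ((hHd u).log (hH0 u hu).ne')).sub
          ((hHd u).const_mul _)).congr_deriv (by
            have h2 := (hH0 u hu).ne'
            rw [hK u hu]
            field_simp
            linear_combination (-2 * β * Real.log (H u) - 3 * β) * hε + hs)
    obtain ⟨δ, hδ⟩ := exists_eq_add_const hJ hJc
      (y := fun u => g₁ u - β * s - s * f₁ u + s ^ 2 * a₀)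
      (F := fun u => β ^ 2 / a₀ * (Real.log (H u) ^ 2 + 2 * Real.log (H u)))
      (fun u hu => (((hg u hu).2.sub_const _).sub ((hf u hu).2.const_mul s)).add_const _) fun u hu =>
        (((((hHd u).log (hH0 u hu).ne').pow 2).add
          (((hHd u).log (hH0 u hu).ne').const_mul 2)).const_mul _).congr_deriv (by
            have h1 := ef u hu
            have h2 := (hH0 u hu).ne'
            have h3 := eg u hu
            rw [hη'] at h1 h3
            rw [hK u hu] at h3
            simp only [Nat.cast_ofNat, Nat.add_one_sub_one, pow_one]
            field_simp
            refine mul_left_cancel₀ hε0 ?_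
            linear_combination -h3 + s * h1 + 2 * β ^ 2 * (Real.log (H u) + 1) * hε - β * hs)
    obtain ⟨K₃, hK₃⟩ := exists_eq_add_const hJ hJc
      (y := fun u => g u - β * s * u - s * f u + s ^ 2 * (a₀ * u + b₀))
      (F := fun u => ε * (β ^ 2 / a₀ ^ 2 * H u * Real.log (H u) ^ 2 + δ / a₀ * H u))
      (fun u hu => (((hg u hu).1.sub (hasDerivAt_mul_left (β * s) u)).sub
        ((hf u hu).1.const_mul s)).add ((hhd u).const_mul _)) fun u hu =>
        (((((hHd u).const_mul (β ^ 2 / a₀ ^ 2)).mul (((hHd u).log (hH0 u hu).ne').pow 2)).add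
          ((hHd u).const_mul (δ / a₀))).const_mul ε).congr_deriv (by
            have h2 := (hH0 u hu).ne'
            rw [hδ u hu]
            simp only [Nat.cast_ofNat, Nat.add_one_sub_one, pow_one, Pi.pow_apply]
            field_simp
            linear_combination (β ^ 2 * (Real.log (H u) ^ 2 + 2 * Real.log (H u)) + a₀ * δ) * hε)
    obtain ⟨T, hT0, hT1, hT⟩ := hT s (ε * K₃) K₂
    refine ⟨T, _, _, _, hT (fun u w => ε * β / a₀ * w + (ε * β / a₀) ^ 2 * u * Real.log u ^ 2
      + δ / a₀ * u) (fun u _ => -2 * (ε * β / a₀) * u * Real.log u - ε * β / a₀ * u)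
      fun z hz => ?_, .inr (.inr (.inr (.inl ⟨hpos' T hT0, ε * β / a₀, δ / a₀,
        fun z _ => ⟨rfl, rfl, rfl⟩⟩)))⟩
    have h1 := hK₂ _ (hmem z hz)
    have h2 := hK₃ _ (hmem z hz)
    rw [hφ z hz, hψ z hz]
    constructor
    · have h3 : β / a₀ * a₀ = β := div_mul_cancel₀ β ha₀
      beta_reduce at h2
      have e1 : ε * β / a₀ = ε * (β / a₀) := by ring
      have e2 : β ^ 2 / a₀ ^ 2 = (β / a₀) ^ 2 := by ring
      rw [e2] at h2
      rw [e1]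
      linear_combination (-ε) * h2 + ε * (z 1 + s * z 0) * h3
        - (δ / a₀ * H (z 0)) * hε
    · linear_combination -h1
  · have h3 : β / α * α = β := div_mul_cancel₀ β hα
    have h4 : α / a₀ * a₀ = α := div_mul_cancel₀ α ha₀
    -- With `s = β / α` the equations decouple: the remaining parts of `ψ` and `φ` satisfy `H y'' =
    -- λ H' y'` with `λ = α / a₀` and `λ = 2α / a₀`.
    have hF := exists_rpow_of_deriv_eq hJ hJc (lam := α / a₀) ha hHd hH0
      (y := fun u => f u - β * u - 2 * (β / α) * (a₀ * u + b₀))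
      (y₁ := fun u => f₁ u - β - 2 * (β / α) * a₀) (y₂ := f₂)
      (fun u hu => ((hf u hu).1.sub (hasDerivAt_mul_left β u)).sub ((hhd u).const_mul _))
      (fun u hu => ((hf u hu).2.sub_const _).sub_const _) fun u hu => by
        have h1 := ef u hu
        rw [hη'] at h1
        refine mul_left_cancel₀ hε0 ?_
        linear_combination h1 - ε ^ 2 * (f₁ u - β - 2 * (β / α) * a₀) * h4
          - α * (f₁ u - β - 2 * (β / α) * a₀) * hε + 2 * a₀ * h3
    have hG := exists_rpow_of_deriv_eq hJ hJc (lam := 2 * (α / a₀)) ha hHd hH0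
      (y := fun u => g u - β / α * f u + (β / α) ^ 2 * (a₀ * u + b₀))
      (y₁ := fun u => g₁ u - β / α * f₁ u + (β / α) ^ 2 * a₀) (y₂ := fun u => g₂ u - β / α * f₂ u)
      (fun u hu => ((hg u hu).1.sub ((hf u hu).1.const_mul _)).add ((hhd u).const_mul _))
      (fun u hu => ((hg u hu).2.sub ((hf u hu).2.const_mul _)).add_const _) fun u hu => by
        have h1 := ef u hu
        have h2 := eg u hu
        rw [hη'] at h1 h2
        refine mul_left_cancel₀ hε0 ?_
        linear_combination h2 - β / α * h1
          - 2 * ε ^ 2 * (g₁ u - β / α * f₁ u + (β / α) ^ 2 * a₀) * h4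
          - 2 * α * (g₁ u - β / α * f₁ u + (β / α) ^ 2 * a₀) * hε
          + (β + f₁ u - 2 * (β / α) * a₀) * h3
    have hTψ : ∀ (Ψ : ℝ → ℝ) (K : ℝ), (∀ u ∈ (fun z : Fin 2 → ℝ => z 0) '' Ω,
        f u - β * u - 2 * (β / α) * (a₀ * u + b₀) = Ψ (H u) + K) → ∀ z ∈ Ω,
        α / a₀ * (a₀ * (z 1 + β / α * z 0)) + Ψ (H (z 0))
          = ψ z - 2 * (β / α) * (a₀ * z 0 + b₀) - K := fun Ψ K h z hz => by
      rw [hψ z hz]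
      linear_combination (z 1 + β / α * z 0) * h4 + z 0 * h3 - h _ (hmem z hz)
    have hTφ : ∀ (Φ : ℝ → ℝ) (K : ℝ), (∀ u ∈ (fun z : Fin 2 → ℝ => z 0) '' Ω,
        g u - β / α * f u + (β / α) ^ 2 * (a₀ * u + b₀) = Φ (H u) + K) → ∀ z ∈ Ω,
        ε * Φ (H (z 0)) = ε * (φ z - β / α * ψ z + (β / α) ^ 2 * (a₀ * z 0 + b₀)) - ε * K :=
      fun Φ K h z hz => by
      rw [hφ z hz, hψ z hz]
      linear_combination ε * z 1 * h3 - ε * h _ (hmem z hz)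
    -- A logarithm replaces the power in `ψ` when `α / a₀ = -1`, and in `φ` when `2α / a₀ = -1`.
    rcases eq_or_ne (α / a₀) (-1) with hρ | hρ
    · obtain ⟨C, K, hCK⟩ := hF.2 hρ
      obtain ⟨C', K', hCK'⟩ := hG.1 (by rw [hρ]; norm_num)
      obtain ⟨T, hT0, hT1, hT⟩ := hT (β / α) (ε * K') K
      refine ⟨T, _, _, _, hT (fun u _ => ε * C' / u) (fun u w => -w + C * Real.log u)
        fun z hz => ⟨?_, ?_⟩, .inr (.inr (.inr (.inr (.inl ⟨hpos' T hT0, C, ε * C',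
          fun z _ => ⟨rfl, rfl, rfl⟩⟩))))⟩
      · rw [← hTφ (fun u => C' * u ^ (2 * (α / a₀) + 1)) K' hCK' z hz, hρ, show (2 * (-1) + 1 : ℝ) = -1 by norm_num, Real.rpow_neg_one]
        ring
      · rw [← hTψ (fun u => C * Real.log u) K hCK z hz, hρ]
        ring
    rcases eq_or_ne (α / a₀) (-1 / 2) with hρ' | hρ'
    · obtain ⟨C, K, hCK⟩ := hF.1 hρ
      obtain ⟨C', K', hCK'⟩ := hG.2 (by rw [hρ']; norm_num)
      obtain ⟨T, hT0, hT1, hT⟩ := hT (β / α) (ε * K') K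
      refine ⟨T, _, _, _, hT (fun u _ => ε * C' * Real.log u)
        (fun u w => -(1 / 2) * w + C * Real.sqrt u)
        fun z hz => ⟨?_, ?_⟩, .inr (.inr (.inr (.inr (.inr (.inl ⟨hpos' T hT0, C, ε * C',
          fun z _ => ⟨rfl, rfl, rfl⟩⟩)))))⟩
      · rw [← hTφ (fun u => C' * Real.log u) K' hCK' z hz]
        ring
      · rw [← hTψ (fun u => C * u ^ (α / a₀ + 1)) K hCK z hz, hρ', Real.sqrt_eq_rpow,
          show (-1 / 2 + 1 : ℝ) = 1 / 2 by norm_num]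
        ring
    · obtain ⟨C, K, hCK⟩ := hF.1 hρ
      obtain ⟨C', K', hCK'⟩ := hG.1 (fun h => hρ' (by linarith))
      obtain ⟨T, hT0, hT1, hT⟩ := hT (β / α) (ε * K') K
      refine ⟨T, _, _, _, hT (fun u _ => ε * C' * u ^ (2 * (α / a₀) + 1))
        (fun u w => α / a₀ * w + C * u ^ (α / a₀ + 1))
        fun z hz => ⟨?_, ?_⟩, .inr (.inr (.inl ⟨hpos' T hT0, α / a₀, C, ε * C',
          div_ne_zero hα ha₀, hρ, hρ', fun z _ => ⟨rfl, rfl, rfl⟩⟩))⟩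
      · rw [← hTφ (fun u => C' * u ^ (2 * (α / a₀) + 1)) K' hCK' z hz]
        ring
      · rw [← hTψ (fun u => C * u ^ (α / a₀ + 1)) K hCK z hz]

/-- Classification of the solutions of the integrability conditions. -/
theorem nonsymInt_iff_exists_normalForm (hΩ : IsOpen Ω) (hc : Convex ℝ Ω) (hφ : ContDiffOn ℝ ∞ φ Ω)
    (hψ : ContDiffOn ℝ ∞ ψ Ω) (hη : ContDiffOn ℝ ∞ η Ω) (hη0 : ∀ z ∈ Ω, η z ≠ 0) :
    NonsymInt Ω φ ψ η ↔ ∃ (T : NonsymTransformation) (φ' ψ' η' : (Fin 2 → ℝ) → ℝ),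
      T.Carries Ω φ ψ η φ' ψ' η' ∧ NonsymNormalForm (T.map '' Ω) φ' ψ' η' := by
  constructor
  swap
  · rintro ⟨T, φ', ψ', η', hT, hN⟩
    refine nonsymInt_of_carries hΩ hφ hψ hη hη0 hT (hN.nonsymInt (T.isOpen_image_map hΩ) ?_)
    rintro _ ⟨z, hz, rfl⟩
    rw [(hT z hz).2.2]
    exact mul_ne_zero (div_ne_zero (pow_ne_zero 2 T.q_ne) (mul_ne_zero T.p_ne T.r_ne)) (hη0 z hz)
  intro H
  rcases Ω.eq_empty_or_nonempty with rfl | ⟨z₀, hz₀⟩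
  · exact ⟨⟨1, 1, 1, 1, 0, 0, 0, 0, 0, one_ne_zero, one_ne_zero, one_ne_zero, one_ne_zero⟩, φ, ψ, η,
      fun z hz => hz.elim, .inl ⟨0, 0, 0, fun z hz => by simp at hz⟩⟩
  obtain ⟨κ, hκ⟩ := H.exists_pd_eta hΩ hc hη hη0
  rcases eq_or_ne κ 0 with rfl | hκ0
  swap
  · obtain ⟨T, φ', ψ', η', hT, hN⟩ := H.exists_expFamily hΩ hc hφ hψ hη hη0 hκ0 hκ
    exact ⟨T, φ', ψ', η', hT, .inr (.inr (.inr (.inr (.inr (.inr hN)))))⟩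
  have hκ' : ∀ z ∈ Ω, pd 1 η z = 0 := fun z hz => (hκ z hz).trans (zero_mul _)
  have hdiv : ∀ z ∈ Ω, ∀ x, pd 1 η z * x / η z = 0 := fun z hz x => by rw [hκ' z hz]; simp
  obtain ⟨β, g, hg, hφg⟩ := exists_linear_form hΩ hc hφ
    (fun z hz => (H z hz).2.1.trans (hdiv z hz _)) (fun z hz => (H z hz).2.2.1.trans (hdiv z hz _))
  obtain ⟨α, f, hf, hψf⟩ := exists_linear_form hΩ hc hψ
    (fun z hz => (H z hz).2.2.2.2.1.trans (hdiv z hz _))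
    (fun z hz => (H z hz).2.2.2.2.2.1.trans (hdiv z hz _))
  obtain ⟨h, hh, hηh⟩ := exists_eq_comp_coord hΩ hc hη 0 fun z hz j hj => by
    obtain rfl : j = 1 := by fin_cases j <;> simp_all
    exact hκ' z hz
  have hJ := isOpen_image_coord hΩ 0
  have hJc := convex_image_coord hc 0
  have hz₀J := Set.mem_image_of_mem (fun z : Fin 2 → ℝ => z 0) hz₀
  have hode := (nonsymInt_linear_iff hΩ hg hf hh (fun z hz => by
    rw [← hηh z hz]; exact hη0 z hz) hφg hψf hηh).1 H
  obtain ⟨a₀, ha₀⟩ := exists_eq_const_of_hasDerivAt_zero hJ hJc (f := deriv h) fun u hu =>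
    (hasDerivAt_deriv_of_contDiffOn hJ hh hu).congr_deriv (hode u hu).2.2
  obtain ⟨b₀, hb₀⟩ := exists_eq_add_const hJ hJc (F := fun u => a₀ * u)
    (fun u hu => hasDerivAt_of_contDiffOn hJ hh hu)
    fun u hu => (hasDerivAt_mul_left a₀ u).congr_deriv (ha₀ u hu).symm
  have hηb : ∀ z ∈ Ω, η z = a₀ * z 0 + b₀ := fun z hz => by
    rw [hηh z hz, hb₀ _ (Set.mem_image_of_mem _ hz)]
  have hf' := fun u hu => And.intro (hasDerivAt_of_contDiffOn (u := u) hJ hf hu)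
    (hasDerivAt_deriv_of_contDiffOn hJ hf hu)
  have hg' := fun u hu => And.intro (hasDerivAt_of_contDiffOn (u := u) hJ hg hu)
    (hasDerivAt_deriv_of_contDiffOn hJ hg hu)
  have eg : ∀ u ∈ (fun z : Fin 2 → ℝ => z 0) '' Ω, iteratedDeriv 2 g u * (a₀ * u + b₀)
      = -(β ^ 2 + β * deriv f u - 2 * α * deriv g u) := fun u hu => by
    rw [← hb₀ u hu]; exact (hode u hu).1
  have ef : ∀ u ∈ (fun z : Fin 2 → ℝ => z 0) '' Ω, iteratedDeriv 2 f u * (a₀ * u + b₀)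
      = -(α * β) + α * deriv f u - 2 * β * a₀ := fun u hu => by
    rw [← hb₀ u hu, ← ha₀ u hu]; exact (hode u hu).2.1
  rcases eq_or_ne a₀ 0 with rfl | ha₀
  · simp only [zero_mul, zero_add, mul_zero, sub_zero] at hηb eg ef
    exact exists_normalForm_of_const hΩ hc (by rw [← hηb z₀ hz₀]; exact hη0 z₀ hz₀) hφg hψf hηb hf'
      hg' eg ef
  · have hne : ∀ u ∈ (fun z : Fin 2 → ℝ => z 0) '' Ω, a₀ * u + b₀ ≠ 0 := by
      rintro _ ⟨z, hz, rfl⟩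
      beta_reduce
      rw [← hηb z hz]; exact hη0 z hz
    have hcont : ContinuousOn (fun u => a₀ * u + b₀) ((fun z : Fin 2 → ℝ => z 0) '' Ω) := by
      fun_prop
    -- On the interval of values of `u` the function `η` has no zero and hence constant sign, which
    -- fixes `ε`.
    have hsign : ∀ u ∈ (fun z : Fin 2 → ℝ => z 0) '' Ω, ∀ v ∈ (fun z : Fin 2 → ℝ => z 0) '' Ω,
        0 < a₀ * u + b₀ → 0 < a₀ * v + b₀ := by
      intro u hu v hv h1
      by_contra h2
      obtain ⟨x, hx, hx0⟩ := hJc.isPreconnected.intermediate_value hv hu hcont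
        ⟨not_lt.1 h2, h1.le⟩
      exact hne x hx hx0
    rcases lt_or_gt_of_ne (hne _ hz₀J) with h0 | h0
    · refine exists_normalForm_of_affine hΩ hc ha₀ (ε := -1) (by norm_num) (fun u hu => ?_) hφg hψf
        hηb hf' hg' eg ef
      rcases lt_or_gt_of_ne (hne u hu) with h1 | h1
      · linarith
      · exact absurd (hsign u hu _ hz₀J h1) (not_lt.2 h0.le)
    · exact exists_normalForm_of_affine hΩ hc ha₀ (ε := 1) (by norm_num)
        (fun u hu => by rw [one_mul]; exact hsign _ hz₀J u hu h0) hφg hψf hηb hf' hg' eg ef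

end Classification

/-! ### Pointwise algebra of the Haantjes tensor -/

section HaantjesTensor

/-- The Nijenhuis tensor at a point, in terms of the matrix `M` and its derivatives
`E p i k = ∂_p M i k`. -/
def nijenhuisAt (M : Fin 3 → Fin 3 → ℝ) (E : Fin 3 → Fin 3 → Fin 3 → ℝ) (i j k : Fin 3) : ℝ :=
  ∑ p, (M p j * E p i k - M p k * E p i j - M i p * (E j p k - E k p j))

/-- The Haantjes tensor at a point, in terms of the matrix and its Nijenhuis tensor. -/
def haantjesAt (M : Fin 3 → Fin 3 → ℝ) (N : Fin 3 → Fin 3 → Fin 3 → ℝ) (i j k : Fin 3) : ℝ :=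
  ∑ p, ∑ r, (N i p r * M p j * M r k - N p j r * M i p * M r k
    - N p r k * M i p * M r j + N p j k * M i r * M r p)

variable {V : (Fin 3 → ℝ) → Matrix (Fin 3) (Fin 3) ℝ} {F : (Fin 3 → ℝ) → Fin 3 → Fin 3 → ℝ}
  {z : Fin 3 → ℝ} {E : Fin 3 → Fin 3 → Fin 3 → ℝ}

lemma haantjes_eq_haantjesAt (hV : ∀ᶠ y in 𝓝 z, ∀ i k, V y i k = F y i k)
    (hE : ∀ i k, HasGrad (fun y => F y i k) (fun p => E p i k) z) (i j k : Fin 3) :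
    haantjes V z i j k = haantjesAt (F z) (nijenhuisAt (F z) E) i j k := by
  have h1 : ∀ i k, V z i k = F z i k := hV.self_of_nhds
  have h2 : ∀ p i k, pd p (fun y => V y i k) z = E p i k := fun p i k => by
    rw [← (hE i k).pd_eq p, pd, pd,
      Filter.EventuallyEq.fderiv_eq (hV.mono fun y hy => hy i k)]
  simp only [haantjes, nijenhuis, haantjesAt, nijenhuisAt, h1, h2]

lemma nijenhuisAt_antisymm (M : Fin 3 → Fin 3 → ℝ) (E : Fin 3 → Fin 3 → Fin 3 → ℝ)
    (i j k : Fin 3) : nijenhuisAt M E i j k = -nijenhuisAt M E i k j := by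
  simp only [nijenhuisAt, ← Finset.sum_neg_distrib]
  exact Finset.sum_congr rfl fun p _ => by ring

lemma haantjesAt_antisymm {M : Fin 3 → Fin 3 → ℝ} {N : Fin 3 → Fin 3 → Fin 3 → ℝ}
    (hN : ∀ i j k, N i j k = -N i k j) (i j k : Fin 3) :
    haantjesAt M N i j k = -haantjesAt M N i k j := by
  have h1 : ∑ p, ∑ r, N i p r * M p j * M r k = -∑ p, ∑ r, N i p r * M p k * M r j := by
    rw [Finset.sum_comm]
    simp only [← Finset.sum_neg_distrib]
    exact Finset.sum_congr rfl fun p _ => Finset.sum_congr rfl fun r _ => by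
      rw [hN i r p]; ring
  simp only [haantjesAt, Finset.sum_add_distrib, Finset.sum_sub_distrib, h1]
  simp only [← Finset.sum_neg_distrib, ← Finset.sum_sub_distrib, ← Finset.sum_add_distrib]
  exact Finset.sum_congr rfl fun p _ => Finset.sum_congr rfl fun r _ => by
    rw [hN p j r, hN p r k, hN p j k]; ring

lemma haantjesAt_eq_zero_of_lt {M : Fin 3 → Fin 3 → ℝ} {N : Fin 3 → Fin 3 → Fin 3 → ℝ}
    (hN : ∀ i j k, N i j k = -N i k j) (h : ∀ i j k, j < k → haantjesAt M N i j k = 0)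
    (i j k : Fin 3) : haantjesAt M N i j k = 0 := by
  rcases lt_trichotomy j k with hjk | rfl | hjk
  · exact h i j k hjk
  · linarith [haantjesAt_antisymm (M := M) hN i j j]
  · rw [haantjesAt_antisymm hN, h i k j hjk, neg_zero]

lemma nijenhuisAt_affine (c κ ε : ℝ) (M : Fin 3 → Fin 3 → ℝ) (E : Fin 3 → Fin 3 → Fin 3 → ℝ)
    (i j k : Fin 3) :
    nijenhuisAt (fun i k => c * (if i = k then 1 else 0) + κ * M i k) (fun p i k => ε * E p i k)
      i j k = κ * ε * nijenhuisAt M E i j k := by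
  have h : ∀ p, (c * (if p = j then 1 else 0) + κ * M p j) * (ε * E p i k)
      - (c * (if p = k then 1 else 0) + κ * M p k) * (ε * E p i j)
      - (c * (if i = p then 1 else 0) + κ * M i p) * (ε * E j p k - ε * E k p j)
      = c * ε * ((if p = j then E p i k else 0) - (if p = k then E p i j else 0)
        - (if i = p then E j p k - E k p j else 0))
        + κ * ε * (M p j * E p i k - M p k * E p i j - M i p * (E j p k - E k p j)) := fun p => by
    split_ifs <;> ring
  simp only [nijenhuisAt, h, Finset.sum_add_distrib, ← Finset.mul_sum]
  rw [Finset.sum_sub_distrib, Finset.sum_sub_distrib, Finset.sum_ite_eq', Finset.sum_ite_eq',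
    Finset.sum_ite_eq]
  simp

/-- The expression `N(M·, M·) - M N(·, M·) - M N(M·, ·) + M² N(·, ·)` does not change when a
multiple of the identity is added to `M`, for any `N`. Together with `nijenhuisAt_affine` this
allows scalar parts and denominators to be removed. -/
lemma haantjesAt_affine (c κ ε : ℝ) (M : Fin 3 → Fin 3 → ℝ) (N : Fin 3 → Fin 3 → Fin 3 → ℝ)
    (i j k : Fin 3) :
    haantjesAt (fun i k => c * (if i = k then 1 else 0) + κ * M i k) (fun i j k => ε * N i j k)
      i j k = κ ^ 2 * ε * haantjesAt M N i j k := by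
  fin_cases i <;> fin_cases j <;> fin_cases k <;>
  · simp [haantjesAt, Fin.sum_univ_three]
    ring

/-- The Haantjes tensor of `c + δ (n ⊗ m / D + K)`, where `n` and `K` are constant. -/
lemma haantjes_eq_zero_of_rank_one {c δ : ℝ} {n : Fin 3 → ℝ} {m : Fin 3 → (Fin 3 → ℝ) → ℝ}
    {D : (Fin 3 → ℝ) → ℝ} {K : Fin 3 → Fin 3 → ℝ} {dm : Fin 3 → Fin 3 → ℝ} {dD : Fin 3 → ℝ}
    (hV : ∀ᶠ y in 𝓝 z, ∀ i k, V y i k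
      = c * (if i = k then 1 else 0) + δ * (n i * (m k y / D y) + K i k))
    (hm : ∀ k, HasGrad (m k) (dm k) z) (hD : HasGrad D dD z) (hD0 : D z ≠ 0)
    (h : ∀ i j k, j < k → haantjesAt (fun i k => n i * m k z + D z * K i k)
      (nijenhuisAt (fun i k => n i * m k z + D z * K i k)
        (fun p i k => n i * (dm k p * D z - m k z * dD p))) i j k = 0) (i j k : Fin 3) :
    haantjes V z i j k = 0 := by
  have hE : ∀ i k, HasGrad (fun y => c * (if i = k then 1 else 0)
      + δ * (n i * (m k y / D y) + K i k))
      (fun p => δ / D z ^ 2 * (n i * (dm k p * D z - m k z * dD p))) z := fun i k => by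
    refine ((hasGrad_const (c * (if i = k then 1 else 0)) z).add
      (((((hm k).div hD hD0).const_mul (n i)).add (hasGrad_const (K i k) z)).const_mul
        δ)).congr_grad fun p => ?_
    ring
  have hM : (fun i k => c * (if i = k then 1 else 0) + δ * (n i * (m k z / D z) + K i k))
      = fun i k => c * (if i = k then 1 else 0) + δ / D z * (n i * m k z + D z * K i k) := by
    funext i k
    field_simp
  rw [haantjes_eq_haantjesAt hV
    (E := fun p i k => δ / D z ^ 2 * (n i * (dm k p * D z - m k z * dD p))) hE, hM]
  have hN := nijenhuisAt_affine c (δ / D z) (δ / D z ^ 2) (fun i k => n i * m k z + D z * K i k)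
    (fun p i k => n i * (dm k p * D z - m k z * dD p))
  rw [show nijenhuisAt _ _ = _ from funext fun i => funext fun j => funext fun k => hN i j k,
    haantjesAt_affine, haantjesAt_eq_zero_of_lt (nijenhuisAt_antisymm _ _) h, mul_zero]

lemma inv_mul_eq_of_mul_eq {P Q W : Matrix (Fin 3) (Fin 3) ℝ} (hP : P.det ≠ 0) (h : P * W = Q) :
    P⁻¹ * Q = W := by
  rw [← h, Matrix.nonsing_inv_mul_cancel_left _ _ (isUnit_iff_ne_zero.2 hP)]

end HaantjesTensor

/-! ### The first order system from the two-parameter family -/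

section HaantjesConditions

variable {Ω : Set (Fin 3 → ℝ)} {φ ψ η τ : (Fin 3 → ℝ) → ℝ}

lemma HaantjesVanishes.haantjesVanishes₂ (hτ0 : ∀ z ∈ Ω, τ z ≠ 0)
    (h : HaantjesVanishes Ω φ ψ η τ) : HaantjesVanishes₂ Ω φ ψ η τ := by
  intro α α' z hz
  have h1 := h α 1 0 α' 0 1 z hz (by
    simpa [symA, symB, Matrix.det_fin_three] using hτ0 z hz)
  simpa using h1

lemma haantjesVanishes₂_matrix_eq {p t q e : ℝ} (α α' : ℝ) (ht : t ≠ 0) :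
    (α • symA + !![p, t, 0; 0, 0, 1; -1, 0, 0])⁻¹ * (α' • symA + !![q, 0, e; -1, 0, 0; 0, 1, 0])
      = ![![0, -1, 0], ![(q - α') / t, (p - α) / t, e / t], ![-1, 0, 0]] := by
  refine inv_mul_eq_of_mul_eq (W := !![0, -1, 0; (q - α') / t, (p - α) / t, e / t; -1, 0, 0]) ?_ ?_
  · simpa [symA, Matrix.det_fin_three] using ht
  · ext i k
    fin_cases i <;> fin_cases k <;> simp [symA, Matrix.mul_apply, Fin.sum_univ_three] <;>
      field_simp <;> ring

lemma HaantjesVanishes₂.symInt (hΩ : IsOpen Ω) (hφ : ContDiffOn ℝ ∞ φ Ω)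
    (hψ : ContDiffOn ℝ ∞ ψ Ω) (hη : ContDiffOn ℝ ∞ η Ω) (hτ : ContDiffOn ℝ ∞ τ Ω)
    (hη0 : ∀ z ∈ Ω, η z ≠ 0) (hτ0 : ∀ z ∈ Ω, τ z ≠ 0)
    (h : HaantjesVanishes₂ Ω φ ψ η τ) : SymInt Ω φ ψ η τ := by
  intro z hz
  have gφ := hasGrad_of_contDiffOn hΩ hφ hz
  have gψ := hasGrad_of_contDiffOn hΩ hψ hz
  have gη := hasGrad_of_contDiffOn hΩ hη hz
  have gτ := hasGrad_of_contDiffOn hΩ hτ hz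
  have ht := hτ0 z hz
  have he := hη0 z hz
  -- At the fixed point `z` the constants `α, α'` can be chosen so that two entries of the matrix
  -- take arbitrary values `a, b`, while the derivatives of the coefficients stay the same.
  have key : ∀ a b : ℝ, ∀ i j k,
      haantjesAt ![![0, -1, 0], ![a, b, η z / τ z], ![-1, 0, 0]]
        (nijenhuisAt ![![0, -1, 0], ![a, b, η z / τ z], ![-1, 0, 0]]
        (fun p => ![0, ![(pd p ψ z - a * pd p τ z) / τ z, (pd p φ z - b * pd p τ z) / τ z,
          (pd p η z - η z / τ z * pd p τ z) / τ z], 0])) i j k = 0 := by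
    intro a b i j k
    have h1 := h (φ z - b * τ z) (ψ z - a * τ z) z hz i j k
    rw [haantjes_eq_haantjesAt (F := fun y => ![![0, -1, 0], ![(ψ y - (ψ z - a * τ z)) / τ y,
        (φ y - (φ z - b * τ z)) / τ y, η y / τ y], ![-1, 0, 0]])
      (E := fun p => ![0, ![(pd p ψ z - a * pd p τ z) / τ z, (pd p φ z - b * pd p τ z) / τ z,
          (pd p η z - η z / τ z * pd p τ z) / τ z], 0])] at h1
    · simpa [ht] using h1
    · filter_upwards [hΩ.mem_nhds hz] with y hy i k
      exact congrFun (congrFun (haantjesVanishes₂_matrix_eq _ _ (hτ0 y hy)) i) k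
    · intro i k
      fin_cases i
      · fin_cases k <;> simpa using hasGrad_const _ z
      · fin_cases k
        · simp
          refine ((gψ.sub (hasGrad_const _ z)).div gτ ht).congr_grad fun p => ?_
          field_simp; ring
        · simp
          refine ((gφ.sub (hasGrad_const _ z)).div gτ ht).congr_grad fun p => ?_
          field_simp; ring
        · simp
          refine (gη.div gτ ht).congr_grad fun p => ?_
          field_simp
      · fin_cases k <;> simpa using hasGrad_const _ z
  -- These three components, taken at `(a, b) = (0, 0), (1, 0), (0, 1)`, already yield all nine
  -- equations.
  have c1 := fun a b => key a b 0 0 1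
  have c2 := fun a b => key a b 0 1 2
  have c3 := fun a b => key a b 2 0 1
  simp only [haantjesAt, nijenhuisAt, Fin.sum_univ_three, Matrix.cons_val_zero, Matrix.cons_val_one,
    Matrix.cons_val, Pi.zero_apply, mul_zero, zero_mul, sub_zero, add_zero, zero_add, neg_zero,
    zero_sub, mul_neg, neg_mul, mul_one, one_mul, neg_neg] at c1 c2 c3
  clear key h gφ gψ gη gτ
  generalize η z = e at *
  generalize τ z = t at *
  generalize pd 0 φ z = f0 at *
  generalize pd 1 φ z = f1 at *
  generalize pd 2 φ z = f2 at *
  generalize pd 0 ψ z = s0 at *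
  generalize pd 1 ψ z = s1 at *
  generalize pd 2 ψ z = s2 at *
  generalize pd 0 η z = h0 at *
  generalize pd 1 η z = h1 at *
  generalize pd 2 η z = h2 at *
  generalize pd 0 τ z = t0 at *
  generalize pd 1 τ z = t1 at *
  generalize pd 2 τ z = t2 at *
  have k1 := c1 0 0
  have k2 := c1 1 0
  have k3 := c1 0 1
  have k4 := c2 0 0
  have k5 := c2 1 0
  have k6 := c2 0 1
  have k7 := c3 0 0
  have k8 := c3 1 0
  have k9 := c3 0 1
  clear c1 c2 c3
  field_simp at k1 k2 k3 k4 k5 k6 k7 k8 k9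
  have e1 : t2 = 0 := mul_left_cancel₀ ht (by linear_combination k1 - k2)
  have e2 : h1 = 0 := mul_left_cancel₀ ht (by linear_combination k3 - k1)
  have e3 : f2 = 0 := mul_left_cancel₀ ht (by linear_combination k5 - k4 + 2 * t * e2)
  have e4 : h0 = s2 := mul_left_cancel₀ ht (by linear_combination k6 - k4)
  have e5 : t0 = f1 := mul_left_cancel₀ ht (by linear_combination k7 - k8)
  have e6 : s1 = 0 := mul_left_cancel₀ ht (by linear_combination k7 - k9 + 2 * t * e1)
  have e7 : t * s2 = e * f1 := by linear_combination -k1 - 2 * t * e4 + 2 * e * e5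
  have e8 : t1 = t / e * s0 := by
    field_simp
    linear_combination -k7 - 2 * t * e3 + t * e2
  have e9 : h2 = e / t * f0 := by
    field_simp
    linear_combination k4 - 2 * e * e6 + e * e1
  exact ⟨e5, e4, e8, e2, e1, e9, e6, e3, e7⟩

end HaantjesConditions

/-! ### Vanishing of the Haantjes tensor by Cayley-Hamilton -/

section HaantjesVanishing

/-- A criterion for the vanishing of the Haantjes tensor when `∂_p M i k = n i * S p k`: the
Nijenhuis tensor is then `n ⊗ X - M n ⊗ Y` with two-forms `X`, `Y`. -/
lemma haantjesAt_eq_zero_of_two_forms {M S X Y : Fin 3 → Fin 3 → ℝ} {n : Fin 3 → ℝ} {c₁ c₂ c₃ : ℝ}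
    (hX : ∀ j k, X j k = ∑ p, (M p j * S p k - M p k * S p j)) (hY : ∀ j k, Y j k = S j k - S k j)
    (h₁ : c₁ = M 0 0 + M 1 1 + M 2 2)
    (h₂ : c₂ = M 0 0 * M 1 1 - M 0 1 * M 1 0 + (M 0 0 * M 2 2 - M 0 2 * M 2 0)
      + (M 1 1 * M 2 2 - M 1 2 * M 2 1))
    (h₃ : c₃ = M 0 0 * (M 1 1 * M 2 2 - M 1 2 * M 2 1) - M 0 1 * (M 1 0 * M 2 2 - M 1 2 * M 2 0)
      + M 0 2 * (M 1 0 * M 2 1 - M 1 1 * M 2 0)) {j k : Fin 3}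
    (e₁ : X j k + ∑ p, (M p j * Y p k + M p k * Y j p) = c₁ * Y j k)
    (e₂ : ∑ p, (M p j * X p k + M p k * X j p) + ∑ p, ∑ r, Y p r * M p j * M r k = c₂ * Y j k)
    (e₃ : ∑ p, ∑ r, X p r * M p j * M r k = c₃ * Y j k) (i : Fin 3) :
    haantjesAt M (nijenhuisAt M (fun p i k => n i * S p k)) i j k = 0 := by
  have hN : nijenhuisAt M (fun p i k => n i * S p k)
      = fun i j k => n i * X j k - (∑ p, M i p * n p) * Y j k := by
    funext i j k
    simp only [nijenhuisAt, hX, hY, Fin.sum_univ_three]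
    ring
  -- Cayley-Hamilton for `M³ n`. The Haantjes tensor is a combination of `n, Mn, M²n, M³n` with
  -- two-forms as coefficients; after elimination of `M³ n` the three remaining coefficients vanish
  -- by `e₁, e₂, e₃`.
  have hCH : ∑ p, M i p * ∑ r, M p r * ∑ s, M r s * n s = c₁ * ∑ p, M i p * ∑ r, M p r * n r
      - c₂ * ∑ p, M i p * n p + c₃ * n i := by
    simp only [h₁, h₂, h₃, Fin.sum_univ_three]
    fin_cases i <;> simp only [Fin.zero_eta, Fin.mk_one, Fin.reduceFinMk] <;> ring
  rw [hN]
  clear hX hY h₁ h₂ h₃ hN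
  simp only [haantjesAt, Fin.sum_univ_three] at *
  linear_combination n i * e₃ - (M i 0 * n 0 + M i 1 * n 1 + M i 2 * n 2) * e₂
    + (M i 0 * (M 0 0 * n 0 + M 0 1 * n 1 + M 0 2 * n 2)
      + M i 1 * (M 1 0 * n 0 + M 1 1 * n 1 + M 1 2 * n 2)
      + M i 2 * (M 2 0 * n 0 + M 2 1 * n 1 + M 2 2 * n 2)) * e₁ - Y j k * hCH

/-- The case `β ≠ 0`: `g` stands for `γ / β`, `M` is the rank one term plus `D` times the constant
matrix of `inv_mul_sym_generic`, and `A, B, C` are the numbers of `SymDifferential`. -/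
lemma haantjesAt_generic_eq_zero {M : Fin 3 → Fin 3 → ℝ} {m : Fin 3 → ℝ} {dm : Fin 3 → Fin 3 → ℝ}
    {dD : Fin 3 → ℝ} {n : Fin 3 → ℝ} {g p q d e t A B C D : ℝ}
    (hD : D = g * p + t + g ^ 3 * e)
    (hm : m = ![q + g * e * d, (p + g ^ 2 * e) * d, e * d])
    (hM : M = ![![g * q + g ^ 2 * e * d, -t * d, g * e * d],
      ![q + g * e * d, (p + g ^ 2 * e) * d, e * d],
      ![g ^ 2 * q - (p * g + t) * d, -g * t * d, g ^ 2 * d * e]])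
    (hdm : dm = ![![d * (e * C) + g * d * (e * B), 0, d * (e * B) + g * d * (e * A)],
      ![d * (t * A + g * (e * C) + g ^ 2 * (e * B)), d * (t * B),
        d * (g * (e * B) + g ^ 2 * (e * A))], ![d * (e * B), 0, d * (e * A)]])
    (hdD : dD = ![g * (t * A + g * (e * C)) + t * B + g ^ 3 * (e * B), g * (t * B) + t * C,
      g * (g * (e * B)) + g ^ 3 * (e * A)]) (i j k : Fin 3) (hjk : j < k) :
    haantjesAt M (nijenhuisAt M (fun p i k => n i * (dm k p * D - m k * dD p))) i j k = 0 := by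
  refine haantjesAt_eq_zero_of_two_forms (fun _ _ => rfl) (fun _ _ => rfl) rfl rfl rfl ?_ ?_ ?_ i
  all_goals
    simp only [Fin.sum_univ_three, hM, hm, hdm, hdD, hD]
    fin_cases j <;> fin_cases k <;> first
    | exact absurd hjk (by decide)
    | (simp only [Fin.zero_eta, Fin.mk_one, Fin.reduceFinMk, Matrix.cons_val_zero,
        Matrix.cons_val_one, Matrix.cons_val]
       ring)

/-- The case `β = 0`, with `η` as denominator. -/
lemma haantjesAt_degenerate_eq_zero {M : Fin 3 → Fin 3 → ℝ} {m : Fin 3 → ℝ}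
    {dm : Fin 3 → Fin 3 → ℝ} {dD : Fin 3 → ℝ} {n : Fin 3 → ℝ} {p q d e t A B C : ℝ}
    (hm : m = ![q, t * d, p * d])
    (hM : M = ![![0, 0, -e * d], ![-e * d, 0, 0], ![q, t * d, p * d]])
    (hdm : dm = ![![d * (t * A), d * (t * B), 0], ![d * (t * B), d * (t * C), 0],
      ![d * (e * C), 0, d * (e * B)]])
    (hdD : dD = ![e * B, 0, e * A]) (i j k : Fin 3) (hjk : j < k) :
    haantjesAt M (nijenhuisAt M (fun p i k => n i * (dm k p * e - m k * dD p))) i j k = 0 := by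
  refine haantjesAt_eq_zero_of_two_forms (fun _ _ => rfl) (fun _ _ => rfl) rfl rfl rfl ?_ ?_ ?_ i
  all_goals
    simp only [Fin.sum_univ_three, hM, hm, hdm, hdD]
    fin_cases j <;> fin_cases k <;> first
    | exact absurd hjk (by decide)
    | (simp only [Fin.zero_eta, Fin.mk_one, Fin.reduceFinMk, Matrix.cons_val_zero,
        Matrix.cons_val_one, Matrix.cons_val]
       ring)

end HaantjesVanishing

/-! ### The first order system implies vanishing for all constants -/

section HaantjesOfSymInt

variable {Ω : Set (Fin 3 → ℝ)} {φ ψ η τ : (Fin 3 → ℝ) → ℝ}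

lemma det_sym_combination (α β γ f s e t : ℝ) :
    (α • symA + β • !![f, t, 0; 0, 0, 1; -1, 0, 0] + γ • !![s, 0, e; -1, 0, 0; 0, 1, 0]).det
      = -(β * γ * (-α + β * f + γ * s) + β ^ 3 * t + γ ^ 3 * e) := by
  simp [symA, Matrix.det_fin_three]
  ring

/-- Subtracting `β' / β` times the first matrix from the second eliminates `B`. The rest depends on
the coefficients only through a rank one matrix whose column vector is constant, which is what
`haantjes_eq_zero_of_rank_one` requires. -/
lemma inv_mul_sym_generic {α β γ α' β' γ' f s e t D : ℝ} (hβ : β ≠ 0)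
    (hD : D = γ / β * (-(α / β) + f + γ / β * s) + t + (γ / β) ^ 3 * e) (hD0 : D ≠ 0) (i k : Fin 3) :
    ((α • symA + β • !![f, t, 0; 0, 0, 1; -1, 0, 0] + γ • !![s, 0, e; -1, 0, 0; 0, 1, 0])⁻¹
      * (α' • symA + β' • !![f, t, 0; 0, 0, 1; -1, 0, 0] + γ' • !![s, 0, e; -1, 0, 0; 0, 1, 0])) i k
      = β' / β * (if i = k then 1 else 0) + β⁻¹ * (![γ / β, 1, (γ / β) ^ 2] i
        * (![-(α' - β' * (α / β)) + (γ' - β' * (γ / β)) * s + γ / β * e * (γ' - β' * (γ / β)),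
            (-(α / β) + f + γ / β * s + (γ / β) ^ 2 * e) * (γ' - β' * (γ / β)),
            e * (γ' - β' * (γ / β))] k / D)
        + ![![0, -(γ' - β' * (γ / β)), 0], 0,
          ![-(γ' - β' * (γ / β)), -(γ / β * (γ' - β' * (γ / β))), 0]] i k) := by
  obtain ⟨a, rfl⟩ : ∃ a, α = β * a := ⟨α / β, by field_simp⟩
  obtain ⟨g, rfl⟩ : ∃ g, γ = β * g := ⟨γ / β, by field_simp⟩
  simp only [mul_div_cancel_left₀ _ hβ] at hD ⊢
  rw [inv_mul_eq_of_mul_eq (W := Matrix.of fun i k => β' / β * (if i = k then 1 else 0)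
      + β⁻¹ * (![g, 1, g ^ 2] i
        * (![-(α' - β' * a) + (γ' - β' * g) * s + g * e * (γ' - β' * g),
            (-a + f + g * s + g ^ 2 * e) * (γ' - β' * g),
            e * (γ' - β' * g)] k / D)
        + ![![0, -(γ' - β' * g), 0], 0, ![-(γ' - β' * g), -(g * (γ' - β' * g)), 0]] i k))]
  · rfl
  · rw [det_sym_combination, neg_ne_zero]
    have : β * (β * g) * (-(β * a) + β * f + β * g * s) + β ^ 3 * t + (β * g) ^ 3 * e
        = β ^ 3 * D := by rw [hD]; ring
    rw [this]
    exact mul_ne_zero (pow_ne_zero 3 hβ) hD0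
  · have ht : t = D - g * (-a + f + g * s) - g ^ 3 * e := by rw [hD]; ring
    subst ht
    clear hD
    ext i k
    fin_cases i <;> fin_cases k <;>
      simp [symA, Matrix.mul_apply, Fin.sum_univ_three] <;> field_simp <;> ring

lemma inv_mul_sym_degenerate {α γ α' β' γ' f s e t : ℝ} (hγ : γ ≠ 0) (he : e ≠ 0) (i k : Fin 3) :
    ((α • symA + (0 : ℝ) • !![f, t, 0; 0, 0, 1; -1, 0, 0] + γ • !![s, 0, e; -1, 0, 0; 0, 1, 0])⁻¹
      * (α' • symA + β' • !![f, t, 0; 0, 0, 1; -1, 0, 0] + γ' • !![s, 0, e; -1, 0, 0; 0, 1, 0])) i k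
      = γ' / γ * (if i = k then 1 else 0) + γ⁻¹ * (![0, 0, 1] i
        * (![-(α' - γ' * (α / γ)) + β' * f, t * β', (-(α / γ) + s) * β'] k / e)
        + ![![0, 0, -β'], ![-β', 0, 0], 0] i k) := by
  obtain ⟨a, rfl⟩ : ∃ a, α = γ * a := ⟨α / γ, by field_simp⟩
  simp only [mul_div_cancel_left₀ _ hγ]
  rw [inv_mul_eq_of_mul_eq (W := Matrix.of fun i k => γ' / γ * (if i = k then 1 else 0)
      + γ⁻¹ * (![0, 0, 1] i * (![-(α' - γ' * a) + β' * f, t * β', (-a + s) * β'] k / e)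
        + ![![0, 0, -β'], ![-β', 0, 0], 0] i k))]
  · rfl
  · rw [det_sym_combination]
    simp [hγ, he]
  · ext i k
    fin_cases i <;> fin_cases k <;>
      simp [symA, Matrix.mul_apply, Fin.sum_univ_three] <;> field_simp <;> ring

/-- At `z` the differentials of `φ, ψ, η, τ` are given by three numbers
`A = φ_u / τ`, `B = φ_v / τ = ψ_w / η`, `C = ψ_u / η`. -/
def SymDifferential (φ ψ η τ : (Fin 3 → ℝ) → ℝ) (z : Fin 3 → ℝ) : Prop :=
  ∃ A B C : ℝ, HasGrad φ ![τ z * A, τ z * B, 0] z ∧ HasGrad ψ ![η z * C, 0, η z * B] z ∧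
    HasGrad η ![η z * B, 0, η z * A] z ∧ HasGrad τ ![τ z * B, τ z * C, 0] z

lemma SymInt.symDifferential (hΩ : IsOpen Ω) (hφ : ContDiffOn ℝ ∞ φ Ω)
    (hψ : ContDiffOn ℝ ∞ ψ Ω) (hη : ContDiffOn ℝ ∞ η Ω) (hτ : ContDiffOn ℝ ∞ τ Ω)
    (hη0 : ∀ z ∈ Ω, η z ≠ 0) (hτ0 : ∀ z ∈ Ω, τ z ≠ 0)
    (h : SymInt Ω φ ψ η τ) : ∀ z ∈ Ω, SymDifferential φ ψ η τ z := by
  intro z hz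
  have ht := hτ0 z hz
  have he := hη0 z hz
  obtain ⟨A, hA⟩ : ∃ A, pd 0 φ z = τ z * A := ⟨pd 0 φ z / τ z, by field_simp⟩
  obtain ⟨B, hB⟩ : ∃ B, pd 1 φ z = τ z * B := ⟨pd 1 φ z / τ z, by field_simp⟩
  obtain ⟨C, hC⟩ : ∃ C, pd 0 ψ z = η z * C := ⟨pd 0 ψ z / η z, by field_simp⟩
  obtain ⟨h1, h2, h3, h4, h5, h6, h7, h8, h9⟩ := h z hz
  have hs2 : pd 2 ψ z = η z * B := mul_left_cancel₀ ht (by rw [h9, hB]; ring)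
  have gφ : HasGrad φ ![τ z * A, τ z * B, 0] z :=
    (hasGrad_of_contDiffOn hΩ hφ hz).congr_grad fun p => by
      fin_cases p <;> simp [hA, hB, h8]
  have gψ : HasGrad ψ ![η z * C, 0, η z * B] z :=
    (hasGrad_of_contDiffOn hΩ hψ hz).congr_grad fun p => by
      fin_cases p <;> simp [hC, h7, hs2]
  have gη : HasGrad η ![η z * B, 0, η z * A] z :=
    (hasGrad_of_contDiffOn hΩ hη hz).congr_grad fun p => by
      fin_cases p <;> simp [h2, hs2, h4, h6, hA]
      field_simp
  have gτ : HasGrad τ ![τ z * B, τ z * C, 0] z :=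
    (hasGrad_of_contDiffOn hΩ hτ hz).congr_grad fun p => by
      fin_cases p <;> simp [h1, hB, h5, h3, hC]
      field_simp
  exact ⟨A, B, C, gφ, gψ, gη, gτ⟩

lemma symInt_of_symDifferential (hη0 : ∀ z ∈ Ω, η z ≠ 0) (hτ0 : ∀ z ∈ Ω, τ z ≠ 0)
    (h : ∀ z ∈ Ω, SymDifferential φ ψ η τ z) : SymInt Ω φ ψ η τ := by
  intro z hz
  have ht := hτ0 z hz
  have he := hη0 z hz
  obtain ⟨A, B, C, gφ, gψ, gη, gτ⟩ := h z hz
  simp only [gφ.pd_eq, gψ.pd_eq, gη.pd_eq, gτ.pd_eq, Matrix.cons_val_zero, Matrix.cons_val_one,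
    Matrix.cons_val, true_and]
  exact ⟨by field_simp, by field_simp, by ring⟩

lemma SymInt.haantjesVanishes (hΩ : IsOpen Ω) (hφ : ContDiffOn ℝ ∞ φ Ω)
    (hψ : ContDiffOn ℝ ∞ ψ Ω) (hη : ContDiffOn ℝ ∞ η Ω) (hτ : ContDiffOn ℝ ∞ τ Ω)
    (hη0 : ∀ z ∈ Ω, η z ≠ 0) (hτ0 : ∀ z ∈ Ω, τ z ≠ 0)
    (h : SymInt Ω φ ψ η τ) : HaantjesVanishes Ω φ ψ η τ := by
  intro α β γ α' β' γ' z hz hdet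
  have ht := hτ0 z hz
  have he := hη0 z hz
  obtain ⟨A, B, C, gφ, gψ, gη, gτ⟩ := h.symDifferential hΩ hφ hψ hη hτ hη0 hτ0 z hz
  rcases eq_or_ne β 0 with rfl | hβ
  · have hγ : γ ≠ 0 := by
      rintro rfl
      exact hdet (by simp [symA, Matrix.det_fin_three])
    refine haantjes_eq_zero_of_rank_one (c := γ' / γ) (δ := γ⁻¹) (n := ![0, 0, 1])
      (m := ![fun y => -(α' - γ' * (α / γ)) + β' * φ y, fun y => τ y * β',
        fun y => (-(α / γ) + ψ y) * β']) (D := η) (K := ![![0, 0, -β'], ![-β', 0, 0], 0])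
      (dm := ![![β' * (τ z * A), β' * (τ z * B), 0], ![β' * (τ z * B), β' * (τ z * C), 0],
        ![β' * (η z * C), 0, β' * (η z * B)]]) (dD := ![η z * B, 0, η z * A]) ?_ ?_ gη he ?_
    · filter_upwards [hΩ.mem_nhds hz] with y hy i k
      refine (inv_mul_sym_degenerate hγ (hη0 y hy) i k).trans ?_
      fin_cases k <;> simp
    · intro k
      fin_cases k
      · refine ((hasGrad_const _ z).add (gφ.const_mul β')).congr_grad fun p => ?_
        fin_cases p <;> simp
      · refine (gτ.mul (hasGrad_const β' z)).congr_grad fun p => ?_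
        fin_cases p <;> simp [mul_comm]
      · refine (((hasGrad_const _ z).add gψ).mul (hasGrad_const β' z)).congr_grad fun p => ?_
        fin_cases p <;> simp [mul_comm]
    · refine haantjesAt_degenerate_eq_zero (m := fun k => _) (p := -(α / γ) + ψ z)
        (q := -(α' - γ' * (α / γ)) + β' * φ z) (d := β') (t := τ z) (A := A) (B := B) (C := C)
        ?_ ?_ rfl rfl
      · funext k; fin_cases k <;> simp
      · funext i k
        fin_cases i <;> fin_cases k <;> simp
  · generalize hg : γ / β = g
    generalize ha : α / β = a
    generalize hd : γ' - β' * g = d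
    have hdD : HasGrad (fun y => g * (-a + φ y + g * ψ y) + τ y + g ^ 3 * η y)
        ![g * (τ z * A + g * (η z * C)) + τ z * B + g ^ 3 * (η z * B), g * (τ z * B) + τ z * C,
          g * (g * (η z * B)) + g ^ 3 * (η z * A)] z := by
      refine ((((((hasGrad_const _ z).add gφ).add (gψ.const_mul g)).const_mul g).add gτ).add
        (gη.const_mul (g ^ 3))).congr_grad fun p => ?_
      fin_cases p <;> simp
    have hD0 : g * (-a + φ z + g * ψ z) + τ z + g ^ 3 * η z ≠ 0 := by
      intro hD
      refine hdet ((det_sym_combination _ _ _ _ _ _ _).trans ?_)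
      rw [show β * γ * (-α + β * φ z + γ * ψ z) + β ^ 3 * τ z + γ ^ 3 * η z
        = β ^ 3 * (g * (-a + φ z + g * ψ z) + τ z + g ^ 3 * η z) by
          rw [← hg, ← ha]; field_simp, hD, mul_zero, neg_zero]
    refine haantjes_eq_zero_of_rank_one (c := β' / β) (δ := β⁻¹) (n := ![g, 1, g ^ 2])
      (m := ![fun y => -(α' - β' * a) + d * ψ y + g * η y * d,
        fun y => (-a + φ y + g * ψ y + g ^ 2 * η y) * d, fun y => η y * d])
      (D := fun y => g * (-a + φ y + g * ψ y) + τ y + g ^ 3 * η y)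
      (K := ![![0, -d, 0], 0, ![-d, -(g * d), 0]])
      (dm := ![![d * (η z * C) + g * d * (η z * B), 0, d * (η z * B) + g * d * (η z * A)],
      ![d * (τ z * A + g * (η z * C) + g ^ 2 * (η z * B)), d * (τ z * B),
        d * (g * (η z * B) + g ^ 2 * (η z * A))], ![d * (η z * B), 0, d * (η z * A)]])
      ?_ ?_ hdD hD0 ?_
    · filter_upwards [ContinuousAt.eventually_ne hdD.continuousAt hD0] with y hy i k
      refine (inv_mul_sym_generic (D := g * (-a + φ y + g * ψ y) + τ y + g ^ 3 * η y) hβ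
        (by rw [hg, ha]) hy i k).trans ?_
      rw [hg, ha, hd]
      fin_cases k <;> simp
    · intro k
      fin_cases k
      · refine (((hasGrad_const _ z).add (gψ.const_mul d)).add
          ((gη.const_mul g).mul (hasGrad_const d z))).congr_grad fun p => ?_
        fin_cases p <;> simp <;> ring
      · refine (((((hasGrad_const _ z).add gφ).add (gψ.const_mul g)).add
          (gη.const_mul (g ^ 2))).mul (hasGrad_const d z)).congr_grad fun p => ?_
        fin_cases p <;> simp <;> ring
      · refine (gη.mul (hasGrad_const d z)).congr_grad fun p => ?_
        fin_cases p <;> simp [mul_comm]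
    · refine haantjesAt_generic_eq_zero (m := fun k => _) (p := -a + φ z + g * ψ z)
        (q := -(α' - β' * a) + d * ψ z) (d := d) (t := τ z) (e := η z) (g := g) (A := A) (B := B)
        (C := C) rfl ?_ ?_ rfl rfl
      · funext k; fin_cases k <;> simp
      · funext i k
        fin_cases i <;> fin_cases k <;> simp <;> ring

end HaantjesOfSymInt

/-! ### Invariance of the symmetric system -/

section SymTransformations

lemma HasGrad.comp_map {n m : ℕ} {F : (Fin m → ℝ) → ℝ} {d : Fin m → ℝ}
    {g : (Fin n → ℝ) → Fin m → ℝ} {e : Fin m → Fin n → ℝ} {z : Fin n → ℝ}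
    (hF : HasGrad F d (g z)) (hg : ∀ j, HasGrad (fun z => g z j) (e j) z) :
    HasGrad (fun z => F (g z)) (fun i => ∑ j, d j * e j i) z := by
  refine (HasFDerivAt.comp z hF (hasFDerivAt_pi.2 hg)).congr_fderiv ?_
  ext v
  simp [Finset.mul_sum, Finset.sum_mul, mul_assoc]
  exact Finset.sum_comm

variable {Ω : Set (Fin 3 → ℝ)} {φ ψ η τ φ' ψ' η' τ' : (Fin 3 → ℝ) → ℝ} {z : Fin 3 → ℝ}

lemma swapVW_swapVW (z : Fin 3 → ℝ) : swapVW (swapVW z) = z := by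
  ext i; fin_cases i <;> simp [swapVW]

lemma contDiff_swapVW : ContDiff ℝ ∞ swapVW := by
  refine contDiff_pi.2 fun i => ?_
  fin_cases i <;> simp [swapVW] <;> fun_prop

lemma image_swapVW (Ω : Set (Fin 3 → ℝ)) : swapVW '' Ω = swapVW ⁻¹' Ω :=
  congrFun (Set.image_eq_preimage_of_inverse swapVW_swapVW swapVW_swapVW) Ω

lemma isOpen_image_swapVW (hΩ : IsOpen Ω) : IsOpen (swapVW '' Ω) := by
  rw [image_swapVW]; exact hΩ.preimage contDiff_swapVW.continuous

lemma convex_image_swapVW (hc : Convex ℝ Ω) : Convex ℝ (swapVW '' Ω) :=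
  hc.is_linear_image ⟨fun x y => by ext i; fin_cases i <;> simp [swapVW],
    fun c x => by ext i; fin_cases i <;> simp [swapVW]⟩

lemma swapVW_mem (hz : z ∈ swapVW '' Ω) : swapVW z ∈ Ω := by
  rwa [image_swapVW] at hz

lemma HasGrad.comp_swapVW {d : Fin 3 → ℝ} (h : HasGrad φ d (swapVW z)) :
    HasGrad (φ ∘ swapVW) ![d 0, d 2, d 1] z := by
  refine (HasGrad.comp_map (g := swapVW)
    (e := ![fun j => if j = 0 then 1 else 0, fun j => if j = 2 then 1 else 0,
      fun j => if j = 1 then 1 else 0]) h fun j => ?_).congr_grad fun i => ?_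
  · fin_cases j
    exacts [hasGrad_coord 0 z, hasGrad_coord 2 z, hasGrad_coord 1 z]
  · fin_cases i <;> simp [Fin.sum_univ_three]

/-- The interchange exchanges `A` with `C` and keeps `B`. -/
lemma SymDifferential.comp_swapVW (h : SymDifferential φ ψ η τ (swapVW z)) :
    SymDifferential (ψ ∘ swapVW) (φ ∘ swapVW) (τ ∘ swapVW) (η ∘ swapVW) z := by
  obtain ⟨A, B, C, gφ, gψ, gη, gτ⟩ := h
  exact ⟨C, B, A, by simpa using gψ.comp_swapVW, by simpa using gφ.comp_swapVW,
    by simpa using gτ.comp_swapVW, by simpa using gη.comp_swapVW⟩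

lemma symDifferential_of_comp_swapVW
    (h : SymDifferential (ψ ∘ swapVW) (φ ∘ swapVW) (τ ∘ swapVW) (η ∘ swapVW) (swapVW z)) :
    SymDifferential φ ψ η τ z := by
  have := h.comp_swapVW
  simpa only [Function.comp_def, swapVW_swapVW] using this

namespace SymTransformation

variable (T : SymTransformation)

lemma isOpen_image_map (hΩ : IsOpen Ω) : IsOpen (T.map '' Ω) := by
  have h1 := T.a_ne
  have h2 := T.p_ne
  have h3 := T.q_ne
  let g : (Fin 3 → ℝ) → Fin 3 → ℝ := fun z => ![(z 0 - T.b) / T.a,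
    (z 1 - T.c) / (T.a * (T.q / T.p)), (z 2 - T.d) / (T.a * (T.p / T.q))]
  have e1 : Function.LeftInverse g T.map := fun z => by
    ext i; fin_cases i <;> simp [g, map] <;> field_simp
  have e2 : Function.RightInverse g T.map := fun z => by
    ext i; fin_cases i <;> simp [g, map] <;> field_simp <;> ring
  have hg : Continuous g := by
    refine continuous_pi fun i => ?_
    fin_cases i <;> simp [g] <;> fun_prop
  rw [congrFun (Set.image_eq_preimage_of_inverse e1 e2) Ω]
  exact hΩ.preimage hg

lemma hasGrad_comp_map {d : Fin 3 → ℝ} (h : HasGrad φ d (T.map z)) :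
    HasGrad (fun z => φ (T.map z))
      ![T.a * d 0, T.a * (T.q / T.p) * d 1, T.a * (T.p / T.q) * d 2] z := by
  refine (HasGrad.comp_map (g := T.map)
    (e := ![fun j => T.a * (if j = 0 then 1 else 0) + 0,
      fun j => T.a * (T.q / T.p) * (if j = 1 then 1 else 0) + 0,
      fun j => T.a * (T.p / T.q) * (if j = 2 then 1 else 0) + 0]) h fun j => ?_).congr_grad fun i => ?_
  · fin_cases j
    exacts [((hasGrad_coord 0 z).const_mul _).add (hasGrad_const _ z),
      ((hasGrad_coord 1 z).const_mul _).add (hasGrad_const _ z),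
      ((hasGrad_coord 2 z).const_mul _).add (hasGrad_const _ z)]
  · fin_cases i <;> simp [Fin.sum_univ_three, mul_comm]

lemma Carries.symDifferential {T : SymTransformation} (hΩ : IsOpen Ω)
    (h : T.Carries Ω φ ψ η τ φ' ψ' η' τ') (hz : z ∈ Ω)
    (H : SymDifferential φ' ψ' η' τ' (T.map z)) : SymDifferential φ ψ η τ z := by
  have h1 := T.a_ne
  have h2 := T.p_ne
  have h3 := T.q_ne
  have h4 := T.r_ne
  obtain ⟨A, B, C, gφ, gψ, gη, gτ⟩ := H
  have cφ : ∀ z ∈ Ω, φ z = T.r / T.p * φ' (T.map z) + T.k₁ / T.p := fun z hz => by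
    rw [(h z hz).1]; field_simp; ring
  have cψ : ∀ z ∈ Ω, ψ z = T.r / T.q * ψ' (T.map z) + T.k₂ / T.q := fun z hz => by
    rw [(h z hz).2.1]; field_simp; ring
  have cη : ∀ z ∈ Ω, η z = T.p * T.r / T.q ^ 2 * η' (T.map z) := fun z hz => by
    rw [(h z hz).2.2.1]; field_simp
  have cτ : ∀ z ∈ Ω, τ z = T.q * T.r / T.p ^ 2 * τ' (T.map z) := fun z hz => by
    rw [(h z hz).2.2.2]; field_simp
  refine ⟨T.a * (T.p / T.q) * A, T.a * B, T.a * (T.q / T.p) * C, ?_, ?_, ?_, ?_⟩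
  · refine ((((T.hasGrad_comp_map gφ).const_mul _).add (hasGrad_const _ z)).congr_of_eqOn hΩ cφ
      hz).congr_grad fun i => ?_
    fin_cases i <;> simp [cτ z hz] <;> field_simp
  · refine ((((T.hasGrad_comp_map gψ).const_mul _).add (hasGrad_const _ z)).congr_of_eqOn hΩ cψ
      hz).congr_grad fun i => ?_
    fin_cases i <;> simp [cη z hz] <;> field_simp
  · refine (((T.hasGrad_comp_map gη).const_mul _).congr_of_eqOn hΩ cη hz).congr_grad fun i => ?_
    fin_cases i <;> simp [cη z hz] <;> field_simp
  · refine (((T.hasGrad_comp_map gτ).const_mul _).congr_of_eqOn hΩ cτ hz).congr_grad fun i => ?_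
    fin_cases i <;> simp [cτ z hz] <;> field_simp

end SymTransformation

end SymTransformations

/-! ### The symmetric normal forms satisfy the first order system -/

section SymNormalForms

variable {Ω : Set (Fin 3 → ℝ)} {φ ψ η τ : (Fin 3 → ℝ) → ℝ} {z : Fin 3 → ℝ}

lemma hasGrad_exp_mul {k : ℝ → ℝ} {k' : ℝ} (β : ℝ) (i : Fin 3) (hk : HasDerivAt k k' (z 0)) :
    HasGrad (fun z => Real.exp (β * z i) * k (z 0))
      (fun j => β * (Real.exp (β * z i) * k (z 0)) * (if j = i then 1 else 0)
        + Real.exp (β * z i) * k' * (if j = 0 then 1 else 0)) z := by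
  have h1 : HasGrad (fun z : Fin 3 → ℝ => Real.exp (β * z i)) _ z :=
    HasGrad.comp (Real.hasDerivAt_exp _) ((hasGrad_coord i z).const_mul β)
  exact (h1.mul (HasGrad.comp hk (hasGrad_coord 0 z))).congr_grad fun j => by ring

lemma isConservationLaw_bilinear_iff {ν μ : ℝ} :
    IsConservationLaw Ω φ ψ η τ (fun u v => ν * (u * v)) (fun u w => μ * (u * w)) ↔
      ∀ z ∈ Ω, φ z = ν * z 1 ∧ τ z = ν * z 0 ∧ ψ z = μ * z 2 ∧ η z = μ * z 0 :=
  forall₂_congr fun z _ => by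
    rw [((hasDerivAt_mul_const (z 1)).const_mul ν).deriv,
      ((hasDerivAt_mul_left (z 0) (z 1)).const_mul ν).deriv,
      ((hasDerivAt_mul_const (z 2)).const_mul μ).deriv,
      ((hasDerivAt_mul_left (z 0) (z 2)).const_mul μ).deriv]

lemma isConservationLaw_linear_iff {ν μ : ℝ} :
    IsConservationLaw Ω φ ψ η τ (fun _ v => ν * v) (fun _ w => μ * w) ↔
      ∀ z ∈ Ω, φ z = 0 ∧ τ z = ν ∧ ψ z = 0 ∧ η z = μ :=
  forall₂_congr fun z _ => by
    rw [deriv_const, deriv_const, (hasDerivAt_mul_left ν (z 1)).deriv,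
      (hasDerivAt_mul_left μ (z 2)).deriv]

lemma isConservationLaw_cubic_iff {ν μ α : ℝ} :
    IsConservationLaw Ω φ ψ η τ (fun u v => ν * (u * v + α * u ^ 3 / 6))
      (fun u w => μ * (Real.exp (α * w) * u)) ↔
      ∀ z ∈ Ω, φ z = ν * (z 1 + α / 2 * (z 0 * z 0)) ∧ τ z = ν * z 0 ∧
        ψ z = μ * (Real.exp (α * z 2) * 1) ∧ η z = μ * α * (Real.exp (α * z 2) * z 0) :=
  forall₂_congr fun z _ => by
    have h1 : HasDerivAt (fun u => ν * (u * z 1 + α * u ^ 3 / 6))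
        (ν * (z 1 + α * (3 * z 0 ^ 2) / 6)) (z 0) := by
      refine HasDerivAt.const_mul ν ((hasDerivAt_mul_const (z 1)).add
        (HasDerivAt.div_const (HasDerivAt.const_mul α ?_) 6))
      simpa using hasDerivAt_pow 3 (z 0)
    rw [h1.deriv, (((hasDerivAt_mul_left (z 0) (z 1)).add_const _).const_mul ν).deriv,
      ((hasDerivAt_mul_left (Real.exp (α * z 2)) (z 0)).const_mul μ).deriv,
      ((((hasDerivAt_mul_left α (z 2)).exp).mul_const (z 0)).const_mul μ).deriv,
      show ν * (z 1 + α * (3 * z 0 ^ 2) / 6) = ν * (z 1 + α / 2 * (z 0 * z 0)) by ring,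
      show μ * (Real.exp (α * z 2) * α * z 0) = μ * α * (Real.exp (α * z 2) * z 0) by ring, mul_one]

lemma isConservationLaw_quadratic_iff {ν μ α : ℝ} :
    IsConservationLaw Ω φ ψ η τ (fun u v => ν * (v + α * u ^ 2 / 2))
      (fun _ w => μ * Real.exp (α * w)) ↔
      ∀ z ∈ Ω, φ z = ν * α * z 0 ∧ τ z = ν ∧ ψ z = 0 ∧ η z = μ * α * (Real.exp (α * z 2) * 1) :=
  forall₂_congr fun z _ => by
    have h1 : HasDerivAt (fun u => ν * (z 1 + α * u ^ 2 / 2)) (ν * (α * (2 * z 0) / 2)) (z 0) := by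
      refine HasDerivAt.const_mul ν (HasDerivAt.const_add (z 1)
        (HasDerivAt.div_const (HasDerivAt.const_mul α ?_) 2))
      simpa using hasDerivAt_pow 2 (z 0)
    rw [h1.deriv, (((hasDerivAt_id' (z 1)).add_const _).const_mul ν).deriv, deriv_const,
      (((hasDerivAt_mul_left α (z 2)).exp).const_mul μ).deriv,
      show ν * (α * (2 * z 0) / 2) = ν * α * z 0 by ring, mul_one,
      show μ * (Real.exp (α * z 2) * α) = μ * α * (Real.exp (α * z 2) * 1) by ring]

lemma isConservationLaw_exponential_iff {ν μ α β : ℝ} {k : ℝ → ℝ} (hk : ContDiff ℝ ∞ k) :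
    IsConservationLaw Ω φ ψ η τ (fun u v => ν * (Real.exp (β * v) * k u))
      (fun u w => μ * (Real.exp (α * w) * k u)) ↔
      ∀ z ∈ Ω, φ z = ν * (Real.exp (β * z 1) * deriv k (z 0)) ∧
        τ z = ν * β * (Real.exp (β * z 1) * k (z 0)) ∧
        ψ z = μ * (Real.exp (α * z 2) * deriv k (z 0)) ∧
        η z = μ * α * (Real.exp (α * z 2) * k (z 0)) :=
  forall₂_congr fun z _ => by
    have d1 : HasDerivAt k (deriv k (z 0)) (z 0) :=
      hasDerivAt_of_contDiffOn isOpen_univ hk.contDiffOn (Set.mem_univ _)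
    rw [((d1.const_mul _).const_mul ν).deriv, ((d1.const_mul _).const_mul μ).deriv,
      ((((hasDerivAt_mul_left β (z 1)).exp).mul_const (k (z 0))).const_mul ν).deriv,
      ((((hasDerivAt_mul_left α (z 2)).exp).mul_const (k (z 0))).const_mul μ).deriv,
      show ν * (Real.exp (β * z 1) * β * k (z 0)) = ν * β * (Real.exp (β * z 1) * k (z 0)) by ring,
      show μ * (Real.exp (α * z 2) * α * k (z 0)) = μ * α * (Real.exp (α * z 2) * k (z 0)) by ring]

lemma symDifferential_bilinear (hΩ : IsOpen Ω) (hτ0 : ∀ z ∈ Ω, τ z ≠ 0) {ν μ : ℝ}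
    (h : IsConservationLaw Ω φ ψ η τ (fun u v => ν * (u * v)) (fun u w => μ * (u * w)))
    (hz : z ∈ Ω) : SymDifferential φ ψ η τ z := by
  have e := isConservationLaw_bilinear_iff.1 h
  have h0 : z 0 ≠ 0 := fun h0 => hτ0 z hz (by rw [(e z hz).2.1, h0, mul_zero])
  refine ⟨0, (z 0)⁻¹, 0, ?_, ?_, ?_, ?_⟩
  · refine (((hasGrad_coord 1 z).const_mul ν).congr_of_eqOn hΩ (fun z hz => (e z hz).1)
      hz).congr_grad fun i => ?_
    fin_cases i <;> simp [e z hz, h0]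
  · refine (((hasGrad_coord 2 z).const_mul μ).congr_of_eqOn hΩ (fun z hz => (e z hz).2.2.1)
      hz).congr_grad fun i => ?_
    fin_cases i <;> simp [e z hz, h0]
  · refine (((hasGrad_coord 0 z).const_mul μ).congr_of_eqOn hΩ (fun z hz => (e z hz).2.2.2)
      hz).congr_grad fun i => ?_
    fin_cases i <;> simp [e z hz, h0]
  · refine (((hasGrad_coord 0 z).const_mul ν).congr_of_eqOn hΩ (fun z hz => (e z hz).2.1)
      hz).congr_grad fun i => ?_
    fin_cases i <;> simp [e z hz, h0]

lemma symDifferential_linear (hΩ : IsOpen Ω) {ν μ : ℝ}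
    (h : IsConservationLaw Ω φ ψ η τ (fun _ v => ν * v) (fun _ w => μ * w))
    (hz : z ∈ Ω) : SymDifferential φ ψ η τ z := by
  have e := isConservationLaw_linear_iff.1 h
  have key : ∀ {F : (Fin 3 → ℝ) → ℝ} {c : ℝ}, (∀ z ∈ Ω, F z = c) → HasGrad F ![0, 0, 0] z :=
    fun hF => ((hasGrad_const _ z).congr_of_eqOn hΩ hF hz).congr_grad fun i => by
      fin_cases i <;> rfl
  refine ⟨0, 0, 0, ?_⟩
  simp only [mul_zero]
  exact ⟨key fun z hz => (e z hz).1, key fun z hz => (e z hz).2.2.1,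
    key fun z hz => (e z hz).2.2.2, key fun z hz => (e z hz).2.1⟩

lemma symDifferential_cubic (hΩ : IsOpen Ω) (hτ0 : ∀ z ∈ Ω, τ z ≠ 0) {ν μ α : ℝ}
    (h : IsConservationLaw Ω φ ψ η τ (fun u v => ν * (u * v + α * u ^ 3 / 6))
      (fun u w => μ * (Real.exp (α * w) * u)))
    (hz : z ∈ Ω) : SymDifferential φ ψ η τ z := by
  have e := isConservationLaw_cubic_iff.1 h
  have h0 : z 0 ≠ 0 := fun h0 => hτ0 z hz (by rw [(e z hz).2.1, h0, mul_zero])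
  refine ⟨α, (z 0)⁻¹, 0, ?_, ?_, ?_, ?_⟩
  · refine ((((hasGrad_coord 1 z).add (((hasGrad_coord 0 z).mul (hasGrad_coord 0 z)).const_mul
      (α / 2))).const_mul ν).congr_of_eqOn hΩ (fun z hz => (e z hz).1) hz).congr_grad fun i => ?_
    fin_cases i <;> simp [e z hz, h0]
    ring
  · refine (((hasGrad_exp_mul α 2 (hasDerivAt_const (z 0) (1 : ℝ))).const_mul μ).congr_of_eqOn hΩ
      (fun z hz => (e z hz).2.2.1) hz).congr_grad fun i => ?_
    fin_cases i <;> simp [e z hz]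
    field_simp
  · refine (((hasGrad_exp_mul α 2 (hasDerivAt_id' (z 0))).const_mul (μ * α)).congr_of_eqOn hΩ
      (fun z hz => (e z hz).2.2.2) hz).congr_grad fun i => ?_
    fin_cases i <;> simp [e z hz] <;> field_simp
  · refine (((hasGrad_coord 0 z).const_mul ν).congr_of_eqOn hΩ (fun z hz => (e z hz).2.1)
      hz).congr_grad fun i => ?_
    fin_cases i <;> simp [e z hz, h0]

lemma symDifferential_quadratic (hΩ : IsOpen Ω) {ν μ α : ℝ}
    (h : IsConservationLaw Ω φ ψ η τ (fun u v => ν * (v + α * u ^ 2 / 2))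
      (fun _ w => μ * Real.exp (α * w)))
    (hz : z ∈ Ω) : SymDifferential φ ψ η τ z := by
  have e := isConservationLaw_quadratic_iff.1 h
  refine ⟨α, 0, 0, ?_, ?_, ?_, ?_⟩
  · refine (((hasGrad_coord 0 z).const_mul (ν * α)).congr_of_eqOn hΩ (fun z hz => (e z hz).1)
      hz).congr_grad fun i => ?_
    fin_cases i <;> simp [e z hz]
  · refine ((hasGrad_const _ z).congr_of_eqOn hΩ (fun z hz => (e z hz).2.2.1) hz).congr_grad
      fun i => ?_
    fin_cases i <;> simp
  · refine (((hasGrad_exp_mul α 2 (hasDerivAt_const (z 0) (1 : ℝ))).const_mul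
      (μ * α)).congr_of_eqOn hΩ (fun z hz => (e z hz).2.2.2) hz).congr_grad fun i => ?_
    fin_cases i <;> simp [e z hz]
    ring
  · refine ((hasGrad_const _ z).congr_of_eqOn hΩ (fun z hz => (e z hz).2.1) hz).congr_grad
      fun i => ?_
    fin_cases i <;> simp

lemma symDifferential_exponential (hΩ : IsOpen Ω) (hτ0 : ∀ z ∈ Ω, τ z ≠ 0) {ν μ α β : ℝ}
    {k : ℝ → ℝ} (hk : ContDiff ℝ ∞ k) (hk2 : ∀ u, iteratedDeriv 2 k u = α * β * k u)
    (h : IsConservationLaw Ω φ ψ η τ (fun u v => ν * (Real.exp (β * v) * k u))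
      (fun u w => μ * (Real.exp (α * w) * k u)))
    (hz : z ∈ Ω) : SymDifferential φ ψ η τ z := by
  have d1 : ∀ u, HasDerivAt k (deriv k u) u := fun u =>
    hasDerivAt_of_contDiffOn isOpen_univ hk.contDiffOn (Set.mem_univ u)
  have d2 : ∀ u, HasDerivAt (deriv k) (α * β * k u) u := fun u => by
    rw [← hk2 u]
    exact hasDerivAt_deriv_of_contDiffOn isOpen_univ hk.contDiffOn (Set.mem_univ u)
  have e := (isConservationLaw_exponential_iff hk).1 h
  have h0 : k (z 0) ≠ 0 := fun h0 => hτ0 z hz (by rw [(e z hz).2.1, h0]; ring)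
  -- The quotient `k' / k` is legitimate because `τ ≠ 0` forces `k ≠ 0`; the equation `k'' = αβk` is
  -- what makes `φ_u = ατ` and `ψ_u = βη`.
  refine ⟨α, deriv k (z 0) / k (z 0), β, ?_, ?_, ?_, ?_⟩
  · refine (((hasGrad_exp_mul β 1 (d2 (z 0))).const_mul ν).congr_of_eqOn hΩ
      (fun z hz => (e z hz).1) hz).congr_grad fun i => ?_
    fin_cases i <;> simp [e z hz] <;> field_simp
  · refine (((hasGrad_exp_mul α 2 (d2 (z 0))).const_mul μ).congr_of_eqOn hΩ
      (fun z hz => (e z hz).2.2.1) hz).congr_grad fun i => ?_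
    fin_cases i <;> simp [e z hz] <;> field_simp
  · refine (((hasGrad_exp_mul α 2 (d1 (z 0))).const_mul (μ * α)).congr_of_eqOn hΩ
      (fun z hz => (e z hz).2.2.2) hz).congr_grad fun i => ?_
    fin_cases i <;> simp [e z hz] <;> field_simp
  · refine (((hasGrad_exp_mul β 1 (d1 (z 0))).const_mul (ν * β)).congr_of_eqOn hΩ
      (fun z hz => (e z hz).2.1) hz).congr_grad fun i => ?_
    fin_cases i <;> simp [e z hz] <;> field_simp

lemma SymNormalForm.symDifferential (hΩ : IsOpen Ω) (hτ0 : ∀ z ∈ Ω, τ z ≠ 0)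
    (h : SymNormalForm Ω φ ψ η τ) (hz : z ∈ Ω) : SymDifferential φ ψ η τ z := by
  rcases h with ⟨ν, μ, h⟩ | ⟨ν, μ, h⟩ | ⟨ν, μ, α, -, h⟩ | ⟨ν, μ, α, -, h⟩ |
    ⟨ν, μ, α, β, -, -, k, hk, hk2, h⟩
  exacts [symDifferential_bilinear hΩ hτ0 h hz, symDifferential_linear hΩ h hz,
    symDifferential_cubic hΩ hτ0 h hz, symDifferential_quadratic hΩ h hz,
    symDifferential_exponential hΩ hτ0 hk hk2 h hz]

lemma SymTransformation.Carries.symDifferential_of_normalForm {T : SymTransformation}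
    {φ' ψ' η' τ' : (Fin 3 → ℝ) → ℝ} (hΩ : IsOpen Ω) (hτ0 : ∀ z ∈ Ω, τ z ≠ 0)
    (h : T.Carries Ω φ ψ η τ φ' ψ' η' τ') (H : SymNormalForm (T.map '' Ω) φ' ψ' η' τ')
    (hz : z ∈ Ω) : SymDifferential φ ψ η τ z := by
  refine h.symDifferential hΩ hz (H.symDifferential (T.isOpen_image_map hΩ) ?_
    (Set.mem_image_of_mem _ hz))
  rintro _ ⟨y, hy, rfl⟩
  rw [(h y hy).2.2.2]
  exact mul_ne_zero (div_ne_zero (pow_ne_zero 2 T.p_ne) (mul_ne_zero T.q_ne T.r_ne)) (hτ0 y hy)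

lemma SymReducible.symInt (hΩ : IsOpen Ω) (hη0 : ∀ z ∈ Ω, η z ≠ 0) (hτ0 : ∀ z ∈ Ω, τ z ≠ 0)
    (h : SymReducible Ω φ ψ η τ) : SymInt Ω φ ψ η τ := by
  obtain ⟨T, φ', ψ', η', τ', ⟨h, H⟩ | ⟨h, H⟩⟩ := h
  · exact symInt_of_symDifferential hη0 hτ0 fun z hz => h.symDifferential_of_normalForm hΩ hτ0 H hz
  · exact symInt_of_symDifferential hη0 hτ0 fun z hz =>
      symDifferential_of_comp_swapVW (h.symDifferential_of_normalForm (isOpen_image_swapVW hΩ)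
        (fun y hy => hη0 _ (swapVW_mem hy)) H (Set.mem_image_of_mem _ hz))

end SymNormalForms

/-! ### Integration of the first order system -/

section SymIntegration

variable {Ω : Set (Fin 3 → ℝ)} {φ ψ η τ : (Fin 3 → ℝ) → ℝ}

lemma exists_eq_add_const_of_hasGrad {n : ℕ} {Ω : Set (Fin n → ℝ)} {F G : (Fin n → ℝ) → ℝ}
    {d : (Fin n → ℝ) → Fin n → ℝ} (hΩ : IsOpen Ω) (hc : Convex ℝ Ω)
    (hF : ∀ z ∈ Ω, HasGrad F (d z) z) (hG : ∀ z ∈ Ω, HasGrad G (d z) z) :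
    ∃ c, ∀ z ∈ Ω, F z = G z + c := by
  rcases Ω.eq_empty_or_nonempty with rfl | ⟨x, hx⟩
  · exact ⟨0, by simp⟩
  have h0 : ∀ z ∈ Ω, HasFDerivAt (fun z => F z - G z) 0 z := fun z hz =>
    (HasFDerivAt.sub (hF z hz) (hG z hz)).congr_fderiv (sub_self _)
  refine ⟨F x - G x, fun z hz => ?_⟩
  have := hΩ.is_const_of_fderiv_eq_zero hc.isPreconnected
    (fun z hz => (h0 z hz).differentiableAt.differentiableWithinAt) (fun z hz => (h0 z hz).fderiv)
    hz hx
  linarith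

/-- Equality of mixed partial derivatives when the partial derivatives are products. -/
lemma pd_mul_eq_pd_mul {n : ℕ} {Ω : Set (Fin n → ℝ)} {F f a g b : (Fin n → ℝ) → ℝ}
    (hΩ : IsOpen Ω) (hF : ContDiffOn ℝ ∞ F Ω) (hf : ContDiffOn ℝ ∞ f Ω) (ha : ContDiffOn ℝ ∞ a Ω)
    (hg : ContDiffOn ℝ ∞ g Ω) (hb : ContDiffOn ℝ ∞ b Ω) {i j : Fin n}
    (hi : ∀ z ∈ Ω, pd i F z = f z * a z) (hj : ∀ z ∈ Ω, pd j F z = g z * b z) :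
    ∀ z ∈ Ω, pd j f z * a z + f z * pd j a z = pd i g z * b z + g z * pd i b z := by
  intro z hz
  have h1 := (((hasGrad_of_contDiffOn hΩ hf hz).mul (hasGrad_of_contDiffOn hΩ ha hz)).congr_of_eqOn
    hΩ hi hz).pd_eq j
  have h2 := (((hasGrad_of_contDiffOn hΩ hg hz).mul (hasGrad_of_contDiffOn hΩ hb hz)).congr_of_eqOn
    hΩ hj hz).pd_eq i
  rw [← h1, ← h2, pd_comm hΩ hF j i hz]

lemma pd_zero_fun {n : ℕ} (i : Fin n) (z : Fin n → ℝ) : pd i (fun _ => (0 : ℝ)) z = 0 :=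
  (hasGrad_const 0 z).pd_eq i

/-- Put `A = φ_u / τ`, `B = φ_v / τ`, `C = ψ_u / η`. Then `B` is also `ψ_w / η` and the
`u`-derivative of `ln |τ|` and of `ln |η|`, while `A` and `C` are the derivatives of `ln |η|` in `w`
and of `ln |τ|` in `v`. Equality of mixed derivatives makes `A = α` and `C = β` constants and `B` a
function of `u`; `τ e^{-βv}` and `η e^{-αw}` are then proportional functions of `u`. -/
lemma SymInt.exists_eq_exp_mul (hΩ : IsOpen Ω) (hc : Convex ℝ Ω) (hφ : ContDiffOn ℝ ∞ φ Ω)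
    (hψ : ContDiffOn ℝ ∞ ψ Ω) (hη : ContDiffOn ℝ ∞ η Ω) (hτ : ContDiffOn ℝ ∞ τ Ω)
    (hη0 : ∀ z ∈ Ω, η z ≠ 0) (hτ0 : ∀ z ∈ Ω, τ z ≠ 0) (h : SymInt Ω φ ψ η τ) :
    ∃ (α β μ : ℝ) (k k' : ℝ → ℝ), (∀ u ∈ (fun z : Fin 3 → ℝ => z 0) '' Ω, HasDerivAt k (k' u) u) ∧
      (∀ u ∈ (fun z : Fin 3 → ℝ => z 0) '' Ω, HasDerivAt k' (α * β * k u) u) ∧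
      ∀ z ∈ Ω, τ z = Real.exp (β * z 1) * k (z 0) ∧ η z = μ * (Real.exp (α * z 2) * k (z 0)) ∧
        HasGrad φ ![α * (Real.exp (β * z 1) * k (z 0)), Real.exp (β * z 1) * k' (z 0), 0] z ∧
        HasGrad ψ ![β * (μ * (Real.exp (α * z 2) * k (z 0))), 0,
          μ * (Real.exp (α * z 2) * k' (z 0))] z := by
  set A : (Fin 3 → ℝ) → ℝ := fun z => pd 0 φ z / τ z with hA
  set B : (Fin 3 → ℝ) → ℝ := fun z => pd 1 φ z / τ z with hB
  set C : (Fin 3 → ℝ) → ℝ := fun z => pd 0 ψ z / η z with hC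
  have sA : ContDiffOn ℝ ∞ A Ω := (contDiffOn_pd hΩ hφ 0).div hτ hτ0
  have sB : ContDiffOn ℝ ∞ B Ω := (contDiffOn_pd hΩ hφ 1).div hτ hτ0
  have sC : ContDiffOn ℝ ∞ C Ω := (contDiffOn_pd hΩ hψ 0).div hη hη0
  have s0 : ContDiffOn ℝ ∞ (fun _ : Fin 3 → ℝ => (0 : ℝ)) Ω := contDiffOn_const
  have φ0 : ∀ z ∈ Ω, pd 0 φ z = τ z * A z := fun z hz => by
    have := hτ0 z hz; simp only [hA]; field_simp
  have φ1 : ∀ z ∈ Ω, pd 1 φ z = τ z * B z := fun z hz => by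
    have := hτ0 z hz; simp only [hB]; field_simp
  have φ2 : ∀ z ∈ Ω, pd 2 φ z = 0 * 0 := fun z hz => by rw [mul_zero]; exact (h z hz).2.2.2.2.2.2.2.1
  have ψ0 : ∀ z ∈ Ω, pd 0 ψ z = η z * C z := fun z hz => by
    have := hη0 z hz; simp only [hC]; field_simp
  have ψ1 : ∀ z ∈ Ω, pd 1 ψ z = 0 * 0 := fun z hz => by rw [mul_zero]; exact (h z hz).2.2.2.2.2.2.1
  have ψ2 : ∀ z ∈ Ω, pd 2 ψ z = η z * B z := fun z hz =>
    mul_left_cancel₀ (hτ0 z hz) (by rw [(h z hz).2.2.2.2.2.2.2.2, φ1 z hz]; ring)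
  have η0 : ∀ z ∈ Ω, pd 0 η z = η z * B z := fun z hz => by rw [(h z hz).2.1, ψ2 z hz]
  have η1 : ∀ z ∈ Ω, pd 1 η z = 0 * 0 := fun z hz => by rw [mul_zero]; exact (h z hz).2.2.2.1
  have η2 : ∀ z ∈ Ω, pd 2 η z = η z * A z := fun z hz => by
    have := hτ0 z hz
    rw [(h z hz).2.2.2.2.2.1, φ0 z hz]; field_simp
  have τ0 : ∀ z ∈ Ω, pd 0 τ z = τ z * B z := fun z hz => by rw [(h z hz).1, φ1 z hz]
  have τ1 : ∀ z ∈ Ω, pd 1 τ z = τ z * C z := fun z hz => by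
    have := hη0 z hz
    rw [(h z hz).2.2.1, ψ0 z hz]; field_simp
  have τ2 : ∀ z ∈ Ω, pd 2 τ z = 0 * 0 := fun z hz => by rw [mul_zero]; exact (h z hz).2.2.2.2.1
  have A2 : ∀ z ∈ Ω, pd 2 A z = 0 := fun z hz => by
    have := pd_mul_eq_pd_mul hΩ hφ hτ sA s0 s0 φ0 φ2 z hz
    simpa [τ2 z hz, pd_zero_fun, hτ0 z hz] using this
  have A1 : ∀ z ∈ Ω, pd 1 A z = 0 := fun z hz => by
    have := pd_mul_eq_pd_mul hΩ hη hη sA s0 s0 η2 η1 z hz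
    simpa [η1 z hz, pd_zero_fun, hη0 z hz] using this
  have B2 : ∀ z ∈ Ω, pd 2 B z = 0 := fun z hz => by
    have := pd_mul_eq_pd_mul hΩ hτ hτ sB s0 s0 τ0 τ2 z hz
    simpa [τ2 z hz, pd_zero_fun, hτ0 z hz] using this
  have B1 : ∀ z ∈ Ω, pd 1 B z = 0 := fun z hz => by
    have := pd_mul_eq_pd_mul hΩ hη hη sB s0 s0 η0 η1 z hz
    simpa [η1 z hz, pd_zero_fun, hη0 z hz] using this
  have C1 : ∀ z ∈ Ω, pd 1 C z = 0 := fun z hz => by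
    have := pd_mul_eq_pd_mul hΩ hψ hη sC s0 s0 ψ0 ψ1 z hz
    simpa [η1 z hz, pd_zero_fun, hη0 z hz] using this
  have C2 : ∀ z ∈ Ω, pd 2 C z = 0 := fun z hz => by
    have := pd_mul_eq_pd_mul hΩ hτ hτ sC s0 s0 τ1 τ2 z hz
    simpa [τ2 z hz, pd_zero_fun, hτ0 z hz] using this
  have A0 : ∀ z ∈ Ω, pd 0 A z = 0 := fun z hz => mul_left_cancel₀ (hη0 z hz) (by
    have := pd_mul_eq_pd_mul hΩ hη hη sA hη sB η2 η0 z hz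
    rw [η0 z hz, η2 z hz, B2 z hz] at this
    linear_combination this)
  have C0 : ∀ z ∈ Ω, pd 0 C z = 0 := fun z hz => mul_left_cancel₀ (hτ0 z hz) (by
    have := pd_mul_eq_pd_mul hΩ hτ hτ sC hτ sB τ1 τ0 z hz
    rw [τ0 z hz, τ1 z hz, B1 z hz] at this
    linear_combination this)
  -- A Riccati equation; for `B = k' / k` it linearises to `k'' = A C k`.
  have B0 : ∀ z ∈ Ω, pd 0 B z = A z * C z - B z ^ 2 := fun z hz => mul_left_cancel₀ (hτ0 z hz) (by
    have := pd_mul_eq_pd_mul hΩ hφ hτ sA hτ sB φ0 φ1 z hz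
    rw [τ0 z hz, τ1 z hz, A1 z hz] at this
    linear_combination -this)
  obtain ⟨α, hα⟩ := exists_eq_const_of_pd_zero hΩ hc sA fun z hz i => by
    fin_cases i
    exacts [A0 z hz, A1 z hz, A2 z hz]
  obtain ⟨β, hβ⟩ := exists_eq_const_of_pd_zero hΩ hc sC fun z hz i => by
    fin_cases i
    exacts [C0 z hz, C1 z hz, C2 z hz]
  have hexp : ∀ (c : ℝ) (i : Fin 3) (z : Fin 3 → ℝ), HasGrad (fun z => Real.exp (c * z i)) _ z :=
    fun c i z => HasGrad.comp (Real.hasDerivAt_exp _) ((hasGrad_coord i z).const_mul c)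
  set K : (Fin 3 → ℝ) → ℝ := fun z => Real.exp (-β * z 1) * τ z with hK
  set L : (Fin 3 → ℝ) → ℝ := fun z => Real.exp (-α * z 2) * η z with hL
  have sK : ContDiffOn ℝ ∞ K Ω :=
    (ContDiff.contDiffOn (by fun_prop : ContDiff ℝ ∞ fun z : Fin 3 → ℝ => Real.exp (-β * z 1))).mul hτ
  have gK : ∀ z ∈ Ω, HasGrad K ![K z * B z, 0, 0] z := fun z hz => by
    refine ((hexp (-β) 1 z).mul (hasGrad_of_contDiffOn hΩ hτ hz)).congr_grad fun i => ?_
    fin_cases i <;> simp [τ0 z hz, τ1 z hz, τ2 z hz, hK, hβ z hz] <;> ring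
  have gL : ∀ z ∈ Ω, HasGrad L ![L z * B z, 0, 0] z := fun z hz => by
    refine ((hexp (-α) 2 z).mul (hasGrad_of_contDiffOn hΩ hη hz)).congr_grad fun i => ?_
    fin_cases i <;> simp [η0 z hz, η1 z hz, η2 z hz, hL, hα z hz] <;> ring
  have K0 : ∀ z ∈ Ω, K z ≠ 0 := fun z hz => mul_ne_zero (Real.exp_pos _).ne' (hτ0 z hz)
  -- `K` and `L` have the same logarithmic gradient, so `L / K` is constant.
  obtain ⟨μ, hμ⟩ := exists_eq_add_const_of_hasGrad (F := fun z => L z / K z) (G := fun _ => 0)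
    (d := fun _ _ => 0) hΩ hc (fun z hz => ((gL z hz).div (gK z hz) (K0 z hz)).congr_grad fun i => by
      fin_cases i <;> simp; left; ring) fun z _ => hasGrad_const 0 z
  obtain ⟨k, sk, hk⟩ := exists_eq_comp_coord hΩ hc sK 0 fun z hz j hj => by
    rw [(gK z hz).pd_eq]
    fin_cases j
    exacts [absurd rfl hj, rfl, rfl]
  have hI := isOpen_image_coord hΩ 0
  have dk : ∀ z ∈ Ω, deriv k (z 0) = K z * B z := fun z hz => by
    have h1 := ((HasGrad.comp (hasDerivAt_of_contDiffOn hI sk (Set.mem_image_of_mem _ hz))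
      (hasGrad_coord 0 z)).congr_of_eqOn hΩ hk hz).pd_eq 0
    rw [(gK z hz).pd_eq] at h1
    simpa using h1.symm
  have hτk : ∀ z ∈ Ω, τ z = Real.exp (β * z 1) * k (z 0) := fun z hz => by
    rw [← hk z hz, hK, ← mul_assoc, ← Real.exp_add]; simp
  have hηk : ∀ z ∈ Ω, η z = μ * (Real.exp (α * z 2) * k (z 0)) := fun z hz => by
    have h1 := hμ z hz
    rw [zero_add, div_eq_iff (K0 z hz)] at h1
    rw [← hk z hz, mul_left_comm, ← h1, hL, ← mul_assoc, ← Real.exp_add]; simp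
  refine ⟨α, β, μ, k, deriv k, fun u hu => hasDerivAt_of_contDiffOn hI sk hu, ?_, fun z hz =>
    ⟨hτk z hz, hηk z hz, ?_, ?_⟩⟩
  · rintro _ ⟨z, hz, rfl⟩
    refine (hasDerivAt_deriv_of_contDiffOn hI sk (Set.mem_image_of_mem _ hz)).congr_deriv ?_
    have h1 := ((gK z hz).mul (hasGrad_of_contDiffOn hΩ sB hz)).pd_eq 0
    have h2 := ((HasGrad.comp (hasDerivAt_deriv_of_contDiffOn hI sk (Set.mem_image_of_mem _ hz))
      (hasGrad_coord 0 z)).congr_of_eqOn (F := fun z => K z * B z) hΩ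
        (fun z hz => (dk z hz).symm) hz).pd_eq 0
    rw [h1, B0 z hz, hα z hz, hβ z hz] at h2
    simp only [Matrix.cons_val_zero, if_true, mul_one] at h2
    rw [← h2, ← hk z hz]
    ring
  · refine (hasGrad_of_contDiffOn hΩ hφ hz).congr_grad fun i => ?_
    have e : Real.exp (β * z 1) * (K z * B z) = τ z * B z := by rw [hτk z hz, hk z hz]; ring
    fin_cases i <;> simp [φ0 z hz, φ1 z hz, φ2 z hz, hα z hz, dk z hz, e, ← hτk z hz]
    ring
  · refine (hasGrad_of_contDiffOn hΩ hψ hz).congr_grad fun i => ?_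
    have e : μ * (Real.exp (α * z 2) * (K z * B z)) = η z * B z := by rw [hηk z hz, hk z hz]; ring
    fin_cases i <;> simp [ψ0 z hz, ψ1 z hz, ψ2 z hz, hβ z hz, dk z hz, e, ← hηk z hz]
    ring

end SymIntegration

/-! ### Classification of symmetric systems -/

section SymClassification

variable {Ω : Set (Fin 3 → ℝ)} {φ ψ η τ : (Fin 3 → ℝ) → ℝ}

/-- Solutions of `k'' = κ k` on an interval extend to the real line. -/
lemma exists_extension_of_hasDerivAt_mul {I : Set ℝ} {k k' : ℝ → ℝ} {κ : ℝ} (hI : IsOpen I)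
    (hc : Convex ℝ I) (hk : ∀ u ∈ I, HasDerivAt k (k' u) u)
    (hk' : ∀ u ∈ I, HasDerivAt k' (κ * k u) u) :
    ∃ K : ℝ → ℝ, ContDiff ℝ ∞ K ∧ (∀ u, iteratedDeriv 2 K u = κ * K u) ∧
      ∀ u ∈ I, k u = K u ∧ k' u = deriv K u := by
  obtain ⟨K, sK, hK, e⟩ : ∃ K : ℝ → ℝ, ContDiff ℝ ∞ K ∧ (∀ u, iteratedDeriv 2 K u = κ * K u) ∧
      ∀ u ∈ I, k u = K u := by
    obtain ⟨a, b, c, ⟨rfl, h⟩ | ⟨rfl, h⟩ | ⟨rfl, h⟩⟩ := exists_of_hasDerivAt_mul hI hc hk hk'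
    · refine ⟨_, by fun_prop, fun u => ?_, h⟩
      refine (iteratedDeriv_two_eq_of_eqOn isOpen_univ (fun _ _ => rfl) (Set.mem_univ u)
        (fun u _ => ((hasDerivAt_mul_left c u).exp.const_mul a).add
          ((hasDerivAt_mul_left (-c) u).exp.const_mul b))
        (fun u _ => (((hasDerivAt_mul_left c u).exp.mul_const c).const_mul a).add
          (((hasDerivAt_mul_left (-c) u).exp.mul_const (-c)).const_mul b))).trans ?_
      ring
    · refine ⟨_, by fun_prop, fun u => ?_, h⟩
      refine (iteratedDeriv_two_eq_of_eqOn isOpen_univ (fun _ _ => rfl) (Set.mem_univ u)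
        (fun u _ => (hasDerivAt_mul_left b u).const_add a)
        (fun u _ => hasDerivAt_const u b)).trans ?_
      ring
    · refine ⟨_, by fun_prop, fun u => ?_, h⟩
      refine (iteratedDeriv_two_eq_of_eqOn isOpen_univ (fun _ _ => rfl) (Set.mem_univ u)
        (fun u _ => ((hasDerivAt_mul_left c u).cos.const_mul a).add
          ((hasDerivAt_mul_left c u).sin.const_mul b))
        (fun u _ => (((hasDerivAt_mul_left c u).sin.neg.mul_const c).const_mul a).add
          (((hasDerivAt_mul_left c u).cos.mul_const c).const_mul b))).trans ?_
      ring
  refine ⟨K, sK, hK, fun u hu => ⟨e u hu, ?_⟩⟩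
  exact (hk u hu).unique (hasDerivAt_congr_of_eqOn hI e hu
    (hasDerivAt_of_contDiffOn isOpen_univ sK.contDiffOn (Set.mem_univ u)))

/-- The translation by `b` in `u` together with the Galilean transformation with velocities
`k₁, k₂`. -/
noncomputable def symTranslation (b k₁ k₂ : ℝ) : SymTransformation where
  p := 1
  q := 1
  r := 1
  a := 1
  b := b
  c := 0
  d := 0
  k₁ := k₁
  k₂ := k₂
  p_ne := one_ne_zero
  q_ne := one_ne_zero
  r_ne := one_ne_zero
  a_ne := one_ne_zero

lemma symTranslation_map (b k₁ k₂ : ℝ) (z : Fin 3 → ℝ) :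
    (symTranslation b k₁ k₂).map z = ![z 0 + b, z 1, z 2] := by
  simp [symTranslation, SymTransformation.map]

lemma exists_carries_of_eq {φ' ψ' η' τ' : (Fin 3 → ℝ) → ℝ} (b k₁ k₂ : ℝ)
    (h : ∀ z ∈ Ω, φ z = φ' ![z 0 + b, z 1, z 2] + k₁ ∧ ψ z = ψ' ![z 0 + b, z 1, z 2] + k₂ ∧
      η z = η' ![z 0 + b, z 1, z 2] ∧ τ z = τ' ![z 0 + b, z 1, z 2])
    (H : ∀ Ω, SymNormalForm Ω φ' ψ' η' τ') :
    ∃ (T : SymTransformation) (φ' ψ' η' τ' : (Fin 3 → ℝ) → ℝ),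
      T.Carries Ω φ ψ η τ φ' ψ' η' τ' ∧ SymNormalForm (T.map '' Ω) φ' ψ' η' τ' := by
  refine ⟨symTranslation b k₁ k₂, φ', ψ', η', τ', fun z hz => ?_, H _⟩
  obtain ⟨h1, h2, h3, h4⟩ := h z hz
  rw [symTranslation_map, h1, h2, h3, h4]
  simp [symTranslation]

/-- If `β = 0`, then `k = c₁u + c₀`, and whether `c₁` and `α` vanish decides between the bilinear,
linear, cubic and quadratic forms. If `α` and `β` are both nonzero the form is exponential. The case
`α = 0`, `β ≠ 0` is left to the interchange of `v` and `w`. -/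
lemma exists_normalForm_of_eq_exp_mul (hΩ : IsOpen Ω) (hc : Convex ℝ Ω) {α β μ : ℝ} {k k' : ℝ → ℝ}
    (hαβ : β ≠ 0 → α ≠ 0) (hk : ∀ u ∈ (fun z : Fin 3 → ℝ => z 0) '' Ω, HasDerivAt k (k' u) u)
    (hk' : ∀ u ∈ (fun z : Fin 3 → ℝ => z 0) '' Ω, HasDerivAt k' (α * β * k u) u)
    (h : ∀ z ∈ Ω, τ z = Real.exp (β * z 1) * k (z 0) ∧ η z = μ * (Real.exp (α * z 2) * k (z 0)) ∧
        HasGrad φ ![α * (Real.exp (β * z 1) * k (z 0)), Real.exp (β * z 1) * k' (z 0), 0] z ∧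
        HasGrad ψ ![β * (μ * (Real.exp (α * z 2) * k (z 0))), 0,
          μ * (Real.exp (α * z 2) * k' (z 0))] z) :
    ∃ (T : SymTransformation) (φ' ψ' η' τ' : (Fin 3 → ℝ) → ℝ),
      T.Carries Ω φ ψ η τ φ' ψ' η' τ' ∧ SymNormalForm (T.map '' Ω) φ' ψ' η' τ' := by
  have hI := isOpen_image_coord hΩ 0
  have hcI := convex_image_coord hc 0
  rcases eq_or_ne β 0 with rfl | hβ
  · simp only [mul_zero, zero_mul, Real.exp_zero, one_mul] at hk' h
    obtain ⟨c₁, hc₁⟩ := exists_eq_const_of_hasDerivAt_zero hI hcI hk'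
    obtain ⟨c₀, hc₀⟩ := exists_eq_add_const hI hcI (F := fun u => c₁ * u) hk fun u hu => by
      rw [hc₁ u hu]; exact hasDerivAt_mul_left c₁ u
    rw [Set.forall_mem_image] at hc₁ hc₀
    obtain ⟨k₁, hk₁⟩ := exists_eq_add_const_of_hasGrad (F := φ)
      (G := fun z => c₁ * (z 1 + α / 2 * (z 0 * z 0)) + α * c₀ * z 0) hΩ hc
      (fun z hz => (h z hz).2.2.1) fun z hz => by
        refine ((((hasGrad_coord 1 z).add (((hasGrad_coord 0 z).mul (hasGrad_coord 0 z)).const_mul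
          (α / 2))).const_mul c₁).add ((hasGrad_coord 0 z).const_mul (α * c₀))).congr_grad fun i => ?_
        fin_cases i <;> simp [hc₁ hz, hc₀ hz]
        ring
    have hψ : ∃ k₂, ∀ z ∈ Ω, ψ z
        = (if α = 0 then μ * c₁ * z 2 else μ * c₁ / α * (Real.exp (α * z 2) * 1)) + k₂ := by
      split_ifs with hα
      · refine exists_eq_add_const_of_hasGrad hΩ hc (fun z hz => (h z hz).2.2.2) fun z hz => ?_
        refine ((hasGrad_coord 2 z).const_mul (μ * c₁)).congr_grad fun i => ?_
        fin_cases i <;> simp [hc₁ hz, hα]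
      · refine exists_eq_add_const_of_hasGrad hΩ hc (fun z hz => (h z hz).2.2.2) fun z hz => ?_
        refine ((hasGrad_exp_mul α 2 (hasDerivAt_const (z 0) (1 : ℝ))).const_mul
          (μ * c₁ / α)).congr_grad fun i => ?_
        fin_cases i <;> simp [hc₁ hz]
        field_simp
    obtain ⟨k₂, hk₂⟩ := hψ
    rcases eq_or_ne c₁ 0 with rfl | hc₁0
    · rcases eq_or_ne α 0 with rfl | hα
      · refine exists_carries_of_eq (φ' := fun _ => 0) (ψ' := fun _ => 0) (η' := fun _ => μ * c₀)
          (τ' := fun _ => c₀) 0 k₁ k₂ (fun z hz => ?_) fun Ω => Or.inr <| Or.inl ⟨c₀, μ * c₀,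
            isConservationLaw_linear_iff.2 fun _ _ => ⟨rfl, rfl, rfl, rfl⟩⟩
        rw [hk₁ z hz, hk₂ z hz, (h z hz).1, (h z hz).2.1, hc₀ hz]
        simp
      · refine exists_carries_of_eq (φ' := fun z => c₀ * α * z 0) (ψ' := fun _ => 0)
          (η' := fun z => μ * c₀ / α * α * (Real.exp (α * z 2) * 1))
          (τ' := fun _ => c₀) 0 k₁ k₂ (fun z hz => ?_) fun Ω => Or.inr <| Or.inr <| Or.inr <| Or.inl
            ⟨c₀, μ * c₀ / α, α, hα,
            isConservationLaw_quadratic_iff.2 fun _ _ => ⟨rfl, rfl, rfl, rfl⟩⟩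
        rw [hk₁ z hz, hk₂ z hz, (h z hz).1, (h z hz).2.1, hc₀ hz]
        simp [hα]
        exact ⟨Or.inl (mul_comm _ _), by ring⟩
    · rcases eq_or_ne α 0 with rfl | hα
      · refine exists_carries_of_eq (φ' := fun z => c₁ * z 1) (ψ' := fun z => μ * c₁ * z 2)
          (η' := fun z => μ * c₁ * z 0) (τ' := fun z => c₁ * z 0) (c₀ / c₁) k₁ k₂ (fun z hz => ?_)
          fun Ω => Or.inl ⟨c₁, μ * c₁,
            isConservationLaw_bilinear_iff.2 fun _ _ => ⟨rfl, rfl, rfl, rfl⟩⟩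
        rw [hk₁ z hz, hk₂ z hz, (h z hz).1, (h z hz).2.1, hc₀ hz]
        simp
        constructor <;> field_simp
      -- The shift of `u` by `c₀ / c₁` completes the square in `φ`; the resulting constant goes into
      -- the Galilean term.
      · refine exists_carries_of_eq (φ' := fun z => c₁ * (z 1 + α / 2 * (z 0 * z 0)))
          (ψ' := fun z => μ * c₁ / α * (Real.exp (α * z 2) * 1))
          (η' := fun z => μ * c₁ / α * α * (Real.exp (α * z 2) * z 0)) (τ' := fun z => c₁ * z 0)
          (c₀ / c₁) (k₁ - α * c₀ ^ 2 / (2 * c₁)) k₂ (fun z hz => ?_) fun Ω => Or.inr <| Or.inr <|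
            Or.inl ⟨c₁, μ * c₁ / α, α, hα,
            isConservationLaw_cubic_iff.2 fun _ _ => ⟨rfl, rfl, rfl, rfl⟩⟩
        rw [hk₁ z hz, hk₂ z hz, (h z hz).1, (h z hz).2.1, hc₀ hz]
        simp [hα]
        refine ⟨?_, ?_, ?_⟩ <;> field_simp
        ring
  · have hα := hαβ hβ
    obtain ⟨K, sK, hK2, hK⟩ := exists_extension_of_hasDerivAt_mul hI hcI hk hk'
    rw [Set.forall_mem_image] at hK hk'
    have dK' : ∀ z ∈ Ω, HasDerivAt (deriv K) (α * β * k (z 0)) (z 0) := fun z hz => by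
      rw [(hK hz).1, ← hK2]
      exact hasDerivAt_deriv_of_contDiffOn isOpen_univ sK.contDiffOn (Set.mem_univ _)
    obtain ⟨k₁, hk₁⟩ := exists_eq_add_const_of_hasGrad (F := φ)
      (G := fun z => β⁻¹ * (Real.exp (β * z 1) * deriv K (z 0))) hΩ hc
      (fun z hz => (h z hz).2.2.1) fun z hz => by
        refine ((hasGrad_exp_mul β 1 (dK' z hz)).const_mul β⁻¹).congr_grad fun i => ?_
        fin_cases i <;> simp [hK hz] <;> field_simp
    obtain ⟨k₂, hk₂⟩ := exists_eq_add_const_of_hasGrad (F := ψ)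
      (G := fun z => μ / α * (Real.exp (α * z 2) * deriv K (z 0))) hΩ hc
      (fun z hz => (h z hz).2.2.2) fun z hz => by
        refine ((hasGrad_exp_mul α 2 (dK' z hz)).const_mul (μ / α)).congr_grad fun i => ?_
        fin_cases i <;> simp [hK hz] <;> field_simp
    refine exists_carries_of_eq (φ' := fun z => β⁻¹ * (Real.exp (β * z 1) * deriv K (z 0)))
      (ψ' := fun z => μ / α * (Real.exp (α * z 2) * deriv K (z 0)))
      (η' := fun z => μ / α * α * (Real.exp (α * z 2) * K (z 0)))
      (τ' := fun z => β⁻¹ * β * (Real.exp (β * z 1) * K (z 0))) 0 k₁ k₂ (fun z hz => ?_)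
      fun Ω => Or.inr <| Or.inr <| Or.inr <| Or.inr ⟨β⁻¹, μ / α, α, β, hα, hβ, K, sK, hK2,
        (isConservationLaw_exponential_iff sK).2 fun _ _ => ⟨rfl, rfl, rfl, rfl⟩⟩
    rw [hk₁ z hz, hk₂ z hz, (h z hz).1, (h z hz).2.1, (hK hz).1]
    simp [hα, hβ]

lemma SymInt.symReducible (hΩ : IsOpen Ω) (hc : Convex ℝ Ω) (hφ : ContDiffOn ℝ ∞ φ Ω)
    (hψ : ContDiffOn ℝ ∞ ψ Ω) (hη : ContDiffOn ℝ ∞ η Ω) (hτ : ContDiffOn ℝ ∞ τ Ω)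
    (hη0 : ∀ z ∈ Ω, η z ≠ 0) (hτ0 : ∀ z ∈ Ω, τ z ≠ 0) (h : SymInt Ω φ ψ η τ) :
    SymReducible Ω φ ψ η τ := by
  obtain ⟨α, β, μ, k, k', hk, hk', hz⟩ := h.exists_eq_exp_mul hΩ hc hφ hψ hη hτ hη0 hτ0
  by_cases hαβ : β ≠ 0 → α ≠ 0
  · obtain ⟨T, φ', ψ', η', τ', hT⟩ := exists_normalForm_of_eq_exp_mul hΩ hc hαβ hk hk' hz
    exact ⟨T, φ', ψ', η', τ', Or.inl hT⟩
  · push Not at hαβ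
    obtain ⟨hβ, rfl⟩ := hαβ
    rcases Ω.eq_empty_or_nonempty with rfl | ⟨x, hx⟩
    · exact ⟨symTranslation 0 0 0, φ, ψ, η, τ, Or.inl ⟨by simp [SymTransformation.Carries],
        Or.inl ⟨0, 0, by simp [IsConservationLaw]⟩⟩⟩
    have hμ : μ ≠ 0 := by
      rintro rfl
      exact hη0 x hx (by rw [(hz x hx).2.1, zero_mul])
    have himg : (fun z : Fin 3 → ℝ => z 0) '' (swapVW '' Ω) = (fun z : Fin 3 → ℝ => z 0) '' Ω := by
      rw [Set.image_image]; rfl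
    -- For `α = 0` the interchange makes `η = μk` the new `τ`. So `μk` takes the place of `k`, `μ⁻¹`
    -- that of `μ`, and the pair `(α, β)` becomes `(β, 0)`.
    obtain ⟨T, φ', ψ', η', τ', hT⟩ := exists_normalForm_of_eq_exp_mul (φ := ψ ∘ swapVW)
      (ψ := φ ∘ swapVW) (η := τ ∘ swapVW) (τ := η ∘ swapVW) (α := β) (β := 0) (μ := μ⁻¹)
      (k := fun u => μ * k u) (k' := fun u => μ * k' u) (isOpen_image_swapVW hΩ)
      (convex_image_swapVW hc) (fun h => absurd rfl h)
      (by rw [himg]; exact fun u hu => (hk u hu).const_mul μ)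
      (by rw [himg]; exact fun u hu => ((hk' u hu).const_mul μ).congr_deriv (by ring)) (by
        intro y hy
        obtain ⟨h1, h2, h3, h4⟩ := hz _ (swapVW_mem hy)
        refine ⟨?_, ?_, ?_, ?_⟩
        · rw [Function.comp_apply, h2]; simp [swapVW]
        · rw [Function.comp_apply, h1]; simp [swapVW]; field_simp
        · refine h4.comp_swapVW.congr_grad fun i => ?_
          fin_cases i <;> simp [swapVW]
        · refine h3.comp_swapVW.congr_grad fun i => ?_
          fin_cases i <;> simp [swapVW]
          field_simp)
    exact ⟨T, φ', ψ', η', τ', Or.inr hT⟩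

theorem haantjes_tfae (hΩ : IsOpen Ω) (hc : Convex ℝ Ω) (hφ : ContDiffOn ℝ ∞ φ Ω)
    (hψ : ContDiffOn ℝ ∞ ψ Ω) (hη : ContDiffOn ℝ ∞ η Ω) (hτ : ContDiffOn ℝ ∞ τ Ω)
    (hη0 : ∀ z ∈ Ω, η z ≠ 0) (hτ0 : ∀ z ∈ Ω, τ z ≠ 0) :
    [HaantjesVanishes Ω φ ψ η τ, HaantjesVanishes₂ Ω φ ψ η τ, SymInt Ω φ ψ η τ,
      SymReducible Ω φ ψ η τ].TFAE := by
  tfae_have 1 → 2 := HaantjesVanishes.haantjesVanishes₂ hτ0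
  tfae_have 2 → 3 := HaantjesVanishes₂.symInt hΩ hφ hψ hη hτ hη0 hτ0
  tfae_have 3 → 1 := SymInt.haantjesVanishes hΩ hφ hψ hη hτ hη0 hτ0
  tfae_have 3 → 4 := SymInt.symReducible hΩ hc hφ hψ hη hτ hη0 hτ0
  tfae_have 4 → 3 := SymReducible.symInt hΩ hη0 hτ0
  tfae_finish

end SymClassification

end DispersionlessLimits

theorem mainTheorem2 :
    -- integrability of non-symmetric systems
    (∀ (Ω : Set (Fin 2 → ℝ)) (φ ψ η : (Fin 2 → ℝ) → ℝ), IsOpen Ω →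
      ContDiffOn ℝ ∞ φ Ω → ContDiffOn ℝ ∞ ψ Ω → ContDiffOn ℝ ∞ η Ω → (∀ z ∈ Ω, η z ≠ 0) →
      (HydrodynamicallyIntegrable Ω φ ψ η ↔ NonsymInt Ω φ ψ η)) ∧
    -- solutions of the integrability conditions up to equivalence
    (∀ (Ω : Set (Fin 2 → ℝ)) (φ ψ η : (Fin 2 → ℝ) → ℝ), IsOpen Ω → Convex ℝ Ω →
      ContDiffOn ℝ ∞ φ Ω → ContDiffOn ℝ ∞ ψ Ω → ContDiffOn ℝ ∞ η Ω → (∀ z ∈ Ω, η z ≠ 0) →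
      (NonsymInt Ω φ ψ η ↔
        ∃ (T : NonsymTransformation) (φ' ψ' η' : (Fin 2 → ℝ) → ℝ),
          T.Carries Ω φ ψ η φ' ψ' η' ∧ NonsymNormalForm (T.map '' Ω) φ' ψ' η')) ∧
    -- the case `η = e^w h(u)`: the equivalent pair of third order equations
    (∀ (I : Set ℝ) (f g h p : ℝ → ℝ), IsOpen I →
      ContDiffOn ℝ ∞ f I → ContDiffOn ℝ ∞ g I → ContDiffOn ℝ ∞ h I → ContDiffOn ℝ ∞ p I →
      (∀ u ∈ I, f u = deriv h u + p u) →
      (ExpSystem I f g h ↔ ∀ u ∈ I, g u = deriv p u ∧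
        h u * iteratedDeriv 3 p u = 2 * deriv h u * iteratedDeriv 2 p u
          - deriv p u * iteratedDeriv 2 h u + 2 * p u * iteratedDeriv 2 p u
          - 2 * (deriv p u) ^ 2 ∧
        h u * iteratedDeriv 3 h u = deriv h u * iteratedDeriv 2 h u
          - 2 * deriv h u * deriv p u + h u * iteratedDeriv 2 p u
          + p u * iteratedDeriv 2 h u)) ∧
    -- the subcase `p = h'`: sigma-functions
    (∀ (I : Set ℝ) (h : ℝ → ℝ), IsOpen I → Convex ℝ I → ContDiffOn ℝ ∞ h I →
      (∀ u ∈ I, h u ≠ 0) →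
      (ExpSystem I (fun u => 2 * deriv h u) (iteratedDeriv 2 h) h ↔
        ∀ u ∈ I, iteratedDeriv 4 h u * h u + 3 * (iteratedDeriv 2 h u) ^ 2
          - 4 * deriv h u * iteratedDeriv 3 h u = 0) ∧
      ((∀ u ∈ I, iteratedDeriv 4 h u * h u + 3 * (iteratedDeriv 2 h u) ^ 2
          - 4 * deriv h u * iteratedDeriv 3 h u = 0) ↔ IsSigmaFunction I h)) ∧
    -- the subcase `p = c h`: exponential solutions
    (∀ (I : Set ℝ) (h : ℝ → ℝ) (c : ℝ), IsOpen I → Convex ℝ I → ContDiffOn ℝ ∞ h I →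
      (∀ u ∈ I, h u ≠ 0) →
      (ExpSystem I (fun u => deriv h u + c * h u) (fun u => c * deriv h u) h ↔
        ∀ u ∈ I, iteratedDeriv 3 h u * h u - iteratedDeriv 2 h u * deriv h u
          = 2 * c * (iteratedDeriv 2 h u * h u - (deriv h u) ^ 2)) ∧
      ((∀ u ∈ I, iteratedDeriv 3 h u * h u - iteratedDeriv 2 h u * deriv h u
          = 2 * c * (iteratedDeriv 2 h u * h u - (deriv h u) ^ 2)) ↔
        ∃ α β γ : ℝ,
          (∀ u ∈ I, h u = α * Real.exp ((c + γ) * u) + β * Real.exp ((c - γ) * u)) ∨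
          (∀ u ∈ I, h u = (α + β * u) * Real.exp (c * u)) ∨
          (∀ u ∈ I, h u = Real.exp (c * u) * (α * Real.cos (γ * u) + β * Real.sin (γ * u))))) ∧
    -- symmetric systems
    (∀ (Ω : Set (Fin 3 → ℝ)) (φ ψ η τ : (Fin 3 → ℝ) → ℝ), IsOpen Ω → Convex ℝ Ω →
      ContDiffOn ℝ ∞ φ Ω → ContDiffOn ℝ ∞ ψ Ω → ContDiffOn ℝ ∞ η Ω → ContDiffOn ℝ ∞ τ Ω →
      (∀ z ∈ Ω, η z ≠ 0) → (∀ z ∈ Ω, τ z ≠ 0) →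
      [HaantjesVanishes Ω φ ψ η τ, HaantjesVanishes₂ Ω φ ψ η τ, SymInt Ω φ ψ η τ,
        SymReducible Ω φ ψ η τ].TFAE) := by
  exact ⟨fun Ω φ ψ η hΩ hφ hψ hη hη0 =>
      ⟨HydrodynamicallyIntegrable.nonsymInt hΩ hφ hψ hη hη0,
        NonsymInt.hydrodynamicallyIntegrable hΩ hφ hψ hη hη0⟩,
    fun Ω φ ψ η hΩ hc hφ hψ hη hη0 => nonsymInt_iff_exists_normalForm hΩ hc hφ hψ hη hη0,
    fun I f g h p hI hf hg hh hp hfp => expSystem_iff_of_eq_add hI hh hp hfp,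
    fun I h hI hc hh h0 => ⟨expSystem_two_mul_deriv_iff hI hh,
      fourth_order_iff_isSigmaFunction hI hc hh h0⟩,
    fun I h c hI hc hh h0 => ⟨expSystem_deriv_add_mul_iff hI hh,
      third_order_iff_exponential hI hc hh h0⟩,
    fun Ω φ ψ η τ hΩ hc hφ hψ hη hτ hη0 hτ0 => haantjes_tfae hΩ hc hφ hψ hη hτ hη0 hτ0⟩
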